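/- Let $\ell$ be an odd prime, let $m\ge 1$ be an integer, and let $C_2$ be a group of order two. **Class groups.** For a number field $F$ let $\mathrm{Id}_F(m)$ be the group of fractional ideals of $\mathcal O_F$ coprime to $m$, and let $F^1(m)$ be the group of all $\alpha\in F^\times$ with $\mathrm{ord}_{\mathfrak p}(\alpha-1)\ge \mathrm{ord}_{\mathfrak p}(m)$ for every prime $\mathfrak p\mid m$. The ray class group $\mathrm{Cl}_F(m)$ is the quotient of $\mathrm{Id}_F(m)$ by $\{(\alpha):\alpha\in F^1(m)\}$. The Arakelov ray class group $\mathrm{Pic}^0_F(m)$ is the quotient of the fibre product $\mathrm{Id}_F(m)\times_{\mathbb R_{>0}}\prod_{v\mid\infty}\mathbb R_{>0}$ (over the ideal norm and $(x_v)_v\mapsto\prod_v x_v^{[F_v:\mathbb R]}$) by the image of $F^1(m)$ under $\alpha\mapsto((\alpha),(|\alpha|_v)_v)$. For a real quadratic field $F$ the residue class of $\alpha$ is sent to the class of $((\alpha),(|\alpha|_v)_v)$; this gives a $\mathrm{Gal}(F/\mathbb Q)$-equivariant injection $(\mathcal O_F/m)^\times/\{\pm1\}\to \mathrm{Pic}^0_F(m)$.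 **The rings $R$ and the model.** For every prime $p\mid m$ choose an étale $\mathbb Q_p$-algebra $A_p$ of degree $2$. Let $\mathcal O_A$ be the integral closure of $\prod_{p\mid m}\mathbb Z_p$ in $\prod_{p\mid m}A_p$, let $R=\mathcal O_A/m$ with $C_2$ acting through the non-trivial automorphisms of the $A_p$, and let $U_R=R^\times/\{\pm1\}$. Consider exact sequences $\Theta\colon 0\to U_R(\ell^\infty)\to B\to C\to 0$ of compact Hausdorff $C_2$-modules in which $C\cong \mathbb R/\mathbb Z\times(\text{finite abelian group})$ and the generator of $C_2$ acts on $C$ by $-1$. An isomorphism $\Theta\to\Theta'$ is an isomorphism $B\to B'$ of topological $C_2$-modules that induces on $U_R(\ell^\infty)$ an automorphism coming from a ring automorphism of $R$; isomorphisms of sequences of discrete $\ell$-groups are defined in the same way. Let $\mathbb P$ be the probability distribution on the set of isomorphism classes of sequences $\Theta$ with $\mathbb P\{\Theta\}$ proportional to $1/\#\mathrm{Aut}(\Theta)$, and for a complex-valued function $f$ of isomorphism classes of sequences $0\to U_R(\ell^\infty)\to B\to C\to 0$ of $\ell$-groups let $\mathbb E_R(f)$ be the expected value of $f(\Theta(\ell^\infty))$,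 where $\Theta(\ell^\infty)$ is the sequence of $\ell$-power torsion subgroups of $\Theta$. **The heuristic for $f$.** For real $X>0$ let $\mathcal F_X(R)$ be the set of pairs $(F,r)$, where $F$ is a real quadratic field (up to isomorphism) of conductor less than $X$ and $r\colon R\to\mathcal O_F/m$ is a $C_2$-equivariant ring isomorphism. For $(F,r)\in\mathcal F_X(R)$ let $S_{F,r}$ be the sequence with first map $U_R(\ell^\infty)\cong \big((\mathcal O_F/m)^\times/\{\pm1\}\big)(\ell^\infty)\to\mathrm{Pic}^0_F(m)(\ell^\infty)$, the isomorphism being induced by $r$. The heuristic holds for $f$ and $R$ if $$\lim_{X\to\infty}\frac{\sum_{(F,r)\in\mathcal F_X(R)}f(S_{F,r})}{\#\mathcal F_X(R)}$$ exists and is equal to $\mathbb E_R(f)$. **Proposition.** Let $\mathcal P_1$, respectively $\mathcal P_{\pm1}$, be the set of primes $p\mid m$ with $p\equiv 1\pmod \ell$, respectively $p\equiv\pm1\pmod\ell$, and let $\mathcal F_X^+$ be the set of real quadratic fields (up to isomorphism) of conductor less than $X$. Suppose that, for all choices of the $A_p$, the heuristic holds for the function $f$ that sends a sequence $0\to U_R(\ell^\infty)\to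 B\to C\to0$ to $\#B[\ell]=\ell^{\dim_{\mathbb F_\ell}B[\ell]}$. Then the limit $$\mathrm{Av}^+(\ell)=\lim_{X\to\infty}\frac{\sum_{F\in\mathcal F_X^+}\#\mathrm{Cl}_F(m)[\ell]}{\#\mathcal F_X^+}$$ exists, and is equal to 1. $\ell^{\#\mathcal P_1}\left(1+\frac1\ell\prod_{p\in\mathcal P_{\pm1}}\frac{p(\ell+1)+2}{2(p+1)}\right)$ if $\ell\nmid m$; 2. $\ell^{\#\mathcal P_1}\left(1+\frac2{\ell+1}\prod_{p\in\mathcal P_{\pm1}}\frac{p(\ell+1)+2}{2(p+1)}\right)$ if $\ell\mid m$ but $\ell^2\nmid m$; 3. $\ell^{\#\mathcal P_1+1}\left(1+\prod_{p\in\mathcal P_{\pm1}}\frac{p(\ell+1)+2}{2(p+1)}\right)$ if $\ell>3$ and $\ell^2\mid m$; 4. $3^{\#\mathcal P_1+1}\left(1+\frac54\prod_{p\in\mathcal P_{\pm1}}\frac{2p+1}{p+1}\right)$ if $\ell=3$ and $9\mid m$. -/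

import Mathlib

open scoped NumberField nonZeroDivisors

noncomputable section

namespace RayHeuristic

/-! ### `S`-power torsion and the groups `Rˣ / {±1}` -/

/-- The `S^∞`-torsion subgroup: the elements killed by a product of primes in `S`. -/
def sTors (S : Finset ℕ) (G : Type*) [CommGroup G] : Subgroup G where
  carrier := {g | ∃ n : ℕ, n ≠ 0 ∧ n.primeFactors ⊆ S ∧ g ^ n = 1}
  one_mem' := ⟨1, one_ne_zero, by simp, by simp⟩
  mul_mem' := by
    rintro a b ⟨n, hn, hnS, ha⟩ ⟨k, hk, hkS, hb⟩
    refine ⟨n * k, mul_ne_zero hn hk, ?_, ?_⟩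
    · rw [Nat.primeFactors_mul hn hk]
      exact Finset.union_subset hnS hkS
    · rw [mul_pow, pow_mul, ha, one_pow, mul_comm n k, pow_mul, hb, one_pow, one_mul]
  inv_mem' := by
    rintro a ⟨n, hn, hnS, ha⟩
    exact ⟨n, hn, hnS, by rw [inv_pow, ha, inv_one]⟩

theorem map_mem_sTors {S : Finset ℕ} {G H : Type*} [CommGroup G] [CommGroup H] (f : G →* H)
    {g : G} (hg : g ∈ sTors S G) : f g ∈ sTors S H := by
  obtain ⟨n, hn, hnS, h⟩ := hg
  exact ⟨n, hn, hnS, by rw [← map_pow, h, map_one]⟩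

/-- The homomorphism induced on `S^∞`-torsion subgroups. -/
def sMap (S : Finset ℕ) {G H : Type*} [CommGroup G] [CommGroup H] (f : G →* H) :
    sTors S G →* sTors S H :=
  (f.comp (sTors S G).subtype).codRestrict (sTors S H) fun g => map_mem_sTors f g.2

/-- `U_R = Rˣ / {±1}`. -/
abbrev UMod (R : Type*) [CommRing R] : Type _ := Rˣ ⧸ Subgroup.zpowers (-1 : Rˣ)

theorem map_zpowers_neg_one {R R' : Type*} [CommRing R] [CommRing R'] (φ : R ≃+* R') :
    (Subgroup.zpowers (-1 : Rˣ)).map (Units.mapEquiv φ.toMulEquiv).toMonoidHom =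
      Subgroup.zpowers (-1 : R'ˣ) := by
  rw [MonoidHom.map_zpowers]
  congr 1
  ext
  simp

/-- The isomorphism `U_R ≃ U_{R'}` induced by a ring isomorphism `R ≃ R'`. -/
def uMap {R R' : Type*} [CommRing R] [CommRing R'] (φ : R ≃+* R') : UMod R ≃* UMod R' :=
  QuotientGroup.congr _ _ (Units.mapEquiv φ.toMulEquiv) (map_zpowers_neg_one φ)

@[simp] theorem uMap_mk {R R' : Type*} [CommRing R] [CommRing R'] (φ : R ≃+* R') (u : Rˣ) :
    uMap φ (QuotientGroup.mk u) = QuotientGroup.mk (Units.mapEquiv φ.toMulEquiv u) := rfl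

/-- The induced map on `U_R(S^∞)`. -/
def uMapS (S : Finset ℕ) {R R' : Type*} [CommRing R] [CommRing R'] (φ : R ≃+* R') :
    sTors S (UMod R) →* sTors S (UMod R') :=
  sMap S (uMap φ).toMonoidHom

theorem uMap_comm {R R' : Type*} [CommRing R] [CommRing R'] (r : R ≃+* R') (τ : R ≃+* R)
    (τ' : R' ≃+* R') (h : ∀ x, r (τ x) = τ' (r x)) (u : UMod R) :
    uMap r (uMap τ u) = uMap τ' (uMap r u) := by
  induction u using QuotientGroup.induction_on with
  | H u =>
    simp only [uMap_mk]
    exact congrArg QuotientGroup.mk (Units.ext (h u))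

theorem uMapS_comp (S : Finset ℕ) {R R' R'' : Type*} [CommRing R] [CommRing R'] [CommRing R'']
    (φ : R ≃+* R') (ψ : R' ≃+* R'') (χ : R ≃+* R'') (h : ∀ x, χ x = ψ (φ x))
    (u : sTors S (UMod R)) :
    uMapS S ψ (uMapS S φ u) = uMapS S χ u := by
  obtain ⟨u, hu⟩ := u
  induction u using QuotientGroup.induction_on with
  | H u =>
    apply Subtype.ext
    change uMap ψ (uMap φ (QuotientGroup.mk u)) = uMap χ (QuotientGroup.mk u)
    simp only [uMap_mk]
    congr 1
    ext
    simp [h]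

theorem uMapS_id (S : Finset ℕ) {R : Type*} [CommRing R] (u : sTors S (UMod R)) :
    uMapS S (RingEquiv.refl R) u = u := by
  obtain ⟨u, hu⟩ := u
  induction u using QuotientGroup.induction_on with
  | H u =>
    apply Subtype.ext
    change uMap (RingEquiv.refl R) (QuotientGroup.mk u) = QuotientGroup.mk u
    simp only [uMap_mk]
    congr 1

theorem uMapS_symm_apply (S : Finset ℕ) {R R' : Type*} [CommRing R] [CommRing R']
    (φ : R ≃+* R') (u : sTors S (UMod R')) : uMapS S φ (uMapS S φ.symm u) = u := by
  rw [uMapS_comp S φ.symm φ (RingEquiv.refl R') (by simp), uMapS_id]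

/-! ### Extensions of `C₂`-modules, and their isomorphisms

All groups are written multiplicatively; an action of the group `C₂` of order two is given by the
involution by which its generator acts. In this section `R` is a commutative ring and `τ` an
involution of `R`, by which the generator of `C₂` acts on `U_R`. -/

section Sequences

variable (S : Finset ℕ) (R : Type) [CommRing R] (τ : R ≃+* R)

/-- A short exact sequence `1 → U_R(S^∞) → B → C → 1` of `C₂`-modules with `B` an `S`-group.
It is recorded by the injection `i`; the third term is the quotient `C = B / im i`.
No condition on `C` is imposed here: the distribution `sProb` below is carried by the sequences of
the form `Θ(S^∞)` with `Θ` a `CptSeq`, for which `C` is the product of the `ℚ_p/ℤ_p`, for `p ∈ S`,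
and a finite `S`-group on which `C₂` acts by inversion. -/
structure SSeq : Type 1 where
  /-- the middle term -/
  B : Type
  [grp : CommGroup B]
  /-- the action of the generator of `C₂` -/
  σ : B →* B
  σ_σ : ∀ b, σ (σ b) = b
  torsion : ∀ b : B, b ∈ sTors S B
  /-- the left hand map -/
  i : sTors S (UMod R) →* B
  injective : Function.Injective i
  equivariant : ∀ u, i (uMapS S τ u) = σ (i u)

/-- A short exact sequence `1 → U_R(S^∞) → B → C → 1` of compact Hausdorff `C₂`-modules in which
`C = B / im i` is isomorphic to the product of the circle group and a finite abelian group, and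
in which the generator of `C₂` acts on `C` by inversion. -/
structure CptSeq : Type 1 where
  /-- the middle term -/
  B : Type
  [grp : CommGroup B]
  [top : TopologicalSpace B]
  [topGrp : IsTopologicalGroup B]
  [compact : CompactSpace B]
  [t2 : T2Space B]
  /-- the action of the generator of `C₂` -/
  σ : B →* B
  σ_continuous : Continuous σ
  σ_σ : ∀ b, σ (σ b) = b
  /-- the left hand map -/
  i : sTors S (UMod R) →* B
  injective : Function.Injective i
  equivariant : ∀ u, i (uMapS S τ u) = σ (i u)
  σ_quotient : ∀ b, b * σ b ∈ i.range
  quotient : ∃ (A : Type) (_ : CommGroup A) (_ : TopologicalSpace A),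
    DiscreteTopology A ∧ Finite A ∧ Nonempty ((B ⧸ i.range) ≃ₜ* (Circle × A))

attribute [instance] SSeq.grp CptSeq.grp CptSeq.top CptSeq.topGrp CptSeq.compact CptSeq.t2

variable {S R τ}

/-- An isomorphism of `C₂`-modules between the middle terms is an isomorphism of sequences if it
induces on `U_R(S^∞)` an automorphism that comes from a ring automorphism of `R`. -/
def SSeq.IsIso (Θ Θ' : SSeq S R τ) (f : Θ.B ≃* Θ'.B) : Prop :=
  (∀ b, f (Θ.σ b) = Θ'.σ (f b)) ∧ ∃ φ : R ≃+* R, ∀ u, f (Θ.i u) = Θ'.i (uMapS S φ u)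

/-- The same for sequences of compact groups; here isomorphisms are homeomorphisms. -/
def CptSeq.IsIso (Θ Θ' : CptSeq S R τ) (f : Θ.B ≃ₜ* Θ'.B) : Prop :=
  (∀ b, f (Θ.σ b) = Θ'.σ (f b)) ∧ ∃ φ : R ≃+* R, ∀ u, f (Θ.i u) = Θ'.i (uMapS S φ u)

instance SSeq.setoid : Setoid (SSeq S R τ) where
  r Θ Θ' := ∃ f : Θ.B ≃* Θ'.B, SSeq.IsIso Θ Θ' f
  iseqv :=
    { refl := fun Θ => ⟨MulEquiv.refl _, fun _ => rfl, RingEquiv.refl R, fun u => by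
        rw [uMapS_id]; rfl⟩
      symm := by
        rintro Θ Θ' ⟨f, hf, φ, hφ⟩
        refine ⟨f.symm, fun b => ?_, φ.symm, fun u => ?_⟩
        · rw [MulEquiv.symm_apply_eq, hf, MulEquiv.apply_symm_apply]
        · rw [MulEquiv.symm_apply_eq, hφ, uMapS_symm_apply]
      trans := by
        rintro Θ Θ' Θ'' ⟨f, hf, φ, hφ⟩ ⟨g, hg, ψ, hψ⟩
        refine ⟨f.trans g, fun b => ?_, φ.trans ψ, fun u => ?_⟩
        · simp [hf, hg]
        · rw [MulEquiv.trans_apply, hφ, hψ, uMapS_comp S φ ψ (φ.trans ψ) (fun _ => rfl)] }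

instance CptSeq.setoid : Setoid (CptSeq S R τ) where
  r Θ Θ' := ∃ f : Θ.B ≃ₜ* Θ'.B, CptSeq.IsIso Θ Θ' f
  iseqv :=
    { refl := fun Θ => ⟨ContinuousMulEquiv.refl _, fun _ => rfl, RingEquiv.refl R, fun u => by
        rw [uMapS_id]; rfl⟩
      symm := by
        rintro Θ Θ' ⟨f, hf, φ, hφ⟩
        refine ⟨f.symm, fun b => ?_, φ.symm, fun u => ?_⟩
        · apply f.injective
          rw [f.apply_symm_apply, hf, f.apply_symm_apply]
        · apply f.injective
          rw [f.apply_symm_apply, hφ, uMapS_symm_apply]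
      trans := by
        rintro Θ Θ' Θ'' ⟨f, hf, φ, hφ⟩ ⟨g, hg, ψ, hψ⟩
        refine ⟨f.trans g, fun b => ?_, φ.trans ψ, fun u => ?_⟩
        · change g (f (Θ.σ b)) = Θ''.σ (g (f b))
          rw [hf, hg]
        · change g (f (Θ.i u)) = _
          rw [hφ, hψ, uMapS_comp S φ ψ (φ.trans ψ) (fun _ => rfl)] }

/-- The number `#Aut_ring Θ` of automorphisms of the sequence `Θ`. -/
def CptSeq.autCard (Θ : CptSeq S R τ) : ℕ := Nat.card {f : Θ.B ≃ₜ* Θ.B // CptSeq.IsIso Θ Θ f}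

theorem sTors_torsion (S : Finset ℕ) {G : Type*} [CommGroup G] (g : sTors S G) :
    g ∈ sTors S (sTors S G) := by
  obtain ⟨g, n, hn, hnS, h⟩ := g
  exact ⟨n, hn, hnS, Subtype.ext h⟩

/-- A `C₂`-module `B` together with an equivariant injection `i` from `U_R(S^∞)` gives rise to the
sequence of `S^∞`-torsion subgroups. -/
def SSeq.ofHom {B : Type} [CommGroup B] (σ : B →* B) (σ_σ : ∀ b, σ (σ b) = b)
    (i : sTors S (UMod R) →* B) (injective : Function.Injective i)
    (equivariant : ∀ u, i (uMapS S τ u) = σ (i u)) : SSeq S R τ where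
  B := sTors S B
  σ := sMap S σ
  σ_σ b := Subtype.ext (σ_σ b)
  torsion := sTors_torsion S
  i := i.codRestrict (sTors S B) fun u => map_mem_sTors i (sTors_torsion S u)
  injective _ _ h := injective (congrArg Subtype.val h)
  equivariant u := Subtype.ext (equivariant u)

/-- The sequence `Θ(S^∞)` of `S^∞`-torsion subgroups, without topology. -/
def CptSeq.sPart (Θ : CptSeq S R τ) : SSeq S R τ :=
  SSeq.ofHom Θ.σ Θ.σ_σ Θ.i Θ.injective Θ.equivariant

variable (S R τ)

/-- Isomorphism classes of sequences of `S`-groups. -/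
abbrev SClass : Type 1 := Quotient (SSeq.setoid (S := S) (R := R) (τ := τ))

/-- Isomorphism classes of sequences of compact groups. -/
abbrev CptClass : Type 1 := Quotient (CptSeq.setoid (S := S) (R := R) (τ := τ))

instance : MeasurableSpace (SClass S R τ) := ⊤

instance : MeasurableSpace (CptClass S R τ) := ⊤

/-- The measure that gives every class `Θ` the mass `1 / #Aut_ring Θ`. -/
def cptMass : MeasureTheory.Measure (CptClass S R τ) :=
  MeasureTheory.Measure.sum fun Θ =>
    (Θ.out.autCard : ENNReal)⁻¹ • MeasureTheory.Measure.dirac Θ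

/-- The probability distribution in which `Θ` has a probability proportional to
`1 / #Aut_ring Θ`. -/
def cptProb : MeasureTheory.Measure (CptClass S R τ) :=
  (cptMass S R τ Set.univ)⁻¹ • cptMass S R τ

/-- The push-forward of that distribution under `Θ ↦ Θ(S^∞)`. -/
def sProb : MeasureTheory.Measure (SClass S R τ) :=
  (cptProb S R τ).map fun Θ => ⟦Θ.out.sPart⟧

variable {S R τ}

/-- The expected value of a function of isomorphism classes under the distribution `sProb`. -/
def expectation (f : SClass S R τ → ℂ) : ℂ := ∫ Θ, f Θ ∂(sProb S R τ)

variable (S R τ)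

/-- The function that sends a sequence with middle term `B` to `#B[ℓ]`. -/
def torsionSize (ℓ : ℕ) : SClass S R τ → ℂ :=
  Quotient.lift (fun Θ => (Nat.card {b : Θ.B // b ^ ℓ = 1} : ℂ)) (by
    rintro Θ Θ' ⟨f, -⟩
    have : Nat.card {b : Θ.B // b ^ ℓ = 1} = Nat.card {b : Θ'.B // b ^ ℓ = 1} :=
      Nat.card_congr (f.toEquiv.subtypeEquiv fun b => by
        change b ^ ℓ = 1 ↔ (f b) ^ ℓ = 1
        rw [← map_pow, map_eq_one_iff f f.injective])
    simp only [this])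

end Sequences

/-! ### The rings `R` -/

instance primeFactorsFact {m : ℕ} (p : m.primeFactors) : Fact (p : ℕ).Prime :=
  ⟨Nat.prime_of_mem_primeFactors p.2⟩

/-- A choice of an étale `ℚ_p`-algebra `A_p` of degree two for every prime `p ∣ m`, together with
its non-trivial automorphism, of which there is exactly one. -/
structure LocalData (m : ℕ) : Type 1 where
  /-- the algebra `A_p` -/
  A : m.primeFactors → Type
  [ring : ∀ p : m.primeFactors, CommRing (A p)]
  [alg : ∀ p : m.primeFactors, Algebra ℚ_[p] (A p)]
  [etale : ∀ p : m.primeFactors, Algebra.Etale ℚ_[p] (A p)]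
  finrank_eq : ∀ p : m.primeFactors, Module.finrank ℚ_[p] (A p) = 2
  /-- the non-trivial automorphism of `A_p` -/
  conj : ∀ p : m.primeFactors, A p ≃ₐ[ℚ_[p]] A p
  conj_ne : ∀ p : m.primeFactors, conj p ≠ AlgEquiv.refl

namespace LocalData

attribute [instance] LocalData.ring LocalData.alg LocalData.etale

variable {m : ℕ} (D : LocalData m)

instance algInt (p : m.primeFactors) : Algebra ℤ_[p] (D.A p) :=
  ((algebraMap ℚ_[p] (D.A p)).comp (algebraMap ℤ_[p] ℚ_[p])).toAlgebra

instance (p : m.primeFactors) : IsScalarTower ℤ_[p] ℚ_[p] (D.A p) :=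
  IsScalarTower.of_algebraMap_eq fun _ => rfl

/-- The integral closure of `∏ ℤ_p` in `∏ A_p`, that is, the product of the integral closures. -/
abbrev OA : Type := ∀ p : m.primeFactors, integralClosure ℤ_[p] (D.A p)

/-- The involution of `OA` given by the non-trivial automorphism of every `A_p`. -/
def conjOA : D.OA ≃+* D.OA :=
  RingEquiv.piCongrRight fun p =>
    (((D.conj p).restrictScalars ℤ_[p]).mapIntegralClosure).toRingEquiv

/-- The finite ring `R = OA / m`. -/
abbrev R : Type := D.OA ⧸ Ideal.span {(m : D.OA)}

/-- The involution of `R`. -/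
def conjR : D.R ≃+* D.R :=
  Ideal.quotientEquiv _ _ D.conjOA (by rw [Ideal.map_span]; simp)

end LocalData

/-! ### Ray class groups and Arakelov ray class groups

The modulus is given by a rational integer `m`, with no infinite places. -/

section NumberField

variable (F : Type) [Field F] [NumberField F] (m : ℕ)

open IsDedekindDomain NumberField

/-- The group of fractional ideals. -/
abbrev Frac : Type := (FractionalIdeal (𝓞 F)⁰ F)ˣ

/-- The ideal of `𝓞 F` that is generated by `m`. -/
abbrev modIdeal : Ideal (𝓞 F) := Ideal.span {(m : 𝓞 F)}

/-- The group `Id_F(m)` of fractional ideals coprime to `m`: the quotients of integral ideals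
that are coprime to `m`. -/
def idCoprime : Subgroup (Frac F) where
  carrier := {I | ∃ J J' : Ideal (𝓞 F), J ≠ ⊥ ∧ J' ≠ ⊥ ∧ IsCoprime J (modIdeal F m) ∧
    IsCoprime J' (modIdeal F m) ∧ (I : FractionalIdeal (𝓞 F)⁰ F) * J' = J}
  one_mem' := ⟨⊤, ⊤, top_ne_bot, top_ne_bot, by simp [Ideal.isCoprime_iff_sup_eq],
    by simp [Ideal.isCoprime_iff_sup_eq], by simp⟩
  mul_mem' := by
    rintro I K ⟨J, J', h1, h2, h3, h4, h5⟩ ⟨L, L', k1, k2, k3, k4, k5⟩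
    refine ⟨J * L, J' * L', mul_ne_zero h1 k1, mul_ne_zero h2 k2, h3.mul_left k3,
      h4.mul_left k4, ?_⟩
    rw [FractionalIdeal.coeIdeal_mul, FractionalIdeal.coeIdeal_mul, ← h5, ← k5, Units.val_mul]
    ring
  inv_mem' := by
    rintro I ⟨J, J', h1, h2, h3, h4, h5⟩
    refine ⟨J', J, h2, h1, h4, h3, ?_⟩
    rw [← h5, ← mul_assoc, Units.inv_mul, one_mul]

theorem valuation_eq_one_of {v : HeightOneSpectrum (𝓞 F)} (hv : (m : 𝓞 F) ∈ v.asIdeal) {x : F}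
    (hx : v.valuation F (x - 1) ≤ v.valuation F (m : F)) : v.valuation F x = 1 := by
  have h1 : v.valuation F (x - 1) < 1 := by
    refine hx.trans_lt ?_
    have := (v.valuation_lt_one_iff_mem (K := F) (m : 𝓞 F)).2 hv
    simpa using this
  have h2 := Valuation.map_one_add_of_lt (v.valuation F) h1
  rwa [add_sub_cancel] at h2

/-- The group `F¹(m)` of all `α ∈ Fˣ` with `ord_v (α - 1) ≥ ord_v m` for all primes `v ∣ m`. -/
def rayUnits : Subgroup Fˣ where
  carrier := {α | ∀ v : HeightOneSpectrum (𝓞 F), (m : 𝓞 F) ∈ v.asIdeal →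
    v.valuation F ((α : F) - 1) ≤ v.valuation F (m : F)}
  one_mem' := by intro v _; simp
  mul_mem' := by
    intro a b ha hb v hv
    have h : ((a * b : Fˣ) : F) - 1 = a * (b - 1) + (a - 1) := by push_cast; ring
    rw [h]
    refine Valuation.map_add_le _ ?_ (ha v hv)
    rw [map_mul, valuation_eq_one_of F m hv (ha v hv), one_mul]
    exact hb v hv
  inv_mem' := by
    intro a ha v hv
    have h : ((a⁻¹ : Fˣ) : F) - 1 = -((a⁻¹ : F) * (a - 1)) := by
      push_cast
      field_simp
      ring
    rw [h, Valuation.map_neg, map_mul, map_inv₀, valuation_eq_one_of F m hv (ha v hv), inv_one,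
      one_mul]
    exact ha v hv

/-- The ray class group `Cl_F(m)`: the quotient of `Id_F(m)` by the principal ideals `(α)` with
`α ∈ F¹(m)`. -/
abbrev RayClassGroup : Type :=
  idCoprime F m ⧸ ((rayUnits F m).map (toPrincipalIdeal (𝓞 F) F)).subgroupOf (idCoprime F m)

instance : CommGroup (RayClassGroup F m) :=
  { QuotientGroup.Quotient.group
      (((rayUnits F m).map (toPrincipalIdeal (𝓞 F) F)).subgroupOf (idCoprime F m)) with
    mul_comm := by
      rintro ⟨a⟩ ⟨b⟩
      exact congrArg QuotientGroup.mk (Subtype.ext (mul_comm _ _)) }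

/-- The group `(F ⊗ ℝ)ˣ` modulo its maximal compact subgroup, in the form `∏_{v ∣ ∞} ℝ_{>0}`. -/
abbrev InfPart : Type := InfinitePlace F → {x : ℝ // 0 < x}

/-- The fibre product of `Id_F(m)` and `InfPart F` over `ℝ_{>0}`. -/
def araGroup : Subgroup (Frac F × InfPart F) where
  carrier := {x | x.1 ∈ idCoprime F m ∧
    ((FractionalIdeal.absNorm (x.1 : FractionalIdeal (𝓞 F)⁰ F) : ℚ) : ℝ) =
      ∏ v, ((x.2 v : ℝ)) ^ v.mult}
  one_mem' := ⟨one_mem _, by simp⟩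
  mul_mem' := by
    rintro a b ⟨ha, ha'⟩ ⟨hb, hb'⟩
    refine ⟨mul_mem ha hb, ?_⟩
    simp only [Prod.fst_mul, Prod.snd_mul, Units.val_mul, map_mul, Rat.cast_mul, ha', hb',
      Pi.mul_apply, Positive.val_mul, mul_pow, Finset.prod_mul_distrib]
  inv_mem' := by
    rintro a ⟨ha, ha'⟩
    refine ⟨inv_mem ha, ?_⟩
    have h : (FractionalIdeal.absNorm ((a.1⁻¹ : Frac F) : FractionalIdeal (𝓞 F)⁰ F) : ℚ) =
        (FractionalIdeal.absNorm (a.1 : FractionalIdeal (𝓞 F)⁰ F))⁻¹ := by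
      apply eq_inv_of_mul_eq_one_left
      rw [← map_mul, Units.inv_mul, map_one]
    simp only [Prod.fst_inv, Prod.snd_inv, Pi.inv_apply, Positive.coe_inv, inv_pow,
      Finset.prod_inv_distrib, h, Rat.cast_inv, ha']

/-- The map `α ↦ ((α), (|α|_v)_v)`. -/
def prinPair : Fˣ →* Frac F × InfPart F :=
  (toPrincipalIdeal (𝓞 F) F).prod
    { toFun := fun α v => ⟨v (α : F), InfinitePlace.pos_iff.2 α.ne_zero⟩
      map_one' := by ext v; simp
      map_mul' := by intro a b; ext v; simp }

/-- The Arakelov ray class group `Pic⁰_F(m)`. -/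
abbrev ArakelovRayClassGroup : Type :=
  araGroup F m ⧸ ((rayUnits F m).map (prinPair F)).subgroupOf (araGroup F m)

instance : CommGroup (ArakelovRayClassGroup F m) :=
  { QuotientGroup.Quotient.group
      (((rayUnits F m).map (prinPair F)).subgroupOf (araGroup F m)) with
    mul_comm := by
      rintro ⟨a⟩ ⟨b⟩
      exact congrArg QuotientGroup.mk (Subtype.ext (Prod.ext (mul_comm _ _) (mul_comm _ _))) }

/-! The Galois action. -/

variable {F} in
/-- The automorphism of `𝓞 F` induced by an automorphism of `F`. -/
abbrev galInt (g : F ≃ₐ[ℚ] F) : 𝓞 F ≃+* 𝓞 F := RingOfIntegers.mapRingEquiv g.toRingEquiv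

variable {F}

theorem intValuation_gal (g : F ≃ₐ[ℚ] F) (v w : HeightOneSpectrum (𝓞 F))
    (h : ∀ a, a ∈ w.asIdeal ↔ galInt g a ∈ v.asIdeal) (a : 𝓞 F) :
    v.intValuation (galInt g a) = w.intValuation a := by
  have hI : w.asIdeal.map (galInt g) = v.asIdeal := by
    ext x
    obtain ⟨y, rfl⟩ := (galInt g).surjective x
    rw [← h, Ideal.mem_map_iff_of_surjective _ (galInt g).surjective]
    constructor
    · rintro ⟨z, hz, hzy⟩
      rwa [← (galInt g).injective hzy]
    · exact fun hy => ⟨y, hy, rfl⟩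
  have key : ∀ n : ℕ, galInt g a ∈ v.asIdeal ^ n ↔ a ∈ w.asIdeal ^ n := by
    intro n
    rw [← hI, ← Ideal.map_pow, Ideal.mem_map_iff_of_surjective _ (galInt g).surjective]
    constructor
    · rintro ⟨z, hz, hzy⟩
      rwa [← (galInt g).injective hzy]
    · exact fun hy => ⟨a, hy, rfl⟩
  rcases eq_or_ne a 0 with rfl | ha
  · simp
  have ha' : galInt g a ≠ 0 := by simpa using ha
  apply le_antisymm
  · rw [w.intValuation_eq_exp_neg_multiplicity ha, v.intValuation_le_pow_iff_mem, key,
      ← w.intValuation_le_pow_iff_mem, ← w.intValuation_eq_exp_neg_multiplicity ha]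
  · rw [v.intValuation_eq_exp_neg_multiplicity ha', w.intValuation_le_pow_iff_mem, ← key,
      ← v.intValuation_le_pow_iff_mem, ← v.intValuation_eq_exp_neg_multiplicity ha']

theorem valuation_gal (g : F ≃ₐ[ℚ] F) (v w : HeightOneSpectrum (𝓞 F))
    (h : ∀ a, a ∈ w.asIdeal ↔ galInt g a ∈ v.asIdeal) (x : F) :
    v.valuation F (g x) = w.valuation F x := by
  obtain ⟨a, b, hb, rfl⟩ := IsFractionRing.div_surjective (A := 𝓞 F) x
  have e : ∀ c : 𝓞 F, g (algebraMap (𝓞 F) F c) = algebraMap (𝓞 F) F (galInt g c) := fun _ => rfl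
  rw [map_div₀, map_div₀, map_div₀, e, e, v.valuation_of_algebraMap, v.valuation_of_algebraMap,
    w.valuation_of_algebraMap, w.valuation_of_algebraMap, intValuation_gal g v w h,
    intValuation_gal g v w h]

theorem rayUnits_gal (g : F ≃ₐ[ℚ] F) {α : Fˣ} (hα : α ∈ rayUnits F m) :
    Units.map (g : F →* F) α ∈ rayUnits F m := by
  intro v hv
  let w : HeightOneSpectrum (𝓞 F) :=
    { asIdeal := v.asIdeal.comap (galInt g)
      isPrime := inferInstance
      ne_bot := by
        intro h
        apply v.ne_bot
        rw [← Ideal.map_comap_of_surjective (galInt g) (galInt g).surjective v.asIdeal, h,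
          Ideal.map_bot] }
  have hw : ∀ a, a ∈ w.asIdeal ↔ galInt g a ∈ v.asIdeal := fun a => Iff.rfl
  have h1 := hα w ((hw _).2 (by simpa using hv))
  rw [← valuation_gal g v w hw, ← valuation_gal g v w hw] at h1
  simpa using h1

/-- The Galois action on fractional ideals. -/
def galFrac (g : F ≃ₐ[ℚ] F) : Frac F →* Frac F :=
  Units.map (FractionalIdeal.ringEquivOfRingEquiv F F (galInt g)).toMonoidHom

theorem mem_galFrac (g : F ≃ₐ[ℚ] F) (I : FractionalIdeal (𝓞 F)⁰ F) (x : F) :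
    x ∈ FractionalIdeal.ringEquivOfRingEquiv F F (galInt g) I ↔ ∃ y ∈ I, g y = x := by
  have e : ∀ y : F, IsFractionRing.ringEquivOfRingEquiv (K := F) (L := F) (galInt g) y = g y := by
    intro y
    obtain ⟨a, b, hb, rfl⟩ := IsFractionRing.div_surjective (A := 𝓞 F) y
    rw [map_div₀, map_div₀, IsFractionRing.ringEquivOfRingEquiv_algebraMap,
      IsFractionRing.ringEquivOfRingEquiv_algebraMap]
    rfl
  rw [← FractionalIdeal.mem_coe, ← FractionalIdeal.val_eq_coe,
    FractionalIdeal.ringEquivOfRingEquiv_apply_val, Submodule.mem_map]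
  constructor
  · rintro ⟨y, hy, rfl⟩
    exact ⟨y, hy, (e y).symm⟩
  · rintro ⟨y, hy, rfl⟩
    exact ⟨y, hy, e y⟩

theorem galFrac_coeIdeal (g : F ≃ₐ[ℚ] F) (J : Ideal (𝓞 F)) :
    FractionalIdeal.ringEquivOfRingEquiv F F (galInt g) (J : FractionalIdeal (𝓞 F)⁰ F) =
      (J.map (galInt g) : Ideal (𝓞 F)) := by
  ext x
  rw [mem_galFrac]
  simp only [FractionalIdeal.mem_coeIdeal,
    Ideal.mem_map_iff_of_surjective _ (galInt g).surjective]
  constructor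
  · rintro ⟨_, ⟨a, ha, rfl⟩, rfl⟩
    exact ⟨_, ⟨a, ha, rfl⟩, rfl⟩
  · rintro ⟨_, ⟨a, ha, rfl⟩, rfl⟩
    exact ⟨_, ⟨a, ha, rfl⟩, rfl⟩

theorem galFrac_spanSingleton (g : F ≃ₐ[ℚ] F) (x : F) :
    FractionalIdeal.ringEquivOfRingEquiv F F (galInt g)
      (FractionalIdeal.spanSingleton (𝓞 F)⁰ x) = FractionalIdeal.spanSingleton (𝓞 F)⁰ (g x) := by
  ext y
  rw [mem_galFrac]
  simp only [FractionalIdeal.mem_spanSingleton]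
  constructor
  · rintro ⟨_, ⟨a, rfl⟩, rfl⟩
    exact ⟨galInt g a, by rw [Algebra.smul_def, Algebra.smul_def, map_mul]; rfl⟩
  · rintro ⟨a, rfl⟩
    obtain ⟨b, rfl⟩ := (galInt g).surjective a
    exact ⟨b • x, ⟨b, rfl⟩, by rw [Algebra.smul_def, Algebra.smul_def, map_mul]; rfl⟩

theorem galFrac_toPrincipalIdeal (g : F ≃ₐ[ℚ] F) (α : Fˣ) :
    galFrac g (toPrincipalIdeal (𝓞 F) F α) =
      toPrincipalIdeal (𝓞 F) F (Units.map (g : F →* F) α) := by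
  ext1
  rw [coe_toPrincipalIdeal]
  change FractionalIdeal.ringEquivOfRingEquiv F F (galInt g)
    ((toPrincipalIdeal (𝓞 F) F α : Frac F) : FractionalIdeal (𝓞 F)⁰ F) = _
  rw [coe_toPrincipalIdeal, galFrac_spanSingleton]
  rfl

theorem absNorm_map_gal (g : F ≃ₐ[ℚ] F) (J : Ideal (𝓞 F)) :
    Ideal.absNorm (J.map (galInt g)) = Ideal.absNorm J := by
  rw [Ideal.absNorm_apply, Ideal.absNorm_apply, Submodule.cardQuot_apply,
    Submodule.cardQuot_apply]
  exact (Nat.card_congr (Ideal.quotientEquiv J _ (galInt g) rfl).toEquiv).symm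

theorem absNorm_galFrac (g : F ≃ₐ[ℚ] F) (I : FractionalIdeal (𝓞 F)⁰ F) :
    FractionalIdeal.absNorm (FractionalIdeal.ringEquivOfRingEquiv F F (galInt g) I) =
      FractionalIdeal.absNorm I := by
  obtain ⟨a, J, ha, hJ⟩ := FractionalIdeal.exists_eq_spanSingleton_mul I
  rw [hJ, map_mul, galFrac_spanSingleton, galFrac_coeIdeal, map_mul, map_mul,
    FractionalIdeal.coeIdeal_absNorm, FractionalIdeal.coeIdeal_absNorm, absNorm_map_gal,
    FractionalIdeal.absNorm_span_singleton, FractionalIdeal.absNorm_span_singleton,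
    Algebra.norm_eq_of_algEquiv]

theorem idCoprime_gal (g : F ≃ₐ[ℚ] F) {I : Frac F} (hI : I ∈ idCoprime F m) :
    galFrac g I ∈ idCoprime F m := by
  obtain ⟨J, J', h1, h2, h3, h4, h5⟩ := hI
  have hm : (modIdeal F m).map (galInt g) = modIdeal F m := by
    rw [Ideal.map_span]; simp
  have hc : ∀ K : Ideal (𝓞 F), IsCoprime K (modIdeal F m) →
      IsCoprime (K.map (galInt g)) (modIdeal F m) := by
    intro K hK
    rw [Ideal.isCoprime_iff_sup_eq] at hK ⊢
    rw [← hm, ← Ideal.map_sup, hK, Ideal.map_top]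
  have hb : ∀ K : Ideal (𝓞 F), K ≠ ⊥ → K.map (galInt g) ≠ ⊥ := by
    intro K hK h
    exact hK ((Ideal.map_eq_bot_iff_of_injective (galInt g).injective).1 h)
  refine ⟨J.map (galInt g), J'.map (galInt g), hb _ h1, hb _ h2, hc _ h3, hc _ h4, ?_⟩
  rw [← galFrac_coeIdeal, ← galFrac_coeIdeal, ← h5, map_mul]
  rfl

/-- The Galois action on `(F ⊗ ℝ)ˣ` modulo its maximal compact subgroup. -/
def galInf (g : F ≃ₐ[ℚ] F) : InfPart F →* InfPart F where
  toFun x v := x (v.comap (g : F →+* F))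
  map_one' := rfl
  map_mul' _ _ := rfl

theorem araGroup_gal (g : F ≃ₐ[ℚ] F) {x : Frac F × InfPart F} (hx : x ∈ araGroup F m) :
    (galFrac g).prodMap (galInf g) x ∈ araGroup F m := by
  refine ⟨idCoprime_gal m g hx.1, ?_⟩
  have h1 : FractionalIdeal.absNorm
      ((galFrac g x.1 : Frac F) : FractionalIdeal (𝓞 F)⁰ F) =
      FractionalIdeal.absNorm (x.1 : FractionalIdeal (𝓞 F)⁰ F) := absNorm_galFrac g _
  change ((FractionalIdeal.absNorm
      ((galFrac g x.1 : Frac F) : FractionalIdeal (𝓞 F)⁰ F) : ℚ) : ℝ) =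
    ∏ v : InfinitePlace F, ((x.2 (v.comap (g : F →+* F)) : ℝ)) ^ v.mult
  rw [h1, hx.2]
  let e : InfinitePlace F ≃ InfinitePlace F :=
    { toFun := fun v => v.comap (g : F →+* F)
      invFun := fun v => v.comap (g.symm : F →+* F)
      left_inv := fun v => by ext; simp
      right_inv := fun v => by ext; simp }
  rw [← e.prod_comp]
  refine Finset.prod_congr rfl fun v _ => ?_
  have hmult : (e v).mult = v.mult := by
    have : (v.comap ((g.toRingEquiv : F ≃+* F) : F →+* F)).IsReal ↔ v.IsReal :=
      InfinitePlace.isReal_comap_iff g.toRingEquiv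
    have : (e v).IsReal ↔ v.IsReal := this
    unfold InfinitePlace.mult
    split_ifs <;> tauto
  rw [hmult]
  rfl

/-- The action of an automorphism of `F` on the fibre product. -/
def galAra (g : F ≃ₐ[ℚ] F) : araGroup F m →* araGroup F m :=
  (((galFrac g).prodMap (galInf g)).comp (araGroup F m).subtype).codRestrict (araGroup F m)
    fun x => araGroup_gal m g x.2

theorem galAra_prinPair (g : F ≃ₐ[ℚ] F) (α : Fˣ) :
    (galFrac g).prodMap (galInf g) (prinPair F α) = prinPair F (Units.map (g : F →* F) α) :=
  Prod.ext (galFrac_toPrincipalIdeal g α) rfl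

/-- The action of an automorphism of `F` on the Arakelov ray class group. -/
def galPic (g : F ≃ₐ[ℚ] F) : ArakelovRayClassGroup F m →* ArakelovRayClassGroup F m :=
  QuotientGroup.map _ _ (galAra m g) (by
    rintro x ⟨α, hα, hx⟩
    refine ⟨Units.map (g : F →* F) α, rayUnits_gal m g hα, ?_⟩
    rw [← galAra_prinPair, hx]
    rfl)

theorem galPic_galPic (g : F ≃ₐ[ℚ] F) (hg : ∀ x, g (g x) = x) (b : ArakelovRayClassGroup F m) :
    galPic m g (galPic m g b) = b := by
  induction b using QuotientGroup.induction_on with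
  | H x =>
    obtain ⟨⟨I, y⟩, hx⟩ := x
    change ((galAra m g (galAra m g ⟨(I, y), hx⟩) : araGroup F m) :
      ArakelovRayClassGroup F m) = _
    congr 1
    apply Subtype.ext
    refine Prod.ext ?_ ?_
    · ext1
      change FractionalIdeal.ringEquivOfRingEquiv F F (galInt g)
        (FractionalIdeal.ringEquivOfRingEquiv F F (galInt g) I) = I
      ext z
      simp only [mem_galFrac]
      constructor
      · rintro ⟨_, ⟨w, hw, rfl⟩, rfl⟩
        rwa [hg]
      · exact fun hz => ⟨g z, ⟨z, hz, rfl⟩, hg z⟩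
    · funext v
      change y ((v.comap (g : F →+* F)).comap (g : F →+* F)) = y v
      congr 1
      ext z
      simp [hg]

/-! The map `(𝓞 F / m)ˣ → Pic⁰_F(m)`: it sends the residue class of `a ∈ 𝓞 F` to the class of
`((a), (|a|_v)_v)`. -/

variable (F)

theorem exists_lift (u : (𝓞 F ⧸ modIdeal F m)ˣ) :
    ∃ a : 𝓞 F, a ≠ 0 ∧ Ideal.Quotient.mk (modIdeal F m) a = u := by
  obtain ⟨a, ha⟩ := Ideal.Quotient.mk_surjective (u : 𝓞 F ⧸ modIdeal F m)
  rcases eq_or_ne a 0 with rfl | h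
  · have h0 : IsUnit (0 : 𝓞 F ⧸ modIdeal F m) := by
      rw [← map_zero (Ideal.Quotient.mk (modIdeal F m)), ha]
      exact u.isUnit
    have := isUnit_zero_iff.1 h0
    refine ⟨1, one_ne_zero, ?_⟩
    have hs := subsingleton_of_zero_eq_one this
    exact Subsingleton.elim _ _
  · exact ⟨a, h, ha⟩

/-- A non-zero algebraic integer with residue class `u`. -/
def lift (u : (𝓞 F ⧸ modIdeal F m)ˣ) : 𝓞 F := (exists_lift F m u).choose

theorem lift_ne_zero (u : (𝓞 F ⧸ modIdeal F m)ˣ) : lift F m u ≠ 0 :=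
  (exists_lift F m u).choose_spec.1

theorem mk_lift (u : (𝓞 F ⧸ modIdeal F m)ˣ) :
    Ideal.Quotient.mk (modIdeal F m) (lift F m u) = u := (exists_lift F m u).choose_spec.2

variable {F}

/-- A non-zero algebraic integer as an element of `Fˣ`. -/
def toUnit (a : 𝓞 F) (ha : a ≠ 0) : Fˣ :=
  Units.mk0 (a : F) (by simpa using ha)

theorem toUnit_mem_araGroup {a : 𝓞 F} (ha : a ≠ 0)
    (hu : IsUnit (Ideal.Quotient.mk (modIdeal F m) a)) :
    prinPair F (toUnit a ha) ∈ araGroup F m := by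
  refine ⟨⟨Ideal.span {a}, ⊤, by simpa using ha, top_ne_bot, ?_,
    by simp [Ideal.isCoprime_iff_sup_eq], ?_⟩, ?_⟩
  · obtain ⟨b, hb⟩ := hu.exists_right_inv
    obtain ⟨b, rfl⟩ := Ideal.Quotient.mk_surjective b
    rw [← map_mul, ← map_one (Ideal.Quotient.mk (modIdeal F m)), Ideal.Quotient.eq] at hb
    obtain ⟨c, hc⟩ := Ideal.mem_span_singleton.1 hb
    rw [Ideal.isCoprime_span_singleton_iff]
    exact ⟨b, -c, by linear_combination hc⟩
  · change ((toPrincipalIdeal (𝓞 F) F (toUnit a ha) : Frac F) :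
      FractionalIdeal (𝓞 F)⁰ F) * _ = _
    rw [coe_toPrincipalIdeal, FractionalIdeal.coeIdeal_top, mul_one,
      FractionalIdeal.coeIdeal_span_singleton]
    rfl
  · change ((FractionalIdeal.absNorm ((toPrincipalIdeal (𝓞 F) F (toUnit a ha) : Frac F) :
      FractionalIdeal (𝓞 F)⁰ F) : ℚ) : ℝ) = ∏ v : InfinitePlace F, (v (a : F)) ^ v.mult
    rw [coe_toPrincipalIdeal, FractionalIdeal.absNorm_span_singleton,
      InfinitePlace.prod_eq_abs_norm]
    rfl

/-- The class of `((a), (|a|_v)_v)` for a non-zero `a ∈ 𝓞 F` that is coprime to `m`. -/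
def prinClass (a : 𝓞 F) (ha : a ≠ 0) (hu : IsUnit (Ideal.Quotient.mk (modIdeal F m) a)) :
    ArakelovRayClassGroup F m :=
  QuotientGroup.mk ⟨prinPair F (toUnit a ha), toUnit_mem_araGroup m ha hu⟩

theorem div_mem_rayUnits {a b : 𝓞 F} (ha : a ≠ 0) (hb : b ≠ 0)
    (hu : IsUnit (Ideal.Quotient.mk (modIdeal F m) a))
    (h : Ideal.Quotient.mk (modIdeal F m) a = Ideal.Quotient.mk (modIdeal F m) b) :
    (toUnit a ha)⁻¹ * toUnit b hb ∈ rayUnits F m := by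
  intro v hv
  have hav : a ∉ v.asIdeal := by
    intro hav
    obtain ⟨c, hc⟩ := hu.exists_right_inv
    obtain ⟨c, rfl⟩ := Ideal.Quotient.mk_surjective c
    rw [← map_mul, ← map_one (Ideal.Quotient.mk (modIdeal F m)), Ideal.Quotient.eq] at hc
    obtain ⟨d, hd⟩ := Ideal.mem_span_singleton.1 hc
    apply v.isPrime.ne_top
    rw [Ideal.eq_top_iff_one]
    have : (1 : 𝓞 F) = a * c - m * d := by linear_combination -hd
    rw [this]
    exact sub_mem (Ideal.mul_mem_right _ _ hav) (Ideal.mul_mem_right _ _ hv)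
  have hval : v.valuation F (a : F) = 1 := (v.valuation_eq_one_iff_notMem).2 hav
  rw [eq_comm, Ideal.Quotient.eq] at h
  obtain ⟨d, hd⟩ := Ideal.mem_span_singleton.1 h
  have ha' : (a : F) ≠ 0 := by simpa using ha
  have e : (((toUnit a ha)⁻¹ * toUnit b hb : Fˣ) : F) - 1 = (a : F)⁻¹ * ((m : F) * (d : F)) := by
    have hd' : (b : F) - (a : F) = (m : F) * (d : F) := by
      rw [← map_sub, hd, map_mul, map_natCast]
    rw [← hd']
    simp only [toUnit, Units.val_mul, Units.val_inv_eq_inv_val, Units.val_mk0]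
    field_simp
  rw [e, map_mul, map_mul, map_inv₀, hval, inv_one, one_mul]
  exact mul_le_of_le_one_right' (v.valuation_le_one d)

theorem prinClass_eq {a b : 𝓞 F} (ha : a ≠ 0) (hb : b ≠ 0)
    (hu : IsUnit (Ideal.Quotient.mk (modIdeal F m) a))
    (hu' : IsUnit (Ideal.Quotient.mk (modIdeal F m) b))
    (h : Ideal.Quotient.mk (modIdeal F m) a = Ideal.Quotient.mk (modIdeal F m) b) :
    prinClass m a ha hu = prinClass m b hb hu' := by
  refine QuotientGroup.eq.2 ⟨_, div_mem_rayUnits m ha hb hu h, ?_⟩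
  rw [map_mul, map_inv]
  rfl

theorem prinClass_mul {a b : 𝓞 F} (ha : a ≠ 0) (hb : b ≠ 0)
    (hu : IsUnit (Ideal.Quotient.mk (modIdeal F m) a))
    (hu' : IsUnit (Ideal.Quotient.mk (modIdeal F m) b))
    (hu'' : IsUnit (Ideal.Quotient.mk (modIdeal F m) (a * b))) :
    prinClass m (a * b) (mul_ne_zero ha hb) hu'' = prinClass m a ha hu * prinClass m b hb hu' := by
  unfold prinClass
  rw [← QuotientGroup.mk_mul]
  congr 1
  apply Subtype.ext
  change prinPair F _ = prinPair F _ * prinPair F _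
  rw [← map_mul]
  congr 1
  ext
  simp [toUnit]

theorem isUnit_mk_lift (u : (𝓞 F ⧸ modIdeal F m)ˣ) :
    IsUnit (Ideal.Quotient.mk (modIdeal F m) (lift F m u)) := by
  rw [mk_lift]; exact u.isUnit

variable (F)

/-- The homomorphism `(𝓞 F / m)ˣ → Pic⁰_F(m)`. -/
def unitsToPic : (𝓞 F ⧸ modIdeal F m)ˣ →* ArakelovRayClassGroup F m :=
  MonoidHom.mk' (fun u => prinClass m (lift F m u) (lift_ne_zero F m u) (isUnit_mk_lift m u)) (by
    intro u w
    have hu : IsUnit (Ideal.Quotient.mk (modIdeal F m) (lift F m u * lift F m w)) := by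
      rw [map_mul]
      exact (isUnit_mk_lift m u).mul (isUnit_mk_lift m w)
    rw [← prinClass_mul m (lift_ne_zero F m u) (lift_ne_zero F m w) _ _ hu]
    apply prinClass_eq
    rw [map_mul, mk_lift, mk_lift, mk_lift, Units.val_mul])

variable {F}

theorem unitsToPic_eq (u : (𝓞 F ⧸ modIdeal F m)ˣ) {a : 𝓞 F} (ha : a ≠ 0)
    (h : Ideal.Quotient.mk (modIdeal F m) a = u) :
    unitsToPic F m u = prinClass m a ha (h ▸ u.isUnit) := by
  exact prinClass_eq m _ _ (isUnit_mk_lift m u) _ (by rw [mk_lift, h])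

theorem unitsToPic_neg_one : unitsToPic F m (-1) = 1 := by
  rw [unitsToPic_eq m (-1) (a := -1) (by simp) (by simp)]
  refine (QuotientGroup.eq_one_iff _).2 ⟨1, one_mem _, ?_⟩
  rw [map_one]
  refine Prod.ext ?_ ?_
  · ext1
    change 1 = ((toPrincipalIdeal (𝓞 F) F _ : Frac F) : FractionalIdeal (𝓞 F)⁰ F)
    rw [coe_toPrincipalIdeal]
    simp only [toUnit, Units.val_mk0, map_neg, map_one]
    rw [← FractionalIdeal.spanSingleton_one]
    ext x
    simp only [FractionalIdeal.mem_spanSingleton]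
    exact ⟨fun ⟨c, hc⟩ => ⟨-c, by simpa using hc⟩, fun ⟨c, hc⟩ => ⟨-c, by simpa using hc⟩⟩
  · funext v
    apply Subtype.ext
    change (1 : ℝ) = v ((-1 : 𝓞 F) : F)
    have h1 : ((-1 : 𝓞 F) : F) = -1 := by simp
    rw [h1]
    exact ((v.1.map_neg 1).trans (map_one v.1)).symm

variable (F)

/-- The homomorphism `(𝓞 F / m)ˣ / {±1} → Pic⁰_F(m)`. -/
def uToPic : UMod (𝓞 F ⧸ modIdeal F m) →* ArakelovRayClassGroup F m :=
  QuotientGroup.lift _ (unitsToPic F m) (by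
    rw [Subgroup.zpowers_le]
    exact unitsToPic_neg_one m)

variable {F}

theorem eq_or_eq_neg_of_real (ρ : F →+* ℝ) {x y : F}
    (h : ∀ v : InfinitePlace F, v x = v y) : x = y ∨ x = -y := by
  have h1 := h (InfinitePlace.mk (Complex.ofRealHom.comp ρ))
  simp only [InfinitePlace.apply, RingHom.comp_apply, Complex.ofRealHom_eq_coe,
    Complex.norm_real, Real.norm_eq_abs, abs_eq_abs] at h1
  rcases h1 with h1 | h1
  · exact Or.inl (ρ.injective h1)
  · exact Or.inr (ρ.injective (by rw [h1, map_neg]))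

theorem mk_eq_one_of_mem {a : 𝓞 F} (ha : a ≠ 0) (hm : m ≠ 0) (h : toUnit a ha ∈ rayUnits F m) :
    Ideal.Quotient.mk (modIdeal F m) a = 1 := by
  rw [← map_one (Ideal.Quotient.mk (modIdeal F m)), Ideal.Quotient.eq, Ideal.mem_span_singleton]
  have hm' : (m : F) ≠ 0 := by exact_mod_cast hm
  have key : ∀ v : HeightOneSpectrum (𝓞 F), v.valuation F (((a : F) - 1) / m) ≤ 1 := by
    intro v
    have hpos : 0 < v.valuation F (m : F) := by
      rw [zero_lt_iff, Valuation.ne_zero_iff]; exact hm'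
    rw [map_div₀, div_le_one₀ hpos]
    by_cases hv : (m : 𝓞 F) ∈ v.asIdeal
    · exact h v hv
    · have h1 : v.valuation F (m : F) = 1 := by
        have := (v.valuation_eq_one_iff_notMem (K := F) (r := (m : 𝓞 F))).2 hv
        simpa using this
      rw [h1]
      have := v.valuation_le_one (K := F) (a - 1)
      simpa using this
  obtain ⟨c, hc⟩ := HeightOneSpectrum.mem_integers_of_valuation_le_one F _ key
  refine ⟨c, ?_⟩
  apply FaithfulSMul.algebraMap_injective (𝓞 F) F
  rw [map_mul, hc, map_natCast, mul_div_cancel₀ _ hm', map_sub, map_one]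

/-- If `F` has a real embedding, so that its only roots of unity are `±1`, then
`(𝓞 F / m)ˣ / {±1} → Pic⁰_F(m)` is injective. -/
theorem uToPic_injective (ρ : F →+* ℝ) (hm : m ≠ 0) : Function.Injective (uToPic F m) := by
  rw [injective_iff_map_eq_one]
  intro u hu
  induction u using QuotientGroup.induction_on with
  | H u =>
    change unitsToPic F m u = 1 at hu
    obtain ⟨β, hβ, hx⟩ := (QuotientGroup.eq_one_iff _).1 hu
    have hv : ∀ v : InfinitePlace F, v (lift F m u : F) = v (β : F) := fun v =>
      (congrArg (fun z : Frac F × InfPart F => ((z.2 v : {x : ℝ // 0 < x}) : ℝ)) hx).symm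
    rw [QuotientGroup.eq_one_iff]
    rcases eq_or_eq_neg_of_real ρ hv with h | h
    · have hβ' : toUnit (lift F m u) (lift_ne_zero F m u) ∈ rayUnits F m := by
        have e : toUnit (lift F m u) (lift_ne_zero F m u) = β := Units.ext h
        rw [e]
        exact hβ
      have h1 := mk_eq_one_of_mem m _ hm hβ'
      rw [mk_lift] at h1
      rw [Units.val_eq_one.1 h1]
      exact one_mem _
    · have hl : -lift F m u ≠ 0 := neg_ne_zero.2 (lift_ne_zero F m u)
      have hβ' : toUnit (-lift F m u) hl ∈ rayUnits F m := by
        have e : toUnit (-lift F m u) hl = β := by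
          ext
          simp [toUnit, h]
        rw [e]
        exact hβ
      have h1 := mk_eq_one_of_mem m _ hm hβ'
      rw [map_neg, mk_lift] at h1
      have h2 : u = -1 := by
        ext
        rw [← neg_neg (u : 𝓞 F ⧸ modIdeal F m), h1]
        simp
      rw [h2]
      exact Subgroup.mem_zpowers _

variable (F) in
/-- The automorphism of `𝓞 F / m` induced by an automorphism of `F`. -/
def galQuot (g : F ≃ₐ[ℚ] F) : (𝓞 F ⧸ modIdeal F m) ≃+* (𝓞 F ⧸ modIdeal F m) :=
  Ideal.quotientEquiv _ _ (galInt g) (by rw [Ideal.map_span]; simp)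

theorem uToPic_gal (g : F ≃ₐ[ℚ] F) (u : UMod (𝓞 F ⧸ modIdeal F m)) :
    uToPic F m (uMap (galQuot F m g) u) = galPic m g (uToPic F m u) := by
  induction u using QuotientGroup.induction_on with
  | H u =>
    rw [uMap_mk]
    change unitsToPic F m (Units.mapEquiv (galQuot F m g).toMulEquiv u) =
      galPic m g (unitsToPic F m u)
    have h0 : galInt g (lift F m u) ≠ 0 := by simpa using lift_ne_zero F m u
    rw [unitsToPic_eq m _ h0 (by
      change _ = galQuot F m g u
      rw [← mk_lift F m u]
      rfl)]
    change _ = ((galAra m g ⟨prinPair F (toUnit _ (lift_ne_zero F m u)), _⟩ : araGroup F m) :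
      ArakelovRayClassGroup F m)
    unfold prinClass
    congr 1
    apply Subtype.ext
    change _ = (galFrac g).prodMap (galInf g) (prinPair F _)
    rw [galAra_prinPair]
    exact congrArg (prinPair F) (Units.ext rfl)

end NumberField

/-- The sequence of `S^∞`-torsion subgroups of
`1 → (𝓞 F / m)ˣ / {±1} → Pic⁰_F(m) → Pic⁰_F → 1`, where the left hand term is identified with
`U_R` by means of `r`, for a field `F` with a real embedding and an involution `g`. -/
def arakelovSeqOf {F : Type} [Field F] [NumberField F] (m : ℕ) [NeZero m] (S : Finset ℕ)
    {R : Type} [CommRing R] (τ : R ≃+* R) (g : F ≃ₐ[ℚ] F) (hg : ∀ x, g (g x) = x) (ρ : F →+* ℝ)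
    (r : R ≃+* (𝓞 F ⧸ modIdeal F m)) (hr : ∀ x, r (τ x) = galQuot F m g (r x)) : SSeq S R τ :=
  SSeq.ofHom (galPic m g) (galPic_galPic m g hg)
    (((uToPic F m).comp (uMap r).toMonoidHom).comp (sTors S (UMod R)).subtype)
    (((uToPic_injective m ρ (NeZero.ne m)).comp (uMap r).injective).comp Subtype.val_injective)
    (fun u => (congrArg (uToPic F m) (uMap_comm r τ _ hr u.1)).trans (uToPic_gal m g _))

/-! ### Real quadratic fields -/

/-- The real quadratic fields, as subfields of `ℝ`: every real quadratic field is isomorphic to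
exactly one of them. -/
abbrev RealQuad : Type := {F : IntermediateField ℚ ℝ // Module.finrank ℚ F = 2}

instance (F : RealQuad) : Algebra.IsQuadraticExtension ℚ F.1 := ⟨F.2⟩

instance (F : RealQuad) : NumberField F.1 where
  to_finiteDimensional := FiniteDimensional.of_finrank_eq_succ (n := 1) F.2

/-- The conductor of a number field that is abelian over `ℚ`: the smallest `n ≥ 1` such that the
field embeds in the `n`-th cyclotomic field. -/
def conductor (F : Type) [Field F] : ℕ :=
  sInf {n : ℕ | 0 < n ∧ Nonempty (F →+* CyclotomicField n ℚ)}

theorem exists_galConj (F : RealQuad) : ∃ g : F.1 ≃ₐ[ℚ] F.1, g ≠ AlgEquiv.refl := by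
  have h : Nat.card (F.1 ≃ₐ[ℚ] F.1) = 2 := by rw [IsGalois.card_aut_eq_finrank, F.2]
  have : Finite (F.1 ≃ₐ[ℚ] F.1) := Nat.finite_of_card_ne_zero (by rw [h]; norm_num)
  have : Nontrivial (F.1 ≃ₐ[ℚ] F.1) := Finite.one_lt_card_iff_nontrivial.1 (by rw [h]; norm_num)
  exact exists_ne _

/-- The non-trivial automorphism of a real quadratic field. -/
def galConj (F : RealQuad) : F.1 ≃ₐ[ℚ] F.1 := (exists_galConj F).choose

theorem galConj_galConj (F : RealQuad) (x : F.1) : galConj F (galConj F x) = x := by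
  have h : Nat.card (F.1 ≃ₐ[ℚ] F.1) = 2 := by rw [IsGalois.card_aut_eq_finrank, F.2]
  have h2 : galConj F ^ Nat.card (F.1 ≃ₐ[ℚ] F.1) = 1 := pow_card_eq_one'
  rw [h, pow_two] at h2
  exact DFunLike.congr_fun h2 x

/-- The set `𝓕_X` of real quadratic fields of conductor less than `X`. -/
def realQuadBelow (X : ℝ) : Set RealQuad := {F | (conductor F.1 : ℝ) < X}

section Heuristic

variable {m : ℕ} [NeZero m] (S : Finset ℕ) (D : LocalData m)

/-- The `C₂`-equivariant ring isomorphisms `R ≃ 𝓞 F / m`. -/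
abbrev Marking (F : RealQuad) : Type :=
  {r : D.R ≃+* (𝓞 F.1 ⧸ modIdeal F.1 m) //
    ∀ x, r (D.conjR x) = galQuot F.1 m (galConj F) (r x)}

/-- The set `𝓕_X(R)` of pairs `(F, r)`. -/
abbrev MarkedBelow (X : ℝ) : Type := Σ F : realQuadBelow X, Marking D F.1

/-- The sequence of a real quadratic field `F` and a marking `r`. -/
def arakelovSeq (F : RealQuad) (r : Marking D F) : SSeq S D.R D.conjR :=
  arakelovSeqOf m S D.conjR (galConj F) (galConj_galConj F) F.1.val.toRingHom r.1 r.2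

/-- The heuristic, for real quadratic fields, for a single function `f` of the isomorphism class
of the sequence: the average of `f` over the pairs `(F, r)`, ordered by the conductor of `F`,
exists and is equal to the expected value of `f`. -/
def HeuristicHolds (f : SClass S D.R D.conjR → ℂ) : Prop :=
  Filter.Tendsto
    (fun X : ℝ => (∑ᶠ p : MarkedBelow D X, f ⟦arakelovSeq S D p.1.1 p.2⟧) /
      (Nat.card (MarkedBelow D X) : ℂ))
    Filter.atTop (nhds (expectation f))

end Heuristic

/-- The average of `#Cl_F(m)[ℓ]` over the real quadratic fields of conductor less than `X`. -/
def averageTorsion (m ℓ : ℕ) (X : ℝ) : ℝ :=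
  (∑ᶠ F : realQuadBelow X, (Nat.card {c : RayClassGroup F.1.1 m // c ^ ℓ = 1} : ℝ)) /
    Nat.card (realQuadBelow X)

/-- The primes `p ∣ m` with `p ≡ 1 mod ℓ`. -/
def primesOne (m ℓ : ℕ) : Finset ℕ := m.primeFactors.filter fun p => (p : ℤ) ≡ 1 [ZMOD ℓ]

/-- The primes `p ∣ m` with `p ≡ ±1 mod ℓ`. -/
def primesPlusMinusOne (m ℓ : ℕ) : Finset ℕ :=
  m.primeFactors.filter fun p => (p : ℤ) ≡ 1 [ZMOD ℓ] ∨ (p : ℤ) ≡ -1 [ZMOD ℓ]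

end RayHeuristic

end

noncomputable section

namespace RayHeuristic

/-! ### Characters of the circle and of products of the circle with a finite group -/

/-! Model side. The involution inverts the third term C, so for odd ℓ the fixed part of B[ℓ] is that
of U_R[ℓ], while the inverted part consists of the inverted part of U_R[ℓ] and of the "new"
elements, which lie outside U_R. The average number of new elements is ℓ by a mass formula. Count
isogenies Θ → Θ' whose kernel is generated by a new element, with weight 1 / (#Aut Θ · #Aut Θ'). For
a fixed source they are the quotients by new elements (`tsum_isogeny_target`). For a fixed target
they are the coverings that adjoin an ℓ-th root of a character of the third term; the dual of that
term is ℤ times a finite group, so the index of its ℓ-th powers is ℓ times the order of its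
ℓ-torsion, and the total weight is ℓ (`tsum_isogeny_source`). This gives 𝔼(#B[ℓ]) = #U⁺[ℓ] · (#U⁻[ℓ]
+ ℓ) in `expectation_torsionSize`, without any evaluation of the total mass. If the mass were zero
or infinite the formal expectation would be 0, which the heuristic excludes because the averages are
bounded below.

Field side. The kernel of Pic⁰_F(m) → Cl_F(m) is a circle by Dirichlet's unit theorem, so
#Pic⁰_F(m)[ℓ] = ℓ · #Cl_F(m)[ℓ] (`card_picTorsion`). Group the fields F by the ring 𝓞_F / m with its
involution: there are finitely many classes, the number of markings is constant on each, and each is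
modelled by the algebras ℚ_p ⊗ F. The heuristic gives the average #U⁺[ℓ] · (1 + #U⁻[ℓ] / ℓ) on every
class (`tendsto_class_average`), and `tendsto_average_of_classes` reduces the theorem to averaging
this number over all fields.

Local side. Both counts are products over p ∣ m (`tor_discConj`). The factor of #U⁺[ℓ] at p does not
depend on F. The factor of #U⁻[ℓ] depends on whether p splits, is inert or ramifies; at p = ℓ with
ℓ² ∣ m it is ℓ, except that for ℓ = 3 it is 9 when the completion is ℚ_3(√-3), which contains the
cube roots of unity. This exception makes the fourth case different from the third. The conductors
of real quadratic fields are the fundamental discriminants D > 1 (`conductor_eq`,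
`exists_conductor_eq`), and a Möbius sieve shows that these are equidistributed over the admissible
residues, independently at different primes. So the average is a product of local means
(`tendsto_average_locMinus`), which are computed explicitly. -/

theorem fourierCoeff_eq_zero_of_mul [Fact (0 < 2 * Real.pi)] {F : AddCircle (2 * Real.pi) → ℂ}
    (hF : ∀ x y, F (x + y) = F x * F y) (n : ℤ)
    (hn : ∃ x, F x ≠ fourier n x) : fourierCoeff F n = 0 := by
  obtain ⟨x, hx⟩ := hn
  unfold fourierCoeff
  have h1 : ∀ y, fourier (-n) (x + y) • F (x + y) =
      (fourier (-n) x * F x) * (fourier (-n) y • F y) := by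
    intro y
    rw [hF, fourier_apply, fourier_apply, fourier_apply, smul_add, AddCircle.toCircle_add]
    simp only [Circle.coe_mul, smul_eq_mul]
    ring
  -- Translation by x multiplies the integrand by its value at x, so invariance of Haar measure
  -- forces the integral to vanish unless this value is 1.
  have h2 : ∫ y, fourier (-n) y • F y ∂AddCircle.haarAddCircle =
      (fourier (-n) x * F x) * ∫ y, fourier (-n) y • F y ∂AddCircle.haarAddCircle := by
    rw [← MeasureTheory.integral_const_mul, ← MeasureTheory.integral_add_left_eq_self _ x]
    exact MeasureTheory.integral_congr_ae (Filter.Eventually.of_forall h1)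
  by_contra h0
  have h3 : fourier (-n) x * F x = 1 := by
    have := mul_right_cancel₀ h0 ((one_mul _).trans h2)
    exact this.symm
  apply hx
  have h4 : fourier n x * fourier (-n) x = (1 : ℂ) := by
    rw [← fourier_add', add_neg_cancel, zero_smul, AddCircle.toCircle_zero, Circle.coe_one]
  calc F x = (fourier n x * fourier (-n) x) * F x := by rw [h4, one_mul]
    _ = fourier n x := by rw [mul_assoc, h3, mul_one]

/-- A multiplicative function different from all characters z ^ n is orthogonal to all of them. Its
Fourier series is then zero, hence summable, and converges pointwise to the function; this
contradicts the value 1 at the identity. -/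
theorem exists_zpow_of_circle (f : Circle →ₜ* Circle) : ∃ n : ℤ, ∀ z, f z = z ^ n := by
  have : Fact (0 < 2 * Real.pi) := ⟨Real.two_pi_pos⟩
  by_contra! hcon
  let F : C(AddCircle (2 * Real.pi), ℂ) :=
    ⟨fun x => (f (AddCircle.toCircle x) : ℂ), by
      have := AddCircle.continuous_toCircle (T := 2 * Real.pi)
      fun_prop⟩
  have hF : ∀ x y, F (x + y) = F x * F y := by
    intro x y
    simp [F, AddCircle.toCircle_add]
  have hne : ∀ n : ℤ, fourierCoeff F n = 0 := by
    intro n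
    apply fourierCoeff_eq_zero_of_mul hF
    obtain ⟨z, hz⟩ := hcon n
    obtain ⟨x, rfl⟩ := (AddCircle.homeomorphCircle' ).surjective z
    refine ⟨x, fun h => hz ?_⟩
    rw [fourier_apply, AddCircle.toCircle_zsmul] at h
    have h' : (f (AddCircle.toCircle x) : ℂ) = ((AddCircle.toCircle x ^ n : Circle) : ℂ) := h
    have e : AddCircle.homeomorphCircle' x = AddCircle.toCircle x := by
      induction x using QuotientAddGroup.induction_on with
      | H x =>
        rw [AddCircle.homeomorphCircle'_apply_mk]
        rw [AddCircle.toCircle_apply_mk, div_self Real.two_pi_pos.ne', one_mul]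
    rw [e]
    exact Circle.ext h'
  have key := has_pointwise_sum_fourier_series_of_summable (f := F) (by
    simp only [show fourierCoeff (F : AddCircle (2 * Real.pi) → ℂ) = 0 from funext hne]
    exact summable_zero) 0
  simp only [hne, zero_smul] at key
  have h0 : F 0 = 0 := (hasSum_zero.unique key).symm
  have h1 : F 0 = 1 := by simp [F]
  rw [h1] at h0
  exact one_ne_zero h0

/-- The group of homomorphisms from a finite group to the circle. -/
def circleHomEquiv (A : Type*) [CommGroup A] [Finite A] : (A →* Circle) ≃ (A →* ℂˣ) where
  toFun f := Circle.toUnits.comp f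
  invFun f :=
    { toFun := fun a => ⟨f a, by
        have h : (f a) ^ Nat.card A = 1 := by rw [← map_pow, pow_card_eq_one', map_one]
        refine mem_sphere_zero_iff_norm.2 ?_
        exact Complex.norm_eq_one_of_pow_eq_one (n := Nat.card A)
          (by rw [← Units.val_pow_eq_pow_val, h, Units.val_one]) Nat.card_pos.ne'⟩
      map_one' := by ext; simp
      map_mul' := by intro a b; ext; simp only [map_mul, Units.val_mul]; rfl }
  left_inv f := by ext; rfl
  right_inv f := by ext; rfl

theorem finite_circleHom (A : Type*) [CommGroup A] [Finite A] : Finite (A →* Circle) := by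
  have : Nat.card (A →* ℂˣ) ≠ 0 := by
    rw [CommGroup.card_monoidHom_of_hasEnoughRootsOfUnity]
    exact Nat.card_pos.ne'
  have := Nat.finite_of_card_ne_zero this
  exact Finite.of_equiv _ (circleHomEquiv A).symm

theorem exists_circleHom_ne_one {A : Type*} [CommGroup A] [Finite A] {a : A} (ha : a ≠ 1) :
    ∃ f : A →* Circle, f a ≠ 1 := by
  obtain ⟨φ, hφ⟩ := CommGroup.exists_apply_ne_one_of_hasEnoughRootsOfUnity A ℂ ha
  refine ⟨(circleHomEquiv A).symm φ, fun h => hφ ?_⟩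
  ext
  exact congrArg (fun z : Circle => (z : ℂ)) h

theorem exists_circle_pow_eq (z : Circle) {n : ℕ} (hn : n ≠ 0) : ∃ w : Circle, w ^ n = z := by
  refine ⟨Circle.exp (Complex.arg z / n), ?_⟩
  rw [← Circle.exp_nsmul, nsmul_eq_mul, mul_div_cancel₀ _ (Nat.cast_ne_zero.2 hn), Circle.exp_arg]

theorem exists_circle_primitiveRoot {n : ℕ} (hn : n ≠ 0) : ∃ ζ : Circle, IsPrimitiveRoot ζ n := by
  refine ⟨Circle.exp (2 * Real.pi / n), ?_⟩
  have h := Complex.isPrimitiveRoot_exp n hn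
  refine IsPrimitiveRoot.of_map_of_injective (f := Circle.coeHom) ?_ Circle.coe_injective
  convert h using 1
  change ((Circle.exp (2 * Real.pi / n) : Circle) : ℂ) = _
  rw [Circle.coe_exp]
  congr 1
  push_cast
  ring

theorem zpow_surjective_pow_ker {q : ℕ} (hq : q.Prime) {ζ w : Circle} (hζ : IsPrimitiveRoot ζ q)
    (hw : w ^ q = 1) : ∃ k : ℕ, ζ ^ k = w := by
  have h : IsPrimitiveRoot (ζ : ℂ) q := hζ.map_of_injective (f := Circle.coeHom) Circle.coe_injective
  have : NeZero q := ⟨hq.ne_zero⟩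
  obtain ⟨k, -, hk⟩ := h.eq_pow_of_pow_eq_one (ξ := (w : ℂ)) (by
    rw [← Circle.coe_pow, hw, Circle.coe_one])
  exact ⟨k, Circle.ext (by rw [Circle.coe_pow, hk])⟩

/-- Characters of `Circle × A` for a finite discrete group `A`. -/
theorem exists_circle_prod_char {A : Type*} [CommGroup A] [TopologicalSpace A] 
    (χ : (Circle × A) →ₜ* Circle) :
    ∃ (n : ℤ) (α : A →* Circle), ∀ z a, χ (z, a) = z ^ n * α a := by
  obtain ⟨n, hn⟩ := exists_zpow_of_circle (χ.comp (ContinuousMonoidHom.inl Circle A))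
  refine ⟨n, χ.toMonoidHom.comp (MonoidHom.inr Circle A), fun z a => ?_⟩
  have : (z, a) = (z, 1) * (1, a) := by simp
  rw [this, map_mul, ← hn]
  rfl

/-- The character `(z, a) ↦ z ^ n * α a`. -/
def circleProdChar {A : Type*} [CommGroup A] [TopologicalSpace A] [DiscreteTopology A] (n : ℤ)
    (α : A →* Circle) : (Circle × A) →ₜ* Circle where
  toFun x := x.1 ^ n * α x.2
  map_one' := by simp
  map_mul' x y := by simp [mul_zpow]; exact mul_mul_mul_comm _ _ _ _
  continuous_toFun := by
    have : Continuous α := continuous_of_discreteTopology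
    fun_prop

/-- The character group of `Circle × A`. -/
def circleProdDual (A : Type*) [CommGroup A] [TopologicalSpace A] [DiscreteTopology A] :
    (Multiplicative ℤ × (A →* Circle)) ≃* ((Circle × A) →ₜ* Circle) :=
  MulEquiv.ofBijective (MonoidHom.mk' (fun x => circleProdChar x.1.toAdd x.2) (by
    intro x y
    refine ContinuousMonoidHom.ext fun a => ?_
    change a.1 ^ (x.1.toAdd + y.1.toAdd) * (x.2 a.2 * y.2 a.2) =
      (a.1 ^ x.1.toAdd * x.2 a.2) * (a.1 ^ y.1.toAdd * y.2 a.2)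
    rw [zpow_add]
    exact mul_mul_mul_comm _ _ _ _)) (by
    constructor
    · rintro ⟨n, α⟩ ⟨k, β⟩ h
      have h1 : ∀ z a, z ^ n.toAdd * α a = z ^ k.toAdd * β a := fun z a => DFunLike.congr_fun h (z, a)
      have h2 : α = β := by
        ext a
        have := h1 1 a
        simp only [one_zpow, one_mul] at this
        rw [this]
      -- The point of angle one radian has infinite order because π is irrational, so its powers
      -- determine the exponent.
      have h3 : n.toAdd = k.toAdd := by
        have h4 : (Circle.exp 1) ^ (n.toAdd) = (Circle.exp 1) ^ (k.toAdd) := by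
          have := h1 (Circle.exp 1) 1
          simpa using this
        have h5 : Circle.exp (n.toAdd - k.toAdd : ℝ) = 1 := by
          have : Circle.exp (n.toAdd - k.toAdd : ℝ) = (Circle.exp 1) ^ (n.toAdd - k.toAdd) := by
            rw [← Circle.exp_zsmul]; simp
          rw [this, zpow_sub, h4, mul_inv_cancel]
        rw [Circle.exp_eq_one] at h5
        obtain ⟨j, hj⟩ := h5
        by_contra hne
        have hj0 : j ≠ 0 := by
          rintro rfl
          apply hne
          have : (n.toAdd : ℝ) - k.toAdd = 0 := by simpa using hj
          exact_mod_cast sub_eq_zero.1 this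
        have hir := irrational_pi
        apply hir
        refine ⟨(n.toAdd - k.toAdd) / (2 * j), ?_⟩
        have : (j : ℝ) ≠ 0 := by exact_mod_cast hj0
        push_cast
        rw [hj]
        field_simp
      exact Prod.ext h3 h2
    · intro χ
      obtain ⟨n, α, h⟩ := exists_circle_prod_char χ
      exact ⟨(Multiplicative.ofAdd n, α), ContinuousMonoidHom.ext fun x => (h x.1 x.2).symm⟩)

/-- Powers in the character group of `Circle × A`: the index of the subgroup of `q`-th powers is
`q` times the number of elements of order dividing `q`. -/
theorem card_quotient_pow_int_prod (A : Type*) [CommGroup A] [Finite A] (q : ℕ) (hq : q ≠ 0) :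
    (powMonoidHom q : (Multiplicative ℤ × A) →* _).range.index =
      q * Nat.card (powMonoidHom q : (Multiplicative ℤ × A) →* _).ker := by
  have h1 : (powMonoidHom q : (Multiplicative ℤ × A) →* _).range =
      (powMonoidHom q : Multiplicative ℤ →* _).range.prod (powMonoidHom q : A →* A).range := by
    ext ⟨x, y⟩
    simp only [MonoidHom.mem_range, powMonoidHom_apply, Subgroup.mem_prod, Prod.exists,
      Prod.pow_mk, Prod.mk.injEq]
    constructor
    · rintro ⟨a, b, h, h'⟩; exact ⟨⟨a, h⟩, ⟨b, h'⟩⟩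
    · rintro ⟨⟨a, h⟩, ⟨b, h'⟩⟩; exact ⟨a, b, h, h'⟩
  have h2 : (powMonoidHom q : (Multiplicative ℤ × A) →* _).ker =
      (⊥ : Subgroup (Multiplicative ℤ)).prod (powMonoidHom q : A →* A).ker := by
    ext ⟨x, y⟩
    simp only [MonoidHom.mem_ker, powMonoidHom_apply, Subgroup.mem_prod, Prod.pow_mk,
      Prod.mk_eq_one, Subgroup.mem_bot]
    refine and_congr_left fun _ => ?_
    constructor
    · intro h
      have : q • x.toAdd = 0 := congrArg Multiplicative.toAdd h
      have h3 : x.toAdd = 0 := by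
        rcases smul_eq_zero.1 this with h | h
        · exact absurd h hq
        · exact h
      exact Multiplicative.toAdd.injective h3
    · rintro rfl; exact one_pow _
  have h3 : (powMonoidHom q : Multiplicative ℤ →* _).range.index = q := by
    have : (powMonoidHom q : Multiplicative ℤ →* _).range =
        AddSubgroup.toSubgroup (AddSubgroup.zmultiples (q : ℤ)) := by
      ext x
      rw [MonoidHom.mem_range]
      change _ ↔ x.toAdd ∈ AddSubgroup.zmultiples (q : ℤ)
      rw [Int.mem_zmultiples_iff]
      constructor
      · rintro ⟨y, rfl⟩
        exact ⟨y.toAdd, by simp⟩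
      · rintro ⟨y, hy⟩
        refine ⟨Multiplicative.ofAdd y, ?_⟩
        apply Multiplicative.toAdd.injective
        rw [hy]
        simp
    rw [this]
    have := Int.index_zmultiples (q : ℤ)
    simp
  -- For an endomorphism of a finite group the index of the image is the order of the kernel. Only
  -- the factor ℤ, where the map is injective with image of index q, contributes the extra q.
  have h4 : (powMonoidHom q : A →* A).range.index = Nat.card (powMonoidHom q : A →* A).ker := by
    have e1 := Subgroup.card_mul_index (powMonoidHom q : A →* A).range
    have e2 := Subgroup.card_mul_index (powMonoidHom q : A →* A).ker
    rw [Subgroup.index_ker] at e2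
    rw [← e2, mul_comm] at e1
    exact Nat.eq_of_mul_eq_mul_right Nat.card_pos e1
  rw [h1, h2, Subgroup.index_prod, h3, h4]
  congr 1
  have := Nat.card_congr ((⊥ : Subgroup (Multiplicative ℤ)).prodEquiv
    (powMonoidHom q : A →* A).ker).toEquiv
  rw [this, Nat.card_prod]
  simp

theorem index_pow_range_congr {G H : Type*} [CommGroup G] [CommGroup H] (e : G ≃* H) (q : ℕ) :
    (powMonoidHom q : G →* G).range.index = (powMonoidHom q : H →* H).range.index ∧
    Nat.card (powMonoidHom q : G →* G).ker = Nat.card (powMonoidHom q : H →* H).ker := by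
  constructor
  · rw [← Subgroup.index_map_equiv _ e]
    congr 1
    ext x
    simp only [Subgroup.mem_map, MonoidHom.mem_range, powMonoidHom_apply]
    constructor
    · rintro ⟨_, ⟨y, rfl⟩, rfl⟩
      exact ⟨e y, by simp⟩
    · rintro ⟨y, rfl⟩
      exact ⟨_, ⟨e.symm y, rfl⟩, by simp⟩
  · refine Nat.card_congr (e.toEquiv.subtypeEquiv fun x => ?_)
    simp only [MonoidHom.mem_ker, powMonoidHom_apply]
    change _ ↔ (e x) ^ q = 1
    rw [← map_pow, map_eq_one_iff e e.injective]

/-- A continuous bijective homomorphism from a compact group to a Hausdorff group is an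
isomorphism of topological groups. -/
def contMulEquivOfBijective {G H : Type*} [Group G] [Group H] [TopologicalSpace G]
    [TopologicalSpace H] [CompactSpace G] [T2Space H] (f : G →* H) (hf : Continuous f)
    (hb : Function.Bijective f) : G ≃ₜ* H :=
  { MulEquiv.ofBijective f hb with
    continuous_toFun := hf
    continuous_invFun := Continuous.continuous_symm_of_equiv_compact_to_t2
      (f := (MulEquiv.ofBijective f hb).toEquiv) hf }

/-- `N` is the kernel of a continuous surjection to the product of the circle and a finite group. -/
def IsCircleFiniteKernel {B : Type} [CommGroup B] [TopologicalSpace B] (N : Subgroup B) : Prop :=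
  ∃ (A : Type) (_ : CommGroup A) (_ : TopologicalSpace A) (_ : DiscreteTopology A) (_ : Finite A)
    (p : B →ₜ* Circle × A), Function.Surjective p ∧ ∀ b, p b = 1 ↔ b ∈ N

/-- The description by a surjection is easier to transport along isogenies than the one by a
quotient topology. The two agree because a continuous bijection from a compact to a Hausdorff space
is a homeomorphism. -/
theorem isCircleFiniteKernel_iff {B : Type} [CommGroup B] [TopologicalSpace B]
    [IsTopologicalGroup B] [CompactSpace B] (N : Subgroup B) :
    IsCircleFiniteKernel N ↔ ∃ (A : Type) (_ : CommGroup A) (_ : TopologicalSpace A),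
      DiscreteTopology A ∧ Finite A ∧ Nonempty ((B ⧸ N) ≃ₜ* (Circle × A)) := by
  constructor
  · rintro ⟨A, _, _, hd, hfin, p, hp, hk⟩
    refine ⟨A, _, _, hd, hfin, ⟨contMulEquivOfBijective
      (QuotientGroup.lift N p.toMonoidHom fun b hb => (hk b).2 hb) ?_ ⟨?_, ?_⟩⟩⟩
    · exact (QuotientGroup.isQuotientMap_mk N).continuous_iff.2 p.continuous_toFun
    · rw [injective_iff_map_eq_one]
      intro b
      induction b using QuotientGroup.induction_on with
      | H b => exact fun h => (QuotientGroup.eq_one_iff b).2 ((hk b).1 h)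
    · intro y
      obtain ⟨b, rfl⟩ := hp y
      exact ⟨b, rfl⟩
  · rintro ⟨A, _, _, hd, hfin, ⟨e⟩⟩
    refine ⟨A, _, _, hd, hfin,
      ⟨(e : (B ⧸ N) →* Circle × A).comp (QuotientGroup.mk' N), ?_⟩, ?_, ?_⟩
    · exact e.continuous.comp QuotientGroup.continuous_mk
    · intro y
      obtain ⟨b, hb⟩ := QuotientGroup.mk_surjective (e.symm y)
      refine ⟨b, ?_⟩
      change e (b : B ⧸ N) = y
      rw [hb, e.apply_symm_apply]
    · intro b
      rw [← QuotientGroup.eq_one_iff]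
      change e (b : B ⧸ N) = 1 ↔ _
      exact map_eq_one_iff e e.injective

theorem exists_circleHom_apply_eq {A : Type*} [CommGroup A] [Finite A] {q : ℕ} (hq : q.Prime)
    {a : A} (ha : a ≠ 1) (haq : a ^ q = 1) {w : Circle} (hw : w ^ q = 1) :
    ∃ h : A →* Circle, h a = w := by
  obtain ⟨f, hf⟩ := exists_circleHom_ne_one ha
  have h1 : IsPrimitiveRoot (f a) q := by
    rw [IsPrimitiveRoot.iff_orderOf]
    have := Fact.mk hq
    exact orderOf_eq_prime (by rw [← map_pow, haq, map_one]) hf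
  obtain ⟨k, hk⟩ := zpow_surjective_pow_ker hq h1 hw
  exact ⟨f ^ k, hk⟩

/-- The quotient of `Circle × A` by a subgroup of prime order. -/
theorem exists_circle_prod_quotient {A : Type} [CommGroup A] [TopologicalSpace A]
    [DiscreteTopology A] [Finite A] {q : ℕ} (hq : q.Prime) {c : Circle × A} (hc : c ≠ 1)
    (hcq : c ^ q = 1) : IsCircleFiniteKernel (Subgroup.zpowers c) := by
  obtain ⟨z, a⟩ := c
  have hz : z ^ q = 1 := congrArg Prod.fst hcq
  have ha : a ^ q = 1 := congrArg Prod.snd hcq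
  -- If c lies in the circle, the q-th power map kills it and has the circle as its image. Otherwise
  -- a character of A with value z⁻¹ at a shears c into A, where the quotient by the powers of a is
  -- taken.
  by_cases ha1 : a = 1
  · subst ha1
    have hz1 : z ≠ 1 := fun h => hc (by rw [h]; rfl)
    have hprim : IsPrimitiveRoot z q := by
      rw [IsPrimitiveRoot.iff_orderOf]
      have := Fact.mk hq
      exact orderOf_eq_prime hz hz1
    refine ⟨A, _, _, inferInstance, inferInstance,
      ⟨((powMonoidHom q).prodMap (MonoidHom.id A)), ?_⟩, ?_, ?_⟩
    · change Continuous fun x : Circle × A => (x.1 ^ q, x.2)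
      fun_prop
    · rintro ⟨w, y⟩
      obtain ⟨v, hv⟩ := exists_circle_pow_eq w hq.ne_zero
      exact ⟨(v, y), Prod.ext hv rfl⟩
    · rintro ⟨w, y⟩
      change (w ^ q, y) = 1 ↔ _
      rw [Prod.mk_eq_one, Subgroup.mem_zpowers_iff]
      constructor
      · rintro ⟨h, rfl⟩
        obtain ⟨k, hk⟩ := zpow_surjective_pow_ker hq hprim h
        exact ⟨k, by simp [hk]⟩
      · rintro ⟨k, hk⟩
        have h1 : z ^ k = w := congrArg Prod.fst hk
        have h2 : (1 : A) ^ k = y := congrArg Prod.snd hk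
        refine ⟨?_, by rw [← h2, one_zpow]⟩
        rw [← h1, ← zpow_natCast, ← zpow_mul, mul_comm, zpow_mul, zpow_natCast, hz, one_zpow]
  · obtain ⟨h, hh⟩ := exists_circleHom_apply_eq hq ha1 ha (w := z⁻¹) (by rw [inv_pow, hz, inv_one])
    let _ : TopologicalSpace (A ⧸ Subgroup.zpowers a) := ⊥
    have : DiscreteTopology (A ⧸ Subgroup.zpowers a) := ⟨rfl⟩
    refine ⟨A ⧸ Subgroup.zpowers a, inferInstance, inferInstance, inferInstance, inferInstance,
      ⟨((MonoidHom.fst Circle A * h.comp (MonoidHom.snd Circle A)).prod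
        ((QuotientGroup.mk' (Subgroup.zpowers a)).comp (MonoidHom.snd Circle A))), ?_⟩, ?_, ?_⟩
    · change Continuous fun x : Circle × A => (x.1 * h x.2, (x.2 : A ⧸ Subgroup.zpowers a))
      have h1 : Continuous h := continuous_of_discreteTopology
      have h2 : Continuous (fun y : A => (y : A ⧸ Subgroup.zpowers a)) :=
        continuous_of_discreteTopology
      exact (continuous_fst.mul (h1.comp continuous_snd)).prodMk (h2.comp continuous_snd)
    · rintro ⟨w, y⟩
      obtain ⟨y, rfl⟩ := QuotientGroup.mk_surjective y
      exact ⟨(w * (h y)⁻¹, y), Prod.ext (inv_mul_cancel_right w (h y)) rfl⟩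
    · rintro ⟨w, y⟩
      change (w * h y, (y : A ⧸ Subgroup.zpowers a)) = 1 ↔ _
      rw [Prod.mk_eq_one, QuotientGroup.eq_one_iff, Subgroup.mem_zpowers_iff,
        Subgroup.mem_zpowers_iff]
      constructor
      · rintro ⟨h1, k, rfl⟩
        refine ⟨k, Prod.ext ?_ rfl⟩
        rw [map_zpow, hh, inv_zpow, mul_inv_eq_one] at h1
        exact h1.symm
      · rintro ⟨k, hk⟩
        have h1 : z ^ k = w := congrArg Prod.fst hk
        have h2 : a ^ k = y := congrArg Prod.snd hk
        refine ⟨?_, k, h2⟩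
        rw [← h1, ← h2, map_zpow, hh, inv_zpow, mul_inv_cancel]

theorem IsCircleFiniteKernel.comp {B B' : Type} [CommGroup B] [TopologicalSpace B]
    [CommGroup B'] [TopologicalSpace B'] {N' : Subgroup B'} (h : IsCircleFiniteKernel N')
    (f : B →ₜ* B') (hf : Function.Surjective f) (N : Subgroup B) (hN : ∀ b, f b ∈ N' ↔ b ∈ N) :
    IsCircleFiniteKernel N := by
  obtain ⟨A, i1, i2, i3, i4, p, hp, hk⟩ := h
  exact ⟨A, i1, i2, i3, i4, p.comp f, hp.comp hf, fun b => (hk _).trans (hN b)⟩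

/-- If `f : B → B'` is a continuous surjection of compact groups whose kernel is generated by an
element `x` of prime order that is not in `N`, then the image of `N` is again the kernel of a
surjection to the product of the circle and a finite group. -/
theorem IsCircleFiniteKernel.quotient {B B' : Type} [CommGroup B] [TopologicalSpace B]
    [CompactSpace B]
    [CommGroup B'] [TopologicalSpace B'] [T2Space B'] {N : Subgroup B} (h : IsCircleFiniteKernel N)
    {q : ℕ} (hq : q.Prime) {x : B} (hx : x ∉ N) (hxq : x ^ q = 1) (f : B →ₜ* B')
    (hf : Function.Surjective f) (hker : ∀ b, f b = 1 ↔ b ∈ Subgroup.zpowers x) :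
    IsCircleFiniteKernel (N.map f.toMonoidHom) := by
  obtain ⟨A, i1, i2, i3, i4, p, hp, hk⟩ := h
  have hpx : p x ≠ 1 := fun h => hx ((hk x).1 h)
  obtain ⟨A', j1, j2, j3, j4, p', hp', hk'⟩ := exists_circle_prod_quotient hq hpx
    (by rw [← map_pow, hxq, map_one])
  have hker' : ∀ b, f b = 1 → p' (p b) = 1 := by
    intro b hb
    obtain ⟨k, rfl⟩ := (hker b).1 hb
    rw [hk']
    refine ⟨k, ?_⟩
    change p x ^ k = p (x ^ k)
    rw [map_zpow]
  let e : (B ⧸ f.toMonoidHom.ker) ≃* B' := QuotientGroup.quotientKerEquivOfSurjective _ hf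
  let g : B' →* Circle × A' := (QuotientGroup.lift f.toMonoidHom.ker
    (p'.toMonoidHom.comp p.toMonoidHom) (fun b hb => hker' b hb)).comp e.symm.toMonoidHom
  have hg : ∀ b, g (f b) = p' (p b) := by
    intro b
    have : e.symm (f b) = (b : B ⧸ f.toMonoidHom.ker) := by
      rw [MulEquiv.symm_apply_eq]; rfl
    exact congrArg (QuotientGroup.lift f.toMonoidHom.ker
      (p'.toMonoidHom.comp p.toMonoidHom) (fun b hb => hker' b hb)) this
  have hquot : Topology.IsQuotientMap f :=
    (f.continuous_toFun.isClosedMap).isQuotientMap f.continuous_toFun hf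
  refine ⟨A', j1, j2, j3, j4, ⟨g, ?_⟩, ?_, ?_⟩
  · refine hquot.continuous_iff.2 ?_
    have : (fun b => g (f b)) = fun b => p' (p b) := funext hg
    change Continuous fun b => g (f b)
    rw [this]
    exact p'.continuous_toFun.comp p.continuous_toFun
  · intro y
    obtain ⟨c, rfl⟩ := hp' y
    obtain ⟨b, rfl⟩ := hp c
    exact ⟨f b, hg b⟩
  · intro b'
    obtain ⟨b, rfl⟩ := hf b'
    change g (f b) = 1 ↔ _
    rw [hg, hk', Subgroup.mem_zpowers_iff, Subgroup.mem_map]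
    constructor
    · rintro ⟨k, h⟩
      refine ⟨b * (x ^ k)⁻¹, ?_, ?_⟩
      · rw [← hk, map_mul, map_inv, map_zpow, h, mul_inv_cancel]
      · change f (b * (x ^ k)⁻¹) = f b
        have hx1 : f x = 1 := (hker x).2 (Subgroup.mem_zpowers x)
        rw [map_mul, map_inv, map_zpow, hx1, one_zpow, inv_one, mul_one]
    · rintro ⟨n, hn, h⟩
      have h1 : f (b * n⁻¹) = 1 := by
        rw [map_mul, map_inv, show f n = f b from h, mul_inv_cancel]
      obtain ⟨k, hk1⟩ := (hker _).1 h1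
      refine ⟨k, ?_⟩
      have h2 : b = x ^ k * n := by
        change x ^ k = b * n⁻¹ at hk1
        rw [hk1, inv_mul_cancel_right]
      rw [h2, map_mul, (hk n).2 hn, mul_one, map_zpow]

/-- The covering group `{(b, w) : χ b = w ^ q}`. -/
def coverGroup {B : Type} [CommGroup B] [TopologicalSpace B] (χ : B →ₜ* Circle) (q : ℕ) :
    Subgroup (B × Circle) where
  carrier := {x | χ x.1 = x.2 ^ q}
  one_mem' := by simp
  mul_mem' := by
    intro a b ha hb
    change χ (a.1 * b.1) = (a.2 * b.2) ^ q
    rw [map_mul, mul_pow, show χ a.1 = _ from ha, show χ b.1 = _ from hb]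
  inv_mem' := by
    intro a ha
    change χ (a.1⁻¹) = (a.2⁻¹) ^ q
    rw [map_inv, inv_pow, show χ a.1 = _ from ha]

theorem mem_coverGroup {B : Type} [CommGroup B] [TopologicalSpace B] {χ : B →ₜ* Circle} {q : ℕ}
    {x : B × Circle} : x ∈ coverGroup χ q ↔ χ x.1 = x.2 ^ q := Iff.rfl

theorem compactSpace_coverGroup {B : Type} [CommGroup B] [TopologicalSpace B] [CompactSpace B]
    (χ : B →ₜ* Circle) (q : ℕ) : CompactSpace (coverGroup χ q) := by
  have h : IsClosed (coverGroup χ q : Set (B × Circle)) :=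
    isClosed_eq (χ.continuous_toFun.comp continuous_fst) (continuous_snd.pow q)
  exact isCompact_iff_compactSpace.1 h.isCompact

/-- Write χ(z, a) = z ^ n · α(a). If n = q k, then w · z ^ (-k) is a q-th root of α(a), and the
covering splits as the circle times the finite covering of A by α. If q ∤ n, choose r n + s q = 1;
then t = z ^ s · w ^ r is a circle coordinate, with inverse z = t ^ q · α(a) ^ (-r), w = t ^ n ·
α(a) ^ s, and the covering is again Circle × A. -/
theorem isCircleFiniteKernel_bot_coverGroup {A : Type} [CommGroup A] [TopologicalSpace A]
    [DiscreteTopology A] [Finite A] {q : ℕ} (hq : q.Prime) (χ : (Circle × A) →ₜ* Circle) :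
    IsCircleFiniteKernel (⊥ : Subgroup (coverGroup χ q)) := by
  obtain ⟨n, α, hχ⟩ := exists_circle_prod_char χ
  by_cases hn : (q : ℤ) ∣ n
  · obtain ⟨k, rfl⟩ := hn
    let α' : A →ₜ* Circle := ⟨α, continuous_of_discreteTopology⟩
    -- From α(a) = w ^ q the second coordinate w is a root of unity of order dividing #A · q.
    have hfin : Finite (coverGroup α' q) := by
      have hq0 : (q : ℕ) ≠ 0 := hq.ne_zero
      let N := Nat.card A * q
      have hN : NeZero N := ⟨mul_ne_zero Nat.card_pos.ne' hq0⟩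
      let g : coverGroup α' q → A × rootsOfUnity N Circle := fun x => (x.1.1,
        rootsOfUnity.mkOfPowEq x.1.2 (by
          have hx : α x.1.1 = x.1.2 ^ q := x.2
          change x.1.2 ^ (Nat.card A * q) = 1
          rw [mul_comm, pow_mul, ← hx, ← map_pow, pow_card_eq_one', map_one]))
      have hroots : Finite (rootsOfUnity N Circle) := by
        let j : rootsOfUnity N Circle → rootsOfUnity N ℂ :=
          restrictRootsOfUnity Circle.coeHom N
        refine Finite.of_injective j ?_
        intro x y hxy
        have := congrArg (fun z : rootsOfUnity N ℂ => ((z : ℂˣ) : ℂ)) hxy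
        exact Subtype.ext (Units.ext (Circle.ext this))
      refine Finite.of_injective g ?_
      intro x y hxy
      have h1 := congrArg Prod.fst hxy
      have h2 := congrArg (fun z => ((z.2 : rootsOfUnity N Circle) : Circleˣ)) hxy
      have h3 : x.1.2 = y.1.2 := congrArg Units.val h2
      exact Subtype.ext (Prod.ext h1 h3)
    refine ⟨coverGroup α' q, inferInstance, inferInstance, inferInstance, hfin,
      ⟨((MonoidHom.fst Circle A).comp ((MonoidHom.fst (Circle × A) Circle).comp
          (coverGroup χ q).subtype)).prod
        (MonoidHom.codRestrict (((MonoidHom.snd Circle A).comp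
          ((MonoidHom.fst (Circle × A) Circle).comp (coverGroup χ q).subtype)).prod
          (((MonoidHom.snd (Circle × A) Circle).comp (coverGroup χ q).subtype) *
          (((zpowGroupHom k).comp (MonoidHom.fst Circle A)).comp
            ((MonoidHom.fst (Circle × A) Circle).comp (coverGroup χ q).subtype))⁻¹))
          (coverGroup α' q) ?_), ?_⟩, ?_, ?_⟩
    · rintro ⟨⟨⟨z, a⟩, w⟩, h⟩
      have h' : z ^ ((q : ℤ) * k) * α a = w ^ q := (hχ z a).symm.trans h
      change α a = (w * (z ^ k)⁻¹) ^ q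
      rw [mul_pow, ← h', inv_pow, ← zpow_natCast (z ^ k), ← zpow_mul, mul_comm k,
        mul_right_comm, mul_inv_cancel, one_mul]
    · change Continuous fun x : coverGroup χ q => (x.1.1.1,
        (⟨(x.1.1.2, x.1.2 * (x.1.1.1 ^ k)⁻¹), _⟩ : coverGroup α' q))
      refine Continuous.prodMk (by fun_prop) (Continuous.subtype_mk ?_ _)
      fun_prop
    · rintro ⟨z, ⟨⟨a, w⟩, h⟩⟩
      have h' : α a = w ^ q := h
      refine ⟨⟨((z, a), w * z ^ k), ?_⟩, ?_⟩
      · change χ (z, a) = (w * z ^ k) ^ q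
        rw [hχ, h', mul_pow, ← zpow_natCast (z ^ k), ← zpow_mul, mul_comm k, mul_comm]
      · refine Prod.ext rfl (Subtype.ext (Prod.ext rfl ?_))
        change w * z ^ k * (z ^ k)⁻¹ = w
        rw [mul_inv_cancel_right]
    · rintro ⟨⟨⟨z, a⟩, w⟩, h⟩
      rw [Subgroup.mem_bot]
      constructor
      · intro h1
        have h2 : z = 1 := congrArg Prod.fst h1
        have h3 : a = 1 := congrArg (fun y => (y.2 : coverGroup α' q).1.1) h1
        have h4 : w * (z ^ k)⁻¹ = 1 := congrArg (fun y => (y.2 : coverGroup α' q).1.2) h1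
        rw [h2, one_zpow, inv_one, mul_one] at h4
        exact Subtype.ext (Prod.ext (Prod.ext h2 h3) h4)
      · intro h1
        rw [h1, map_one]
  · have hcop : IsCoprime n (q : ℤ) :=
      ((Nat.prime_iff_prime_int.1 hq).coprime_iff_not_dvd.2 hn).symm
    obtain ⟨r, s, hrs⟩ := hcop
    have hχ' : ∀ z a w, ((z, a), w) ∈ coverGroup χ q → z ^ n * α a = w ^ q := fun z a w h =>
      (hχ z a).symm.trans h
    let F : (Circle × A) × Circle →* Circle :=
      (zpowGroupHom s).comp ((MonoidHom.fst Circle A).comp (MonoidHom.fst _ _)) *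
        (zpowGroupHom r).comp (MonoidHom.snd _ _)
    have hF : ∀ z a w, F ((z, a), w) = z ^ s * w ^ r := fun _ _ _ => rfl
    have key : ∀ t u : Circle, (t ^ (q : ℤ) * u ^ (-r)) ^ n * u = (t ^ n * u ^ s) ^ (q : ℤ) := by
      intro t u
      simp only [mul_zpow, ← zpow_mul]
      rw [mul_assoc, mul_comm n, ← zpow_add_one]
      congr 2
      linear_combination (-1 : ℤ) * hrs
    have key2 : ∀ t u : Circle, (t ^ (q : ℤ) * u ^ (-r)) ^ s * (t ^ n * u ^ s) ^ r = t := by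
      intro t u
      simp only [mul_zpow, ← zpow_mul]
      rw [mul_mul_mul_comm, ← zpow_add, ← zpow_add, show (q : ℤ) * s + n * r = 1 by
        linear_combination hrs, show -r * s + s * r = 0 by ring, zpow_zero, zpow_one, mul_one]
    refine ⟨A, inferInstance, inferInstance, inferInstance, inferInstance,
      ⟨(F.prod ((MonoidHom.snd Circle A).comp (MonoidHom.fst _ _))).comp
        (coverGroup χ q).subtype, ?_⟩, ?_, ?_⟩
    · have : Continuous fun x : coverGroup χ q => ((x.1.1.1 ^ s * x.1.2 ^ r), x.1.1.2) := by
        fun_prop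
      refine this.congr fun x => Prod.ext (hF _ _ _).symm rfl
    · rintro ⟨t, a⟩
      refine ⟨⟨((t ^ (q : ℤ) * α a ^ (-r), a), t ^ n * α a ^ s), ?_⟩, Prod.ext ?_ rfl⟩
      · change χ (_, a) = (t ^ n * α a ^ s) ^ q
        rw [hχ, ← zpow_natCast]
        exact key t (α a)
      · exact key2 t (α a)
    · rintro ⟨⟨⟨z, a⟩, w⟩, h⟩
      rw [Subgroup.mem_bot]
      constructor
      · intro h1
        have h2 : F ((z, a), w) = 1 := congrArg Prod.fst h1
        have h3 : a = 1 := congrArg Prod.snd h1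
        subst h3
        rw [hF] at h2
        have h4 := hχ' z 1 w h
        rw [map_one, mul_one] at h4
        have hz : z = 1 := by
          calc z = z ^ (r * n + s * q) := by rw [hrs, zpow_one]
            _ = (z ^ n) ^ r * (z ^ s) ^ (q : ℤ) := by
              rw [zpow_add, mul_comm r, zpow_mul, zpow_mul]
            _ = (z ^ s * w ^ r) ^ (q : ℤ) := by
              rw [h4, mul_zpow, mul_comm, ← zpow_natCast, ← zpow_mul, ← zpow_mul, ← zpow_mul,
                mul_comm (q : ℤ) r]
            _ = 1 := by rw [h2, one_zpow]
        have hw : w = 1 := by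
          calc w = w ^ (r * n + s * q) := by rw [hrs, zpow_one]
            _ = (w ^ r) ^ n * (w ^ (q : ℕ)) ^ s := by
              rw [zpow_add, zpow_mul, mul_comm s, zpow_mul, zpow_natCast]
            _ = (z ^ s * w ^ r) ^ n := by
              rw [← h4, mul_zpow, mul_comm, ← zpow_mul, ← zpow_mul, ← zpow_mul, mul_comm n s]
            _ = 1 := by rw [h2, one_zpow]
        exact Subtype.ext (Prod.ext (Prod.ext hz rfl) hw)
      · intro h1
        rw [h1, map_one]

/-! ### Isogenies of sequences and quotients by new elements -/

section Isogenies

variable {S : Finset ℕ} {R : Type} [CommRing R] {τ : R ≃+* R}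

/-- Build a sequence of compact groups from a kernel description of the third term. -/
def CptSeq.ofKernel (B : Type) [CommGroup B] [TopologicalSpace B] [IsTopologicalGroup B]
    [CompactSpace B] [T2Space B] (σ : B →* B) (σ_continuous : Continuous σ)
    (σ_σ : ∀ b, σ (σ b) = b) (i : sTors S (UMod R) →* B) (injective : Function.Injective i)
    (equivariant : ∀ u, i (uMapS S τ u) = σ (i u)) (σ_quotient : ∀ b, b * σ b ∈ i.range)
    (h : IsCircleFiniteKernel i.range) : CptSeq S R τ where
  B := B
  σ := σ
  σ_continuous := σ_continuous
  σ_σ := σ_σ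
  i := i
  injective := injective
  equivariant := equivariant
  σ_quotient := σ_quotient
  quotient := (isCircleFiniteKernel_iff _).1 h

theorem CptSeq.isCircleFiniteKernel (Θ : CptSeq S R τ) : IsCircleFiniteKernel Θ.i.range :=
  (isCircleFiniteKernel_iff _).2 Θ.quotient

/-- Morphisms of sequences that induce on the left hand terms an automorphism that comes from a
ring automorphism. -/
structure CptSeq.IsHom (Θ Θ' : CptSeq S R τ) (f : Θ.B →ₜ* Θ'.B) : Prop where
  surjective : Function.Surjective f
  equivariant : ∀ b, f (Θ.σ b) = Θ'.σ (f b)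
  ring : ∃ φ : R ≃+* R, ∀ u, f (Θ.i u) = Θ'.i (uMapS S φ u)

/-- An element of order `q` on which the involution acts by inversion and that is not in the image
of the left hand term. -/
structure CptSeq.IsNew (Θ : CptSeq S R τ) (q : ℕ) (x : Θ.B) : Prop where
  pow_eq : x ^ q = 1
  σ_eq : Θ.σ x = x⁻¹
  notMem : x ∉ Θ.i.range

/-- Isogenies whose kernel is generated by a new element of order `q`, together with a generator. -/
def CptSeq.Isogeny (Θ Θ' : CptSeq S R τ) (q : ℕ) : Type :=
  {p : (Θ.B →ₜ* Θ'.B) × Θ.B // Θ.IsHom Θ' p.1 ∧ Θ.IsNew q p.2 ∧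
    ∀ b, p.1 b = 1 ↔ b ∈ Subgroup.zpowers p.2}

theorem CptSeq.IsHom.mem_range_iff {Θ Θ' : CptSeq S R τ} {f : Θ.B →ₜ* Θ'.B} (hf : Θ.IsHom Θ' f) :
    ∀ u, ∃ v, f (Θ.i v) = Θ'.i u := by
  obtain ⟨φ, hφ⟩ := hf.ring
  intro u
  exact ⟨uMapS S φ.symm u, by rw [hφ, uMapS_symm_apply]⟩

/-- Two continuous surjections from a compact group with the same kernel differ by an
isomorphism. -/
theorem exists_contMulEquiv_of_ker_eq {B B₁ B₂ : Type*} [CommGroup B] [TopologicalSpace B]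
    [CompactSpace B] [CommGroup B₁] [TopologicalSpace B₁] [T2Space B₁]
    [CommGroup B₂] [TopologicalSpace B₂] [T2Space B₂]
    (f₁ : B →ₜ* B₁) (f₂ : B →ₜ* B₂) (h₁ : Function.Surjective f₁) (h₂ : Function.Surjective f₂)
    (h : ∀ b, f₁ b = 1 ↔ f₂ b = 1) : ∃ g : B₁ ≃ₜ* B₂, ∀ b, g (f₁ b) = f₂ b := by
  let e : (B ⧸ f₁.toMonoidHom.ker) ≃* B₁ := QuotientGroup.quotientKerEquivOfSurjective _ h₁
  let l : (B ⧸ f₁.toMonoidHom.ker) →* B₂ := QuotientGroup.lift f₁.toMonoidHom.ker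
    f₂.toMonoidHom (fun b hb => (h b).1 hb)
  let g : B₁ →* B₂ := l.comp e.symm.toMonoidHom
  have hg : ∀ b, g (f₁ b) = f₂ b := by
    intro b
    have : e.symm (f₁ b) = (b : B ⧸ f₁.toMonoidHom.ker) := by
      rw [MulEquiv.symm_apply_eq]; rfl
    exact congrArg l this
  have hquot : Topology.IsQuotientMap f₁ :=
    (f₁.continuous_toFun.isClosedMap).isQuotientMap f₁.continuous_toFun h₁
  have hc : Continuous g := by
    refine hquot.continuous_iff.2 ?_
    change Continuous fun b => g (f₁ b)
    rw [funext hg]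
    exact f₂.continuous_toFun
  have hcpt : CompactSpace B₁ := by
    have := isCompact_range f₁.continuous_toFun
    rw [show Set.range f₁.toFun = Set.univ from h₁.range_eq] at this
    exact isCompact_univ_iff.1 this
  refine ⟨contMulEquivOfBijective g hc ⟨?_, ?_⟩, hg⟩
  · rw [injective_iff_map_eq_one]
    intro b hb
    obtain ⟨b, rfl⟩ := h₁ b
    rw [hg] at hb
    exact (h b).2 hb
  · intro b
    obtain ⟨b, rfl⟩ := h₂ b
    exact ⟨f₁ b, hg b⟩

/-- The quotient of a sequence by the subgroup generated by a new element. -/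
theorem CptSeq.exists_quotient (Θ : CptSeq S R τ) {q : ℕ} (hq : q.Prime) {x : Θ.B}
    (hx : Θ.IsNew q x) : ∃ (Θ' : CptSeq S R τ) (p : Θ.Isogeny Θ' q), p.1.2 = x := by
  let K := Subgroup.zpowers x
  have hfinK : Finite K := by
    have : IsOfFinOrder x := isOfFinOrder_iff_pow_eq_one.2 ⟨q, hq.pos, hx.pow_eq⟩
    exact this.finite_zpowers
  have hclosed : IsClosed (K : Set Θ.B) := (Set.toFinite _).isClosed
  have : T2Space (Θ.B ⧸ K) := by
    have : T1Space (Θ.B ⧸ K) := by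
      have := hclosed
      exact (QuotientGroup.t1Space_iff (N := K)).2 hclosed
    infer_instance
  have hσK : K ≤ K.comap Θ.σ := by
    rw [Subgroup.zpowers_le, Subgroup.mem_comap, hx.σ_eq]
    exact inv_mem (Subgroup.mem_zpowers x)
  let f : Θ.B →ₜ* Θ.B ⧸ K := ⟨QuotientGroup.mk' K, QuotientGroup.continuous_mk⟩
  have hf : Function.Surjective f := QuotientGroup.mk_surjective
  have hker : ∀ b, f b = 1 ↔ b ∈ K := fun b => QuotientGroup.eq_one_iff b
  -- The subgroup K has prime order q and is not contained in the image of i: if q ∤ k then x is a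
  -- power of x ^ k, so x ^ k cannot lie in the image.
  have hinter : ∀ u, Θ.i u ∈ K → u = 1 := by
    rintro u ⟨k, hk⟩
    change x ^ k = Θ.i u at hk
    by_cases hqk : (q : ℤ) ∣ k
    · obtain ⟨j, rfl⟩ := hqk
      rw [zpow_mul, zpow_natCast, hx.pow_eq, one_zpow] at hk
      exact Θ.injective (by rw [← hk, map_one])
    · exfalso
      obtain ⟨r, s, hrs⟩ := ((Nat.prime_iff_prime_int.1 hq).coprime_iff_not_dvd.2 hqk).symm
      apply hx.notMem
      refine ⟨u ^ r, ?_⟩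
      rw [map_zpow, ← hk, ← zpow_mul]
      calc x ^ (k * r) = x ^ (r * k + s * q) := by
            rw [zpow_add, mul_comm s, zpow_mul x q, zpow_natCast, hx.pow_eq, one_zpow, mul_one,
              mul_comm]
        _ = x := by rw [hrs, zpow_one]
  have hrange : (f.toMonoidHom.comp Θ.i).range = Θ.i.range.map f.toMonoidHom :=
    MonoidHom.range_comp _ _
  let Θ' : CptSeq S R τ := CptSeq.ofKernel (Θ.B ⧸ K) (QuotientGroup.map K K Θ.σ hσK)
    (by
      refine (QuotientGroup.isQuotientMap_mk K).continuous_iff.2 ?_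
      exact f.continuous_toFun.comp Θ.σ_continuous)
    (by
      intro b
      obtain ⟨b, rfl⟩ := hf b
      exact congrArg f (Θ.σ_σ b))
    (f.toMonoidHom.comp Θ.i)
    (by
      rw [injective_iff_map_eq_one]
      exact fun u hu => hinter u ((hker _).1 hu))
    (fun u => congrArg f (Θ.equivariant u))
    (by
      intro b
      obtain ⟨b, rfl⟩ := hf b
      obtain ⟨u, hu⟩ := Θ.σ_quotient b
      exact ⟨u, congrArg f hu⟩)
    (by
      rw [hrange]
      exact Θ.isCircleFiniteKernel.quotient hq hx.notMem hx.pow_eq f hf hker)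
  exact ⟨Θ', ⟨(f, x), ⟨hf, fun _ => rfl, RingEquiv.refl R, fun u => by rw [uMapS_id]; rfl⟩, hx,
    hker⟩, rfl⟩

/-- Isogenies with the same kernel differ by an isomorphism. -/
theorem CptSeq.Isogeny.exists_iso {Θ Θ₁ Θ₂ : CptSeq S R τ} {q : ℕ} (p₁ : Θ.Isogeny Θ₁ q)
    (p₂ : Θ.Isogeny Θ₂ q) (h : p₁.1.2 = p₂.1.2) :
    ∃ g : Θ₁.B ≃ₜ* Θ₂.B, CptSeq.IsIso Θ₁ Θ₂ g ∧ ∀ b, g (p₁.1.1 b) = p₂.1.1 b := by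
  obtain ⟨⟨f₁, x⟩, h₁, hx, hk₁⟩ := p₁
  obtain ⟨⟨f₂, x'⟩, h₂, hx', hk₂⟩ := p₂
  obtain rfl : x = x' := h
  obtain ⟨g, hg⟩ := exists_contMulEquiv_of_ker_eq f₁ f₂ h₁.surjective h₂.surjective
    fun b => (hk₁ b).trans (hk₂ b).symm
  refine ⟨g, ⟨?_, ?_⟩, hg⟩
  · intro b
    obtain ⟨b, rfl⟩ := h₁.surjective b
    rw [← h₁.equivariant, hg, hg, h₂.equivariant]
  · obtain ⟨φ₁, hφ₁⟩ := h₁.ring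
    obtain ⟨φ₂, hφ₂⟩ := h₂.ring
    refine ⟨φ₁.symm.trans φ₂, fun u => ?_⟩
    have h3 : Θ₁.i u = f₁ (Θ.i (uMapS S φ₁.symm u)) := by rw [hφ₁, uMapS_symm_apply]
    rw [h3, hg, hφ₂, uMapS_comp S φ₁.symm φ₂ (φ₁.symm.trans φ₂) fun _ => rfl]

/-- Composition of an isogeny with an isomorphism. -/
def CptSeq.Isogeny.compIso {Θ Θ₁ Θ₂ : CptSeq S R τ} {q : ℕ} (p : Θ.Isogeny Θ₁ q)
    (g : Θ₁.B ≃ₜ* Θ₂.B) (hg : CptSeq.IsIso Θ₁ Θ₂ g) : Θ.Isogeny Θ₂ q :=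
  ⟨((g : Θ₁.B →ₜ* Θ₂.B).comp p.1.1, p.1.2),
    ⟨g.surjective.comp p.2.1.surjective, fun b => by
      change g (p.1.1 (Θ.σ b)) = _
      rw [p.2.1.equivariant, hg.1]
      rfl, by
      obtain ⟨φ, hφ⟩ := p.2.1.ring
      obtain ⟨ψ, hψ⟩ := hg.2
      refine ⟨φ.trans ψ, fun u => ?_⟩
      change g (p.1.1 (Θ.i u)) = _
      rw [hφ, hψ, uMapS_comp S φ ψ (φ.trans ψ) fun _ => rfl]⟩, p.2.2.1, fun b => by
      rw [← p.2.2.2]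
      change g (p.1.1 b) = 1 ↔ _
      exact map_eq_one_iff g g.injective⟩

/-- The isogenies with given source, target and kernel are a torsor under the automorphism group
of the target. -/
theorem CptSeq.Isogeny.card_fiber {Θ Θ' : CptSeq S R τ} {q : ℕ} (p : Θ.Isogeny Θ' q) :
    Nat.card {p' : Θ.Isogeny Θ' q // p'.1.2 = p.1.2} = Θ'.autCard := by
  symm
  refine Nat.card_congr (Equiv.ofBijective (fun g => ⟨p.compIso g.1 g.2, rfl⟩) ⟨?_, ?_⟩)
  · intro g g' h
    apply Subtype.ext
    apply ContinuousMulEquiv.ext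
    intro b
    obtain ⟨b, rfl⟩ := p.2.1.surjective b
    exact DFunLike.congr_fun (congrArg (fun y => y.1.1.1) h) b
  · rintro ⟨p', hp'⟩
    obtain ⟨g, hg, hgp⟩ := p.exists_iso p' hp'.symm
    refine ⟨⟨g, hg⟩, Subtype.ext (Subtype.ext (Prod.ext ?_ hp'.symm))⟩
    exact ContinuousMonoidHom.ext hgp

end Isogenies

/-! ### Coverings that adjoin a q-th root of a character of the third term -/

section Covers

variable {S : Finset ℕ} {R : Type} [CommRing R] {τ : R ≃+* R}

/-- The characters of the third term of a sequence. -/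
def CptSeq.dual (Θ : CptSeq S R τ) : Subgroup (Θ.B →ₜ* Circle) where
  carrier := {χ | ∀ u, χ (Θ.i u) = 1}
  one_mem' := fun _ => rfl
  mul_mem' := by
    intro a b ha hb u
    change a (Θ.i u) * b (Θ.i u) = 1
    rw [ha u, hb u, one_mul]
  inv_mem' := by
    intro a ha u
    change (a (Θ.i u))⁻¹ = 1
    rw [ha u, inv_one]

theorem CptSeq.dual_σ {Θ : CptSeq S R τ} {χ : Θ.B →ₜ* Circle} (hχ : χ ∈ Θ.dual) (b : Θ.B) :
    χ (Θ.σ b) = (χ b)⁻¹ := by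
  obtain ⟨u, hu⟩ := Θ.σ_quotient b
  have : χ b * χ (Θ.σ b) = 1 := by rw [← map_mul, ← hu, hχ]
  exact (inv_eq_of_mul_eq_one_right this).symm

/-- Pull-back along the surjection B → Circle × A identifies the dual with the characters of that
product; continuity descends because the surjection is closed. The free part of rank one, from the
circle, is responsible for the factor q in the mass formula. -/
theorem CptSeq.exists_dualEquiv (Θ : CptSeq S R τ) : ∃ (A : Type) (_ : CommGroup A),
    Finite A ∧ Nonempty (Θ.dual ≃* (Multiplicative ℤ × A)) := by
  obtain ⟨A, i1, i2, i3, i4, p, hp, hk⟩ := Θ.isCircleFiniteKernel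
  refine ⟨A →* Circle, inferInstance, finite_circleHom A, ⟨?_⟩⟩
  have hpi : ∀ u, p (Θ.i u) = 1 := fun u => (hk _).2 ⟨u, rfl⟩
  have hbij : Function.Bijective (fun χ : (Circle × A) →ₜ* Circle =>
      (⟨χ.comp p, fun u => by
        change χ (p (Θ.i u)) = 1
        rw [hpi, map_one]⟩ : Θ.dual)) := by
    constructor
    · intro χ χ' h
      refine ContinuousMonoidHom.ext fun c => ?_
      obtain ⟨b, rfl⟩ := hp c
      exact DFunLike.congr_fun (congrArg Subtype.val h) b
    · rintro ⟨ψ, hψ⟩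
      have hquot : Topology.IsQuotientMap p :=
        (p.continuous_toFun.isClosedMap).isQuotientMap p.continuous_toFun hp
      let e : (Θ.B ⧸ p.toMonoidHom.ker) ≃* Circle × A :=
        QuotientGroup.quotientKerEquivOfSurjective _ hp
      let l : (Θ.B ⧸ p.toMonoidHom.ker) →* Circle := QuotientGroup.lift p.toMonoidHom.ker
        ψ.toMonoidHom (fun b hb => by
          obtain ⟨u, rfl⟩ := (hk b).1 hb
          exact hψ u)
      have hl : ∀ b, l.comp e.symm.toMonoidHom (p b) = ψ b := by
        intro b
        have : e.symm (p b) = (b : Θ.B ⧸ p.toMonoidHom.ker) := by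
          rw [MulEquiv.symm_apply_eq]; rfl
        exact congrArg l this
      refine ⟨⟨l.comp e.symm.toMonoidHom, ?_⟩, Subtype.ext (ContinuousMonoidHom.ext hl)⟩
      refine hquot.continuous_iff.2 ?_
      change Continuous fun b => l.comp e.symm.toMonoidHom (p b)
      rw [funext hl]
      exact ψ.continuous_toFun
  let e : ((Circle × A) →ₜ* Circle) ≃* Θ.dual :=
    { Equiv.ofBijective _ hbij with map_mul' := fun χ χ' => rfl }
  exact e.symm.trans (circleProdDual A).symm

/-- The `q`-th powers have index `q · #dual[q]` in the dual of the third term. -/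
theorem CptSeq.dual_index (Θ : CptSeq S R τ) {q : ℕ} (hq : q ≠ 0) :
    (powMonoidHom q : Θ.dual →* _).range.index =
      q * Nat.card (powMonoidHom q : Θ.dual →* _).ker ∧
    Finite (powMonoidHom q : Θ.dual →* _).ker := by
  obtain ⟨A, i1, i2, ⟨e⟩⟩ := Θ.exists_dualEquiv
  obtain ⟨h1, h2⟩ := index_pow_range_congr e q
  refine ⟨by rw [h1, h2, card_quotient_pow_int_prod A q hq], ?_⟩
  refine Finite.of_injective (β := A) (fun x => (e x.1).2) ?_
  rintro ⟨x, hx⟩ ⟨y, hy⟩ h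
  have aux : ∀ x : Θ.dual, x ∈ (powMonoidHom q : Θ.dual →* _).ker → (e x).1 = 1 := by
    intro x hx
    have h3 : (e x) ^ q = 1 := by
      rw [← map_pow, show x ^ q = 1 from hx, map_one]
    have h4 : q • (e x).1.toAdd = 0 := congrArg (fun z => Multiplicative.toAdd z.1) h3
    apply Multiplicative.toAdd.injective
    rcases smul_eq_zero.1 h4 with h | h
    · exact absurd h hq
    · exact h
  exact Subtype.ext (e.injective (Prod.ext ((aux x hx).trans (aux y hy).symm) h))

/-- A new element survives in Circle × A as an element of order q, and the characters of that group
take every q-th root of unity as a value there. It supplies the root ψ from which an isogeny is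
recovered. -/
theorem CptSeq.IsNew.exists_char {Θ : CptSeq S R τ} {q : ℕ} (hq : q.Prime) {x : Θ.B}
    (hx : Θ.IsNew q x) {ζ : Circle} (hζ : ζ ^ q = 1) : ∃ ψ ∈ Θ.dual, ψ x = ζ := by
  obtain ⟨A, i1, i2, i3, i4, p, hp, hk⟩ := Θ.isCircleFiniteKernel
  have hpi : ∀ u, p (Θ.i u) = 1 := fun u => (hk _).2 ⟨u, rfl⟩
  have hpx : p x ≠ 1 := fun h => hx.notMem ((hk x).1 h)
  have hpq : (p x) ^ q = 1 := by rw [← map_pow, hx.pow_eq, map_one]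
  obtain ⟨χ, hχ⟩ : ∃ χ : (Circle × A) →ₜ* Circle, χ (p x) = ζ := by
    obtain ⟨⟨z, a⟩, hza⟩ : ∃ c, c = p x := ⟨_, rfl⟩
    rw [← hza] at hpx hpq ⊢
    have hz : z ^ q = 1 := congrArg Prod.fst hpq
    have ha : a ^ q = 1 := congrArg Prod.snd hpq
    by_cases ha1 : a = 1
    · subst ha1
      have hz1 : z ≠ 1 := fun h => hpx (by rw [h]; rfl)
      have hprim : IsPrimitiveRoot z q := by
        rw [IsPrimitiveRoot.iff_orderOf]
        have := Fact.mk hq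
        exact orderOf_eq_prime hz hz1
      obtain ⟨k, hk⟩ := zpow_surjective_pow_ker hq hprim hζ
      refine ⟨circleProdChar k 1, ?_⟩
      change z ^ (k : ℤ) * 1 = ζ
      rw [mul_one, zpow_natCast, hk]
    · obtain ⟨h, hh⟩ := exists_circleHom_apply_eq hq ha1 ha hζ
      refine ⟨circleProdChar 0 h, ?_⟩
      change z ^ (0 : ℤ) * h a = ζ
      rw [zpow_zero, one_mul, hh]
  refine ⟨χ.comp p, fun u => ?_, hχ⟩
  change χ (p (Θ.i u)) = 1
  rw [hpi, map_one]

/-- The character `χ` of the target of an isogeny is related to the isogeny if the isogeny is the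
covering that adjoins a `q`-th root of `χ`. -/
structure CptSeq.Isogeny.Root {Θ Θ' : CptSeq S R τ} {q : ℕ} (p : Θ.Isogeny Θ' q) (ζ : Circle)
    (χ : Θ'.B →ₜ* Circle) (ψ : Θ.B →ₜ* Circle) : Prop where
  mem : ψ ∈ Θ.dual
  apply_eq : ψ p.1.2 = ζ
  pow_eq : ∀ b, ψ b ^ q = χ (p.1.1 b)

theorem CptSeq.dual_of_comp {Θ Θ' : CptSeq S R τ} {f : Θ.B →ₜ* Θ'.B} (hf : Θ.IsHom Θ' f)
    {χ : Θ'.B →ₜ* Circle} : χ.comp f ∈ Θ.dual ↔ χ ∈ Θ'.dual := by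
  constructor
  · intro h u
    obtain ⟨v, hv⟩ := hf.mem_range_iff u
    rw [← hv]
    exact h v
  · intro h u
    obtain ⟨φ, hφ⟩ := hf.ring
    change χ (f (Θ.i u)) = 1
    rw [hφ, h]

/-- A character that is trivial on the kernel of an isogeny factors. -/
theorem CptSeq.Isogeny.exists_factor {Θ Θ' : CptSeq S R τ} {q : ℕ} (p : Θ.Isogeny Θ' q)
    {ψ : Θ.B →ₜ* Circle} (hψ : ψ ∈ Θ.dual) (h : ψ p.1.2 = 1) :
    ∃ χ ∈ Θ'.dual, ∀ b, χ (p.1.1 b) = ψ b := by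
  obtain ⟨⟨f, x⟩, hf, hx, hk⟩ := p
  have hquot : Topology.IsQuotientMap f :=
    (f.continuous_toFun.isClosedMap).isQuotientMap f.continuous_toFun hf.surjective
  let e : (Θ.B ⧸ f.toMonoidHom.ker) ≃* Θ'.B :=
    QuotientGroup.quotientKerEquivOfSurjective _ hf.surjective
  let l : (Θ.B ⧸ f.toMonoidHom.ker) →* Circle := QuotientGroup.lift f.toMonoidHom.ker
    ψ.toMonoidHom (fun b hb => by
      obtain ⟨k, rfl⟩ := (hk b).1 hb
      change ψ (x ^ k) = 1
      rw [map_zpow, show ψ x = 1 from h, one_zpow])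
  have hl : ∀ b, l.comp e.symm.toMonoidHom (f b) = ψ b := by
    intro b
    have : e.symm (f b) = (b : Θ.B ⧸ f.toMonoidHom.ker) := by
      rw [MulEquiv.symm_apply_eq]; rfl
    exact congrArg l this
  let χ : Θ'.B →ₜ* Circle := ⟨l.comp e.symm.toMonoidHom, by
    refine hquot.continuous_iff.2 ?_
    change Continuous fun b => l.comp e.symm.toMonoidHom (f b)
    rw [funext hl]
    exact ψ.continuous_toFun⟩
  refine ⟨χ, ?_, hl⟩
  rw [← CptSeq.dual_of_comp hf]
  have : χ.comp f = ψ := ContinuousMonoidHom.ext hl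
  rwa [this]

/-- Extend the character of the kernel that sends the chosen generator to ζ to a character ψ; its
q-th power is trivial on the kernel and so descends to χ. Thus every isogeny adjoins a q-th root of
some χ. -/
theorem CptSeq.Isogeny.exists_root {Θ Θ' : CptSeq S R τ} {q : ℕ} (hq : q.Prime)
    (p : Θ.Isogeny Θ' q) {ζ : Circle} (hζ : ζ ^ q = 1) :
    ∃ χ ∈ Θ'.dual, ∃ ψ, p.Root ζ χ ψ := by
  obtain ⟨ψ, hψ, hψx⟩ := p.2.2.1.exists_char hq hζ
  obtain ⟨χ, hχ, h⟩ := p.exists_factor (pow_mem hψ q) (by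
    rw [ContinuousMonoidHom.pow_apply, hψx, hζ])
  exact ⟨χ, hχ, ψ, hψ, hψx, fun b => by rw [h, ContinuousMonoidHom.pow_apply]⟩

/-- The quotient of two roots ψ is trivial on the kernel and so descends to the target. Together
with `CptSeq.Isogeny.Root.mul_pow` this shows that the characters related to an isogeny form exactly
one class modulo q-th powers. -/
theorem CptSeq.Isogeny.Root.exists_pow {Θ Θ' : CptSeq S R τ} {q : ℕ}
    {p : Θ.Isogeny Θ' q} {ζ : Circle} {χ χ' : Θ'.B →ₜ* Circle} {ψ ψ' : Θ.B →ₜ* Circle}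
    (h : p.Root ζ χ ψ) (h' : p.Root ζ χ' ψ') : ∃ κ ∈ Θ'.dual, χ' = χ * κ ^ q ∧
      ∀ b, ψ' b = ψ b * κ (p.1.1 b) := by
  obtain ⟨κ, hκ, hκ'⟩ := p.exists_factor (mul_mem h'.mem (inv_mem h.mem)) (by
    change ψ' p.1.2 * (ψ p.1.2)⁻¹ = 1
    rw [h'.apply_eq, h.apply_eq, mul_inv_cancel])
  have hκ2 : ∀ b, ψ' b = ψ b * κ (p.1.1 b) := by
    intro b
    rw [hκ']
    exact (mul_inv_cancel_comm_assoc (ψ b) (ψ' b)).symm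
  refine ⟨κ, hκ, ContinuousMonoidHom.ext fun b => ?_, hκ2⟩
  obtain ⟨b, rfl⟩ := p.2.1.surjective b
  rw [← h'.pow_eq, hκ2, mul_pow, h.pow_eq, ContinuousMonoidHom.mul_apply,
    ContinuousMonoidHom.pow_apply]

theorem CptSeq.Isogeny.Root.mul_pow {Θ Θ' : CptSeq S R τ} {q : ℕ}
    {p : Θ.Isogeny Θ' q} {ζ : Circle} {χ : Θ'.B →ₜ* Circle} {ψ : Θ.B →ₜ* Circle}
    (h : p.Root ζ χ ψ) {κ : Θ'.B →ₜ* Circle} (hκ : κ ∈ Θ'.dual) :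
    p.Root ζ (χ * κ ^ q) (ψ * κ.comp p.1.1) := by
  refine ⟨mul_mem h.mem ((CptSeq.dual_of_comp p.2.1).2 hκ), ?_, fun b => ?_⟩
  · change ψ p.1.2 * κ (p.1.1 p.1.2) = ζ
    rw [h.apply_eq, (p.2.2.2 _).2 (Subgroup.mem_zpowers _), map_one, mul_one]
  · rw [ContinuousMonoidHom.mul_apply, ContinuousMonoidHom.mul_apply,
      ContinuousMonoidHom.pow_apply, _root_.mul_pow, h.pow_eq]
    rfl

/-- ψ sends the generator of the kernel to a primitive q-th root of unity, so it is faithful on the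
kernel. Identities in the source can therefore be checked after applying the isogeny and ψ. -/
theorem CptSeq.Isogeny.Root.injective {Θ Θ' : CptSeq S R τ} {q : ℕ}
    {p : Θ.Isogeny Θ' q} {ζ : Circle} (hζ : IsPrimitiveRoot ζ q)
    {χ : Θ'.B →ₜ* Circle} {ψ : Θ.B →ₜ* Circle}
    (h : p.Root ζ χ ψ) {b b' : Θ.B} (h1 : p.1.1 b = p.1.1 b') (h2 : ψ b = ψ b') : b = b' := by
  have h3 : p.1.1 (b * b'⁻¹) = 1 := by rw [map_mul, map_inv, h1, mul_inv_cancel]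
  obtain ⟨k, hk⟩ := (p.2.2.2 _).1 h3
  change p.1.2 ^ k = b * b'⁻¹ at hk
  have h4 : ζ ^ k = 1 := by
    rw [← h.apply_eq, ← map_zpow, hk, map_mul, map_inv, h2, mul_inv_cancel]
  obtain ⟨j, rfl⟩ := (hζ.zpow_eq_one_iff_dvd k).1 h4
  rw [zpow_mul, zpow_natCast, p.2.2.1.pow_eq, one_zpow] at hk
  exact mul_inv_eq_one.1 hk.symm

/-- The source of an isogeny is the covering group of a related character. -/
theorem CptSeq.Isogeny.Root.exists_equiv {Θ Θ' : CptSeq S R τ} {q : ℕ} (hq : q.Prime)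
    {p : Θ.Isogeny Θ' q} {ζ : Circle} (hζ : IsPrimitiveRoot ζ q)
    {χ : Θ'.B →ₜ* Circle} {ψ : Θ.B →ₜ* Circle}
    (h : p.Root ζ χ ψ) : ∃ e : Θ.B ≃ₜ* coverGroup χ q, ∀ b, (e b).1 = (p.1.1 b, ψ b) := by
  let F : Θ.B →* coverGroup χ q :=
    (p.1.1.toMonoidHom.prod ψ.toMonoidHom).codRestrict (coverGroup χ q)
      fun b => (h.pow_eq b).symm
  have hc : Continuous F :=
    (p.1.1.continuous_toFun.prodMk ψ.continuous_toFun).subtype_mk _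
  refine ⟨contMulEquivOfBijective F hc ⟨?_, ?_⟩, fun b => rfl⟩
  · intro b b' hb
    have h1 := congrArg (fun y : coverGroup χ q => y.1.1) hb
    have h2 := congrArg (fun y : coverGroup χ q => y.1.2) hb
    exact h.injective hζ h1 h2
  · rintro ⟨⟨b', w⟩, hw⟩
    obtain ⟨b, rfl⟩ := p.2.1.surjective b'
    have hw' : χ (p.1.1 b) = w ^ q := hw
    rw [← h.pow_eq] at hw'
    have h1 : (w * (ψ b)⁻¹) ^ q = 1 := by
      rw [_root_.mul_pow, ← hw', inv_pow, mul_inv_cancel]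
    obtain ⟨k, hk⟩ := zpow_surjective_pow_ker hq hζ h1
    refine ⟨b * p.1.2 ^ k, Subtype.ext (Prod.ext ?_ ?_)⟩
    · change p.1.1 (b * p.1.2 ^ k) = p.1.1 b
      rw [map_mul, map_pow, (p.2.2.2 _).2 (Subgroup.mem_zpowers _), one_pow, mul_one]
    · change ψ (b * p.1.2 ^ k) = w
      rw [map_mul, map_pow, h.apply_eq, hk]
      exact mul_inv_cancel_comm_assoc _ _

/-- Both sources are the covering group of χ. The identification respects the involutions, the left
hand maps and the kernel generators because the isogeny and ψ determine all of these. -/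
theorem CptSeq.Isogeny.Root.exists_iso {Θ₁ Θ₂ Θ' : CptSeq S R τ} {q : ℕ} (hq : q.Prime)
    {p₁ : Θ₁.Isogeny Θ' q} {p₂ : Θ₂.Isogeny Θ' q} {ζ : Circle} (hζ : IsPrimitiveRoot ζ q)
    {χ : Θ'.B →ₜ* Circle} {ψ₁ : Θ₁.B →ₜ* Circle} {ψ₂ : Θ₂.B →ₜ* Circle}
    (h₁ : p₁.Root ζ χ ψ₁) (h₂ : p₂.Root ζ χ ψ₂) :
    ∃ g : Θ₁.B ≃ₜ* Θ₂.B, CptSeq.IsIso Θ₁ Θ₂ g ∧ (∀ b, p₂.1.1 (g b) = p₁.1.1 b) ∧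
      (∀ b, ψ₂ (g b) = ψ₁ b) ∧ g p₁.1.2 = p₂.1.2 := by
  obtain ⟨e₁, he₁⟩ := h₁.exists_equiv hq hζ
  obtain ⟨e₂, he₂⟩ := h₂.exists_equiv hq hζ
  let g := e₁.trans e₂.symm
  have hg : ∀ b, e₂ (g b) = e₁ b := fun b => e₂.apply_symm_apply _
  have hg1 : ∀ b, p₂.1.1 (g b) = p₁.1.1 b := by
    intro b
    have := congrArg (fun y : coverGroup χ q => y.1.1) (hg b)
    simpa only [he₁, he₂] using this
  have hg2 : ∀ b, ψ₂ (g b) = ψ₁ b := by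
    intro b
    have := congrArg (fun y : coverGroup χ q => y.1.2) (hg b)
    simpa only [he₁, he₂] using this
  refine ⟨g, ⟨fun b => ?_, ?_⟩, hg1, hg2, ?_⟩
  · apply h₂.injective hζ
    · rw [hg1, p₁.2.1.equivariant, p₂.2.1.equivariant, hg1]
    · rw [hg2, CptSeq.dual_σ h₁.mem, CptSeq.dual_σ h₂.mem, hg2]
  · obtain ⟨φ₁, hφ₁⟩ := p₁.2.1.ring
    obtain ⟨φ₂, hφ₂⟩ := p₂.2.1.ring
    refine ⟨φ₁.trans φ₂.symm, fun u => ?_⟩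
    apply h₂.injective hζ
    · rw [hg1, hφ₁, hφ₂, ← uMapS_comp S φ₁ φ₂.symm (φ₁.trans φ₂.symm) fun _ => rfl,
        uMapS_symm_apply]
    · rw [hg2, h₁.mem, h₂.mem]
  · apply h₂.injective hζ
    · rw [hg1, (p₁.2.2.2 _).2 (Subgroup.mem_zpowers _), (p₂.2.2.2 _).2 (Subgroup.mem_zpowers _)]
    · rw [hg2, h₁.apply_eq, h₂.apply_eq]

/-- Every character has a covering. -/
theorem CptSeq.exists_cover (Θ' : CptSeq S R τ) {q : ℕ} (hq : q.Prime) {ζ : Circle}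
    (hζ : IsPrimitiveRoot ζ q) {χ : Θ'.B →ₜ* Circle} (hχ : χ ∈ Θ'.dual) :
    ∃ (Θ : CptSeq S R τ) (p : Θ.Isogeny Θ' q) (ψ : Θ.B →ₜ* Circle), p.Root ζ χ ψ := by
  have hζq := hζ.pow_eq_one
  have hcpt := compactSpace_coverGroup χ q
  let f : coverGroup χ q →ₜ* Θ'.B :=
    ⟨(MonoidHom.fst _ _).comp (coverGroup χ q).subtype, by
      change Continuous fun y : coverGroup χ q => y.1.1
      fun_prop⟩
  let ψ : coverGroup χ q →ₜ* Circle :=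
    ⟨(MonoidHom.snd _ _).comp (coverGroup χ q).subtype, by
      change Continuous fun y : coverGroup χ q => y.1.2
      fun_prop⟩
  have hf : Function.Surjective f := by
    intro b
    obtain ⟨w, hw⟩ := exists_circle_pow_eq (χ b) hq.ne_zero
    exact ⟨⟨(b, w), hw.symm⟩, rfl⟩
  -- The root w must be inverted, since the involution inverts χ.
  let σ : coverGroup χ q →* coverGroup χ q :=
    ((Θ'.σ.comp ((MonoidHom.fst _ _).comp (coverGroup χ q).subtype)).prod
      ((MonoidHom.snd _ _).comp (coverGroup χ q).subtype)⁻¹).codRestrict _ (by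
        rintro ⟨⟨b, w⟩, h⟩
        have h' : χ b = w ^ q := h
        change χ (Θ'.σ b) = (w⁻¹) ^ q
        rw [CptSeq.dual_σ hχ, h', inv_pow])
  let i : sTors S (UMod R) →* coverGroup χ q :=
    (Θ'.i.prod 1).codRestrict _ (by
      intro u
      change χ (Θ'.i u) = 1 ^ q
      rw [hχ, one_pow])
  -- χ factors through B → Circle × A as χ₀, and modulo the image of i the covering group of χ
  -- becomes that of χ₀.
  have hker : IsCircleFiniteKernel i.range := by
    obtain ⟨A, i1, i2, i3, i4, P, hP, hk⟩ := Θ'.isCircleFiniteKernel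
    have hPi : ∀ u, P (Θ'.i u) = 1 := fun u => (hk _).2 ⟨u, rfl⟩
    have hquot : Topology.IsQuotientMap P :=
      (P.continuous_toFun.isClosedMap).isQuotientMap P.continuous_toFun hP
    let e : (Θ'.B ⧸ P.toMonoidHom.ker) ≃* Circle × A :=
      QuotientGroup.quotientKerEquivOfSurjective _ hP
    let l : (Θ'.B ⧸ P.toMonoidHom.ker) →* Circle := QuotientGroup.lift P.toMonoidHom.ker
      χ.toMonoidHom (fun b hb => by
        obtain ⟨u, rfl⟩ := (hk b).1 hb
        exact hχ u)
    have hl : ∀ b, l.comp e.symm.toMonoidHom (P b) = χ b := by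
      intro b
      have : e.symm (P b) = (b : Θ'.B ⧸ P.toMonoidHom.ker) := by
        rw [MulEquiv.symm_apply_eq]; rfl
      exact congrArg l this
    let χ₀ : (Circle × A) →ₜ* Circle := ⟨l.comp e.symm.toMonoidHom, by
      refine hquot.continuous_iff.2 ?_
      change Continuous fun b => l.comp e.symm.toMonoidHom (P b)
      rw [funext hl]
      exact χ.continuous_toFun⟩
    have hχ₀ : ∀ b, χ₀ (P b) = χ b := hl
    let G : coverGroup χ q →ₜ* coverGroup χ₀ q :=
      ⟨((P.toMonoidHom.comp f.toMonoidHom).prod ψ.toMonoidHom).codRestrict _ (by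
        rintro ⟨⟨b, w⟩, h⟩
        change χ₀ (P b) = w ^ q
        rw [hχ₀]
        exact h), by
        refine Continuous.subtype_mk ?_ _
        exact (P.continuous_toFun.comp f.continuous_toFun).prodMk ψ.continuous_toFun⟩
    refine (isCircleFiniteKernel_bot_coverGroup hq χ₀).comp G ?_ _ ?_
    · rintro ⟨⟨c, w⟩, h⟩
      obtain ⟨b, rfl⟩ := hP c
      have h' : χ b = w ^ q := (hχ₀ b).symm.trans h
      exact ⟨⟨(b, w), h'⟩, rfl⟩
    · rintro ⟨⟨b, w⟩, h⟩
      rw [Subgroup.mem_bot]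
      constructor
      · intro h1
        have h2 : P b = 1 := congrArg (fun y : coverGroup χ₀ q => y.1.1) h1
        have h3 : w = 1 := congrArg (fun y : coverGroup χ₀ q => y.1.2) h1
        obtain ⟨u, rfl⟩ := (hk b).1 h2
        exact ⟨u, Subtype.ext (Prod.ext rfl h3.symm)⟩
      · rintro ⟨u, hu⟩
        have h2 : Θ'.i u = b := congrArg (fun y : coverGroup χ q => y.1.1) hu
        have h3 : 1 = w := congrArg (fun y : coverGroup χ q => y.1.2) hu
        refine Subtype.ext (Prod.ext ?_ h3.symm)
        change P b = 1
        rw [← h2, hPi]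
  let Θ : CptSeq S R τ := CptSeq.ofKernel (coverGroup χ q) σ
    (by
      refine Continuous.subtype_mk ?_ _
      exact (Θ'.σ_continuous.comp f.continuous_toFun).prodMk ψ.continuous_toFun.inv)
    (by
      rintro ⟨⟨b, w⟩, h⟩
      exact Subtype.ext (Prod.ext (Θ'.σ_σ b) (inv_inv w)))
    i
    (by
      intro u u' h
      exact Θ'.injective (congrArg (fun y : coverGroup χ q => y.1.1) h))
    (fun u => Subtype.ext (Prod.ext (Θ'.equivariant u) inv_one.symm))
    (by
      rintro ⟨⟨b, w⟩, h⟩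
      obtain ⟨u, hu⟩ := Θ'.σ_quotient b
      exact ⟨u, Subtype.ext (Prod.ext hu (mul_inv_cancel w).symm)⟩)
    hker
  let x : coverGroup χ q := ⟨(1, ζ), by
    change χ 1 = ζ ^ q
    rw [map_one, hζq]⟩
  refine ⟨Θ, ⟨(f, x), ⟨hf, fun _ => rfl, RingEquiv.refl R, fun u => by rw [uMapS_id]; rfl⟩,
    ⟨?_, ?_, ?_⟩, ?_⟩, ψ, ⟨fun _ => rfl, rfl, fun b => b.2.symm⟩⟩
  · exact Subtype.ext (Prod.ext (one_pow q) hζq)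
  · exact Subtype.ext (Prod.ext ((map_one Θ'.σ).trans inv_one.symm) rfl)
  · rintro ⟨u, hu⟩
    have h3 : 1 = ζ := congrArg (fun y : coverGroup χ q => y.1.2) hu
    exact hζ.ne_one hq.one_lt h3.symm
  · rintro ⟨⟨b, w⟩, h⟩
    change b = 1 ↔ _
    constructor
    · rintro rfl
      have h' : w ^ q = 1 := by rw [← mem_coverGroup.1 h]; exact map_one χ
      obtain ⟨k, hk⟩ := zpow_surjective_pow_ker hq hζ h'
      refine ⟨k, Subtype.ext (Prod.ext (one_zpow _) ?_)⟩
      change ζ ^ (k : ℤ) = w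
      rw [zpow_natCast, hk]
    · rintro ⟨k, hk⟩
      have h2 : (1 : Θ'.B) ^ k = b := congrArg (fun y : coverGroup χ q => y.1.1) hk
      rw [← h2, one_zpow]

end Covers

/-! ### The mass formula for new elements -/

section Counting

variable {S : Finset ℕ} {R : Type} [CommRing R] {τ : R ≃+* R}

/-- Composition of an isogeny with an isomorphism of the source. -/
def CptSeq.Isogeny.preIso {Θ Θ₁ Θ' : CptSeq S R τ} {q : ℕ} (p : Θ.Isogeny Θ' q)
    (g : Θ₁.B ≃ₜ* Θ.B) (hg : CptSeq.IsIso Θ₁ Θ g) : Θ₁.Isogeny Θ' q :=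
  ⟨(p.1.1.comp (g : Θ₁.B →ₜ* Θ.B), g.symm p.1.2),
    ⟨p.2.1.surjective.comp g.surjective, fun b => by
      change p.1.1 (g (Θ₁.σ b)) = _
      rw [hg.1, p.2.1.equivariant]
      rfl, by
      obtain ⟨φ, hφ⟩ := hg.2
      obtain ⟨ψ, hψ⟩ := p.2.1.ring
      refine ⟨φ.trans ψ, fun u => ?_⟩
      change p.1.1 (g (Θ₁.i u)) = _
      rw [hφ, hψ, uMapS_comp S φ ψ (φ.trans ψ) fun _ => rfl]⟩,
    ⟨by rw [← map_pow, p.2.2.1.pow_eq, map_one], by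
      apply g.injective
      rw [hg.1, map_inv, g.apply_symm_apply, p.2.2.1.σ_eq], by
      rintro ⟨u, hu⟩
      obtain ⟨φ, hφ⟩ := hg.2
      apply p.2.2.1.notMem
      refine ⟨uMapS S φ u, ?_⟩
      rw [← hφ, hu, g.apply_symm_apply]⟩, fun b => by
      change p.1.1 (g b) = 1 ↔ _
      rw [p.2.2.2, Subgroup.mem_zpowers_iff, Subgroup.mem_zpowers_iff]
      refine exists_congr fun k => ?_
      rw [← map_zpow, g.symm_apply_eq]⟩

theorem CptSeq.Isogeny.Root.preIso {Θ Θ₁ Θ' : CptSeq S R τ} {q : ℕ} {p : Θ.Isogeny Θ' q}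
    {ζ : Circle} {χ : Θ'.B →ₜ* Circle} {ψ : Θ.B →ₜ* Circle} (h : p.Root ζ χ ψ)
    (g : Θ₁.B ≃ₜ* Θ.B) (hg : CptSeq.IsIso Θ₁ Θ g) :
    (p.preIso g hg).Root ζ χ (ψ.comp (g : Θ₁.B →ₜ* Θ.B)) := by
  refine ⟨fun u => ?_, ?_, fun b => h.pow_eq (g b)⟩
  · obtain ⟨φ, hφ⟩ := hg.2
    change ψ (g (Θ₁.i u)) = 1
    rw [hφ, h.mem]
  · change ψ (g (g.symm p.1.2)) = ζ
    rw [g.apply_symm_apply, h.apply_eq]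

theorem CptSeq.IsIso.symm {Θ Θ' : CptSeq S R τ} {g : Θ.B ≃ₜ* Θ'.B} (hg : CptSeq.IsIso Θ Θ' g) :
    CptSeq.IsIso Θ' Θ g.symm := by
  obtain ⟨h, φ, hφ⟩ := hg
  refine ⟨fun b => ?_, φ.symm, fun u => ?_⟩
  · rw [g.symm_apply_eq, h, g.apply_symm_apply]
  · rw [g.symm_apply_eq, hφ, uMapS_symm_apply]

/-- The isogenies with given source and target that are related to a given character. -/
theorem CptSeq.Isogeny.Root.card_fiber {Θ Θ' : CptSeq S R τ} {q : ℕ} (hq : q.Prime)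
    {p : Θ.Isogeny Θ' q} {ζ : Circle} (hζ : IsPrimitiveRoot ζ q) {χ : Θ'.B →ₜ* Circle}
    {ψ : Θ.B →ₜ* Circle} (h : p.Root ζ χ ψ) :
    Nat.card {p' : Θ.Isogeny Θ' q // ∃ ψ', p'.Root ζ χ ψ'} *
      Nat.card (powMonoidHom q : Θ'.dual →* _).ker = Θ.autCard := by
  rw [← Nat.card_prod]
  have hκ : ∀ κ : (powMonoidHom q : Θ'.dual →* _).ker,
      p.Root ζ χ (ψ * (κ.1.1).comp p.1.1) := by
    rintro ⟨⟨κ, hκ⟩, hκq⟩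
    have h1 := h.mul_pow hκ
    have h2 : κ ^ q = 1 := congrArg Subtype.val hκq
    rwa [h2, mul_one] at h1
  -- A pair (p', κ) corresponds to the automorphism g that carries p to p' and ψ · κ to the chosen
  -- root ψ' of p'. Conversely, g determines p' as the transport of p, and κ as the discrepancy
  -- between the transported root and the chosen one.
  choose ψ' hψ' using fun p' : {p' : Θ.Isogeny Θ' q // ∃ ψ', p'.Root ζ χ ψ'} => p'.2
  choose g hg1 hg2 hg3 hg4 using fun (p' : {p' : Θ.Isogeny Θ' q // ∃ ψ', p'.Root ζ χ ψ'})
    (κ : (powMonoidHom q : Θ'.dual →* _).ker) => (hκ κ).exists_iso hq hζ (hψ' p')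
  refine Nat.card_congr (Equiv.ofBijective (fun y => ⟨g y.1 y.2, hg1 y.1 y.2⟩) ⟨?_, ?_⟩)
  · rintro ⟨p₁, κ₁⟩ ⟨p₂, κ₂⟩ heq
    have heq' : g p₁ κ₁ = g p₂ κ₂ := congrArg Subtype.val heq
    have hp : p₁ = p₂ := by
      apply Subtype.ext
      apply Subtype.ext
      refine Prod.ext (ContinuousMonoidHom.ext fun b => ?_) ?_
      · obtain ⟨b, rfl⟩ := (g p₁ κ₁).surjective b
        rw [hg2]
        rw [heq', hg2]
      · rw [← hg4 p₁ κ₁, ← hg4 p₂ κ₂, heq']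
    subst hp
    refine Prod.ext rfl (Subtype.ext (Subtype.ext (ContinuousMonoidHom.ext fun b => ?_)))
    obtain ⟨b, rfl⟩ := p.2.1.surjective b
    have h1 := hg3 p₁ κ₁ b
    have h2 := hg3 p₁ κ₂ b
    rw [heq', h2] at h1
    exact (mul_left_cancel (a := ψ b) h1).symm
  · rintro ⟨g', hg'⟩
    let p' := p.preIso g'.symm hg'.symm
    have hp' : p'.Root ζ χ _ := h.preIso g'.symm hg'.symm
    let P : {p' : Θ.Isogeny Θ' q // ∃ ψ', p'.Root ζ χ ψ'} := ⟨p', _, hp'⟩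
    obtain ⟨κ, hκ1, hκ2, hκ3⟩ := hp'.exists_pow (hψ' P)
    have hκq : κ ^ q = 1 := mul_eq_left.1 hκ2.symm
    let K : (powMonoidHom q : Θ'.dual →* _).ker := ⟨⟨κ, hκ1⟩, Subtype.ext hκq⟩
    refine ⟨(P, K), Subtype.ext (ContinuousMulEquiv.ext fun b => ?_)⟩
    apply (hψ' P).injective hζ
    · rw [hg2]
      change _ = p.1.1 (g'.symm (g' b))
      rw [g'.symm_apply_apply]
    · rw [hg3, hκ3]
      change ψ b * κ (p.1.1 b) = ψ (g'.symm (g' b)) * κ (p.1.1 (g'.symm (g' b)))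
      rw [g'.symm_apply_apply]

/-- A weighted count of labelled objects. -/
theorem tsum_card_div_eq {C : Type*} {V : Type*} [Finite V] (a : C → ℕ) (ha : ∀ c, a c ≠ 0)
    (T : C → Type*) (lab : ∀ c, T c → V) (s : ℕ) (h1 : ∀ v, ∃ c t, lab c t = v)
    (h2 : ∀ c c' t t', lab c t = lab c' t' → c = c')
    (h3 : ∀ c t, Nat.card {t' // lab c t' = lab c t} * s = a c) :
    ∑' c, (Nat.card (T c) : ENNReal) / a c = Nat.card V / s := by
  classical
  have := Fintype.ofFinite V
  choose c₀ t₀ hct using h1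
  have hfin : ∀ c v, Finite {t : T c // lab c t = v} := by
    intro c v
    by_cases hv : ∃ t, lab c t = v
    · obtain ⟨t, rfl⟩ := hv
      refine Nat.finite_of_card_ne_zero fun h => ha c ?_
      rw [← h3 c t, h, zero_mul]
    · have : IsEmpty {t : T c // lab c t = v} := ⟨fun t => hv ⟨t.1, t.2⟩⟩
      infer_instance
  have hcard : ∀ c, Nat.card (T c) = ∑ v, Nat.card {t : T c // lab c t = v} := by
    intro c
    rw [← Nat.card_sigma]
    exact Nat.card_congr (Equiv.sigmaFiberEquiv (lab c)).symm
  -- Each label occurs for one class c only, and there for a c / s objects, so its total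
  -- contribution is 1 / s.
  have hterm : ∀ c v, (Nat.card {t : T c // lab c t = v} : ENNReal) / a c =
      if c = c₀ v then (s : ENNReal)⁻¹ else 0 := by
    intro c v
    split_ifs with hc
    · subst hc
      have e := h3 _ (t₀ v)
      rw [hct v] at e
      have hne : Nat.card {t' // lab (c₀ v) t' = v} ≠ 0 := by
        intro h
        rw [h, zero_mul] at e
        exact ha _ e.symm
      rw [← e, Nat.cast_mul, ENNReal.div_eq_inv_mul, ENNReal.mul_inv (Or.inl (by exact_mod_cast hne))
        (Or.inl (ENNReal.natCast_ne_top _)), mul_right_comm, ENNReal.inv_mul_cancel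
        (by exact_mod_cast hne) (ENNReal.natCast_ne_top _), one_mul]
    · have : IsEmpty {t : T c // lab c t = v} := by
        refine ⟨fun t => hc (h2 _ _ t.1 (t₀ v) ?_)⟩
        rw [t.2, hct]
      simp
  calc ∑' c, (Nat.card (T c) : ENNReal) / a c
      = ∑' c, ∑ v, (Nat.card {t : T c // lab c t = v} : ENNReal) / a c := by
        refine tsum_congr fun c => ?_
        rw [hcard, Nat.cast_sum]
        simp only [div_eq_mul_inv, Finset.sum_mul]
    _ = ∑ v, ∑' c, (Nat.card {t : T c // lab c t = v} : ENNReal) / a c :=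
        Summable.tsum_finsetSum fun _ _ => ENNReal.summable
    _ = ∑ v : V, (s : ENNReal)⁻¹ := by
        refine Finset.sum_congr rfl fun v _ => ?_
        simp only [hterm, tsum_ite_eq]
    _ = Nat.card V / s := by
        rw [Finset.sum_const, Finset.card_univ, nsmul_eq_mul, Nat.card_eq_fintype_card,
          div_eq_mul_inv]

theorem CptSeq.out_equiv (Θ : CptSeq S R τ) :
    ∃ g : (⟦Θ⟧ : CptClass S R τ).out.B ≃ₜ* Θ.B, CptSeq.IsIso _ _ g := Quotient.mk_out Θ

theorem CptClass.eq_of_iso {c c' : CptClass S R τ} {g : c.out.B ≃ₜ* c'.out.B}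
    (h : CptSeq.IsIso _ _ g) : c = c' := Quotient.out_equiv_out.1 ⟨g, h⟩

theorem finite_pow_eq_one_circle_prod (A : Type*) [CommGroup A] [Finite A] {q : ℕ} (hq : q.Prime) :
    Finite {x : Circle × A // x ^ q = 1} := by
  obtain ⟨ζ, hζ⟩ := exists_circle_primitiveRoot hq.ne_zero
  have : {x : Circle × A | x ^ q = 1} ⊆ (Set.range fun k : Fin q => ζ ^ (k : ℕ)) ×ˢ Set.univ := by
    rintro ⟨z, a⟩ h
    have hz : z ^ q = 1 := congrArg Prod.fst h
    obtain ⟨k, rfl⟩ := zpow_surjective_pow_ker hq hζ hz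
    refine ⟨⟨⟨k % q, Nat.mod_lt _ hq.pos⟩, ?_⟩, Set.mem_univ _⟩
    change ζ ^ (k % q) = ζ ^ k
    conv_lhs => rw [hζ.eq_orderOf, pow_mod_orderOf]
  exact (((Set.finite_range _).prod Set.finite_univ).subset this).to_subtype

theorem CptSeq.finite_pow_eq_one [Finite R] (Θ : CptSeq S R τ) {q : ℕ} (hq : q.Prime) :
    Finite {x : Θ.B // x ^ q = 1} := by
  obtain ⟨A, i1, i2, i3, i4, p, hp, hk⟩ := Θ.isCircleFiniteKernel
  have hfin := finite_pow_eq_one_circle_prod A hq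
  have hUfin : Finite Θ.i.range := by
    have : Finite (sTors S (UMod R)) := inferInstance
    exact (Set.finite_range Θ.i).to_subtype
  have hfib : ∀ c, (p ⁻¹' {c}).Finite := by
    intro c
    obtain ⟨b, rfl⟩ := hp c
    refine ((Set.toFinite (Θ.i.range : Set Θ.B)).image (fun u => b * u)).subset ?_
    intro b' hb'
    refine ⟨b⁻¹ * b', ?_, by simp⟩
    refine (hk _).1 ?_
    rw [map_mul, map_inv, show p b' = p b from hb', inv_mul_cancel]
  have h1 : (Set.Finite {c : Circle × A | c ^ q = 1}) := hfin
  refine ((h1.biUnion fun c _ => hfib c).subset ?_ : Set.Finite {x : Θ.B | x ^ q = 1}).to_subtype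
  intro x hx
  simp only [Set.mem_iUnion]
  refine ⟨p x, ?_, rfl⟩
  change p x ^ q = 1
  rw [← map_pow, show x ^ q = 1 from hx, map_one]

/-- Label an isogeny by its kernel generator, a new element of Θ. Every new element occurs, it
determines the target up to isomorphism, and the isogenies with that label form a torsor under the
automorphisms of the target. So each label has weight one. -/
theorem tsum_isogeny_target [Finite R] (h0 : ∀ c : CptClass S R τ, c.out.autCard ≠ 0) {q : ℕ}
    (hq : q.Prime) (Θ : CptSeq S R τ) :
    ∑' c : CptClass S R τ, (Nat.card (Θ.Isogeny c.out q) : ENNReal) / c.out.autCard =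
      Nat.card {x : Θ.B // Θ.IsNew q x} := by
  have := Θ.finite_pow_eq_one hq
  have hfin : Finite {x : Θ.B // Θ.IsNew q x} :=
    Finite.of_injective (fun x => (⟨x.1, x.2.pow_eq⟩ : {x : Θ.B // x ^ q = 1}))
      fun x y h => Subtype.ext (congrArg (fun z : {x : Θ.B // x ^ q = 1} => z.1) h)
  rw [tsum_card_div_eq (V := {x : Θ.B // Θ.IsNew q x}) (fun c : CptClass S R τ => c.out.autCard) h0
    (fun c => Θ.Isogeny c.out q) (fun c p => ⟨p.1.2, p.2.2.1⟩) 1]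
  · rw [Nat.cast_one, div_one]
  · rintro ⟨x, hx⟩
    obtain ⟨Θ', p, rfl⟩ := Θ.exists_quotient hq hx
    obtain ⟨g, hg⟩ := Θ'.out_equiv
    exact ⟨⟦Θ'⟧, p.compIso g.symm hg.symm, rfl⟩
  · intro c c' p p' h
    obtain ⟨g, hg, -⟩ := p.exists_iso p' (congrArg Subtype.val h)
    exact CptClass.eq_of_iso hg
  · intro c p
    rw [mul_one, ← p.card_fiber]
    refine Nat.card_congr (Equiv.subtypeEquivRight fun p' => ?_)
    rw [Subtype.mk.injEq]

/-- Label an isogeny by the class of a related character modulo q-th powers. Every class occurs, it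
determines the source up to isomorphism, and it accounts for #Aut / #dual[q] isogenies. The total is
the index of the q-th powers divided by #dual[q], which is q. -/
theorem tsum_isogeny_source (h0 : ∀ c : CptClass S R τ, c.out.autCard ≠ 0) {q : ℕ}
    (hq : q.Prime) (Θ' : CptSeq S R τ) :
    ∑' c : CptClass S R τ, (Nat.card (c.out.Isogeny Θ' q) : ENNReal) / c.out.autCard = q := by
  obtain ⟨ζ, hζ⟩ := exists_circle_primitiveRoot hq.ne_zero
  obtain ⟨hidx, hkfin⟩ := Θ'.dual_index hq.ne_zero
  have hk0 : Nat.card (powMonoidHom q : Θ'.dual →* _).ker ≠ 0 := Nat.card_pos.ne'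
  let V := Θ'.dual ⧸ (powMonoidHom q : Θ'.dual →* _).range
  have hV : Nat.card V = q * Nat.card (powMonoidHom q : Θ'.dual →* _).ker := hidx
  have hVfin : Finite V := by
    refine Nat.finite_of_card_ne_zero ?_
    rw [hV]
    exact mul_ne_zero hq.ne_zero hk0
  choose χ hχ hroot using fun (c : CptClass S R τ) (p : c.out.Isogeny Θ' q) =>
    p.exists_root hq hζ.pow_eq_one
  have hlab : ∀ (c : CptClass S R τ) (p : c.out.Isogeny Θ' q) (χ' : Θ'.dual),
      ((⟨χ c p, hχ c p⟩ : Θ'.dual) : V) = (χ' : V) ↔ ∃ ψ, p.Root ζ χ'.1 ψ := by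
    intro c p χ'
    obtain ⟨ψ, hψ⟩ := hroot c p
    rw [QuotientGroup.eq]
    constructor
    · rintro ⟨κ, hκ⟩
      have h1 : χ' = ⟨χ c p, hχ c p⟩ * κ ^ q := by
        rw [show κ ^ q = _ from hκ, mul_inv_cancel_left]
      rw [h1]
      exact ⟨_, hψ.mul_pow κ.2⟩
    · rintro ⟨ψ', hψ'⟩
      obtain ⟨κ, hκ, h1, -⟩ := hψ.exists_pow hψ'
      refine ⟨⟨κ, hκ⟩, ?_⟩
      rw [eq_inv_mul_iff_mul_eq]
      exact Subtype.ext h1.symm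
  rw [tsum_card_div_eq (V := V) (fun c : CptClass S R τ => c.out.autCard) h0
    (fun c => c.out.Isogeny Θ' q) (fun c p => ((⟨χ c p, hχ c p⟩ : Θ'.dual) : V))
    (Nat.card (powMonoidHom q : Θ'.dual →* _).ker)]
  · rw [hV, Nat.cast_mul, ENNReal.mul_div_cancel_right (by exact_mod_cast hk0)
      (ENNReal.natCast_ne_top _)]
  · intro v
    obtain ⟨⟨χ', hχ'⟩, rfl⟩ := QuotientGroup.mk_surjective v
    obtain ⟨Θ, p, ψ, h⟩ := Θ'.exists_cover hq hζ hχ'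
    obtain ⟨g, hg⟩ := Θ.out_equiv
    exact ⟨⟦Θ⟧, p.preIso g hg, (hlab _ _ _).2 ⟨_, h.preIso g hg⟩⟩
  · intro c c' p p' h
    obtain ⟨ψ, h1⟩ := (hlab c p _).1 h
    obtain ⟨ψ', h2⟩ := hroot c' p'
    obtain ⟨g, hg, -⟩ := h1.exists_iso hq hζ h2
    exact CptClass.eq_of_iso hg
  · intro c p
    obtain ⟨ψ, h1⟩ := hroot c p
    rw [← h1.card_fiber hq hζ]
    congr 1
    exact Nat.card_congr (Equiv.subtypeEquivRight fun p' => hlab c p' _)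

/-- The weighted number of new elements of order `q` is `q` times the total mass. -/
theorem tsum_card_isNew [Finite R] (h0 : ∀ c : CptClass S R τ, c.out.autCard ≠ 0) {q : ℕ}
    (hq : q.Prime) :
    ∑' c : CptClass S R τ, (Nat.card {x : c.out.B // c.out.IsNew q x} : ENNReal) / c.out.autCard =
      q * ∑' c : CptClass S R τ, (c.out.autCard : ENNReal)⁻¹ := by
  -- Every isogeny between representatives gets the weight 1 / (#Aut source · #Aut target), and the
  -- two orders of summation are compared; with values in [0, ∞] no convergence is needed.
  calc _ = ∑' c : CptClass S R τ, ∑' c' : CptClass S R τ,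
        (Nat.card (c.out.Isogeny c'.out q) : ENNReal) / c'.out.autCard / c.out.autCard := by
        refine tsum_congr fun c => ?_
        rw [← tsum_isogeny_target h0 hq]
        simp only [div_eq_mul_inv, ENNReal.tsum_mul_right]
    _ = ∑' c' : CptClass S R τ, ∑' c : CptClass S R τ,
        (Nat.card (c.out.Isogeny c'.out q) : ENNReal) / c'.out.autCard / c.out.autCard :=
        ENNReal.tsum_comm
    _ = _ := by
        rw [← ENNReal.tsum_mul_left]
        refine tsum_congr fun c' => ?_
        rw [← tsum_isogeny_source h0 hq c'.out, ← ENNReal.tsum_mul_right]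
        refine tsum_congr fun c => ?_
        simp only [div_eq_mul_inv]
        rw [mul_right_comm]

end Counting

/-! ### The expected value of the number of elements of order dividing `ℓ` -/

/-- The eigenspace decomposition of the `ℓ`-torsion under an involution, for odd `ℓ`. -/
theorem card_torsion_eq_mul {G : Type*} [CommGroup G] (σ : G →* G) (hσ : ∀ b, σ (σ b) = b) {ℓ : ℕ}
    (hodd : Odd ℓ) :
    Nat.card {b : G // b ^ ℓ = 1} = Nat.card {b : G // b ^ ℓ = 1 ∧ σ b = b} *
      Nat.card {b : G // b ^ ℓ = 1 ∧ σ b = b⁻¹} := by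
  obtain ⟨k, rfl⟩ := hodd
  rw [← Nat.card_prod]
  -- For ℓ = 2k + 1 the exponent k + 1 is the inverse of 2 modulo ℓ.
  have h2 : ∀ b : G, b ^ (2 * k + 1) = 1 → (b ^ 2) ^ (k + 1) = b := by
    intro b hb
    rw [← pow_mul, show 2 * (k + 1) = 2 * k + 1 + 1 by ring, pow_succ, hb, one_mul]
  symm
  refine Nat.card_congr (Equiv.ofBijective (fun y => ⟨y.1.1 * y.2.1, by
    rw [mul_pow, y.1.2.1, y.2.2.1, one_mul]⟩) ⟨?_, ?_⟩)
  · rintro ⟨⟨a, ha, ha'⟩, ⟨b, hb, hb'⟩⟩ ⟨⟨c, hc, hc'⟩, ⟨d, hd, hd'⟩⟩ h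
    have h1 : a * b = c * d := congrArg Subtype.val h
    have h3 : a * b⁻¹ = c * d⁻¹ := by
      rw [← ha', ← hb', ← hc', ← hd', ← map_mul, ← map_mul, h1]
    have h4 : a ^ 2 = c ^ 2 := by
      calc a ^ 2 = (a * b) * (a * b⁻¹) := by rw [mul_mul_mul_comm, mul_inv_cancel, mul_one, pow_two]
        _ = c ^ 2 := by rw [h1, h3, mul_mul_mul_comm, mul_inv_cancel, mul_one, pow_two]
    have h5 : a = c := by rw [← h2 a ha, h4, h2 c hc]
    subst h5
    have h6 : b = d := mul_left_cancel h1
    subst h6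
    rfl
  · rintro ⟨b, hb⟩
    have hσb : (σ b) ^ (2 * k + 1) = 1 := by rw [← map_pow, hb, map_one]
    refine ⟨(⟨(b * σ b) ^ (k + 1), ?_, ?_⟩, ⟨(b * (σ b)⁻¹) ^ (k + 1), ?_, ?_⟩), Subtype.ext ?_⟩
    · rw [pow_right_comm, mul_pow, hb, hσb, one_mul, one_pow]
    · rw [map_pow, map_mul, hσ, mul_comm]
    · rw [pow_right_comm, mul_pow, inv_pow, hb, hσb, inv_one, one_mul, one_pow]
    · rw [map_pow, map_mul, map_inv, hσ, ← inv_pow, mul_inv, inv_inv, mul_comm]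
    · change (b * σ b) ^ (k + 1) * (b * (σ b)⁻¹) ^ (k + 1) = b
      rw [← mul_pow, mul_mul_mul_comm, mul_inv_cancel, mul_one, ← pow_two, h2 b hb]

section Expectation

variable {S : Finset ℕ} {R : Type} [CommRing R] {τ : R ≃+* R}

variable (S τ) in
/-- The number of elements of order dividing `ℓ` in `U_R(S^∞)` that are fixed. -/
def uPlus (ℓ : ℕ) : ℕ := Nat.card {u : sTors S (UMod R) // u ^ ℓ = 1 ∧ uMapS S τ u = u}

variable (S τ) in
/-- The number of elements of order dividing `ℓ` in `U_R(S^∞)` that are inverted. -/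
def uMinus (ℓ : ℕ) : ℕ := Nat.card {u : sTors S (UMod R) // u ^ ℓ = 1 ∧ uMapS S τ u = u⁻¹}

/-- For every b the product b · σ(b) lies in the image of U. If b is fixed this is b², and b, being
of odd order, is a power of b²; so the fixed torsion comes from U. The inverted torsion is the
disjoint union of the part from U and the new elements. -/
theorem CptSeq.card_torsion [Finite R] (Θ : CptSeq S R τ) {ℓ : ℕ} (hℓ : ℓ.Prime) (hodd : Odd ℓ) :
    Nat.card {b : Θ.B // b ^ ℓ = 1} =
      uPlus S τ ℓ * (uMinus S τ ℓ + Nat.card {x : Θ.B // Θ.IsNew ℓ x}) := by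
  rw [card_torsion_eq_mul Θ.σ Θ.σ_σ hodd]
  have hi : ∀ u v, Θ.i u = Θ.i v ↔ u = v := fun u v => Θ.injective.eq_iff
  congr 1
  · symm
    refine Nat.card_congr (Equiv.ofBijective (fun u => ⟨Θ.i u.1, by
      rw [← map_pow, u.2.1, map_one], by rw [← Θ.equivariant, u.2.2]⟩) ⟨?_, ?_⟩)
    · intro u v h
      exact Subtype.ext (Θ.injective (congrArg Subtype.val h))
    · rintro ⟨b, hb, hσ⟩
      obtain ⟨k, rfl⟩ := hodd
      obtain ⟨u, hu⟩ := Θ.σ_quotient b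
      have h1 : Θ.i (u ^ (k + 1)) = b := by
        rw [map_pow, hu, hσ, ← pow_two, ← pow_mul, show 2 * (k + 1) = 2 * k + 1 + 1 by ring,
          pow_succ, hb, one_mul]
      refine ⟨⟨u ^ (k + 1), ?_, ?_⟩, Subtype.ext h1⟩
      · rw [← hi, map_pow, h1, hb, map_one]
      · rw [← hi, Θ.equivariant, h1, hσ]
  · have := Θ.finite_pow_eq_one hℓ
    have hfin : Finite {x : Θ.B // Θ.IsNew ℓ x} :=
      Finite.of_injective (fun x => (⟨x.1, x.2.pow_eq⟩ : {x : Θ.B // x ^ ℓ = 1}))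
        fun x y h => Subtype.ext (congrArg (fun z : {x : Θ.B // x ^ ℓ = 1} => z.1) h)
    rw [uMinus, ← Nat.card_sum]
    symm
    refine Nat.card_congr (Equiv.ofBijective (fun y => y.elim
      (fun u => (⟨Θ.i u.1, by rw [← map_pow, u.2.1, map_one], by
        rw [← Θ.equivariant, u.2.2, map_inv]⟩ : {b : Θ.B // b ^ ℓ = 1 ∧ Θ.σ b = b⁻¹}))
      (fun x => ⟨x.1, x.2.pow_eq, x.2.σ_eq⟩)) ⟨?_, ?_⟩)
    · rintro (u | x) (v | y) h
      · exact congrArg Sum.inl (Subtype.ext (Θ.injective (congrArg Subtype.val h)))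
      · exact absurd ⟨u.1, congrArg Subtype.val h⟩ y.2.notMem
      · exact absurd ⟨v.1, (congrArg Subtype.val h).symm⟩ x.2.notMem
      · exact congrArg Sum.inr (Subtype.ext (congrArg (fun z => z.1) h))
    · rintro ⟨b, hb, hσ⟩
      by_cases hbi : b ∈ Θ.i.range
      · obtain ⟨u, rfl⟩ := hbi
        refine ⟨Sum.inl ⟨u, ?_, ?_⟩, rfl⟩
        · rw [← hi, map_pow, hb, map_one]
        · rw [← hi, Θ.equivariant, hσ, map_inv]
      · exact ⟨Sum.inr ⟨b, hb, hσ, hbi⟩, rfl⟩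

theorem cptMass_univ : cptMass S R τ Set.univ =
    ∑' c : CptClass S R τ, (c.out.autCard : ENNReal)⁻¹ := by
  rw [cptMass, MeasureTheory.Measure.sum_apply _ MeasurableSet.univ]
  refine tsum_congr fun c => ?_
  simp

theorem mem_sTors_of_pow_eq_one {G : Type*} [CommGroup G] {ℓ : ℕ} (hℓ : ℓ.Prime) (hS : ℓ ∈ S)
    {g : G} (hg : g ^ ℓ = 1) : g ∈ sTors S G :=
  ⟨ℓ, hℓ.ne_zero, by rw [hℓ.primeFactors]; simpa using hS, hg⟩

theorem card_sTors_torsion {G : Type*} [CommGroup G] {ℓ : ℕ} (hℓ : ℓ.Prime) (hS : ℓ ∈ S) :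
    Nat.card {b : sTors S G // b ^ ℓ = 1} = Nat.card {b : G // b ^ ℓ = 1} :=
  Nat.card_congr
    { toFun := fun b => ⟨b.1.1, congrArg Subtype.val b.2⟩
      invFun := fun b => ⟨⟨b.1, mem_sTors_of_pow_eq_one hℓ hS b.2⟩, Subtype.ext b.2⟩
      left_inv := fun _ => rfl
      right_inv := fun _ => rfl }

/-- The expected value is an average over the isomorphism classes of sequences of compact
groups. -/
theorem expectation_torsionSize_eq {ℓ : ℕ} (hℓ : ℓ.Prime) (hS : ℓ ∈ S) :
    expectation (torsionSize S R τ ℓ) =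
      (((cptMass S R τ Set.univ)⁻¹ * ∑' c : CptClass S R τ, (c.out.autCard : ENNReal)⁻¹ *
        (Nat.card {b : c.out.B // b ^ ℓ = 1} : ENNReal)).toReal : ℂ) := by
  have hmeas : Measurable (fun Θ : CptClass S R τ => (⟦Θ.out.sPart⟧ : SClass S R τ)) :=
    fun _ _ => trivial
  have hf : MeasureTheory.StronglyMeasurable (torsionSize S R τ ℓ) := by
    have h : Measurable (torsionSize S R τ ℓ) := fun _ _ => trivial
    exact h.stronglyMeasurable
  rw [expectation, sProb, MeasureTheory.integral_map hmeas.aemeasurable hf.aestronglyMeasurable]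
  have hterm : ∀ Θ : CptClass S R τ, torsionSize S R τ ℓ ⟦Θ.out.sPart⟧ =
      ((Nat.card {b : Θ.out.B // b ^ ℓ = 1} : ℝ) : ℂ) := by
    intro Θ
    rw [← card_sTors_torsion hℓ hS]
    rw [Complex.ofReal_natCast]
    rfl
  simp only [hterm]
  rw [integral_complex_ofReal, MeasureTheory.integral_eq_lintegral_of_nonneg_ae
    (Filter.Eventually.of_forall fun _ => Nat.cast_nonneg _)
    (by
      have h : Measurable fun Θ : CptClass S R τ => (Nat.card {b : Θ.out.B // b ^ ℓ = 1} : ℝ) :=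
        fun _ _ => trivial
      exact h.aestronglyMeasurable)]
  simp only [ENNReal.ofReal_natCast]
  rw [cptProb, MeasureTheory.lintegral_smul_measure, cptMass, MeasureTheory.lintegral_sum_measure]
  congr 3
  refine tsum_congr fun c => ?_
  rw [MeasureTheory.lintegral_smul_measure, MeasureTheory.lintegral_dirac]
  rfl

/-- If the total mass is finite and positive then the expected value of `#B[ℓ]` is
`#U⁺[ℓ] · (#U⁻[ℓ] + ℓ)`. -/
theorem expectation_torsionSize [Finite R] {ℓ : ℕ} (hℓ : ℓ.Prime) (hodd : Odd ℓ) (hS : ℓ ∈ S)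
    (h0 : cptMass S R τ Set.univ ≠ 0) (htop : cptMass S R τ Set.univ ≠ ⊤) :
    expectation (torsionSize S R τ ℓ) = (uPlus S τ ℓ * (uMinus S τ ℓ + ℓ) : ℕ) := by
  rw [expectation_torsionSize_eq hℓ hS]
  -- An infinite automorphism group has `Nat.card` equal to 0 and would contribute the mass 1 / 0 =
  -- ∞.
  have haut : ∀ c : CptClass S R τ, c.out.autCard ≠ 0 := by
    intro c hc
    rw [cptMass_univ] at htop
    refine ENNReal.ne_top_of_tsum_ne_top htop c ?_
    rw [hc, Nat.cast_zero, ENNReal.inv_zero]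
  have key : ∑' c : CptClass S R τ, (c.out.autCard : ENNReal)⁻¹ *
      (Nat.card {b : c.out.B // b ^ ℓ = 1} : ENNReal) =
      (uPlus S τ ℓ * (uMinus S τ ℓ + ℓ) : ℕ) * cptMass S R τ Set.univ := by
    calc _ = ∑' c : CptClass S R τ, (uPlus S τ ℓ : ENNReal) *
          (uMinus S τ ℓ * (c.out.autCard : ENNReal)⁻¹ +
            (Nat.card {x : c.out.B // c.out.IsNew ℓ x} : ENNReal) / c.out.autCard) := by
          refine tsum_congr fun c => ?_
          rw [c.out.card_torsion hℓ hodd, div_eq_mul_inv]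
          push_cast
          ring
      _ = (uPlus S τ ℓ : ENNReal) * (uMinus S τ ℓ * cptMass S R τ Set.univ +
            ℓ * cptMass S R τ Set.univ) := by
          rw [ENNReal.tsum_mul_left, ENNReal.tsum_add, ENNReal.tsum_mul_left,
            tsum_card_isNew haut hℓ, cptMass_univ]
      _ = _ := by push_cast; ring
  rw [key, mul_comm, mul_assoc, ENNReal.mul_inv_cancel h0 htop, mul_one, ENNReal.toReal_natCast,
    Complex.ofReal_natCast]

/-- For total mass 0 the measure itself vanishes, and for total mass ∞ the normalising factor does.
This makes the degenerate case incompatible with the heuristic later on. -/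
theorem expectation_eq_zero
    (h : cptMass S R τ Set.univ = 0 ∨ cptMass S R τ Set.univ = ⊤) (f : SClass S R τ → ℂ) :
    expectation f = 0 := by
  have : cptProb S R τ = 0 ∨ cptMass S R τ = 0 := by
    rcases h with h | h
    · right
      exact MeasureTheory.Measure.measure_univ_eq_zero.1 h
    · left
      rw [cptProb, h, ENNReal.inv_top, zero_smul]
  have h2 : cptProb S R τ = 0 := by
    rcases this with h | h
    · exact h
    · rw [cptProb, h, smul_zero]
  rw [expectation, sProb, h2, MeasureTheory.Measure.map_zero, MeasureTheory.integral_zero_measure]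

end Expectation

/-! ### Torsion in `U_R` and torsion units -/

section Units

variable {S : Finset ℕ} {R : Type} [CommRing R] (τ : R ≃+* R)

/-- The number of units of order dividing `ℓ` that are fixed by `τ`. -/
def unitPlus (ℓ : ℕ) : ℕ :=
  Nat.card {u : Rˣ // u ^ ℓ = 1 ∧ Units.mapEquiv τ.toMulEquiv u = u}

/-- The number of units of order dividing `ℓ` that are inverted by `τ`. -/
def unitMinus (ℓ : ℕ) : ℕ :=
  Nat.card {u : Rˣ // u ^ ℓ = 1 ∧ Units.mapEquiv τ.toMulEquiv u = u⁻¹}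

/-- The subgroup generated by -1 has order dividing 2, so dividing by it does not affect torsion of
odd order. With `exists_lift_pow` this replaces U_R[ℓ] by the ℓ-torsion of the unit group. -/
theorem mk_eq_mk_iff_of_pow {ℓ : ℕ} (hodd : Odd ℓ) {v w : Rˣ} (hv : v ^ ℓ = 1) (hw : w ^ ℓ = 1) :
    (QuotientGroup.mk v : UMod R) = QuotientGroup.mk w ↔ v = w := by
  refine ⟨fun h => ?_, fun h => by rw [h]⟩
  rw [QuotientGroup.eq] at h
  obtain ⟨k, hk⟩ := h
  have h1 : (v⁻¹ * w) ^ ℓ = 1 := by rw [mul_pow, inv_pow, hv, hw, inv_one, one_mul]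
  have h2 : v⁻¹ * w = 1 := by
    change (-1 : Rˣ) ^ k = v⁻¹ * w at hk
    rw [← hk] at h1 ⊢
    rcases Int.even_or_odd k with hk | hk
    · exact hk.neg_one_zpow
    · rw [hk.neg_one_zpow] at h1 ⊢
      rw [hodd.neg_one_pow] at h1
      exact h1
  exact (inv_mul_eq_one.1 h2)

theorem exists_lift_pow {ℓ : ℕ} (hodd : Odd ℓ) {u : UMod R} (hu : u ^ ℓ = 1) :
    ∃ v : Rˣ, v ^ ℓ = 1 ∧ QuotientGroup.mk v = u := by
  obtain ⟨v, rfl⟩ := QuotientGroup.mk_surjective u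
  rw [← QuotientGroup.mk_pow, QuotientGroup.eq_one_iff] at hu
  obtain ⟨k, hk⟩ := hu
  change (-1 : Rˣ) ^ k = v ^ ℓ at hk
  rcases Int.even_or_odd k with h | h
  · rw [h.neg_one_zpow] at hk
    exact ⟨v, hk.symm, rfl⟩
  · rw [h.neg_one_zpow] at hk
    refine ⟨-v, by rw [hodd.neg_pow, ← hk, neg_neg], ?_⟩
    rw [QuotientGroup.eq]
    exact ⟨1, by
      change (-1 : Rˣ) ^ (1 : ℤ) = (-v)⁻¹ * v
      rw [zpow_one, inv_neg, neg_mul, inv_mul_cancel]⟩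

theorem card_units_eq_card_sTors {ℓ : ℕ} (hℓ : ℓ.Prime) (hodd : Odd ℓ) (hS : ℓ ∈ S)
    (P : Rˣ → Prop) (Q : sTors S (UMod R) → Prop)
    (h : ∀ (v : Rˣ) (u : sTors S (UMod R)), v ^ ℓ = 1 → u.1 = QuotientGroup.mk v → (P v ↔ Q u)) :
    Nat.card {u : sTors S (UMod R) // u ^ ℓ = 1 ∧ Q u} = Nat.card {v : Rˣ // v ^ ℓ = 1 ∧ P v} := by
  symm
  have hmem : ∀ v : Rˣ, v ^ ℓ = 1 → (QuotientGroup.mk v : UMod R) ∈ sTors S (UMod R) := fun v hv =>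
    mem_sTors_of_pow_eq_one hℓ hS (by rw [← QuotientGroup.mk_pow, hv]; rfl)
  refine Nat.card_congr (Equiv.ofBijective (fun v => ⟨⟨QuotientGroup.mk v.1, hmem v.1 v.2.1⟩,
    Subtype.ext (by
      change (QuotientGroup.mk v.1 : UMod R) ^ ℓ = 1
      rw [← QuotientGroup.mk_pow, v.2.1]; rfl), (h v.1 _ v.2.1 rfl).1 v.2.2⟩) ⟨?_, ?_⟩)
  · rintro ⟨v, hv⟩ ⟨w, hw⟩ e
    have e' := congrArg (fun z => z.1.1) e
    exact Subtype.ext ((mk_eq_mk_iff_of_pow hodd hv.1 hw.1).1 e')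
  · rintro ⟨⟨u, hu⟩, hu1, hu2⟩
    obtain ⟨v, hv, rfl⟩ := exists_lift_pow hodd (congrArg Subtype.val hu1 : u ^ ℓ = 1)
    exact ⟨⟨v, hv, (h v _ hv rfl).2 hu2⟩, rfl⟩

theorem uPlus_eq {ℓ : ℕ} (hℓ : ℓ.Prime) (hodd : Odd ℓ) (hS : ℓ ∈ S) :
    uPlus S τ ℓ = unitPlus τ ℓ := by
  refine card_units_eq_card_sTors hℓ hodd hS _ _ ?_
  rintro v ⟨u, hu⟩ hv rfl
  have h1 : (Units.mapEquiv τ.toMulEquiv v) ^ ℓ = 1 := by rw [← map_pow, hv, map_one]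
  rw [← mk_eq_mk_iff_of_pow hodd h1 hv, Subtype.ext_iff]
  rfl

theorem uMinus_eq {ℓ : ℕ} (hℓ : ℓ.Prime) (hodd : Odd ℓ) (hS : ℓ ∈ S) :
    uMinus S τ ℓ = unitMinus τ ℓ := by
  refine card_units_eq_card_sTors hℓ hodd hS _ _ ?_
  rintro v ⟨u, hu⟩ hv rfl
  have h1 : (Units.mapEquiv τ.toMulEquiv v) ^ ℓ = 1 := by rw [← map_pow, hv, map_one]
  have h2 : (v⁻¹) ^ ℓ = 1 := by rw [inv_pow, hv, inv_one]
  rw [← mk_eq_mk_iff_of_pow hodd h1 h2, Subtype.ext_iff]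
  rfl

end Units

/-! ### The torsion of the Arakelov ray class group of a real quadratic field -/

/-- Divisibility of the kernel by n allows n-torsion elements of H to be lifted to n-torsion
elements of G; a choice of lifts gives a bijection with the product. -/
theorem card_torsion_of_surjective {G H : Type*} [CommGroup G] [CommGroup H] {n : ℕ} (f : G →* H)
    (hf : Function.Surjective f) (hdiv : ∀ k ∈ f.ker, ∃ k' ∈ f.ker, k' ^ n = k) :
    Nat.card {g : G // g ^ n = 1} =
      Nat.card {k : f.ker // k ^ n = 1} * Nat.card {h : H // h ^ n = 1} := by
  have hs : ∀ h : {h : H // h ^ n = 1}, ∃ g : G, g ^ n = 1 ∧ f g = h := by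
    rintro ⟨h, hh⟩
    obtain ⟨g, rfl⟩ := hf h
    obtain ⟨k, hk, hkg⟩ := hdiv (g ^ n) (by rw [MonoidHom.mem_ker, map_pow, hh])
    refine ⟨g * k⁻¹, by rw [mul_pow, inv_pow, hkg, mul_inv_cancel], ?_⟩
    rw [map_mul, map_inv, MonoidHom.mem_ker.1 hk, inv_one, mul_one]
  choose s hs1 hs2 using hs
  rw [← Nat.card_prod]
  have hp : ∀ g : G, g ^ n = 1 → f g ^ n = 1 := fun g hg => by rw [← map_pow, hg, map_one]
  refine Nat.card_congr
    { toFun := fun g => ⟨⟨⟨g.1 * (s ⟨f g.1, hp g.1 g.2⟩)⁻¹, by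
          rw [MonoidHom.mem_ker, map_mul, map_inv, hs2, mul_inv_cancel]⟩, Subtype.ext (by
          change (g.1 * (s ⟨f g.1, hp g.1 g.2⟩)⁻¹) ^ n = 1
          rw [mul_pow, inv_pow, hs1, g.2, inv_one, mul_one])⟩, ⟨f g.1, hp g.1 g.2⟩⟩
      invFun := fun x => ⟨x.1.1.1 * s x.2, by
        have := congrArg Subtype.val x.1.2
        change (x.1.1 : G) ^ n = 1 at this
        rw [mul_pow, this, hs1, one_mul]⟩
      left_inv := fun g => Subtype.ext (by simp)
      right_inv := ?_ }
  rintro ⟨⟨⟨k, hk⟩, hk1⟩, ⟨h, hh⟩⟩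
  have e : f (k * s ⟨h, hh⟩) = h := by rw [map_mul, MonoidHom.mem_ker.1 hk, one_mul, hs2]
  refine Prod.ext (Subtype.ext (Subtype.ext ?_)) (Subtype.ext e)
  change k * s ⟨h, hh⟩ * (s ⟨f (k * s ⟨h, hh⟩), _⟩)⁻¹ = k
  simp only [e, mul_inv_cancel_right]

/-- K is ℝ / cℤ, and its n-torsion consists of the classes of i · c / n with 0 ≤ i < n. -/
theorem card_torsion_of_real_cover {K : Type*} [CommGroup K] (j : Multiplicative ℝ →* K)
    (hj : Function.Surjective j) {c : ℝ} (hc : c ≠ 0)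
    (hker : ∀ t : ℝ, j (Multiplicative.ofAdd t) = 1 ↔ ∃ k : ℤ, t = k * c) {n : ℕ} (hn : n ≠ 0) :
    Nat.card {k : K // k ^ n = 1} = n := by
  have hn' : (n : ℝ) ≠ 0 := Nat.cast_ne_zero.2 hn
  have hpow : ∀ (t : ℝ) (i : ℕ), j (Multiplicative.ofAdd t) ^ i =
      j (Multiplicative.ofAdd (i * t)) := by
    intro t i
    rw [← map_pow, ← ofAdd_nsmul, nsmul_eq_mul]
  have heq : ∀ s t : ℝ, j (Multiplicative.ofAdd s) = j (Multiplicative.ofAdd t) ↔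
      ∃ k : ℤ, s - t = k * c := by
    intro s t
    rw [← hker, ofAdd_sub, map_div, div_eq_one]
  conv_rhs => rw [← Nat.card_fin n]
  symm
  refine Nat.card_congr (Equiv.ofBijective
    (fun i : Fin n => ⟨j (Multiplicative.ofAdd ((i : ℕ) * c / n)), ?_⟩) ⟨?_, ?_⟩)
  · rw [hpow, hker]
    exact ⟨(i : ℕ), by push_cast; field_simp⟩
  · intro a b hab
    obtain ⟨k, hk⟩ := (heq _ _).1 (congrArg Subtype.val hab)
    have h1 : (((a : ℕ) : ℤ) - ((b : ℕ) : ℤ) : ℤ) = n * k := by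
      have : (((a : ℕ) : ℝ) - ((b : ℕ) : ℝ)) = n * k := by
        field_simp at hk
        linarith
      exact_mod_cast this
    have h2 : (((a : ℕ) : ℤ)) % n = ((b : ℕ) : ℤ) % n := by
      rw [Int.emod_eq_emod_iff_emod_sub_eq_zero, h1, Int.mul_emod_right]
    apply Fin.ext
    rw [← Int.natCast_inj]
    rwa [Int.emod_eq_of_lt (by positivity) (by exact_mod_cast a.2),
      Int.emod_eq_of_lt (by positivity) (by exact_mod_cast b.2)] at h2
  · rintro ⟨k, hk⟩
    obtain ⟨t, rfl⟩ := hj k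
    change ℝ at t
    change j (Multiplicative.ofAdd t) ^ n = 1 at hk
    rw [hpow, hker] at hk
    obtain ⟨q, hq⟩ := hk
    have hpos : (0 : ℤ) < n := by exact_mod_cast Nat.pos_of_ne_zero hn
    refine ⟨⟨(q % n).toNat, ?_⟩, Subtype.ext ?_⟩
    · have := Int.emod_lt_of_pos q hpos
      have := Int.emod_nonneg q hpos.ne'
      omega
    · refine (heq _ _).2 ⟨-(q / n), ?_⟩
      have h0 : (((q % n).toNat : ℕ) : ℝ) = ((q % n : ℤ) : ℝ) := by
        have := Int.toNat_of_nonneg (Int.emod_nonneg q hpos.ne')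
        exact_mod_cast this
      have h1 : ((q % n : ℤ) : ℝ) + n * ((q / n : ℤ) : ℝ) = q := by
        exact_mod_cast Int.emod_add_mul_ediv q n
      change (((q % n).toNat : ℕ) : ℝ) * c / n - t = _
      rw [h0]
      push_cast
      field_simp
      rw [hq, ← h1]
      ring

open NumberField

section Places

variable {F : Type} [Field F] [NumberField F]

/-- The embedding ρ gives a real place, so r₁ + 2 r₂ = 2 leaves no room for a complex one. -/
theorem exists_two_places (ρ : F →+* ℝ) (h2 : Module.finrank ℚ F = 2) :
    ∃ v₀ v₁ : InfinitePlace F, v₀ ≠ v₁ ∧ (∀ v, v = v₀ ∨ v = v₁) ∧ (∀ v : InfinitePlace F, v.mult = 1) ∧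
      ∀ f : InfinitePlace F → ℝ, ∏ v, f v = f v₀ * f v₁ := by
  classical
  have h1 := InfinitePlace.card_add_two_mul_card_eq_rank F
  have h3 := InfinitePlace.card_eq_nrRealPlaces_add_nrComplexPlaces F
  have hreal : (InfinitePlace.mk (Complex.ofRealHom.comp ρ)).IsReal := by
    refine ⟨_, ?_, rfl⟩
    rw [ComplexEmbedding.isReal_iff]
    ext x
    simp [ComplexEmbedding.conjugate]
  have hpos : 0 < InfinitePlace.nrRealPlaces F := Fintype.card_pos_iff.2 ⟨⟨_, hreal⟩⟩
  have hc : InfinitePlace.nrComplexPlaces F = 0 := by omega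
  have hcard : Fintype.card (InfinitePlace F) = 2 := by omega
  obtain ⟨v₀, v₁, hne, huniv⟩ := Finset.card_eq_two.1 (Finset.card_univ.trans hcard)
  refine ⟨v₀, v₁, hne, fun v => ?_, fun v => ?_, fun f => ?_⟩
  · have : v ∈ ({v₀, v₁} : Finset _) := huniv ▸ Finset.mem_univ v
    simpa using this
  · have hv : v.IsReal := by
      rw [← InfinitePlace.not_isComplex_iff_isReal]
      intro hv
      have : IsEmpty {w : InfinitePlace F // w.IsComplex} := Fintype.card_eq_zero_iff.1 hc
      exact this.false ⟨v, hv⟩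
    exact InfinitePlace.mult_isReal ⟨v, hv⟩
  · rw [huniv, Finset.prod_pair hne]

theorem toPrincipalIdeal_unit (u : (𝓞 F)ˣ) :
    toPrincipalIdeal (𝓞 F) F (Units.map (algebraMap (𝓞 F) F : 𝓞 F →* F) u) = 1 := by
  rw [toPrincipalIdeal_eq_iff]
  change FractionalIdeal.spanSingleton (𝓞 F)⁰ (algebraMap (𝓞 F) F u) = 1
  rw [← FractionalIdeal.coeIdeal_span_singleton, Ideal.span_singleton_eq_top.2 u.isUnit,
    FractionalIdeal.coeIdeal_top]

theorem exists_unit_of_toPrincipalIdeal_eq_one {α : Fˣ}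
    (h : toPrincipalIdeal (𝓞 F) F α = 1) : ∃ u : (𝓞 F)ˣ, (algebraMap (𝓞 F) F u : F) = α := by
  have key : ∀ β : Fˣ, toPrincipalIdeal (𝓞 F) F β = 1 →
      ∃ b : 𝓞 F, algebraMap (𝓞 F) F b = β := by
    intro β hβ
    rw [toPrincipalIdeal_eq_iff] at hβ
    have : (β : F) ∈ ((1 : Frac F) : FractionalIdeal (𝓞 F)⁰ F) := by
      rw [← hβ]
      exact FractionalIdeal.mem_spanSingleton_self _ _
    exact (FractionalIdeal.mem_one_iff (𝓞 F)⁰).1 this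
  obtain ⟨a, ha⟩ := key α h
  obtain ⟨b, hb⟩ := key α⁻¹ (by rw [map_inv, h, inv_one])
  have hab : a * b = 1 := by
    apply FaithfulSMul.algebraMap_injective (𝓞 F) F
    rw [map_mul, ha, hb, map_one, Units.mul_inv]
  exact ⟨⟨a, b, hab, by rw [mul_comm, hab]⟩, ha⟩

variable (m : ℕ)

/-- The unit group of the finite ring 𝓞 F / m is finite. Hence the units congruent to 1 modulo m
still have full rank. -/
theorem exists_pow_mem_rayUnits (hm : m ≠ 0) (u : (𝓞 F)ˣ) :
    ∃ N : ℕ, N ≠ 0 ∧ Units.map (algebraMap (𝓞 F) F : 𝓞 F →* F) (u ^ N) ∈ rayUnits F m := by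
  have hne : modIdeal F m ≠ ⊥ := by
    rw [Ne, Ideal.span_singleton_eq_bot]
    exact_mod_cast hm
  have := Ideal.finiteQuotientOfFreeOfNeBot (modIdeal F m) hne
  have hfin : Finite (𝓞 F ⧸ modIdeal F m)ˣ := inferInstance
  refine ⟨Nat.card (𝓞 F ⧸ modIdeal F m)ˣ, Nat.card_pos.ne', ?_⟩
  have h1 : Ideal.Quotient.mk (modIdeal F m)
      ((u ^ Nat.card (𝓞 F ⧸ modIdeal F m)ˣ : (𝓞 F)ˣ) : 𝓞 F) = 1 := by
    have h0 : (Units.map ((Ideal.Quotient.mk (modIdeal F m) : 𝓞 F →+* _) :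
        𝓞 F →* 𝓞 F ⧸ modIdeal F m) u) ^ Nat.card (𝓞 F ⧸ modIdeal F m)ˣ = 1 := pow_card_eq_one'
    rw [Units.val_pow_eq_pow_val, map_pow]
    exact (Units.val_pow_eq_pow_val _ _).symm.trans (congrArg Units.val h0)
  have h2 := div_mem_rayUnits m (a := 1) (b := ((u ^ Nat.card (𝓞 F ⧸ modIdeal F m)ˣ : (𝓞 F)ˣ) : 𝓞 F))
    one_ne_zero (Units.ne_zero _) (by simp) (by rw [h1, map_one])
  convert h2 using 1
  ext
  simp [toUnit]

end Places

open NumberField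

section Pic

variable (F : Type) [Field F] [NumberField F] (m : ℕ)

/-- The projection `Pic⁰_F(m) → Cl_F(m)`. -/
def picToClass : ArakelovRayClassGroup F m →* RayClassGroup F m :=
  QuotientGroup.map _ _
    (((MonoidHom.fst (Frac F) (InfPart F)).comp (araGroup F m).subtype).codRestrict
      (idCoprime F m) fun x => x.2.1) (by
    rintro x ⟨α, hα, hx⟩
    exact ⟨α, hα, congrArg Prod.fst hx⟩)

theorem absNorm_pos (I : Frac F) :
    0 < ((FractionalIdeal.absNorm (I : FractionalIdeal (𝓞 F)⁰ F) : ℚ) : ℝ) := by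
  have h1 : FractionalIdeal.absNorm (I : FractionalIdeal (𝓞 F)⁰ F) ≠ 0 := by
    rw [Ne, FractionalIdeal.absNorm_eq_zero_iff]
    exact I.ne_zero
  have h2 : 0 ≤ FractionalIdeal.absNorm (I : FractionalIdeal (𝓞 F)⁰ F) :=
    FractionalIdeal.absNorm_nonneg _
  exact_mod_cast lt_of_le_of_ne h2 h1.symm

theorem picToClass_surjective : Function.Surjective (picToClass F m) := by
  intro c
  obtain ⟨⟨I, hI⟩, rfl⟩ := QuotientGroup.mk_surjective c
  have hpos := absNorm_pos F I
  -- All coordinates at infinity are taken equal to N(I) ^ (1 / [F : ℚ]), so that their weighted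
  -- product is N(I).
  refine ⟨QuotientGroup.mk ⟨(I, fun _ => ⟨((FractionalIdeal.absNorm
    (I : FractionalIdeal (𝓞 F)⁰ F) : ℚ) : ℝ) ^ (1 / (Module.finrank ℚ F : ℝ)),
    Real.rpow_pos_of_pos hpos _⟩), hI, ?_⟩, rfl⟩
  have hn : (Module.finrank ℚ F : ℝ) ≠ 0 := by
    exact_mod_cast (Module.finrank_pos (R := ℚ) (M := F)).ne'
  simp only
  rw [Finset.prod_pow_eq_pow_sum, InfinitePlace.sum_mult_eq, ← Real.rpow_natCast,
    ← Real.rpow_mul hpos.le, one_div, inv_mul_cancel₀ hn, Real.rpow_one]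

variable {F}

/-- The elements `(exp t, exp (-t))` of `∏_{v ∣ ∞} ℝ_{>0}`. -/
def expInf (v₀ : InfinitePlace F) : Multiplicative ℝ →* InfPart F := by
  classical
  exact
  { toFun := fun t v => ⟨Real.exp ((if v = v₀ then 1 else -1) * t.toAdd), Real.exp_pos _⟩
    map_one' := by ext v; simp
    map_mul' := fun s t => by
      ext v
      simp [mul_add, Real.exp_add] }

theorem expInf_self {F : Type} [Field F] (v₀ : InfinitePlace F) (t : Multiplicative ℝ) :
    ((expInf v₀ t v₀ : {x : ℝ // 0 < x}) : ℝ) = Real.exp t.toAdd := by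
  simp [expInf]

theorem expInf_of_ne {F : Type} [Field F] {v₀ v₁ : InfinitePlace F} (h : v₁ ≠ v₀) (t : Multiplicative ℝ) :
    ((expInf v₀ t v₁ : {x : ℝ // 0 < x}) : ℝ) = Real.exp (-t.toAdd) := by
  simp [expInf, h]

/-- In logarithmic coordinates the kernel is the line of trace zero modulo the logarithms of the
units in F¹(m). By Dirichlet's theorem these form a lattice of rank one, so the kernel is a circle:
it is divisible and has n elements of order dividing n. -/
theorem card_ker_picToClass_torsion (hm : m ≠ 0) (ρ : F →+* ℝ) (h2 : Module.finrank ℚ F = 2)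
    {n : ℕ} (hn : n ≠ 0) :
    (∀ k ∈ (picToClass F m).ker, ∃ k' ∈ (picToClass F m).ker, k' ^ n = k) ∧
    Nat.card {k : (picToClass F m).ker // k ^ n = 1} = n := by
  obtain ⟨v₀, v₁, hne, huniv, hmult, hprod⟩ := exists_two_places ρ h2
  have hmem : ∀ t : Multiplicative ℝ, (1, expInf v₀ t) ∈ araGroup F m := by
    intro t
    refine ⟨one_mem _, ?_⟩
    simp only [hmult, pow_one, hprod, expInf_self, expInf_of_ne hne.symm]
    rw [← Real.exp_add, add_neg_cancel, Real.exp_zero]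
    simp
  let j₀ : Multiplicative ℝ →* araGroup F m :=
    MonoidHom.codRestrict ((1 : Multiplicative ℝ →* Frac F).prod (expInf v₀)) _ hmem
  let j : Multiplicative ℝ →* (picToClass F m).ker :=
    MonoidHom.codRestrict ((QuotientGroup.mk' _).comp j₀) _ fun t => by
      rw [MonoidHom.mem_ker]
      exact (QuotientGroup.eq_one_iff _).2 (one_mem _)
  have hunit : ∀ u : (𝓞 F)ˣ, v₀ (algebraMap (𝓞 F) F u) * v₁ (algebraMap (𝓞 F) F u) = 1 := by
    intro u
    have h1 := InfinitePlace.prod_eq_abs_norm (algebraMap (𝓞 F) F u)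
    simp only [hmult, pow_one, hprod] at h1
    rw [h1, Units.norm, Rat.cast_one]
  have hj : ∀ t : ℝ, j (Multiplicative.ofAdd t) = 1 ↔ ∃ u : (𝓞 F)ˣ,
      Units.map (algebraMap (𝓞 F) F : 𝓞 F →* F) u ∈ rayUnits F m ∧
        v₀ (algebraMap (𝓞 F) F u) = Real.exp t := by
    intro t
    rw [Subtype.ext_iff]
    change (QuotientGroup.mk (j₀ _) : ArakelovRayClassGroup F m) = 1 ↔ _
    rw [QuotientGroup.eq_one_iff, Subgroup.mem_subgroupOf, Subgroup.mem_map]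
    constructor
    · rintro ⟨α, hα, h⟩
      obtain ⟨u, hu⟩ := exists_unit_of_toPrincipalIdeal_eq_one (congrArg Prod.fst h)
      have e : Units.map (algebraMap (𝓞 F) F : 𝓞 F →* F) u = α := Units.ext hu
      refine ⟨u, by rwa [e], ?_⟩
      rw [hu]
      have h3 := congrArg (fun z : Frac F × InfPart F => ((z.2 v₀ : {x : ℝ // 0 < x}) : ℝ)) h
      exact h3.trans (expInf_self v₀ _)
    · rintro ⟨u, hu, hut⟩
      refine ⟨_, hu, Prod.ext (toPrincipalIdeal_unit u) (funext fun v => Subtype.ext ?_)⟩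
      change v (algebraMap (𝓞 F) F u) = ((expInf v₀ (Multiplicative.ofAdd t) v :
        {x : ℝ // 0 < x}) : ℝ)
      rcases huniv v with rfl | rfl
      · rw [expInf_self, hut]; rfl
      · rw [expInf_of_ne hne.symm, toAdd_ofAdd, Real.exp_neg, ← hut]
        exact eq_inv_of_mul_eq_one_right (hunit u)
  have hsurj : Function.Surjective j := by
    rintro ⟨k, hk⟩
    obtain ⟨⟨⟨I, y⟩, hx⟩, rfl⟩ := QuotientGroup.mk_surjective k
    obtain ⟨α, hα, hI⟩ := (QuotientGroup.eq_one_iff _).1 (MonoidHom.mem_ker.1 hk)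
    change toPrincipalIdeal (𝓞 F) F α = I at hI
    have hα0 : ∀ v : InfinitePlace F, 0 < v (α : F) := fun v => InfinitePlace.pos_iff.2 α.ne_zero
    have hnorm : (y v₀ : ℝ) * y v₁ = v₀ (α : F) * v₁ (α : F) := by
      have h3 := hx.2
      simp only [hmult, pow_one, hprod] at h3
      rw [← h3, ← hI, coe_toPrincipalIdeal, FractionalIdeal.absNorm_span_singleton,
        ← InfinitePlace.prod_eq_abs_norm]
      simp only [hmult, pow_one, hprod]
    have hy : 0 < (y v₀ : ℝ) / v₀ (α : F) := div_pos (y v₀).2 (hα0 v₀)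
    refine ⟨Multiplicative.ofAdd (Real.log ((y v₀ : ℝ) / v₀ (α : F))), Subtype.ext ?_⟩
    refine QuotientGroup.eq.2 ⟨α, hα, Prod.ext ?_ (funext fun v => Subtype.ext ?_)⟩
    · change toPrincipalIdeal (𝓞 F) F α = 1⁻¹ * I
      rw [hI, inv_one, one_mul]
    · change v (α : F) = ((expInf v₀ (Multiplicative.ofAdd _) v : {x : ℝ // 0 < x}) : ℝ)⁻¹ * y v
      have h4 := (hα0 v₀).ne'
      have h5 := (hα0 v₁).ne'
      have h6 := (y v₀).2.ne'
      rcases huniv v with rfl | rfl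
      · rw [expInf_self, toAdd_ofAdd, Real.exp_log hy]
        field_simp
      · rw [expInf_of_ne hne.symm, toAdd_ofAdd, Real.exp_neg, Real.exp_log hy, inv_inv]
        field_simp
        linarith
  obtain ⟨c, hc, hker⟩ : ∃ c : ℝ, c ≠ 0 ∧
      ∀ t : ℝ, j (Multiplicative.ofAdd t) = 1 ↔ ∃ k : ℤ, t = k * c := by
    have hrank : Units.rank F = 1 := by
      have : Fintype.card (InfinitePlace F) = 2 := by
        classical
        rw [← Finset.card_univ, show (Finset.univ : Finset (InfinitePlace F)) = {v₀, v₁} by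
          ext v; simpa using huniv v, Finset.card_pair hne]
      rw [Units.rank, this]
    let ε : (𝓞 F)ˣ := Units.fundSystem F ⟨0, by omega⟩
    have hgen : ∀ u : (𝓞 F)ˣ, ∃ k : ℤ,
        v₀ (algebraMap (𝓞 F) F u) = v₀ (algebraMap (𝓞 F) F ε) ^ k := by
      intro u
      obtain ⟨⟨ζ, e⟩, hζ, -⟩ := Units.exist_unique_eq_mul_prod F u
      refine ⟨e ⟨0, by omega⟩, ?_⟩
      have : ∏ i, Units.fundSystem F i ^ e i = ε ^ e ⟨0, by omega⟩ := by
        rw [Finset.prod_eq_single ⟨0, by omega⟩]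
        · rintro ⟨i, hi⟩ - h
          exact absurd (Fin.ext (by simp; omega)) h
        · intro h
          exact absurd (Finset.mem_univ _) h
      simp only [this] at hζ
      rw [hζ, Units.val_mul, map_mul, map_mul, (Units.mem_torsion F).1 ζ.2 v₀, one_mul]
      have : (algebraMap (𝓞 F) F ((ε ^ e ⟨0, by omega⟩ : (𝓞 F)ˣ) : 𝓞 F)) =
          (algebraMap (𝓞 F) F ε) ^ e ⟨0, by omega⟩ := by
        have := congrArg Units.val (map_zpow (Units.map (algebraMap (𝓞 F) F : 𝓞 F →* F)) ε
          (e ⟨0, by omega⟩))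
        rw [Units.val_zpow_eq_zpow_val] at this
        exact this
      rw [this, map_zpow₀]
    set a := Real.log (v₀ (algebraMap (𝓞 F) F ε)) with ha
    have hεpos : 0 < v₀ (algebraMap (𝓞 F) F ε) := Units.pos_at_place ε v₀
    have hexp : ∀ k : ℤ, v₀ (algebraMap (𝓞 F) F ε) ^ k = Real.exp (k * a) := by
      intro k
      rw [ha, mul_comm, Real.exp_mul, Real.exp_log hεpos, Real.rpow_intCast]
    -- Dirichlet's theorem provides a unit of absolute value less than 1 at v₀, so the fundamental
    -- unit cannot have absolute value 1 there.
    have ha0 : a ≠ 0 := by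
      intro h0
      obtain ⟨u, hu⟩ := Units.dirichletUnitTheorem.exists_unit F v₁
      obtain ⟨k, hk⟩ := hgen u
      have h7 := hu v₀ hne
      rw [hexp, h0, mul_zero, Real.exp_zero] at hk
      have hk' : v₀ ((u : 𝓞 F) : F) = 1 := hk
      rw [hk', Real.log_one] at h7
      exact lt_irrefl _ h7
    -- H consists of the exponents k for which the parameter k · a becomes trivial in Pic⁰. As a
    -- subgroup of ℤ it is generated by some d, non-zero because a power of ε lies in F¹(m); the
    -- period is c = d · a.
    let H : AddSubgroup ℤ :=
      { carrier := {k | j (Multiplicative.ofAdd ((k : ℝ) * a)) = 1}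
        zero_mem' := by simp
        add_mem' := by
          intro x y hx hy
          simp only [Set.mem_ofPred_eq] at hx hy ⊢
          rw [Int.cast_add, add_mul, ofAdd_add, map_mul, hx, hy, one_mul]
        neg_mem' := by
          intro x hx
          simp only [Set.mem_ofPred_eq] at hx ⊢
          rw [Int.cast_neg, neg_mul, ofAdd_neg, map_inv, hx, inv_one] }
    obtain ⟨d, hd⟩ := Int.subgroup_cyclic H
    rw [← AddSubgroup.zmultiples_eq_closure] at hd
    have hd0 : d ≠ 0 := by
      rintro rfl
      obtain ⟨N, hN, hεN⟩ := exists_pow_mem_rayUnits m hm ε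
      have h8 : (N : ℤ) ∈ H := by
        change j (Multiplicative.ofAdd (((N : ℤ) : ℝ) * a)) = 1
        rw [hj]
        refine ⟨ε ^ N, hεN, ?_⟩
        rw [← hexp, Units.val_pow_eq_pow_val, map_pow, map_pow, zpow_natCast]
      rw [hd, AddSubgroup.zmultiples_zero_eq_bot, AddSubgroup.mem_bot] at h8
      exact hN (by exact_mod_cast h8)
    refine ⟨d * a, mul_ne_zero (Int.cast_ne_zero.2 hd0) ha0, fun t => ⟨fun ht => ?_, ?_⟩⟩
    · obtain ⟨u, -, hu⟩ := (hj t).1 ht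
      obtain ⟨k, hk⟩ := hgen u
      rw [hk, hexp] at hu
      have htk : t = k * a := (Real.exp_injective hu).symm
      have hkH : k ∈ H := by
        change j (Multiplicative.ofAdd ((k : ℝ) * a)) = 1
        rwa [← htk]
      rw [hd, AddSubgroup.mem_zmultiples_iff] at hkH
      obtain ⟨q, rfl⟩ := hkH
      refine ⟨q, ?_⟩
      rw [htk, smul_eq_mul]
      push_cast
      ring
    · rintro ⟨k, rfl⟩
      have hkH : k * d ∈ H := by
        rw [hd, AddSubgroup.mem_zmultiples_iff]
        exact ⟨k, rfl⟩
      have : j (Multiplicative.ofAdd (((k * d : ℤ) : ℝ) * a)) = 1 := hkH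
      rwa [Int.cast_mul, mul_assoc] at this
  refine ⟨fun k hk => ?_, card_torsion_of_real_cover j hsurj hc hker hn⟩
  obtain ⟨t, ht⟩ := hsurj ⟨k, hk⟩
  change ℝ at t
  refine ⟨(j (Multiplicative.ofAdd (t / n))).1, (j _).2, ?_⟩
  have : j (Multiplicative.ofAdd (t / n)) ^ n = ⟨k, hk⟩ := by
    rw [← map_pow, ← ofAdd_nsmul, nsmul_eq_mul, mul_div_cancel₀ _ (Nat.cast_ne_zero.2 hn)]
    exact ht
  exact congrArg Subtype.val this

/-- The `n`-torsion of the Arakelov ray class group of a real quadratic field is `n` times as large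
as that of the ray class group. -/
theorem card_picTorsion (hm : m ≠ 0) (ρ : F →+* ℝ) (h2 : Module.finrank ℚ F = 2)
    {n : ℕ} (hn : n ≠ 0) :
    Nat.card {k : ArakelovRayClassGroup F m // k ^ n = 1} =
      n * Nat.card {c : RayClassGroup F m // c ^ n = 1} := by
  obtain ⟨h1, h3⟩ := card_ker_picToClass_torsion m hm ρ h2 hn
  rw [card_torsion_of_surjective (picToClass F m) (picToClass_surjective F m) h1, h3]

end Pic

/-! ### The density of integers that are squarefree away from `M` in residue classes -/

/-- No square of a prime that does not divide `M` divides `n`. -/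
def SqfreeAway (M n : ℕ) : Prop := ∀ p : ℕ, p.Prime → ¬ p ∣ M → ¬ p ^ 2 ∣ n

theorem dvd_of_sq_dvd_sq_mul {a b k : ℕ} (ha : Squarefree a) (hb : b ≠ 0)
    (h : k ^ 2 ∣ b ^ 2 * a) : k ∣ b := by
  have ha0 : a ≠ 0 := ha.ne_zero
  have hn : b ^ 2 * a ≠ 0 := mul_ne_zero (pow_ne_zero 2 hb) ha0
  have hk : k ≠ 0 := by
    rintro rfl
    rw [zero_pow two_ne_zero, zero_dvd_iff] at h
    exact hn h
  rw [← Nat.factorization_le_iff_dvd hk hb]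
  intro p
  have h1 := (Nat.factorization_le_iff_dvd (pow_ne_zero 2 hk) hn).2 h p
  rw [Nat.factorization_mul (pow_ne_zero 2 hb) ha0, Nat.factorization_pow,
    Nat.factorization_pow] at h1
  have h2 := Squarefree.natFactorization_le_one p ha
  simp only [Finsupp.coe_add, Finsupp.coe_smul, Pi.add_apply, Pi.smul_apply, smul_eq_mul] at h1
  omega

theorem exists_coprime_part (M : ℕ) : ∀ b : ℕ, b ≠ 0 →
    ∃ t : ℕ, t ≠ 0 ∧ ∀ k : ℕ, (k ∣ b ∧ k.Coprime M) ↔ k ∣ t := by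
  intro b
  induction b using Nat.strong_induction_on with
  | _ b ih =>
    intro hb
    by_cases h : b.Coprime M
    · exact ⟨b, hb, fun k => ⟨fun hk => hk.1, fun hk => ⟨hk, h.coprime_dvd_left hk⟩⟩⟩
    · obtain ⟨p, hp, hpb, hpM⟩ := Nat.Prime.not_coprime_iff_dvd.1 h
      obtain ⟨c, rfl⟩ := hpb
      have hc : c ≠ 0 := by
        rintro rfl
        exact hb (mul_zero p)
      obtain ⟨t, ht, h1⟩ := ih c (lt_mul_of_one_lt_left (Nat.pos_of_ne_zero hc) hp.one_lt) hc
      refine ⟨t, ht, fun k => ?_⟩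
      rw [← h1]
      constructor
      · rintro ⟨hk, hkM⟩
        exact ⟨(hkM.coprime_dvd_right hpM).dvd_of_dvd_mul_left hk, hkM⟩
      · rintro ⟨hk, hkM⟩
        exact ⟨hk.mul_left p, hkM⟩

/-- Write n = b² a with a squarefree: then k² ∣ n means k ∣ b, and t is the largest divisor of b
coprime to M. This turns the sieve sum over k into a full divisor sum of the Möbius function. -/
theorem exists_sq_dvd_iff (M : ℕ) {n : ℕ} (hn : n ≠ 0) :
    ∃ t : ℕ, t ≠ 0 ∧ ∀ k : ℕ, (k ^ 2 ∣ n ∧ k.Coprime M) ↔ k ∣ t := by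
  obtain ⟨a, b, rfl, ha⟩ := Nat.sq_mul_squarefree n
  have hb : b ≠ 0 := by
    rintro rfl
    simp at hn
  obtain ⟨t, ht, h⟩ := exists_coprime_part M b hb
  refine ⟨t, ht, fun k => ?_⟩
  rw [← h]
  refine and_congr_left fun _ => ⟨dvd_of_sq_dvd_sq_mul ha hb, fun hk => ?_⟩
  exact (pow_dvd_pow_of_dvd hk 2).mul_right a

open Classical in
theorem sum_moebius_sq_dvd (M : ℕ) {n N : ℕ} (hn : n ≠ 0) (hnN : n ≤ N) :
    ∑ k ∈ (Finset.Ioc 0 N).filter (fun k => k ^ 2 ∣ n ∧ k.Coprime M),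
      ((ArithmeticFunction.moebius k : ℤ) : ℝ) = if SqfreeAway M n then 1 else 0 := by
  obtain ⟨t, ht, h⟩ := exists_sq_dvd_iff M hn
  have e : (Finset.Ioc 0 N).filter (fun k => k ^ 2 ∣ n ∧ k.Coprime M) = t.divisors := by
    ext k
    rw [Finset.mem_filter, Nat.mem_divisors, h, Finset.mem_Ioc]
    refine ⟨fun hk => ⟨hk.2, ht⟩, fun hk => ⟨⟨Nat.pos_of_dvd_of_pos hk.1 (Nat.pos_of_ne_zero ht),
      ?_⟩, hk.1⟩⟩
    have h1 := ((h k).2 hk.1).1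
    exact ((Nat.le_self_pow two_ne_zero k).trans
      (Nat.le_of_dvd (Nat.pos_of_ne_zero hn) h1)).trans hnN
  have hsum : ∑ k ∈ t.divisors, (ArithmeticFunction.moebius k : ℤ) = if t = 1 then 1 else 0 := by
    rw [← ArithmeticFunction.coe_mul_zeta_apply, ArithmeticFunction.moebius_mul_coe_zeta,
      ArithmeticFunction.one_apply]
  have hiff : t = 1 ↔ SqfreeAway M n := by
    constructor
    · rintro rfl p hp hpM hpn
      exact hp.one_lt.ne' (Nat.dvd_one.1 ((h p).1 ⟨hpn, (Nat.Prime.coprime_iff_not_dvd hp).2 hpM⟩))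
    · intro hs
      by_contra h1
      obtain ⟨p, hp, hpt⟩ := Nat.exists_prime_and_dvd h1
      obtain ⟨h2, h3⟩ := (h p).2 hpt
      exact hs p hp ((Nat.Prime.coprime_iff_not_dvd hp).1 h3) h2
  rw [e, ← Int.cast_sum, hsum]
  by_cases h1 : t = 1
  · rw [if_pos h1, if_pos (hiff.1 h1), Int.cast_one]
  · rw [if_neg h1, if_neg (fun h2 => h1 (hiff.2 h2)), Int.cast_zero]

theorem tendsto_card_modEq_div {q : ℕ} (hq : 0 < q) (v : ℕ) :
    Filter.Tendsto (fun N : ℕ => (((Finset.Ioc 0 N).filter (fun n => n ≡ v [MOD q])).card : ℝ) / N)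
      Filter.atTop (nhds (1 / q)) := by
  have hq' : (0 : ℝ) < q := Nat.cast_pos.2 hq
  have hb : ∀ N : ℕ, |(((Finset.Ioc 0 N).filter (fun n => n ≡ v [MOD q])).card : ℝ) - N / q| ≤ 1 := by
    intro N
    have h := Nat.Ioc_filter_modEq_card 0 N hq v
    have h1 : (⌊(((N : ℕ) : ℚ) - v) / q⌋ : ℝ) ≤ ((N : ℝ) - v) / q := by
      have := Int.floor_le ((((N : ℕ) : ℚ) - v) / q)
      exact_mod_cast (Rat.cast_le (K := ℝ)).2 this
    have h2 : ((N : ℝ) - v) / q < (⌊(((N : ℕ) : ℚ) - v) / q⌋ : ℝ) + 1 := by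
      have := Int.lt_floor_add_one ((((N : ℕ) : ℚ) - v) / q)
      exact_mod_cast (Rat.cast_lt (K := ℝ)).2 this
    have h3 : (⌊(((0 : ℕ) : ℚ) - v) / q⌋ : ℝ) ≤ ((0 : ℝ) - v) / q := by
      have := Int.floor_le ((((0 : ℕ) : ℚ) - v) / q)
      exact_mod_cast (Rat.cast_le (K := ℝ)).2 this
    have h4 : ((0 : ℝ) - v) / q < (⌊(((0 : ℕ) : ℚ) - v) / q⌋ : ℝ) + 1 := by
      have := Int.lt_floor_add_one ((((0 : ℕ) : ℚ) - v) / q)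
      exact_mod_cast (Rat.cast_lt (K := ℝ)).2 this
    have h5 : (((Finset.Ioc 0 N).filter (fun n => n ≡ v [MOD q])).card : ℝ) =
        max ((⌊(((N : ℕ) : ℚ) - v) / q⌋ : ℝ) - (⌊(((0 : ℕ) : ℚ) - v) / q⌋ : ℝ)) 0 := by
      exact_mod_cast congrArg (Int.cast : ℤ → ℝ) h
    have h6 : ((N : ℝ) - v) / q - ((0 : ℝ) - v) / q = N / q := by ring
    have h7 : (0 : ℝ) ≤ N / q := by positivity
    rw [h5, abs_le]
    constructor
    · have := le_max_left ((⌊(((N : ℕ) : ℚ) - v) / q⌋ : ℝ) - (⌊(((0 : ℕ) : ℚ) - v) / q⌋ : ℝ)) 0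
      linarith
    · have : max ((⌊(((N : ℕ) : ℚ) - v) / q⌋ : ℝ) - (⌊(((0 : ℕ) : ℚ) - v) / q⌋ : ℝ)) 0 ≤ N / q + 1 :=
        max_le (by linarith) (by linarith)
      linarith
  rw [tendsto_iff_norm_sub_tendsto_zero]
  refine squeeze_zero' (Filter.Eventually.of_forall fun _ => norm_nonneg _) ?_
    (tendsto_one_div_atTop_nhds_zero_nat (𝕜 := ℝ))
  filter_upwards [Filter.eventually_gt_atTop 0] with N hN
  have hN' : (0 : ℝ) < N := Nat.cast_pos.2 hN
  rw [Real.norm_eq_abs, show (((Finset.Ioc 0 N).filter (fun n => n ≡ v [MOD q])).card : ℝ) / N - 1 / q =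
    ((((Finset.Ioc 0 N).filter (fun n => n ≡ v [MOD q])).card : ℝ) - N / q) / N by field_simp,
    abs_div, abs_of_pos hN']
  gcongr
  exact hb N

/-- The constant `∑_{k ≥ 1, (k, M) = 1} μ(k) / k² = ∏_{p ∤ M} (1 - 1 / p²)`. -/
def sieveConst (M : ℕ) : ℝ :=
  ∑' k : ℕ, if k.Coprime M then ((ArithmeticFunction.moebius k : ℤ) : ℝ) * (1 / (k : ℝ) ^ 2) else 0

theorem norm_moebius_le (k : ℕ) : |((ArithmeticFunction.moebius k : ℤ) : ℝ)| ≤ 1 := by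
  exact_mod_cast ArithmeticFunction.abs_moebius_le_one (n := k)

/-- The term k = 1 is 1, and the others add up to at most ζ(2) - 1 = π² / 6 - 1 < 1 in absolute
value. -/
theorem sieveConst_pos (M : ℕ) : 0 < sieveConst M := by
  have hs : Summable fun k : ℕ => 1 / (k : ℝ) ^ 2 := hasSum_zeta_two.summable
  have hb : ∀ k : ℕ, ‖(if k.Coprime M then ((ArithmeticFunction.moebius k : ℤ) : ℝ) *
      (1 / (k : ℝ) ^ 2) else 0)‖ ≤ 1 / (k : ℝ) ^ 2 := by
    intro k
    split_ifs
    · rw [norm_mul, Real.norm_of_nonneg (by positivity : (0 : ℝ) ≤ 1 / (k : ℝ) ^ 2)]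
      exact mul_le_of_le_one_left (by positivity) (norm_moebius_le k)
    · simp
  have hs' := Summable.of_norm_bounded hs hb
  have h1 : sieveConst M = 1 + ∑' k : ℕ, (if (k + 2).Coprime M then
      ((ArithmeticFunction.moebius (k + 2) : ℤ) : ℝ) * (1 / ((k + 2 : ℕ) : ℝ) ^ 2) else 0) := by
    unfold sieveConst
    rw [← hs'.sum_add_tsum_nat_add 2]
    simp [Finset.sum_range_succ]
  have h2 : ∑' k : ℕ, 1 / ((k + 2 : ℕ) : ℝ) ^ 2 = Real.pi ^ 2 / 6 - 1 := by
    have := hs.sum_add_tsum_nat_add 2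
    rw [hasSum_zeta_two.tsum_eq] at this
    simp only [Finset.sum_range_succ, Finset.sum_range_zero] at this
    norm_num at this ⊢
    linarith
  have h3 : ‖∑' k : ℕ, (if (k + 2).Coprime M then
      ((ArithmeticFunction.moebius (k + 2) : ℤ) : ℝ) * (1 / ((k + 2 : ℕ) : ℝ) ^ 2) else 0)‖ ≤
      ∑' k : ℕ, 1 / ((k + 2 : ℕ) : ℝ) ^ 2 :=
    tsum_of_norm_bounded ((summable_nat_add_iff 2).2 hs).hasSum fun k => hb (k + 2)
  have h4 : Real.pi ^ 2 < 12 := by nlinarith [Real.pi_lt_d2, Real.pi_pos]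
  rw [h1]
  have := neg_le_of_abs_le (h3.trans_eq h2)
  linarith

open Classical in
-- Expand the condition with the Möbius function. For k coprime to M the conditions n ≡ r mod M and
-- k² ∣ n combine to one class modulo M k², of density 1 / (M k²). The k-th term is bounded by 1 /
-- k² uniformly in N, so the limit may be taken term by term.
theorem tendsto_card_sqfreeAway {M : ℕ} (hM : 0 < M) (r : ℕ) :
    Filter.Tendsto (fun N : ℕ => (((Finset.Ioc 0 N).filter
      (fun n => n ≡ r [MOD M] ∧ SqfreeAway M n)).card : ℝ) / N)
      Filter.atTop (nhds (sieveConst M / M)) := by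
  have hM' : (0 : ℝ) < M := Nat.cast_pos.2 hM
  let f : ℕ → ℕ → ℝ := fun N k => if k.Coprime M then ((ArithmeticFunction.moebius k : ℤ) : ℝ) *
    ((((Finset.Ioc 0 N).filter (fun n => n ≡ r [MOD M] ∧ k ^ 2 ∣ n)).card : ℝ) / N) else 0
  have hf : ∀ N : ℕ, ∑' k, f N k = (((Finset.Ioc 0 N).filter
      (fun n => n ≡ r [MOD M] ∧ SqfreeAway M n)).card : ℝ) / N := by
    intro N
    have h0 : ∀ k ∉ Finset.Ioc 0 N, f N k = 0 := by
      intro k hk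
      rcases Nat.eq_zero_or_pos k with rfl | hk0
      · simp [f]
      · have hkN : N < k := by
          by_contra h
          exact hk (Finset.mem_Ioc.2 ⟨hk0, not_lt.1 h⟩)
        have : (Finset.Ioc 0 N).filter (fun n => n ≡ r [MOD M] ∧ k ^ 2 ∣ n) = ∅ := by
          refine Finset.filter_eq_empty_iff.2 fun n hn h => ?_
          rw [Finset.mem_Ioc] at hn
          have h1 := Nat.le_of_dvd hn.1 h.2
          have h2 := Nat.le_self_pow two_ne_zero k
          omega
        simp [f, this]
    rw [tsum_eq_sum h0]
    have h1 : ∀ k ∈ Finset.Ioc 0 N, f N k = (∑ n ∈ (Finset.Ioc 0 N).filter (fun n => n ≡ r [MOD M]),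
        if k ^ 2 ∣ n ∧ k.Coprime M then ((ArithmeticFunction.moebius k : ℤ) : ℝ) else 0) / N := by
      intro k _
      by_cases hk : k.Coprime M
      · have hand : ∀ P : Prop, (P ∧ k.Coprime M) ↔ P := fun P => and_iff_left hk
        simp only [f, if_pos hk, hand]
        rw [← Finset.sum_filter, Finset.filter_filter, Finset.sum_const, nsmul_eq_mul]
        ring
      · simp [f, hk]
    rw [Finset.sum_congr rfl h1, ← Finset.sum_div, Finset.sum_comm]
    congr 1
    have h2 : ∀ n ∈ (Finset.Ioc 0 N).filter (fun n => n ≡ r [MOD M]),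
        ∑ k ∈ Finset.Ioc 0 N, (if k ^ 2 ∣ n ∧ k.Coprime M then
          ((ArithmeticFunction.moebius k : ℤ) : ℝ) else 0) = if SqfreeAway M n then 1 else 0 := by
      intro n hn
      rw [Finset.mem_filter, Finset.mem_Ioc] at hn
      rw [← Finset.sum_filter]
      exact sum_moebius_sq_dvd M hn.1.1.ne' hn.1.2
    rw [Finset.sum_congr rfl h2, ← Finset.sum_filter, Finset.filter_filter, Finset.sum_const,
      nsmul_eq_mul, mul_one]
  have hlim : ∑' k : ℕ, (if k.Coprime M then ((ArithmeticFunction.moebius k : ℤ) : ℝ) *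
      (1 / (M * (k : ℝ) ^ 2)) else 0) = sieveConst M / M := by
    unfold sieveConst
    rw [div_eq_mul_inv, ← tsum_mul_right]
    refine tsum_congr fun k => ?_
    split_ifs
    · rw [one_div, one_div, mul_inv]
      ring
    · rw [zero_mul]
  rw [← hlim]
  refine (tendsto_tsum_of_dominated_convergence (f := f) hasSum_zeta_two.summable ?_ ?_).congr hf
  · intro k
    by_cases hk : k.Coprime M
    · simp only [f, if_pos hk]
      refine Filter.Tendsto.const_mul _ ?_
      have hc : M.Coprime (k ^ 2) := (Nat.Coprime.pow_left 2 hk).symm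
      rcases Nat.eq_zero_or_pos k with rfl | hk0
      · simp only [ne_eq, OfNat.ofNat_ne_zero, not_false_eq_true, zero_pow, zero_dvd_iff,
          Nat.cast_zero, mul_zero, div_zero]
        refine tendsto_const_nhds.congr fun N => ?_
        have : (Finset.Ioc 0 N).filter (fun n => n ≡ r [MOD M] ∧ n = 0) = ∅ := by
          refine Finset.filter_eq_empty_iff.2 fun n hn h => ?_
          rw [Finset.mem_Ioc] at hn
          omega
        rw [this, Finset.card_empty, Nat.cast_zero, zero_div]
      · obtain ⟨v, hv1, hv2⟩ := Nat.chineseRemainder hc r 0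
        have h := tendsto_card_modEq_div (q := M * k ^ 2) (by positivity) v
        push_cast at h
        refine h.congr fun N => ?_
        congr 3
        ext n
        simp only [Finset.mem_filter]
        refine and_congr_right fun _ => ?_
        rw [← Nat.modEq_and_modEq_iff_modEq_mul hc, ← Nat.modEq_zero_iff_dvd]
        exact and_congr ⟨fun h => h.trans hv1, fun h => h.trans hv1.symm⟩
          ⟨fun h => h.trans hv2, fun h => h.trans hv2.symm⟩
    · simp [f, hk]
  · refine Filter.Eventually.of_forall fun N k => ?_
    by_cases hk : k.Coprime M
    · simp only [f, if_pos hk]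
      rw [norm_mul]
      refine (mul_le_of_le_one_left (norm_nonneg _) (norm_moebius_le k)).trans ?_
      rw [Real.norm_of_nonneg (by positivity)]
      rcases Nat.eq_zero_or_pos N with rfl | hN
      · simp
      have hN' : (0 : ℝ) < N := Nat.cast_pos.2 hN
      rcases Nat.eq_zero_or_pos k with rfl | hk0
      · have : (Finset.Ioc 0 N).filter (fun n => n ≡ r [MOD M] ∧ 0 ^ 2 ∣ n) = ∅ := by
          refine Finset.filter_eq_empty_iff.2 fun n hn h => ?_
          rw [Finset.mem_Ioc] at hn
          have := h.2
          simp at this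
          omega
        rw [this]
        simp
      have hk' : (0 : ℝ) < k := Nat.cast_pos.2 hk0
      rw [div_le_div_iff₀ hN' (by positivity), one_mul]
      have h1 : ((Finset.Ioc 0 N).filter (fun n => n ≡ r [MOD M] ∧ k ^ 2 ∣ n)).card ≤ N / k ^ 2 := by
        rw [← Nat.Ioc_filter_dvd_card_eq_div]
        exact Finset.card_le_card fun n => by
          simp only [Finset.mem_filter]
          exact fun h => ⟨h.1, h.2.2⟩
      have h2 := Nat.div_mul_le_self N (k ^ 2)
      exact_mod_cast (Nat.mul_le_mul_right (k ^ 2) h1).trans h2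
    · simp only [f, if_neg hk, norm_zero]
      positivity

open Classical in
theorem tendsto_sum_sqfreeAway {M : ℕ} (hM : 0 < M) [NeZero M] (W : ZMod M → ℝ) :
    Filter.Tendsto (fun N : ℕ => (∑ n ∈ (Finset.Ioc 0 N).filter (fun n => SqfreeAway M n), W n) / N)
      Filter.atTop (nhds (sieveConst M / M * ∑ r, W r)) := by
  rw [Finset.mul_sum]
  have h : ∀ r : ZMod M, r ∈ Finset.univ → Filter.Tendsto (fun N : ℕ => (((Finset.Ioc 0 N).filter
      (fun n => n ≡ r.val [MOD M] ∧ SqfreeAway M n)).card : ℝ) / N * W r)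
      Filter.atTop (nhds (sieveConst M / M * W r)) := fun r _ =>
    (tendsto_card_sqfreeAway hM r.val).mul_const _
  refine (tendsto_finsetSum _ h).congr fun N => ?_
  have h1 : ∑ n ∈ (Finset.Ioc 0 N).filter (fun n => SqfreeAway M n), W n =
      ∑ r : ZMod M, ∑ n ∈ ((Finset.Ioc 0 N).filter (fun n => SqfreeAway M n)).filter
        (fun n : ℕ => (n : ZMod M) = r), W n := (Finset.sum_fiberwise _ _ _).symm
  rw [h1, Finset.sum_div]
  refine Finset.sum_congr rfl fun r _ => ?_
  have h2 : ∀ n ∈ ((Finset.Ioc 0 N).filter (fun n => SqfreeAway M n)).filter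
      (fun n : ℕ => (n : ZMod M) = r), W n = W r := by
    intro n hn
    rw [(Finset.mem_filter.1 hn).2]
  rw [Finset.sum_congr rfl h2, Finset.sum_const, nsmul_eq_mul, Finset.filter_filter]
  have h3 : (Finset.Ioc 0 N).filter (fun n => n ≡ r.val [MOD M] ∧ SqfreeAway M n) =
      (Finset.Ioc 0 N).filter (fun n => SqfreeAway M n ∧ (n : ZMod M) = r) := by
    ext n
    simp only [Finset.mem_filter]
    refine and_congr_right fun _ => ?_
    rw [and_comm, ← ZMod.natCast_eq_natCast_iff, ZMod.natCast_zmod_val]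
  rw [h3]
  ring

open Classical in
-- The integer 1 satisfies the local conditions for a fundamental discriminant but belongs to no
-- quadratic field; dropping it does not change the limit.
theorem tendsto_sum_sqfreeAway_Ioc_one {M : ℕ} (hM : 0 < M) [NeZero M] (W : ZMod M → ℝ) :
    Filter.Tendsto (fun N : ℕ => (∑ n ∈ (Finset.Ioc 1 N).filter (fun n => SqfreeAway M n), W n) / N)
      Filter.atTop (nhds (sieveConst M / M * ∑ r, W r)) := by
  have h1 := tendsto_sum_sqfreeAway hM W
  have h2 : Filter.Tendsto (fun N : ℕ => (∑ n ∈ ({1} : Finset ℕ).filter (fun n => SqfreeAway M n),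
      W n) / (N : ℝ)) Filter.atTop (nhds 0) := tendsto_const_div_atTop_nhds_zero_nat _
  have h3 := h1.sub h2
  rw [sub_zero] at h3
  refine h3.congr' ?_
  filter_upwards [Filter.eventually_ge_atTop 1] with N hN
  have h4 : Finset.Ioc 0 N = {1} ∪ Finset.Ioc 1 N := by
    ext n
    simp only [Finset.mem_union, Finset.mem_singleton, Finset.mem_Ioc]
    omega
  have h5 : Disjoint (({1} : Finset ℕ).filter (fun n => SqfreeAway M n))
      ((Finset.Ioc 1 N).filter (fun n => SqfreeAway M n)) :=
    Finset.disjoint_filter_filter (by simp)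
  rw [h4, Finset.filter_union, Finset.sum_union h5]
  ring

open Classical in
/-- Averages of products of local functions over the integers that satisfy local conditions and are
squarefree away from the modulus and larger than one. -/
theorem tendsto_average_prod {ι : Type*} [Fintype ι] (q : ι → ℕ) (hq : ∀ i, q i ≠ 0)
    (hco : Pairwise (Function.onFun Nat.Coprime q)) (g : ∀ i, ZMod (q i) → Prop)
    (hg : ∀ i, ∃ r, g i r) (w : ∀ i, ZMod (q i) → ℝ) [∀ i, NeZero (q i)] :
    Filter.Tendsto (fun N : ℕ =>
      (∑ n ∈ (Finset.Ioc 1 N).filter (fun n => SqfreeAway (∏ i, q i) n ∧ ∀ i, g i n),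
        ∏ i, w i n) /
      (((Finset.Ioc 1 N).filter (fun n => SqfreeAway (∏ i, q i) n ∧ ∀ i, g i n)).card : ℝ))
      Filter.atTop (nhds (∏ i, ((∑ r ∈ Finset.univ.filter (g i), w i r) /
        ((Finset.univ.filter (g i)).card : ℝ)))) := by
  have hM : 0 < ∏ i, q i := Finset.prod_pos fun i _ => Nat.pos_of_ne_zero (hq i)
  have : NeZero (∏ i, q i) := ⟨hM.ne'⟩
  let e := ZMod.prodEquivPi q hco
  have key : ∀ w : ∀ i, ZMod (q i) → ℝ, Filter.Tendsto (fun N : ℕ =>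
      (∑ n ∈ (Finset.Ioc 1 N).filter (fun n => SqfreeAway (∏ i, q i) n ∧ ∀ i, g i n),
        ∏ i, w i n) / (N : ℝ)) Filter.atTop
      (nhds (sieveConst (∏ i, q i) / (∏ i, q i : ℕ) *
        ∏ i, ∑ r ∈ Finset.univ.filter (g i), w i r)) := by
    intro w
    let h : ∀ i, ZMod (q i) → ℝ := fun i r => if g i r then w i r else 0
    have h1 := tendsto_sum_sqfreeAway_Ioc_one hM fun r => ∏ i, h i (e r i)
    have h2 : ∑ r, ∏ i, h i (e r i) = ∏ i, ∑ r ∈ Finset.univ.filter (g i), w i r := by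
      refine (Equiv.sum_comp e.toEquiv (fun x => ∏ i, h i (x i))).trans ?_
      simp only [Finset.sum_filter]
      rw [Finset.prod_univ_sum, Fintype.piFinset_univ]
    rw [h2] at h1
    refine h1.congr fun N => ?_
    congr 1
    have h3 : ∀ n : ℕ, ∏ i, h i (e (n : ZMod (∏ i, q i)) i) =
        if ∀ i, g i n then ∏ i, w i n else 0 := by
      intro n
      have h4 : ∀ i, e (n : ZMod (∏ i, q i)) i = n := fun i => by rw [map_natCast]; rfl
      simp only [h4, h]
      split_ifs with h5
      · exact Finset.prod_congr rfl fun i _ => if_pos (h5 i)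
      · push Not at h5
        obtain ⟨i, hi⟩ := h5
        exact Finset.prod_eq_zero (Finset.mem_univ i) (if_neg hi)
    simp only [h3]
    rw [← Finset.sum_filter, Finset.filter_filter]
  have hc : (0 : ℝ) < ∏ i, ((Finset.univ.filter (g i)).card : ℝ) := by
    refine Finset.prod_pos fun i _ => ?_
    obtain ⟨r, hr⟩ := hg i
    exact Nat.cast_pos.2 (Finset.card_pos.2 ⟨r, Finset.mem_filter.2 ⟨Finset.mem_univ _, hr⟩⟩)
  have hs : sieveConst (∏ i, q i) / (∏ i, q i : ℕ) ≠ 0 :=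
    (div_pos (sieveConst_pos _) (Nat.cast_pos.2 hM)).ne'
  have k1 := key w
  have k2 := key fun _ _ => 1
  simp only [Finset.prod_const_one, Finset.sum_const, nsmul_eq_mul, mul_one] at k2
  -- Numerator and denominator contain the same sieve constant, which cancels and leaves a product
  -- of local averages.
  have k3 := k1.div k2 (mul_ne_zero hs hc.ne')
  rw [mul_div_mul_left _ _ hs, ← Finset.prod_div_distrib] at k3
  refine k3.congr' ?_
  filter_upwards [Filter.eventually_gt_atTop 0] with N hN
  exact div_div_div_cancel_right₀ (Nat.cast_ne_zero.2 hN.ne') _ _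

/-! ### Counting units of prime order in rings with an involution -/

section RingCounts

variable {R R' : Type*} [CommRing R] [CommRing R']

/-- The number of `z` with `z ^ ℓ = 1` that are fixed by `τ`. -/
def torPlus (τ : R ≃+* R) (ℓ : ℕ) : ℕ := Nat.card {z : R // z ^ ℓ = 1 ∧ τ z = z}

/-- The number of `z` with `z ^ ℓ = 1` that are inverted by `τ`. -/
def torMinus (τ : R ≃+* R) (ℓ : ℕ) : ℕ := Nat.card {z : R // z ^ ℓ = 1 ∧ z * τ z = 1}

theorem card_units_subtype {ℓ : ℕ} (hℓ : ℓ ≠ 0) (P : Rˣ → Prop) (Q : R → Prop)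
    (h : ∀ u : Rˣ, P u ↔ Q u) :
    Nat.card {u : Rˣ // u ^ ℓ = 1 ∧ P u} = Nat.card {z : R // z ^ ℓ = 1 ∧ Q z} := by
  refine Nat.card_congr (Equiv.ofBijective (fun u => ⟨(u.1 : R), by
    rw [← Units.val_pow_eq_pow_val, u.2.1, Units.val_one], (h _).1 u.2.2⟩) ⟨?_, ?_⟩)
  · intro u v huv
    exact Subtype.ext (Units.ext (congrArg Subtype.val huv))
  · rintro ⟨z, hz, hQ⟩
    let u := Units.ofPowEqOne z ℓ hz hℓ
    exact ⟨⟨u, Units.ext hz, (h u).2 hQ⟩, rfl⟩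

theorem unitPlus_eq_torPlus {R : Type} [CommRing R] (τ : R ≃+* R) {ℓ : ℕ} (hℓ : ℓ ≠ 0) :
    unitPlus τ ℓ = torPlus τ ℓ :=
  card_units_subtype hℓ _ _ fun u => by
    rw [Units.ext_iff]
    rfl

theorem unitMinus_eq_torMinus {R : Type} [CommRing R] (τ : R ≃+* R) {ℓ : ℕ} (hℓ : ℓ ≠ 0) :
    unitMinus τ ℓ = torMinus τ ℓ :=
  card_units_subtype hℓ _ _ fun u => by
    rw [eq_inv_iff_mul_eq_one, Units.ext_iff, mul_comm]
    rfl

theorem card_pow_eq_torPlus_mul_torMinus (τ : R ≃+* R) (hτ : ∀ z, τ (τ z) = z) {ℓ : ℕ}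
    (hodd : Odd ℓ) : Nat.card {z : R // z ^ ℓ = 1} = torPlus τ ℓ * torMinus τ ℓ := by
  have hℓ : ℓ ≠ 0 := hodd.pos.ne'
  have h1 := card_units_subtype (R := R) hℓ (fun _ => True) (fun _ => True) fun _ => Iff.rfl
  simp only [and_true] at h1
  rw [← h1, card_torsion_eq_mul (Units.mapEquiv τ.toMulEquiv).toMonoidHom
    (fun u => Units.ext (hτ u)) hodd]
  congr 1
  · exact card_units_subtype hℓ _ _ fun u => by
      rw [Units.ext_iff]
      rfl
  · exact card_units_subtype hℓ _ _ fun u => by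
      rw [eq_inv_iff_mul_eq_one, Units.ext_iff, mul_comm]
      rfl

theorem torPlus_congr (r : R ≃+* R') {τ : R ≃+* R} {τ' : R' ≃+* R'}
    (h : ∀ x, r (τ x) = τ' (r x)) (ℓ : ℕ) : torPlus τ ℓ = torPlus τ' ℓ :=
  Nat.card_congr (r.toEquiv.subtypeEquiv fun z => by
    change _ ↔ (r z) ^ ℓ = 1 ∧ τ' (r z) = r z
    rw [← h, ← map_pow, r.injective.eq_iff, map_eq_one_iff r r.injective])

theorem torMinus_congr (r : R ≃+* R') {τ : R ≃+* R} {τ' : R' ≃+* R'}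
    (h : ∀ x, r (τ x) = τ' (r x)) (ℓ : ℕ) : torMinus τ ℓ = torMinus τ' ℓ :=
  Nat.card_congr (r.toEquiv.subtypeEquiv fun z => by
    change _ ↔ (r z) ^ ℓ = 1 ∧ r z * τ' (r z) = 1
    rw [← h, ← map_pow, ← map_mul, map_eq_one_iff r r.injective, map_eq_one_iff r r.injective])

/-- A surjection with nilpotent kernel induces bijections on elements of order prime to the
characteristic. -/
theorem tor_eq_of_surjective (f : R →+* R') (hf : Function.Surjective f) {p K ℓ : ℕ}
    (hker : ∀ z w, f z = f w → (p : R) ∣ z - w) (hp : (p : R) ^ K = 0) (hco : p.Coprime ℓ)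
    {τ : R ≃+* R} {τ' : R' ≃+* R'} (h : ∀ x, f (τ x) = τ' (f x)) :
    torPlus τ ℓ = torPlus τ' ℓ ∧ torMinus τ ℓ = torMinus τ' ℓ := by
  have hpow : ∀ z w, f z = f w → z ^ p ^ K = w ^ p ^ K := by
    intro z w hzw
    obtain ⟨c, hc⟩ := dvd_sub_pow_of_dvd_sub (hker z w hzw) K
    rw [pow_succ, hp, zero_mul, zero_mul] at hc
    exact sub_eq_zero.1 hc
  -- With e inverse to p ^ K modulo ℓ, the power map of exponent p ^ K · e is the identity on
  -- ℓ-torsion and depends only on the image under f. It therefore gives both injectivity and a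
  -- Teichmüller-type lift.
  obtain ⟨e, he⟩ : ∃ e : ℕ, p ^ K * e ≡ 1 [MOD ℓ] := by
    rcases Nat.lt_or_ge 1 ℓ with h1 | h1
    · obtain ⟨e, -, he⟩ := Nat.exists_mul_mod_eq_one_of_coprime (hco.pow_left K) h1
      exact ⟨e, by rw [Nat.ModEq, he, Nat.mod_eq_of_lt h1]⟩
    · rcases Nat.le_one_iff_eq_zero_or_eq_one.1 h1 with rfl | rfl
      · rw [Nat.coprime_zero_right] at hco
        exact ⟨1, by rw [hco, one_pow, mul_one]⟩
      · exact ⟨0, Nat.modEq_one⟩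
  have hself : ∀ z : R, z ^ ℓ = 1 → z ^ (p ^ K * e) = z := by
    intro z hz
    have := pow_eq_pow_of_modEq he hz
    rwa [pow_one] at this
  have hself' : ∀ z : R', z ^ ℓ = 1 → z ^ (p ^ K * e) = z := by
    intro z hz
    have := pow_eq_pow_of_modEq he hz
    rwa [pow_one] at this
  have hinj : ∀ z w : R, z ^ ℓ = 1 → w ^ ℓ = 1 → f z = f w → z = w := by
    intro z w hz hw hzw
    rw [← hself z hz, ← hself w hw, pow_mul, pow_mul, hpow z w hzw]
  have hlift : ∀ y : R', y ^ ℓ = 1 → ∃ z : R, z ^ ℓ = 1 ∧ f z = y := by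
    intro y hy
    obtain ⟨x, rfl⟩ := hf y
    refine ⟨x ^ (p ^ K * e), ?_, by rw [map_pow, hself' _ hy]⟩
    rw [← pow_mul, mul_comm (p ^ K * e), pow_mul, pow_mul,
      hpow (x ^ ℓ) 1 (by rw [map_pow, hy, map_one]), one_pow, one_pow]
  constructor
  · refine Nat.card_congr (Equiv.ofBijective (fun z => ⟨f z.1, by
      rw [← map_pow, z.2.1, map_one], by rw [← h, z.2.2]⟩) ⟨?_, ?_⟩)
    · intro z w hzw
      exact Subtype.ext (hinj _ _ z.2.1 w.2.1 (congrArg Subtype.val hzw))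
    · rintro ⟨y, hy, hy'⟩
      obtain ⟨z, hz, rfl⟩ := hlift y hy
      exact ⟨⟨z, hz, hinj _ _ (by rw [← map_pow, hz, map_one]) hz (by rw [h, hy'])⟩, rfl⟩
  · refine Nat.card_congr (Equiv.ofBijective (fun z => ⟨f z.1, by
      rw [← map_pow, z.2.1, map_one], by rw [← h, ← map_mul, z.2.2, map_one]⟩) ⟨?_, ?_⟩)
    · intro z w hzw
      exact Subtype.ext (hinj _ _ z.2.1 w.2.1 (congrArg Subtype.val hzw))
    · rintro ⟨y, hy, hy'⟩
      obtain ⟨z, hz, rfl⟩ := hlift y hy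
      refine ⟨⟨z, hz, hinj _ _ ?_ (one_pow _) (by rw [map_mul, h, hy', map_one])⟩, rfl⟩
      rw [mul_pow, ← map_pow, hz, map_one, one_mul]

theorem torMinus_pi {ι : Type*} [Fintype ι] {A : ι → Type*} [∀ i, CommRing (A i)]
    (τ : ∀ i, A i ≃+* A i) (ℓ : ℕ) :
    torMinus (RingEquiv.piCongrRight τ) ℓ = ∏ i, torMinus (τ i) ℓ := by
  unfold torMinus
  rw [← Nat.card_pi]
  exact Nat.card_congr
    { toFun := fun z i => ⟨z.1 i, congrFun z.2.1 i, congrFun z.2.2 i⟩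
      invFun := fun z => ⟨fun i => (z i).1, funext fun i => (z i).2.1, funext fun i => (z i).2.2⟩
      left_inv := fun _ => rfl
      right_inv := fun _ => rfl }

theorem torPlus_pi {ι : Type*} [Fintype ι] {A : ι → Type*} [∀ i, CommRing (A i)]
    (τ : ∀ i, A i ≃+* A i) (ℓ : ℕ) :
    torPlus (RingEquiv.piCongrRight τ) ℓ = ∏ i, torPlus (τ i) ℓ := by
  unfold torPlus
  rw [← Nat.card_pi]
  exact Nat.card_congr
    { toFun := fun z i => ⟨z.1 i, congrFun z.2.1 i, congrFun z.2.2 i⟩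
      invFun := fun z => ⟨fun i => (z i).1, funext fun i => (z i).2.1, funext fun i => (z i).2.2⟩
      left_inv := fun _ => rfl
      right_inv := fun _ => rfl }

theorem card_pow_eq_one_of_isCyclic {G : Type*} [CommGroup G] [IsCyclic G] [Finite G] {ℓ : ℕ}
    (hℓ : ℓ.Prime) : Nat.card {g : G // g ^ ℓ = 1} = if ℓ ∣ Nat.card G then ℓ else 1 := by
  have h := IsCyclic.card_powMonoidHom_ker (G := G) ℓ
  have h1 : Nat.card {g : G // g ^ ℓ = 1} = Nat.card (powMonoidHom ℓ : G →* G).ker := rfl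
  rw [h1, h]
  split_ifs with hd
  · exact Nat.gcd_eq_right hd
  · exact (Nat.coprime_comm.1 ((Nat.Prime.coprime_iff_not_dvd hℓ).2 hd))

end RingCounts

/-! ### Quadratic algebras over `ZMod n` -/

section Quad

open QuadraticAlgebra

/-- The map between quadratic algebras that is induced by a ring homomorphism. -/
def quadMap {R S : Type*} [CommRing R] [CommRing S] (f : R →+* S) {a b : R} {a' b' : S}
    (ha : f a = a') (hb : f b = b') : QuadraticAlgebra R a b →+* QuadraticAlgebra S a' b' where
  toFun z := ⟨f z.re, f z.im⟩
  map_one' := by ext <;> simp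
  map_zero' := by ext <;> simp
  map_add' x y := by ext <;> simp
  map_mul' x y := by ext <;> simp [ha, hb]

/-- The involution of a quadratic algebra. -/
abbrev quadConj {R : Type*} [CommRing R] (a b : R) :
    QuadraticAlgebra R a b ≃+* QuadraticAlgebra R a b := starRingAut

theorem quadMap_conj {R S : Type*} [CommRing R] [CommRing S] (f : R →+* S) {a b : R} {a' b' : S}
    (ha : f a = a') (hb : f b = b') (z : QuadraticAlgebra R a b) :
    quadMap f ha hb (quadConj a b z) = quadConj a' b' (quadMap f ha hb z) := by
  rw [starRingAut_apply, starRingAut_apply]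
  ext <;> simp [quadMap, hb]

/-- The ring `ℤ[ω] / n` with `ω² = a + b ω`. -/
abbrev QuadMod (n : ℕ) (a b : ℤ) : Type := QuadraticAlgebra (ZMod n) (a : ZMod n) (b : ZMod n)

/-- The involution of `QuadMod n a b`. -/
abbrev quadModConj (n : ℕ) (a b : ℤ) : QuadMod n a b ≃+* QuadMod n a b := quadConj _ _

/-- The units congruent to 1 modulo p form a p-group, so torsion of order ℓ prime to p is already
visible modulo p. -/
theorem tor_quadMod_primePow {p k : ℕ} (hp : p.Prime) (hk : k ≠ 0) {ℓ : ℕ} (hco : p.Coprime ℓ)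
    (a b : ℤ) :
    torPlus (quadModConj (p ^ k) a b) ℓ = torPlus (quadModConj p a b) ℓ ∧
      torMinus (quadModConj (p ^ k) a b) ℓ = torMinus (quadModConj p a b) ℓ := by
  have hd : p ∣ p ^ k := dvd_pow_self p hk
  have : NeZero (p ^ k) := ⟨pow_ne_zero k hp.ne_zero⟩
  let f : QuadMod (p ^ k) a b →+* QuadMod p a b :=
    quadMap (ZMod.castHom hd (ZMod p)) (map_intCast _ _) (map_intCast _ _)
  have hc : ∀ x y : ZMod (p ^ k), ZMod.castHom hd (ZMod p) x = ZMod.castHom hd (ZMod p) y →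
      ∃ c, x - y = p * c := by
    intro x y hxy
    obtain ⟨n, hn⟩ := ZMod.natCast_zmod_surjective (x - y)
    have h1 : ((n : ℕ) : ZMod p) = 0 := by
      have := congrArg (ZMod.castHom hd (ZMod p)) hn
      rwa [map_natCast, map_sub, hxy, sub_self] at this
    obtain ⟨c, rfl⟩ := (ZMod.natCast_eq_zero_iff n p).1 h1
    exact ⟨c, by rw [← hn]; push_cast; rfl⟩
  refine tor_eq_of_surjective f ?_ (p := p) (K := k) ?_ ?_ hco fun x => quadMap_conj _ _ _ x
  · rintro ⟨x, y⟩
    obtain ⟨x', hx⟩ := ZMod.castHom_surjective hd x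
    obtain ⟨y', hy⟩ := ZMod.castHom_surjective hd y
    exact ⟨⟨x', y'⟩, by ext; exacts [hx, hy]⟩
  · intro z w hzw
    obtain ⟨c, hc1⟩ := hc z.re w.re (congrArg QuadraticAlgebra.re hzw)
    obtain ⟨d, hd1⟩ := hc z.im w.im (congrArg QuadraticAlgebra.im hzw)
    exact ⟨⟨c, d⟩, by ext <;> simp [hc1, hd1]⟩
  · have : ((p ^ k : ℕ) : QuadMod (p ^ k) a b) = 0 := by
      ext
      · rw [re_natCast, ZMod.natCast_self]; rfl
      · rw [im_natCast]; rfl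
    exact_mod_cast this

theorem tor_quadMod_eq_prod {m : ℕ} (hm : m ≠ 0) (ℓ : ℕ) (a b : ℤ) :
    torPlus (quadModConj m a b) ℓ =
      ∏ p : m.primeFactors, torPlus (quadModConj (p ^ m.factorization p) a b) ℓ ∧
    torMinus (quadModConj m a b) ℓ =
      ∏ p : m.primeFactors, torMinus (quadModConj (p ^ m.factorization p) a b) ℓ := by
  let e := ZMod.equivPi m hm
  let f : ∀ p : m.primeFactors, QuadMod m a b →+* QuadMod (p ^ m.factorization p) a b := fun p =>
    quadMap ((Pi.evalRingHom _ p).comp e.toRingHom) (map_intCast _ _) (map_intCast _ _)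
  have hbij : Function.Bijective (RingHom.pi f) := by
    constructor
    · intro z w hzw
      have h1 : ∀ p, e z.re p = e w.re p := fun p =>
        congrArg QuadraticAlgebra.re (congrFun hzw p)
      have h2 : ∀ p, e z.im p = e w.im p := fun p =>
        congrArg QuadraticAlgebra.im (congrFun hzw p)
      ext
      exacts [e.injective (funext h1), e.injective (funext h2)]
    · intro y
      refine ⟨⟨e.symm fun p => (y p).re, e.symm fun p => (y p).im⟩, funext fun p => ?_⟩
      ext
      · exact congrFun (e.apply_symm_apply _) p
      · exact congrFun (e.apply_symm_apply _) p
  let r := RingEquiv.ofBijective _ hbij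
  have hr : ∀ x, r (quadModConj m a b x) = RingEquiv.piCongrRight
      (fun p : m.primeFactors => quadModConj (p ^ m.factorization p) a b) (r x) :=
    fun x => funext fun p => quadMap_conj
      ((Pi.evalRingHom (fun p : m.primeFactors => ZMod (p ^ m.factorization p)) p).comp e.toRingHom)
      (map_intCast _ _) (map_intCast _ _) x
  exact ⟨(torPlus_congr r hr ℓ).trans (torPlus_pi _ ℓ), (torMinus_congr r hr ℓ).trans (torMinus_pi _ ℓ)⟩

end Quad

open QuadraticAlgebra

/-! ### Torsion units over a prime field: the split, inert and ramified cases -/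

section PrimeField

variable {p ℓ : ℕ}

theorem card_zmod_pow_eq_one (hp : p.Prime) (hℓ : ℓ.Prime) :
    Nat.card {x : ZMod p // x ^ ℓ = 1} = if ℓ ∣ p - 1 then ℓ else 1 := by
  have : Fact p.Prime := ⟨hp⟩
  have h1 := card_units_subtype (R := ZMod p) hℓ.ne_zero (fun _ => True) (fun _ => True)
    fun _ => Iff.rfl
  simp only [and_true] at h1
  rw [← h1, card_pow_eq_one_of_isCyclic hℓ, Nat.card_units, Nat.card_zmod]

theorem eq_one_of_sq_of_pow {G : Type*} [Monoid G] (hodd : Odd ℓ) {x : G} (h2 : x ^ 2 = 1)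
    (hx : x ^ ℓ = 1) : x = 1 := by
  obtain ⟨k, rfl⟩ := hodd
  rwa [pow_succ, pow_mul, h2, one_pow, one_mul] at hx

theorem torPlus_swap {R : Type*} [CommRing R] (ℓ : ℕ) :
    torPlus (RingEquiv.prodComm : R × R ≃+* R × R) ℓ = Nat.card {x : R // x ^ ℓ = 1} :=
  Nat.card_congr
    { toFun := fun z => ⟨z.1.1, congrArg Prod.fst z.2.1⟩
      invFun := fun x => ⟨(x.1, x.1), Prod.ext x.2 x.2, rfl⟩
      left_inv := fun z => Subtype.ext (Prod.ext rfl (congrArg Prod.fst z.2.2).symm)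
      right_inv := fun _ => rfl }

/-- The inverted elements are the pairs (x, x⁻¹); with ℓ = k + 1 the inverse of x is x ^ k. -/
theorem torMinus_swap {R : Type*} [CommRing R] {ℓ : ℕ} (hℓ : ℓ ≠ 0) :
    torMinus (RingEquiv.prodComm : R × R ≃+* R × R) ℓ = Nat.card {x : R // x ^ ℓ = 1} := by
  obtain ⟨k, rfl⟩ := Nat.exists_eq_succ_of_ne_zero hℓ
  have hxk : ∀ x : R, x ^ (k + 1) = 1 → x * x ^ k = 1 := fun x hx => by rw [← pow_succ', hx]
  refine Nat.card_congr
    { toFun := fun z => ⟨z.1.1, congrArg Prod.fst z.2.1⟩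
      invFun := fun x => ⟨(x.1, x.1 ^ k), Prod.ext x.2 (by
        change (x.1 ^ k) ^ (k + 1) = 1
        rw [← pow_mul, mul_comm, pow_mul, x.2, one_pow]), Prod.ext (hxk x.1 x.2)
        ((mul_comm _ _).trans (hxk x.1 x.2))⟩
      left_inv := fun z => Subtype.ext (Prod.ext rfl ?_)
      right_inv := fun _ => rfl }
  have h1 : z.1.1 * z.1.2 = 1 := congrArg Prod.fst z.2.2
  have h2 := hxk z.1.1 (congrArg Prod.fst z.2.1)
  change z.1.1 ^ k = z.1.2
  calc z.1.1 ^ k = z.1.1 ^ k * (z.1.1 * z.1.2) := by rw [h1, mul_one]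
    _ = (z.1.1 * z.1.1 ^ k) * z.1.2 := by ring
    _ = z.1.2 := by rw [h2, one_mul]

/-- A quadratic algebra over a field with two roots is a product of two copies of the field. -/
theorem exists_equiv_prod_of_roots {K : Type*} [Field K] {a b r s : K} (hrs : r ≠ s)
    (hb : r + s = b) (ha : r * s = -a) :
    ∃ e : QuadraticAlgebra K a b ≃+* K × K, ∀ z, e (quadConj a b z) = RingEquiv.prodComm (e z) := by
  have hr : r * r = a + b * r := by rw [← hb]; linear_combination -ha
  have hs : s * s = a + b * s := by rw [← hb]; linear_combination -ha
  let f : QuadraticAlgebra K a b →+* K × K :=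
    { toFun := fun z => (z.re + z.im * r, z.re + z.im * s)
      map_one' := by ext <;> simp
      map_zero' := by ext <;> simp
      map_add' := fun x y => by ext <;> simp <;> ring
      map_mul' := fun x y => by
        ext
        · simp only [re_mul, im_mul, Prod.fst_mul]
          linear_combination (-x.im * y.im) * hr
        · simp only [re_mul, im_mul, Prod.snd_mul]
          linear_combination (-x.im * y.im) * hs }
  have hsub : r - s ≠ 0 := sub_ne_zero.2 hrs
  refine ⟨RingEquiv.ofBijective f ⟨?_, ?_⟩, fun z => ?_⟩
  · intro z w hzw
    have h1 : z.re + z.im * r = w.re + w.im * r := congrArg Prod.fst hzw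
    have h2 : z.re + z.im * s = w.re + w.im * s := congrArg Prod.snd hzw
    have h3 : (z.im - w.im) * (r - s) = 0 := by linear_combination h1 - h2
    have h4 : z.im = w.im := sub_eq_zero.1 ((mul_eq_zero.1 h3).resolve_right hsub)
    ext
    · rw [h4] at h1
      exact add_right_cancel h1
    · exact h4
  · rintro ⟨x, y⟩
    refine ⟨⟨x - (x - y) / (r - s) * r, (x - y) / (r - s)⟩, Prod.ext ?_ ?_⟩
    · change x - (x - y) / (r - s) * r + (x - y) / (r - s) * r = x
      ring
    · change x - (x - y) / (r - s) * r + (x - y) / (r - s) * s = y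
      field_simp
      ring
  · change f (star z) = (z.re + z.im * s, z.re + z.im * r)
    refine Prod.ext ?_ ?_
    · change (star z).re + (star z).im * r = z.re + z.im * s
      rw [re_star, im_star]
      linear_combination (-z.im) * hb
    · change (star z).re + (star z).im * s = z.re + z.im * r
      rw [re_star, im_star]
      linear_combination (-z.im) * hb

theorem tor_split (hp : p.Prime) (hℓ : ℓ.Prime) {a b : ℤ} {r s : ZMod p} (hrs : r ≠ s)
    (hb : r + s = b) (ha : r * s = -(a : ZMod p)) :
    torPlus (quadModConj p a b) ℓ = (if ℓ ∣ p - 1 then ℓ else 1) ∧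
      torMinus (quadModConj p a b) ℓ = if ℓ ∣ p - 1 then ℓ else 1 := by
  have : Fact p.Prime := ⟨hp⟩
  obtain ⟨e, he⟩ := exists_equiv_prod_of_roots hrs hb ha
  rw [torPlus_congr e he, torMinus_congr e he, torPlus_swap, torMinus_swap hℓ.ne_zero,
    card_zmod_pow_eq_one hp hℓ]
  exact ⟨rfl, rfl⟩

/-- The algebra is the field of p² elements with its conjugation. The fixed elements form the prime
field, all ℓ-torsion lies in a cyclic group of order (p - 1)(p + 1), and the inverted part is found
by division; an odd ℓ divides at most one of the two factors. -/
theorem tor_inert (hp : p.Prime) (hℓ : ℓ.Prime) (hodd : Odd ℓ) {a b : ℤ}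
    (h : ∀ r : ZMod p, r ^ 2 ≠ a + b * r) :
    torPlus (quadModConj p a b) ℓ = (if ℓ ∣ p - 1 then ℓ else 1) ∧
      torMinus (quadModConj p a b) ℓ = if ℓ ∣ p + 1 then ℓ else 1 := by
  have : Fact p.Prime := ⟨hp⟩
  have : Fact (∀ r : ZMod p, r ^ 2 ≠ a + b * r) := ⟨h⟩
  have hplus : torPlus (quadModConj p a b) ℓ = if ℓ ∣ p - 1 then ℓ else 1 := by
    rw [← card_zmod_pow_eq_one hp hℓ]
    have him : ∀ z : QuadMod p a b, quadModConj p a b z = z → z.im = 0 := by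
      intro z hz
      have h1 : z.re + b * z.im = z.re := by
        rw [starRingAut_apply] at hz
        simpa using congrArg QuadraticAlgebra.re hz
      have h2 : -z.im = z.im := by
        rw [starRingAut_apply] at hz
        simpa using congrArg QuadraticAlgebra.im hz
      by_contra h0
      have hb0 : (b : ZMod p) = 0 := by
        have : (b : ZMod p) * z.im = 0 := by linear_combination h1
        exact (mul_eq_zero.1 this).resolve_right h0
      have h20 : (2 : ZMod p) = 0 := by
        have : (2 : ZMod p) * z.im = 0 := by linear_combination -h2
        exact (mul_eq_zero.1 this).resolve_right h0
      have hp2 : p = 2 := by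
        have h3 : ((2 : ℕ) : ZMod p) = 0 := by exact_mod_cast h20
        exact (Nat.prime_dvd_prime_iff_eq hp Nat.prime_two).1 ((ZMod.natCast_eq_zero_iff 2 p).1 h3)
      subst hp2
      -- In characteristic two with b = 0, the element a is itself a root of r² = a.
      refine h (a : ZMod 2) ?_
      rw [hb0, zero_mul, add_zero]
      generalize (a : ZMod 2) = x
      revert x
      decide
    refine Nat.card_congr
      { toFun := fun z => ⟨z.1.re, ?_⟩
        invFun := fun x => ⟨algebraMap (ZMod p) _ x.1, by rw [← map_pow, x.2, map_one], by
          rw [starRingAut_apply]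
          ext <;> simp⟩
        left_inv := fun z => Subtype.ext (by
          ext
          · rfl
          · exact (him z.1 z.2.2).symm)
        right_inv := fun _ => rfl }
    have h1 : z.1 = algebraMap (ZMod p) _ z.1.re := by
      ext
      · rfl
      · exact him z.1 z.2.2
    have h2 := z.2.1
    rw [h1, ← map_pow] at h2
    exact congrArg QuadraticAlgebra.re h2
  refine ⟨hplus, ?_⟩
  have hcard : Nat.card (QuadMod p a b) = p * p := by
    rw [Nat.card_congr (equivProd _ _), Nat.card_prod, Nat.card_zmod]
  have hfin : Finite (QuadMod p a b) := Nat.finite_of_card_ne_zero (by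
    rw [hcard]; exact mul_ne_zero hp.ne_zero hp.ne_zero)
  have htot : Nat.card {z : QuadMod p a b // z ^ ℓ = 1} = if ℓ ∣ (p - 1) * (p + 1) then ℓ else 1 := by
    have h1 := card_units_subtype (R := QuadMod p a b) hℓ.ne_zero (fun _ => True) (fun _ => True)
      fun _ => Iff.rfl
    simp only [and_true] at h1
    rw [← h1, card_pow_eq_one_of_isCyclic hℓ, Nat.card_units, hcard]
    congr 2
    obtain ⟨q, rfl⟩ := Nat.exists_eq_succ_of_ne_zero hp.ne_zero
    simp only [Nat.succ_eq_add_one, Nat.add_sub_cancel]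
    exact Nat.sub_eq_of_eq_add (by ring)
  have hmul := card_pow_eq_torPlus_mul_torMinus (quadModConj p a b) (fun z => by
    simp only [starRingAut_apply, star_star]) hodd
  rw [htot, hplus] at hmul
  have hl := hℓ.pos
  by_cases h1 : ℓ ∣ p - 1
  · have h2 : ¬ ℓ ∣ p + 1 := by
      intro h2
      have h3 : ℓ ∣ 2 := by
        have h4 : p + 1 - (p - 1) = 2 := by have := hp.one_lt; omega
        rw [← h4]
        exact Nat.dvd_sub h2 h1
      have := (Nat.prime_dvd_prime_iff_eq hℓ Nat.prime_two).1 h3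
      subst this
      exact absurd hodd (by decide)
    rw [if_pos h1, if_pos (h1.mul_right _)] at hmul
    rw [if_neg h2]
    exact Nat.eq_of_mul_eq_mul_left hl (by rw [mul_one]; exact hmul.symm)
  · rw [if_neg h1, one_mul] at hmul
    rw [← hmul]
    simp [hℓ.dvd_mul, h1]

theorem dual_pow {R : Type*} [CommRing R] (x y : R) (n : ℕ) :
    (⟨x, y⟩ : QuadraticAlgebra R 0 0) ^ (n + 1) = ⟨x ^ (n + 1), (n + 1) * x ^ n * y⟩ := by
  induction n with
  | zero => simp
  | succ n ih =>
    rw [pow_succ, ih]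
    ext
    · simp [pow_succ]
    · simp
      ring

/-- A quadratic algebra with a double root is an algebra of dual numbers. -/
theorem exists_equiv_dual {R : Type*} [CommRing R] {a b r : R} (hb : 2 * r = b) (ha : r * r = -a) :
    ∃ e : QuadraticAlgebra R a b ≃+* QuadraticAlgebra R 0 0,
      ∀ z, e (quadConj a b z) = quadConj 0 0 (e z) := by
  refine ⟨{ toFun := fun z => ⟨z.re + z.im * r, z.im⟩
            invFun := fun z => ⟨z.re - z.im * r, z.im⟩
            left_inv := fun z => by ext <;> simp
            right_inv := fun z => by ext <;> simp
            map_add' := fun x y => by ext <;> simp <;> ring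
            map_mul' := fun x y => ?_ }, fun z => ?_⟩
  · ext
    · simp only [re_mul, im_mul]
      linear_combination (x.im * y.im) * ha - (x.im * y.im * r) * hb
    · simp only [im_mul]
      linear_combination (-(x.im * y.im)) * hb
  · simp only [starRingAut_apply]
    ext
    · change (star z).re + (star z).im * r = z.re + z.im * r + 0 * z.im
      rw [re_star, im_star]
      linear_combination (-z.im) * hb
    · rfl

/-- In the dual numbers x + yε the ℓ-th power is x ^ ℓ + ℓ x ^ (ℓ - 1) y ε and the norm is x². Hence
an ℓ-torsion element of norm one has x = 1, and y is arbitrary for p = ℓ and zero otherwise. -/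
theorem tor_ramified (hp : p.Prime) (hℓ : ℓ.Prime) (hodd : Odd ℓ) {a b : ℤ} {r : ZMod p}
    (hb : 2 * r = b) (ha : r * r = -(a : ZMod p)) :
    torPlus (quadModConj p a b) ℓ = (if ℓ ∣ p - 1 then ℓ else 1) ∧
      torMinus (quadModConj p a b) ℓ = if p = ℓ then ℓ else 1 := by
  have : Fact p.Prime := ⟨hp⟩
  obtain ⟨e, he⟩ := exists_equiv_dual hb ha
  rw [torPlus_congr e he, torMinus_congr e he]
  obtain ⟨k, rfl⟩ := Nat.exists_eq_succ_of_ne_zero hℓ.ne_zero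
  simp only [Nat.succ_eq_add_one] at hℓ hodd ⊢
  have hpow : ∀ z : QuadraticAlgebra (ZMod p) 0 0, z ^ (k + 1) = 1 ↔
      z.re ^ (k + 1) = 1 ∧ (p = k + 1 ∨ z.im = 0) := by
    intro z
    have hz : z = ⟨z.re, z.im⟩ := rfl
    rw [hz, dual_pow, QuadraticAlgebra.ext_iff]
    simp only [re_one, im_one]
    refine and_congr_right fun h => ?_
    have h1 : z.re ≠ 0 := by
      intro h0
      rw [h0, zero_pow (Nat.succ_ne_zero k)] at h
      exact zero_ne_one h
    rw [mul_eq_zero, mul_eq_zero, or_iff_left (pow_ne_zero k h1)]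
    refine or_congr_left ?_
    have h2 : ((k : ZMod p) + 1) = ((k + 1 : ℕ) : ZMod p) := by push_cast; rfl
    rw [h2, ZMod.natCast_eq_zero_iff]
    exact Nat.prime_dvd_prime_iff_eq hp hℓ
  constructor
  · rw [← card_zmod_pow_eq_one hp hℓ]
    have him : ∀ z : QuadraticAlgebra (ZMod p) 0 0, z ^ (k + 1) = 1 → quadConj 0 0 z = z →
        z.im = 0 := by
      intro z hz hz'
      rw [starRingAut_apply] at hz'
      have h1 : -z.im = z.im := by simpa using congrArg QuadraticAlgebra.im hz'
      rcases ((hpow z).1 hz).2 with h2 | h2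
      · by_contra h0
        have h3 : (2 : ZMod p) * z.im = 0 := by linear_combination -h1
        have h4 : ((2 : ℕ) : ZMod p) = 0 := by
          exact_mod_cast (mul_eq_zero.1 h3).resolve_right h0
        have h5 := (Nat.prime_dvd_prime_iff_eq hp Nat.prime_two).1 ((ZMod.natCast_eq_zero_iff 2 p).1 h4)
        rw [h5] at h2
        rw [← h2] at hodd
        exact absurd hodd (by decide)
      · exact h2
    exact Nat.card_congr
      { toFun := fun z => ⟨z.1.re, ((hpow z.1).1 z.2.1).1⟩
        invFun := fun x => ⟨⟨x.1, 0⟩, (hpow _).2 ⟨x.2, Or.inr rfl⟩, by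
          rw [starRingAut_apply]; ext <;> simp⟩
        left_inv := fun z => Subtype.ext (by
          ext
          · rfl
          · exact (him z.1 z.2.1 z.2.2).symm)
        right_inv := fun _ => rfl }
  · have hstar : ∀ z : QuadraticAlgebra (ZMod p) 0 0, z * quadConj 0 0 z = 1 ↔ z.re ^ 2 = 1 := by
      intro z
      rw [starRingAut_apply, QuadraticAlgebra.ext_iff]
      simp only [re_mul, re_star, zero_mul, add_zero, im_star, im_mul, re_one, im_one, pow_two]
      exact ⟨fun h => h.1, fun h => ⟨h, by ring⟩⟩
    have hre : ∀ z : QuadraticAlgebra (ZMod p) 0 0, z ^ (k + 1) = 1 ∧ z * quadConj 0 0 z = 1 ↔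
        z.re = 1 ∧ (p = k + 1 ∨ z.im = 0) := by
      intro z
      rw [hpow, hstar]
      constructor
      · rintro ⟨⟨h1, h2⟩, h3⟩
        exact ⟨eq_one_of_sq_of_pow hodd h3 h1, h2⟩
      · rintro ⟨h1, h2⟩
        rw [h1, one_pow, one_pow]
        exact ⟨⟨rfl, h2⟩, rfl⟩
    have hc := Nat.card_congr (Equiv.subtypeEquivRight hre)
    refine hc.trans ?_
    split_ifs with h
    · have e : {z : QuadraticAlgebra (ZMod p) 0 0 // z.re = 1 ∧ (p = k + 1 ∨ z.im = 0)} ≃ ZMod p :=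
        { toFun := fun z => z.1.im
          invFun := fun y => ⟨⟨1, y⟩, rfl, Or.inl h⟩
          left_inv := fun z => Subtype.ext (by ext; exacts [z.2.1.symm, rfl])
          right_inv := fun _ => rfl }
      rw [Nat.card_congr e, Nat.card_zmod, h]
    · refine Nat.card_eq_one_iff_unique.2 ⟨⟨?_⟩, ⟨⟨1, 0⟩, rfl, Or.inr rfl⟩⟩
      rintro ⟨z, hz1, hz2⟩ ⟨w, hw1, hw2⟩
      refine Subtype.ext ?_
      ext
      · rw [hz1, hw1]
      · rw [hz2.resolve_left h, hw2.resolve_left h]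

end PrimeField

open QuadraticAlgebra

/-! ### Torsion of order ℓ modulo powers of ℓ itself -/

section OwnPrime

variable {ℓ : ℕ}

theorem geom_sum_one_add {R : Type*} [CommRing R] (w : R) (n : ℕ) :
    ∑ i ∈ Finset.range n, (1 + w) ^ i = ∑ i ∈ Finset.range n, (n.choose (i + 1) : R) * w ^ i := by
  have h := congrArg (Polynomial.eval w) (Polynomial.geom_sum_X_comp_X_add_one_eq_sum (R := R) n)
  simpa [Polynomial.eval_comp, Polynomial.eval_finsetSum, add_comm] using h

/-- If `w` is nilpotent with `w² ∈ ℓ R`, then `1 + z + ⋯ + z ^ (ℓ - 1)` is a unit times `ℓ` for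
`z = 1 + w`, except possibly if `ℓ = 3`. -/
theorem exists_unit_geom_sum {R : Type*} [CommRing R] (hℓ : ℓ.Prime) (hodd : ℓ ≠ 2) {w e : R}
    (hw : IsNilpotent w) (he : w ^ 2 = ℓ * e) (h3 : ℓ = 3 → IsUnit (1 + e)) :
    ∃ u : R, IsUnit u ∧ ∑ i ∈ Finset.range ℓ, (1 + w) ^ i = ℓ * u := by
  rw [geom_sum_one_add]
  have h2 := hℓ.two_le
  rcases Nat.lt_or_ge 3 ℓ with hlt | hle
  · have hodd' := hℓ.odd_of_ne_two hodd
    have h5 : 5 ≤ ℓ := by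
      rcases hodd' with ⟨k, hk⟩
      omega
    obtain ⟨j, hj⟩ : ∃ j, ℓ = j + 5 := ⟨ℓ - 5, by omega⟩
    have hmid : ∀ i ∈ Finset.range (j + 3), ∃ c : R,
        (ℓ.choose (i + 1 + 1) : R) * w ^ (i + 1) = ℓ * w * c := by
      intro i hi
      rw [Finset.mem_range] at hi
      obtain ⟨c, hc⟩ := hℓ.dvd_choose_self (k := i + 1 + 1) (by omega) (by omega)
      exact ⟨c * w ^ i, by rw [hc]; push_cast; ring⟩
    obtain ⟨C, hC⟩ : ∃ C : R, ∑ i ∈ Finset.range (j + 3),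
        (ℓ.choose (i + 1 + 1) : R) * w ^ (i + 1) = ℓ * w * C := by
      have : (ℓ * w : R) ∣ ∑ i ∈ Finset.range (j + 3),
          (ℓ.choose (i + 1 + 1) : R) * w ^ (i + 1) := Finset.dvd_sum fun i hi => hmid i hi
      exact this
    refine ⟨1 + w * (C + e * w * w ^ j), ((Commute.all _ _).isNilpotent_mul_right hw).isUnit_one_add, ?_⟩
    have hsplit : ∑ i ∈ Finset.range ℓ, (ℓ.choose (i + 1) : R) * w ^ i =
        ∑ i ∈ Finset.range (j + 3), (ℓ.choose (i + 1 + 1) : R) * w ^ (i + 1) + w ^ (j + 4) + ℓ := by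
      conv_lhs => rw [show Finset.range ℓ = Finset.range (j + 3 + 1 + 1) by rw [hj]]
      rw [Finset.sum_range_succ', Finset.sum_range_succ]
      have h6 : ℓ.choose (j + 3 + 1 + 1) = 1 := by rw [hj]; exact Nat.choose_self _
      rw [h6]
      simp
    rw [hsplit, hC]
    -- Since ℓ - 1 = j + 4 > 2, replacing one factor w² by ℓ e leaves further factors w, so the last
    -- term also contributes only a nilpotent. For ℓ = 3 no such factor is left, and e itself enters
    -- the unit.
    have h7 : w ^ (j + 4) = ℓ * e * w ^ 2 * w ^ j := by rw [← he]; ring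
    rw [h7]
    ring
  · have h3' : ℓ = 3 := by omega
    subst h3'
    refine ⟨1 + e + w, ?_, ?_⟩
    · exact hw.isUnit_add_left_of_commute (h3 rfl) (Commute.all _ _)
    · simp only [Finset.sum_range_succ, Finset.sum_range_zero]
      have c1 : Nat.choose 3 1 = 3 := rfl
      have c2 : Nat.choose 3 2 = 3 := rfl
      have c3 : Nat.choose 3 3 = 1 := rfl
      norm_num [c1, c2, c3]
      push_cast at he
      linear_combination he

/-- The difference (1 + w) ^ ℓ - 1 is w times the geometric sum, that is, ℓ w times a unit. -/
theorem pow_eq_one_iff_mul_eq_zero {R : Type*} [CommRing R] (hℓ : ℓ.Prime) (hodd : ℓ ≠ 2) {w e : R}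
    (hw : IsNilpotent w) (he : w ^ 2 = ℓ * e) (h3 : ℓ = 3 → IsUnit (1 + e)) :
    (1 + w) ^ ℓ = 1 ↔ (ℓ : R) * w = 0 := by
  obtain ⟨u, hu, hs⟩ := exists_unit_geom_sum hℓ hodd hw he h3
  have h := geom_sum_mul (1 + w) ℓ
  rw [hs, add_sub_cancel_left] at h
  rw [← sub_eq_zero, ← h]
  constructor
  · intro h1
    have : u * ((ℓ : R) * w) = 0 := by rw [← h1]; ring
    exact (hu.mul_right_eq_zero).1 this
  · intro h1
    calc (ℓ : R) * u * w = u * ((ℓ : R) * w) := by ring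
      _ = 0 := by rw [h1, mul_zero]

theorem pow_eq_one_of_dvd {R : Type*} [CommRing R] (hℓ : ℓ.Prime) (hodd : ℓ ≠ 2)
    (hn : IsNilpotent (ℓ : R)) {w : R} (hd : (ℓ : R) ∣ w) :
    (1 + w) ^ ℓ = 1 ↔ (ℓ : R) * w = 0 := by
  obtain ⟨s, rfl⟩ := hd
  refine pow_eq_one_iff_mul_eq_zero hℓ hodd ((Commute.all _ _).isNilpotent_mul_right hn)
    (e := ℓ * s ^ 2) (by ring) fun _ => ?_
  exact ((Commute.all _ _).isNilpotent_mul_right hn).isUnit_one_add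

theorem card_mul_eq_zero (hℓ : ℓ.Prime) {k : ℕ} (hk : k ≠ 0) :
    Nat.card {x : ZMod (ℓ ^ k) // (ℓ : ZMod (ℓ ^ k)) * x = 0} = ℓ := by
  have : NeZero (ℓ ^ k) := ⟨pow_ne_zero k hℓ.ne_zero⟩
  have h := IsAddCyclic.card_nsmulAddMonoidHom_ker (G := ZMod (ℓ ^ k)) ℓ
  rw [Nat.card_zmod, Nat.gcd_eq_right (dvd_pow_self ℓ hk)] at h
  refine Eq.trans (Nat.card_congr (Equiv.subtypeEquivRight fun x => ?_)) h
  rw [AddMonoidHom.mem_ker, nsmulAddMonoidHom_apply, nsmul_eq_mul]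

variable {k : ℕ}

theorem zmod_dvd_iff (hℓ : ℓ.Prime) (hk : k ≠ 0) (x : ZMod (ℓ ^ k)) :
    (ℓ : ZMod (ℓ ^ k)) ∣ x ↔ ZMod.castHom (dvd_pow_self ℓ hk) (ZMod ℓ) x = 0 := by
  have : NeZero (ℓ ^ k) := ⟨pow_ne_zero k hℓ.ne_zero⟩
  constructor
  · rintro ⟨c, rfl⟩
    rw [map_mul, map_natCast, ZMod.natCast_self, zero_mul]
  · intro h
    obtain ⟨n, rfl⟩ := ZMod.natCast_zmod_surjective x
    rw [map_natCast, ZMod.natCast_eq_zero_iff] at h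
    obtain ⟨c, rfl⟩ := h
    exact ⟨c, by push_cast; rfl⟩

/-- From ℓ x = 0 one gets ℓ ^ (k - 1) ∣ x, and k - 1 ≥ 1. The case k = 1 behaves differently, which
is why ℓ ∣ m and ℓ² ∣ m are separate cases of the theorem. -/
theorem zmod_dvd_of_mul_eq_zero (hℓ : ℓ.Prime) (hk : 2 ≤ k) {x : ZMod (ℓ ^ k)}
    (h : (ℓ : ZMod (ℓ ^ k)) * x = 0) : (ℓ : ZMod (ℓ ^ k)) ∣ x := by
  have : NeZero (ℓ ^ k) := ⟨pow_ne_zero k hℓ.ne_zero⟩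
  obtain ⟨n, rfl⟩ := ZMod.natCast_zmod_surjective x
  rw [← Nat.cast_mul, ZMod.natCast_eq_zero_iff] at h
  obtain ⟨j, rfl⟩ := Nat.exists_eq_add_of_le hk
  have h1 : ℓ ∣ n := by
    refine Nat.dvd_of_mul_dvd_mul_left hℓ.pos (dvd_trans ?_ h)
    rw [← pow_two]
    exact pow_dvd_pow ℓ (Nat.le_add_right 2 j)
  obtain ⟨c, rfl⟩ := h1
  exact ⟨c, by push_cast; rfl⟩

theorem zmod_isUnit_iff (hℓ : ℓ.Prime) (hk : k ≠ 0) (x : ZMod (ℓ ^ k)) :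
    IsUnit x ↔ ¬ (ℓ : ZMod (ℓ ^ k)) ∣ x := by
  have : NeZero (ℓ ^ k) := ⟨pow_ne_zero k hℓ.ne_zero⟩
  have : Fact ℓ.Prime := ⟨hℓ⟩
  rw [zmod_dvd_iff hℓ hk]
  obtain ⟨n, rfl⟩ := ZMod.natCast_zmod_surjective x
  rw [map_natCast, ZMod.natCast_eq_zero_iff, ZMod.isUnit_iff_coprime,
    Nat.coprime_pow_right_iff (Nat.pos_of_ne_zero hk), Nat.coprime_comm,
    Nat.Prime.coprime_iff_not_dvd hℓ]

theorem zmod_isUnit_two (hodd : ℓ ≠ 2) (hℓ : ℓ.Prime) : IsUnit (2 : ZMod (ℓ ^ k)) := by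
  have h : IsUnit ((2 : ℕ) : ZMod (ℓ ^ k)) := by
    rw [ZMod.isUnit_iff_coprime]
    exact Nat.Coprime.pow_right k ((Nat.coprime_primes Nat.prime_two hℓ).2 hodd.symm)
  exact_mod_cast h

variable (a b : ℤ)

theorem quadMod_natCast_mul_eq_zero {n c : ℕ} (z : QuadMod n a b) :
    (c : QuadMod n a b) * z = 0 ↔ (c : ZMod n) * z.re = 0 ∧ (c : ZMod n) * z.im = 0 := by
  rw [QuadraticAlgebra.ext_iff]
  simp

theorem quadMod_natCast_dvd {n c : ℕ} (z : QuadMod n a b) :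
    (c : QuadMod n a b) ∣ z ↔ (c : ZMod n) ∣ z.re ∧ (c : ZMod n) ∣ z.im := by
  constructor
  · rintro ⟨s, rfl⟩
    exact ⟨⟨s.re, by simp⟩, ⟨s.im, by simp⟩⟩
  · rintro ⟨⟨x, hx⟩, ⟨y, hy⟩⟩
    exact ⟨⟨x, y⟩, by ext <;> simp [hx, hy]⟩

theorem quadMod_isNilpotent (ℓ k : ℕ) : IsNilpotent (ℓ : QuadMod (ℓ ^ k) a b) := by
  refine ⟨k, ?_⟩
  have : ((ℓ ^ k : ℕ) : QuadMod (ℓ ^ k) a b) = 0 := by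
    ext
    · rw [re_natCast, ZMod.natCast_self]; rfl
    · rw [im_natCast]; rfl
  exact_mod_cast this

/-- The elements `t` with `ℓ t = 0` and trace zero. -/
theorem card_ker_trace (hℓ : ℓ.Prime) (hodd : ℓ ≠ 2) (hk : 2 ≤ k) :
    Nat.card {t : QuadMod (ℓ ^ k) a b // (ℓ : QuadMod (ℓ ^ k) a b) * t = 0 ∧
      t + quadModConj (ℓ ^ k) a b t = 0} = ℓ := by
  refine Eq.trans ?_ (card_mul_eq_zero hℓ (show k ≠ 0 by omega))
  -- With h the inverse of 2, trace zero means re = -h · b · im, so im is a free parameter among the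
  -- elements killed by ℓ.
  obtain ⟨h, hh⟩ := (zmod_isUnit_two (k := k) hodd hℓ).exists_left_inv
  have htr : ∀ t : QuadMod (ℓ ^ k) a b, t + quadModConj (ℓ ^ k) a b t = 0 ↔
      2 * t.re + b * t.im = 0 := by
    intro t
    rw [starRingAut_apply, QuadraticAlgebra.ext_iff]
    simp only [re_add, re_star, im_add, im_star, re_zero, im_zero, add_neg_cancel, and_true]
    rw [← add_assoc, ← two_mul]
  refine Nat.card_congr
    { toFun := fun t => ⟨t.1.im, ((quadMod_natCast_mul_eq_zero a b _).1 t.2.1).2⟩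
      invFun := fun y => ⟨⟨-h * b * y.1, y.1⟩, (quadMod_natCast_mul_eq_zero a b _).2
        ⟨by linear_combination (-h * (b : ZMod (ℓ ^ k))) * y.2, y.2⟩, (htr _).2 (by
          simp only
          linear_combination (-(b : ZMod (ℓ ^ k)) * y.1) * hh)⟩
      left_inv := fun t => Subtype.ext (by
        have h1 := (htr t.1).1 t.2.2
        ext
        · change -h * (b : ZMod (ℓ ^ k)) * t.1.im = t.1.re
          linear_combination t.1.re * hh - h * h1
        · rfl)
      right_inv := fun _ => rfl }

/-- An element t killed by ℓ is divisible by ℓ because k ≥ 2, so t times its conjugate vanishes. For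
1 + t the norm-one condition thus becomes the linear condition of trace zero. -/
theorem one_add_mul_conj (hℓ : ℓ.Prime) (hk : 2 ≤ k) {t : QuadMod (ℓ ^ k) a b}
    (ht : (ℓ : QuadMod (ℓ ^ k) a b) * t = 0) :
    (ℓ : QuadMod (ℓ ^ k) a b) ∣ t ∧
    (1 + t) * quadModConj (ℓ ^ k) a b (1 + t) = 1 + (t + quadModConj (ℓ ^ k) a b t) := by
  have hd : (ℓ : QuadMod (ℓ ^ k) a b) ∣ t := by
    rw [quadMod_natCast_dvd]
    have := (quadMod_natCast_mul_eq_zero a b t).1 ht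
    exact ⟨zmod_dvd_of_mul_eq_zero hℓ hk this.1, zmod_dvd_of_mul_eq_zero hℓ hk this.2⟩
  refine ⟨hd, ?_⟩
  obtain ⟨s, hs⟩ := hd
  rw [map_add, map_one]
  have h1 : t * quadModConj (ℓ ^ k) a b t = 0 := by
    conv_lhs => rw [hs, map_mul, map_natCast]
    have : (ℓ : QuadMod (ℓ ^ k) a b) * (ℓ * s) = 0 := by rw [← hs, ht]
    calc (ℓ : QuadMod (ℓ ^ k) a b) * s * (ℓ * quadModConj (ℓ ^ k) a b s) =
        (ℓ * (ℓ * s)) * quadModConj (ℓ ^ k) a b s := by ring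
      _ = 0 := by rw [this, zero_mul]
  linear_combination h1

end OwnPrime

open QuadraticAlgebra

section OwnPrime

variable {ℓ k : ℕ} (a b : ℤ)

theorem quadModConj_eq_iff (hℓ : ℓ.Prime) (hodd : ℓ ≠ 2) (z : QuadMod (ℓ ^ k) a b) :
    quadModConj (ℓ ^ k) a b z = z ↔ z.im = 0 := by
  rw [starRingAut_apply, QuadraticAlgebra.ext_iff, re_star, im_star]
  constructor
  · rintro ⟨-, h⟩
    have h2 : 2 * z.im = 0 := by linear_combination -h
    exact ((zmod_isUnit_two hodd hℓ).mul_right_eq_zero).1 h2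
  · intro h
    rw [h, mul_zero, neg_zero, add_zero]
    exact ⟨rfl, rfl⟩

/-- As 2 is invertible, the fixed ring is ℤ / ℓ ^ k, whose unit group is cyclic of order ℓ ^ (k - 1)
(ℓ - 1), divisible by ℓ since k ≥ 2. -/
theorem torPlus_own (hℓ : ℓ.Prime) (hodd : ℓ ≠ 2) (hk : 2 ≤ k) :
    torPlus (quadModConj (ℓ ^ k) a b) ℓ = ℓ := by
  have : NeZero (ℓ ^ k) := ⟨pow_ne_zero k hℓ.ne_zero⟩
  have hcyc := ZMod.isCyclic_units_of_prime_pow ℓ hℓ hodd k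
  have h1 := card_units_subtype (R := ZMod (ℓ ^ k)) hℓ.ne_zero (fun _ => True) (fun _ => True)
    fun _ => Iff.rfl
  simp only [and_true] at h1
  have hdvd : ℓ ∣ Nat.card (ZMod (ℓ ^ k))ˣ := by
    rw [Nat.card_eq_fintype_card, ZMod.card_units_eq_totient,
      Nat.totient_prime_pow hℓ (by omega : 0 < k)]
    exact (dvd_pow_self ℓ (by omega)).mul_right _
  have h2 : Nat.card {x : ZMod (ℓ ^ k) // x ^ ℓ = 1} = ℓ := by
    rw [← h1, card_pow_eq_one_of_isCyclic hℓ, if_pos hdvd]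
  refine Eq.trans (Nat.card_congr ?_) h2
  have him := fun z => (quadModConj_eq_iff (k := k) a b hℓ hodd z).1
  refine
    { toFun := fun z => ⟨z.1.re, ?_⟩
      invFun := fun x => ⟨algebraMap _ _ x.1, by rw [← map_pow, x.2, map_one],
        (quadModConj_eq_iff a b hℓ hodd _).2 rfl⟩
      left_inv := fun z => Subtype.ext (by
        ext
        · rfl
        · exact (him z.1 z.2.2).symm)
      right_inv := fun _ => rfl }
  have h3 : z.1 = algebraMap (ZMod (ℓ ^ k)) _ z.1.re := by
    ext
    · rfl
    · exact him z.1 z.2.2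
  have h4 := z.2.1
  rw [h3, ← map_pow] at h4
  exact congrArg QuadraticAlgebra.re h4

/-- If `z ^ ℓ = 1` then `z - 1` has trace and norm divisible by `ℓ`. -/
theorem dvd_trace_norm (hℓ : ℓ.Prime) (hk : k ≠ 0) {w : QuadMod (ℓ ^ k) a b}
    (hw : (1 + w) ^ ℓ = 1) : (ℓ : ZMod (ℓ ^ k)) ∣ trace w ∧ (ℓ : ZMod (ℓ ^ k)) ∣ norm w := by
  have : Fact ℓ.Prime := ⟨hℓ⟩
  let f : QuadMod (ℓ ^ k) a b →+* QuadMod ℓ a b :=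
    quadMap (ZMod.castHom (dvd_pow_self ℓ hk) (ZMod ℓ)) (map_intCast _ _) (map_intCast _ _)
  have htr : trace (f w) = ZMod.castHom (dvd_pow_self ℓ hk) (ZMod ℓ) (trace w) := by
    rw [trace_def, trace_def, map_add, map_mul, map_mul, map_intCast, map_ofNat]
    rfl
  have hnm : norm (f w) = ZMod.castHom (dvd_pow_self ℓ hk) (ZMod ℓ) (norm w) := by
    rw [norm_def, norm_def, map_sub, map_add, map_mul, map_mul, map_mul, map_mul, map_mul,
      map_intCast, map_intCast]
    rfl
  have hch : CharP (QuadMod ℓ a b) ℓ := charP_of_injective_algebraMap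
    (algebraMap_injective (R := ZMod ℓ) (a := (a : ZMod ℓ)) (b := (b : ZMod ℓ))) ℓ
  -- In characteristic ℓ, (1 + w) ^ ℓ = 1 + w ^ ℓ, so the reduction of w is nilpotent. Its norm is
  -- then zero, w² = tr(w) · w, and nilpotency forces the trace to vanish too.
  have hpow : (f w) ^ ℓ = 0 := by
    have h1 : (1 + f w) ^ ℓ = 1 := by rw [← map_one f, ← map_add, ← map_pow, hw]
    rw [add_pow_char, one_pow] at h1
    exact add_eq_left.1 h1
  have hnorm : norm (f w) = 0 := by
    have h2 : norm (f w) ^ ℓ = 0 := by rw [← map_pow, hpow, QuadraticAlgebra.norm_zero]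
    exact pow_eq_zero_iff hℓ.ne_zero |>.1 h2
  have htrace : trace (f w) = 0 := by
    have hsq : f w * f w = trace (f w) • f w := by
      have := sq_eq_trace_smul_sub_norm (z := f w)
      rw [hnorm, map_zero, sub_zero, pow_two] at this
      exact this
    have hpw : ∀ n : ℕ, (f w) ^ (n + 1) = trace (f w) ^ n • f w := by
      intro n
      induction n with
      | zero => simp
      | succ n ih => rw [pow_succ, ih, smul_mul_assoc, hsq, smul_smul, pow_succ]
    obtain ⟨n, hn⟩ := Nat.exists_eq_succ_of_ne_zero hℓ.ne_zero
    have h3 := hpw n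
    rw [← Nat.succ_eq_add_one, ← hn, hpow] at h3
    by_contra h0
    have h4 : f w = 0 := by
      rcases smul_eq_zero.1 h3.symm with h5 | h5
      · exact absurd (eq_zero_of_pow_eq_zero h5) h0
      · exact h5
    rw [h4, map_zero] at h0
    exact h0 rfl
  rw [zmod_dvd_iff hℓ hk, zmod_dvd_iff hℓ hk, ← htr, ← hnm]
  exact ⟨htrace, hnorm⟩

theorem four_mul_norm {R : Type*} [CommRing R] {a b : R} (z : QuadraticAlgebra R a b) :
    4 * norm z = trace z ^ 2 - (b ^ 2 + 4 * a) * z.im ^ 2 := by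
  rw [norm_def, trace_def]
  ring

/-- For an element 1 + w of order dividing ℓ, the trace and norm of w are ℓ t and ℓ n, so w² = ℓ e
with e = t w - n, and `pow_eq_one_iff_mul_eq_zero` applies if 1 + e is a unit or ℓ > 3. For ℓ = 3
this fails only if n ≡ 1 mod 3, which forces the discriminant to be 6 modulo 9: the completion is
then ℚ_3(√-3), where further cube roots of unity do exist. -/
theorem mul_sub_one_eq_zero (hℓ : ℓ.Prime) (hodd : ℓ ≠ 2) (hk : 2 ≤ k)
    (hgen : ¬ (ℓ = 3 ∧ ((b ^ 2 + 4 * a : ℤ) : ZMod 9) = 6)) {w : QuadMod (ℓ ^ k) a b}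
    (hw : (1 + w) ^ ℓ = 1) : (ℓ : QuadMod (ℓ ^ k) a b) * w = 0 := by
  have hk0 : k ≠ 0 := by omega
  obtain ⟨⟨t, ht⟩, ⟨n, hn⟩⟩ := dvd_trace_norm a b hℓ hk0 hw
  let e : QuadMod (ℓ ^ k) a b := algebraMap _ _ t * w - algebraMap _ _ n
  have he : w ^ 2 = ℓ * e := by
    rw [sq_eq_trace_smul_sub_norm, ht, hn, Algebra.smul_def, map_mul, map_mul, map_natCast]
    ring
  have hnil : IsNilpotent w := by
    obtain ⟨N, hN⟩ := quadMod_isNilpotent a b ℓ k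
    exact ⟨2 * N, by rw [pow_mul, he, mul_pow, hN, zero_mul]⟩
  refine (pow_eq_one_iff_mul_eq_zero hℓ hodd hnil he fun h3 => ?_).1 hw
  have hu : IsUnit (1 - n) := by
    rw [zmod_isUnit_iff hℓ hk0]
    rintro ⟨c, hc⟩
    refine hgen ⟨h3, ?_⟩
    subst h3
    have h9 : 9 ∣ 3 ^ k := pow_dvd_pow 3 hk
    -- With trace 3t and norm 3n, n ≡ 1 mod 3, this reads disc · im² ≡ -12 ≡ 6 mod 9. The squares of
    -- units modulo 9 are 1, 4, 7, which all fix 6, so disc ≡ 6.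
    have h4 := four_mul_norm w
    have hn' : n = 1 - 3 * c := by push_cast at hc; linear_combination -hc
    rw [ht, hn, hn'] at h4
    have h5 := congrArg (ZMod.castHom h9 (ZMod 9)) h4
    simp only [map_mul, map_sub, map_pow, map_add, map_natCast, map_intCast, map_ofNat,
      map_one] at h5
    push_cast at h5 ⊢
    generalize (ZMod.castHom h9 (ZMod 9)) w.im = y at h5
    generalize (ZMod.castHom h9 (ZMod 9)) c = c' at h5
    generalize (ZMod.castHom h9 (ZMod 9)) t = t' at h5
    have h90 : (9 : ZMod 9) = 0 := by decide
    have h6 : ((b : ZMod 9) ^ 2 + 4 * (a : ZMod 9)) * y ^ 2 = 6 := by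
      linear_combination h5 + (t' ^ 2 + 4 * c' - 2) * h90
    clear h5
    revert h6
    generalize (b : ZMod 9) ^ 2 + 4 * (a : ZMod 9) = d
    revert y d
    decide
  have h7 : (1 : QuadMod (ℓ ^ k) a b) + e = algebraMap _ _ (1 - n) + algebraMap _ _ t * w := by
    rw [map_sub, map_one]
    ring
  rw [h7]
  exact ((Commute.all _ _).isNilpotent_mul_left hnil).isUnit_add_left_of_commute
    (hu.map (algebraMap _ _)) (Commute.all _ _)

theorem torMinus_own (hℓ : ℓ.Prime) (hodd : ℓ ≠ 2) (hk : 2 ≤ k)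
    (hgen : ¬ (ℓ = 3 ∧ ((b ^ 2 + 4 * a : ℤ) : ZMod 9) = 6)) :
    torMinus (quadModConj (ℓ ^ k) a b) ℓ = ℓ := by
  refine Eq.trans ?_ (card_ker_trace a b hℓ hodd hk)
  refine Nat.card_congr ((Equiv.addLeft (-1 : QuadMod (ℓ ^ k) a b)).subtypeEquiv fun z => ?_)
  change _ ↔ (ℓ : QuadMod (ℓ ^ k) a b) * (-1 + z) = 0 ∧
    (-1 + z) + quadModConj (ℓ ^ k) a b (-1 + z) = 0
  generalize ht : -1 + z = t
  obtain rfl : z = 1 + t := by rw [← ht]; ring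
  constructor
  · rintro ⟨h1, h2⟩
    have h3 := mul_sub_one_eq_zero a b hℓ hodd hk hgen h1
    rw [(one_add_mul_conj a b hℓ hk h3).2, add_eq_left] at h2
    exact ⟨h3, h2⟩
  · rintro ⟨h1, h2⟩
    obtain ⟨h3, h4⟩ := one_add_mul_conj a b hℓ hk h1
    rw [h4, h2, add_zero]
    exact ⟨(pow_eq_one_of_dvd hℓ hodd (quadMod_isNilpotent a b ℓ k) h3).2 h1, rfl⟩

/-- The class of `im z` modulo three. -/
def imMod (hk : k ≠ 0) (z : QuadMod (3 ^ k) a b) : ZMod 3 :=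
  ZMod.castHom (dvd_pow_self 3 hk) (ZMod 3) z.im

theorem re_castHom (hk : k ≠ 0) {z : QuadMod (3 ^ k) a b} (hz : z ^ 3 = 1) :
    ZMod.castHom (dvd_pow_self 3 hk) (ZMod 3) z.re =
      1 + b * ZMod.castHom (dvd_pow_self 3 hk) (ZMod 3) z.im := by
  have h1 := (dvd_trace_norm a b Nat.prime_three hk (w := z - 1) (by rwa [add_sub_cancel])).1
  rw [zmod_dvd_iff Nat.prime_three hk, trace_def, re_sub, im_sub, re_one, im_one, sub_zero,
    map_add, map_mul, map_mul, map_sub, map_one, map_intCast, map_ofNat] at h1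
  have h3 : (3 : ZMod 3) = 0 := by decide
  linear_combination -h1 + (ZMod.castHom (dvd_pow_self 3 hk) (ZMod 3) z.re - 1) * h3

/-- On cube roots of one, re ≡ 1 + b · im modulo 3, so the mixed terms of the product add up to a
multiple of 3. The resulting homomorphism to ℤ / 3 separates the powers of ζ in
`torMinus_own_three`. -/
theorem imMod_mul (hk : k ≠ 0) {z z' : QuadMod (3 ^ k) a b} (hz : z ^ 3 = 1) (hz' : z' ^ 3 = 1) :
    imMod a b hk (z * z') = imMod a b hk z + imMod a b hk z' := by
  unfold imMod
  rw [im_mul, map_add, map_add, map_mul, map_mul, map_mul, map_mul, map_intCast,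
    re_castHom a b hk hz, re_castHom a b hk hz']
  have h3 : (3 : ZMod 3) = 0 := by decide
  linear_combination ((b : ZMod 3) * ZMod.castHom (dvd_pow_self 3 hk) (ZMod 3) z.im *
    ZMod.castHom (dvd_pow_self 3 hk) (ZMod 3) z'.im) * h3

/-- The discriminant is -3u with u ≡ 1 mod 3, and u is a square modulo 3 ^ k; so √-3 is available
and yields a primitive cube root of unity ζ of norm one. The group is the product of ⟨ζ⟩ with the
group of all 1 + t, 3t = 0, of norm one, which has order 3 and is the kernel of `imMod`. -/
theorem torMinus_own_three (hk : 2 ≤ k) (h6 : ((b ^ 2 + 4 * a : ℤ) : ZMod 9) = 6) :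
    torMinus (quadModConj (3 ^ k) a b) 3 = 9 := by
  have hk0 : k ≠ 0 := by omega
  have hp3 : Nat.Prime 3 := Nat.prime_three
  obtain ⟨h, hh⟩ := (zmod_isUnit_two (k := k) (by norm_num) hp3).exists_left_inv
  obtain ⟨s, hs⟩ : ∃ s : ZMod (3 ^ k), s ^ 2 * (b ^ 2 + 4 * a) = -3 := by
    obtain ⟨u, hu, hu1⟩ : ∃ u : ℤ, b ^ 2 + 4 * a = -3 * u ∧ (3 : ℤ) ∣ u - 1 := by
      have h7 : ((b ^ 2 + 4 * a - 6 : ℤ) : ZMod 9) = 0 := by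
        rw [Int.cast_sub, h6]
        decide
      obtain ⟨c, hc⟩ := (ZMod.intCast_zmod_eq_zero_iff_dvd _ 9).1 h7
      push_cast at hc
      exact ⟨-2 - 3 * c, by linarith, ⟨-1 - c, by ring⟩⟩
    have hu2 : (u : ZMod (3 ^ k)) ^ 3 ^ k = 1 := by
      have h8 : ((3 : ℕ) : ZMod (3 ^ k)) ∣ (u : ZMod (3 ^ k)) - 1 := by
        obtain ⟨c, hc⟩ := hu1
        exact ⟨c, by rw [← Int.cast_one, ← Int.cast_sub, hc]; push_cast; ring⟩
      obtain ⟨c, hc⟩ := dvd_sub_pow_of_dvd_sub h8 k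
      have h9 : (((3 : ℕ) : ZMod (3 ^ k))) ^ (k + 1) = 0 := by
        rw [pow_succ, ← Nat.cast_pow, ZMod.natCast_self, zero_mul]
      rw [one_pow, h9, zero_mul] at hc
      exact sub_eq_zero.1 hc
    -- As u ^ (2j + 1) = 1, the power u ^ j is a square root of u⁻¹.
    obtain ⟨j, hj⟩ : ∃ j, 3 ^ k = 2 * j + 1 := (show Odd 3 by decide).pow
    refine ⟨(u : ZMod (3 ^ k)) ^ j, ?_⟩
    have h10 : ((b : ZMod (3 ^ k)) ^ 2 + 4 * a) = -3 * u := by exact_mod_cast congrArg Int.cast hu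
    rw [h10, ← pow_mul, mul_comm j 2]
    have h11 : (u : ZMod (3 ^ k)) ^ (2 * j) * u = 1 := by rw [← pow_succ, ← hj, hu2]
    linear_combination -3 * h11
  have hs0 : ZMod.castHom (dvd_pow_self 3 hk0) (ZMod 3) s ≠ 0 := by
    intro h0
    obtain ⟨c, hc⟩ := (zmod_dvd_iff hp3 hk0 s).2 h0
    have h9 : 9 ∣ 3 ^ k := pow_dvd_pow 3 hk
    have h12 := congrArg (ZMod.castHom h9 (ZMod 9)) hs
    rw [hc] at h12
    simp only [map_mul, map_pow, map_add, map_natCast, map_intCast, map_ofNat, map_neg] at h12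
    generalize (ZMod.castHom h9 (ZMod 9)) c = c' at h12
    push_cast at h12
    generalize (b : ZMod 9) ^ 2 + 4 * (a : ZMod 9) = d at h12
    revert c' d
    decide
  -- This is ζ = (-1 + s√d) / 2 with √d = 2ω - b, where s²d = -3.
  obtain ⟨ζ, hre, him⟩ : ∃ ζ : QuadMod (3 ^ k) a b, ζ.re = (-1 - s * b) * h ∧ ζ.im = s :=
    ⟨⟨(-1 - s * b) * h, s⟩, rfl, rfl⟩
  have hζ : ζ ^ 2 + ζ + 1 = 0 := by
    rw [pow_two]
    ext
    · rw [re_add, re_add, re_mul, re_one, re_zero, hre, him]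
      linear_combination h ^ 2 * hs + (-(h + 1) + s * b * h - a * s ^ 2 * (2 * h + 1)) * hh
    · rw [im_add, im_add, im_mul, im_one, im_zero, hre, him]
      linear_combination (-s - s ^ 2 * b) * hh
  have hζ3 : ζ ^ 3 = 1 := by linear_combination (ζ - 1) * hζ
  have hζs : quadModConj (3 ^ k) a b ζ = -1 - ζ := by
    rw [starRingAut_apply]
    ext
    · rw [re_star, re_sub, re_neg, re_one, hre, him]
      linear_combination (-1 - s * b) * hh
    · rw [im_star, im_sub, im_neg, im_one]
      ring
  have hζn : ζ * quadModConj (3 ^ k) a b ζ = 1 := by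
    rw [hζs]
    linear_combination -hζ
  have hζpow : ∀ i : ℕ, (ζ ^ i) ^ 3 = 1 ∧ ζ ^ i * quadModConj (3 ^ k) a b (ζ ^ i) = 1 := by
    intro i
    rw [map_pow, ← mul_pow, hζn, one_pow, ← pow_mul, mul_comm, pow_mul, hζ3, one_pow]
    exact ⟨rfl, rfl⟩
  have hmul := fun z z' => imMod_mul a b hk0 (z := z) (z' := z')
  have hγ : imMod a b hk0 ζ ≠ 0 := by
    rw [imMod, him]
    exact hs0
  have himpow : ∀ i : ℕ, imMod a b hk0 (ζ ^ i) = i * imMod a b hk0 ζ := by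
    intro i
    induction i with
    | zero => simp [imMod]
    | succ i ih =>
      rw [pow_succ, hmul _ _ (hζpow i).1 hζ3, ih]
      push_cast
      ring
  have hT := card_ker_trace a b hp3 (by norm_num) hk
  have hGT : ∀ t : QuadMod (3 ^ k) a b, ((3 : ℕ) : QuadMod (3 ^ k) a b) * t = 0 ∧
      t + quadModConj (3 ^ k) a b t = 0 → (1 + t) ^ 3 = 1 ∧
      (1 + t) * quadModConj (3 ^ k) a b (1 + t) = 1 ∧ imMod a b hk0 (1 + t) = 0 := by
    rintro t ⟨h1, h2⟩
    obtain ⟨h3, h4⟩ := one_add_mul_conj a b hp3 hk h1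
    refine ⟨(pow_eq_one_of_dvd hp3 (by norm_num) (quadMod_isNilpotent a b 3 k) h3).2 h1,
      by rw [h4, h2, add_zero], ?_⟩
    rw [imMod, im_add, im_one, zero_add]
    exact (zmod_dvd_iff hp3 hk0 _).1 ((quadMod_natCast_dvd a b t).1 h3).2
  have h9 : 9 = Nat.card ({t : QuadMod (3 ^ k) a b // ((3 : ℕ) : QuadMod (3 ^ k) a b) * t = 0 ∧
      t + quadModConj (3 ^ k) a b t = 0} × Fin 3) := by
    rw [Nat.card_prod, hT, Nat.card_fin]
  rw [h9]
  symm
  have hval : ∀ (t : QuadMod (3 ^ k) a b) (i : ℕ), (((3 : ℕ) : QuadMod (3 ^ k) a b) * t = 0 ∧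
      t + quadModConj (3 ^ k) a b t = 0) →
      imMod a b hk0 ((1 + t) * ζ ^ i) = i * imMod a b hk0 ζ := by
    intro t i ht
    obtain ⟨h1, h2, h3⟩ := hGT t ht
    rw [hmul _ _ h1 (hζpow i).1, h3, zero_add, himpow]
  refine Nat.card_congr (Equiv.ofBijective (fun x => ⟨(1 + x.1.1) * ζ ^ (x.2 : ℕ), ?_, ?_⟩)
    ⟨?_, ?_⟩)
  · rw [mul_pow, (hGT _ x.1.2).1, (hζpow _).1, one_mul]
  · rw [map_mul, mul_mul_mul_comm, (hGT _ x.1.2).2.1, (hζpow _).2, one_mul]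
  · rintro ⟨⟨t, ht⟩, i⟩ ⟨⟨t', ht'⟩, i'⟩ hx
    have hx' : (1 + t) * ζ ^ (i : ℕ) = (1 + t') * ζ ^ (i' : ℕ) := congrArg Subtype.val hx
    have h1 := congrArg (imMod a b hk0) hx'
    rw [hval t _ ht, hval t' _ ht'] at h1
    have h2 : ((i : ℕ) : ZMod 3) = ((i' : ℕ) : ZMod 3) := mul_right_cancel₀ hγ h1
    have h3 : i = i' := by
      rw [ZMod.natCast_eq_natCast_iff, Nat.ModEq, Nat.mod_eq_of_lt i.2, Nat.mod_eq_of_lt i'.2] at h2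
      exact Fin.ext h2
    subst h3
    have h4 : 1 + t = 1 + t' := by
      have := congrArg (· * quadModConj (3 ^ k) a b (ζ ^ (i : ℕ))) hx'
      simpa only [mul_assoc, (hζpow _).2, mul_one] using this
    rw [Prod.mk.injEq]
    exact ⟨Subtype.ext (add_left_cancel h4), rfl⟩
  · rintro ⟨z, hz, hzn⟩
    -- c is the exponent for which ζ ^ c has the same class under `imMod` as z; multiplication by ζ
    -- ^ (2c), the inverse of ζ ^ c, moves z into the kernel.
    let c : ZMod 3 := imMod a b hk0 z * (imMod a b hk0 ζ)⁻¹
    have hc : ((c.val : ℕ) : ZMod 3) * imMod a b hk0 ζ = imMod a b hk0 z := by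
      rw [ZMod.natCast_zmod_val, mul_assoc, inv_mul_cancel₀ hγ, mul_one]
    have h30 : (3 : ZMod 3) = 0 := by decide
    have h1 : imMod a b hk0 (z * ζ ^ (2 * c.val)) = 0 := by
      rw [hmul _ _ hz (hζpow _).1, himpow, ← hc]
      push_cast
      linear_combination ((c.val : ZMod 3) * imMod a b hk0 ζ) * h30
    have h2 : (z * ζ ^ (2 * c.val)) ^ 3 = 1 := by rw [mul_pow, hz, (hζpow _).1, one_mul]
    have h3 : (z * ζ ^ (2 * c.val)) * quadModConj (3 ^ k) a b (z * ζ ^ (2 * c.val)) = 1 := by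
      rw [map_mul, mul_mul_mul_comm, hzn, (hζpow _).2, one_mul]
    obtain ⟨t, ht⟩ : ∃ t, z * ζ ^ (2 * c.val) = 1 + t := ⟨z * ζ ^ (2 * c.val) - 1, by ring⟩
    rw [ht] at h1 h2 h3
    have h4 : ((3 : ℕ) : QuadMod (3 ^ k) a b) ∣ t := by
      have h5 := re_castHom a b hk0 h2
      have h6 : ZMod.castHom (dvd_pow_self 3 hk0) (ZMod 3) (1 + t).im = 0 := h1
      rw [h6, mul_zero, add_zero, re_add, re_one, map_add, map_one, add_eq_left] at h5
      rw [im_add, im_one, zero_add] at h6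
      exact (quadMod_natCast_dvd a b t).2 ⟨(zmod_dvd_iff hp3 hk0 _).2 h5,
        (zmod_dvd_iff hp3 hk0 _).2 h6⟩
    have h5 := (pow_eq_one_of_dvd hp3 (by norm_num) (quadMod_isNilpotent a b 3 k) h4).1 h2
    rw [(one_add_mul_conj a b hp3 hk h5).2, add_eq_left] at h3
    refine ⟨⟨⟨t, h5, h3⟩, ⟨c.val, ZMod.val_lt c⟩⟩, Subtype.ext ?_⟩
    change (1 + t) * ζ ^ c.val = z
    rw [← ht, mul_assoc, ← pow_add, show 2 * c.val + c.val = 3 * c.val by ring, pow_mul, hζ3,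
      one_pow, mul_one]

end OwnPrime

/-! ### Local counts as functions of the discriminant -/

section LocalCounts

/-- The condition at two for `n` to be a fundamental discriminant. -/
def FundTwo (n : ℕ) : Prop :=
  n % 16 = 1 ∨ n % 16 = 5 ∨ n % 16 = 8 ∨ n % 16 = 9 ∨ n % 16 = 12 ∨ n % 16 = 13

instance : DecidablePred FundTwo := fun n => by unfold FundTwo; infer_instance

/-- The involution of `ℤ[ω] / n`, where `ℤ[ω]` is the quadratic order of discriminant `D`. -/
abbrev discConj (D n : ℕ) : QuadMod n (D / 4 : ℕ) (D % 4 : ℕ) ≃+* QuadMod n (D / 4 : ℕ) (D % 4 : ℕ) :=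
  quadModConj n _ _

open Classical in
/-- The number of elements of order dividing `ℓ` in the norm one part modulo `p` of the quadratic
order of discriminant `x`, for odd `p` different from `ℓ`. -/
def signMinus (p ℓ : ℕ) (x : ZMod p) : ℕ :=
  if x = 0 then 1
  else if IsSquare x then (if ℓ ∣ p - 1 then ℓ else 1)
  else if ℓ ∣ p + 1 then ℓ else 1

/-- The number of elements of order dividing `ℓ` in the norm one part modulo `p ^ k` of the
quadratic order of discriminant `n`. -/
def locMinus (p k ℓ n : ℕ) : ℕ :=
  if p = 2 then (if n % 8 = 5 ∧ ℓ = 3 then 3 else 1)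
  else if p = ℓ then
    (if k = 1 then (if (n : ZMod p) = 0 then ℓ else 1) else if ℓ = 3 ∧ n % 9 = 6 then 9 else ℓ)
  else signMinus p ℓ n

/-- The number of elements of order dividing `ℓ` in `(ℤ / p ^ k)ˣ`. -/
def locPlus (p k ℓ : ℕ) : ℕ :=
  if p = ℓ then (if k = 1 then 1 else ℓ) else if ℓ ∣ p - 1 then ℓ else 1

variable {p k ℓ D : ℕ}

/-- D mod 4 is 0 or 1, hence equal to its own square. So ω² = D / 4 + (D % 4) ω defines an order of
discriminant D. -/
theorem FundTwo.mod_four (h : FundTwo D) : (D % 4) ^ 2 + 4 * (D / 4) = D := by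
  have h1 : D % 4 = 0 ∨ D % 4 = 1 := by unfold FundTwo at h; omega
  rcases h1 with h1 | h1 <;> rw [h1] <;> omega

theorem FundTwo.cast_eq (h : FundTwo D) (R : Type*) [CommRing R] :
    (((D % 4 : ℕ) : ℤ) : R) ^ 2 + 4 * (((D / 4 : ℕ) : ℤ) : R) = D := by
  simp only [Int.cast_natCast]
  have := congrArg (Nat.cast : ℕ → R) h.mod_four
  simpa only [Nat.cast_add, Nat.cast_mul, Nat.cast_pow, Nat.cast_ofNat] using this

theorem not_dvd_pred_self (hℓ : ℓ.Prime) : ¬ ℓ ∣ ℓ - 1 := by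
  intro h
  have h2 := hℓ.two_le
  have := Nat.le_of_dvd (by omega) h
  omega

theorem not_dvd_succ_self (hℓ : ℓ.Prime) : ¬ ℓ ∣ ℓ + 1 := by
  intro h
  have h1 := (Nat.dvd_add_right (dvd_refl ℓ)).1 h
  exact hℓ.one_lt.ne' (Nat.dvd_one.1 h1)

theorem zmod_two_sq : ∀ r : ZMod 2, r ^ 2 = r := by decide

theorem zmod_two_double : ∀ r : ZMod 2, 2 * r = 0 := by decide

theorem zmod_two_neg : ∀ r : ZMod 2, -r = r := by decide

open Classical in
-- The roots of the defining polynomial are (b ± √D) / 2, so p is ramified, split or inert according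
-- to whether D is zero, a non-zero square or a non-square modulo p.
theorem tor_prime_odd (hp : p.Prime) (hp2 : p ≠ 2) (hℓ : ℓ.Prime) (hodd : ℓ ≠ 2) (a b : ℤ)
    (hdisc : (b : ZMod p) ^ 2 + 4 * a = D) :
    torPlus (quadModConj p a b) ℓ = (if ℓ ∣ p - 1 then ℓ else 1) ∧
      torMinus (quadModConj p a b) ℓ = locMinus p 1 ℓ D := by
  have : Fact p.Prime := ⟨hp⟩
  have hodd' := hℓ.odd_of_ne_two hodd
  have h2 : (2 : ZMod p) ≠ 0 := by
    intro h
    have h4 : ((2 : ℕ) : ZMod p) = 0 := by exact_mod_cast h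
    exact hp2 ((Nat.prime_dvd_prime_iff_eq hp Nat.prime_two).1 ((ZMod.natCast_eq_zero_iff 2 p).1 h4))
  have hval : locMinus p 1 ℓ D = if (D : ZMod p) = 0 then (if p = ℓ then ℓ else 1) else
      if IsSquare (D : ZMod p) then (if ℓ ∣ p - 1 then ℓ else 1) else
      if ℓ ∣ p + 1 then ℓ else 1 := by
    unfold locMinus signMinus
    rw [if_neg hp2]
    -- For p = ℓ neither p - 1 nor p + 1 is divisible by ℓ, so the split and inert values are both
    -- 1.
    by_cases h : p = ℓ
    · subst h
      simp [not_dvd_pred_self hp, not_dvd_succ_self hp]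
    · simp only [h, if_false]
      congr
  rw [hval]
  by_cases h0 : (D : ZMod p) = 0
  · rw [if_pos h0]
    rw [h0] at hdisc
    refine tor_ramified (r := (b : ZMod p) / 2) hp hℓ hodd' (by field_simp) ?_
    field_simp
    linear_combination hdisc
  · rw [if_neg h0]
    by_cases hs : IsSquare (D : ZMod p)
    · rw [if_pos hs]
      obtain ⟨t, ht⟩ := hs
      have ht0 : t ≠ 0 := by
        rintro rfl
        exact h0 (by rw [ht, mul_zero])
      refine tor_split (r := ((b : ZMod p) + t) / 2) (s := ((b : ZMod p) - t) / 2) hp hℓ ?_ ?_ ?_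
      · intro h
        field_simp at h
        have : 2 * t = 0 := by linear_combination h
        exact (mul_ne_zero h2 ht0) this
      · field_simp
        ring
      · field_simp
        linear_combination hdisc + ht
    · rw [if_neg hs]
      refine tor_inert hp hℓ hodd' fun r hr => hs ⟨2 * r - b, ?_⟩
      linear_combination (-4 : ZMod p) * hr - hdisc

theorem tor_prime (hp : p.Prime) (hℓ : ℓ.Prime) (hodd : ℓ ≠ 2) (hD : FundTwo D) :
    torPlus (discConj D p) ℓ = locPlus p 1 ℓ ∧ torMinus (discConj D p) ℓ = locMinus p 1 ℓ D := by
  have : Fact p.Prime := ⟨hp⟩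
  have hodd' := hℓ.odd_of_ne_two hodd
  have h3 : ℓ ∣ 3 ↔ ℓ = 3 := Nat.prime_dvd_prime_iff_eq hℓ Nat.prime_three
  have h1 : ¬ ℓ ∣ 1 := fun h => hℓ.one_lt.ne' (Nat.dvd_one.1 h)
  have hplus : (if ℓ ∣ p - 1 then ℓ else 1) = locPlus p 1 ℓ := by
    unfold locPlus
    by_cases h : p = ℓ
    · rw [if_pos h, if_pos rfl, h, if_neg (not_dvd_pred_self hℓ)]
    · rw [if_neg h]
  rw [← hplus]
  by_cases hp2 : p = 2
  · subst hp2
    have hp2ℓ : ¬ 2 = ℓ := fun h => hodd h.symm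
    have hcast : ∀ n : ℕ, n % 2 = 0 → (((n : ℕ) : ℤ) : ZMod 2) = 0 := fun n hn => by
      rw [Int.cast_natCast, ZMod.natCast_eq_zero_iff]
      omega
    have hcast1 : ∀ n : ℕ, n % 2 = 1 → (((n : ℕ) : ℤ) : ZMod 2) = 1 := fun n hn => by
      rw [Int.cast_natCast, ← Nat.cast_one, ZMod.natCast_eq_natCast_iff]
      exact hn
    -- At 2 these are the split, inert and ramified cases.
    have hcases : (D % 8 = 1) ∨ (D % 8 = 5) ∨ (D % 4 = 0) := by
      unfold FundTwo at hD
      omega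
    rcases hcases with h | h | h
    · have ha := hcast (D / 4) (by omega)
      have hb := hcast1 (D % 4) (by omega)
      have h4 := tor_split (r := (0 : ZMod 2)) (s := 1) Nat.prime_two hℓ (by simp)
        (by rw [hb, zero_add]) (by rw [ha]; simp)
      refine ⟨h4.1, h4.2.trans ?_⟩
      have h5 : ¬ (D % 8 = 5 ∧ ℓ = 3) := by omega
      simp [locMinus, h5, h1]
    · have ha := hcast1 (D / 4) (by omega)
      have hb := hcast1 (D % 4) (by omega)
      have h4 := tor_inert (p := 2) (a := (D / 4 : ℕ)) (b := (D % 4 : ℕ)) Nat.prime_two hℓ hodd'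
        (by rw [ha, hb]; simp)
      refine ⟨h4.1, h4.2.trans ?_⟩
      simp only [locMinus, if_true, h, true_and, h3]
      split_ifs with h6
      · exact h6
      · rfl
    · have hb := hcast (D % 4) (by omega)
      have h4 := tor_ramified (r := (((D / 4 : ℕ) : ℤ) : ZMod 2)) (b := (D % 4 : ℕ))
        (a := (D / 4 : ℕ)) Nat.prime_two hℓ hodd'
        (by rw [hb]; exact zmod_two_double _)
        (by rw [← pow_two, zmod_two_sq, zmod_two_neg])
      refine ⟨h4.1, h4.2.trans ?_⟩
      have h5 : ¬ (D % 8 = 5 ∧ ℓ = 3) := by omega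
      simp [locMinus, h5, hp2ℓ]
  · exact tor_prime_odd hp hp2 hℓ hodd _ _ (hD.cast_eq (ZMod p))

theorem tor_discConj (hp : p.Prime) (hk : k ≠ 0) (hℓ : ℓ.Prime) (hodd : ℓ ≠ 2) (hD : FundTwo D) :
    torPlus (discConj D (p ^ k)) ℓ = locPlus p k ℓ ∧
      torMinus (discConj D (p ^ k)) ℓ = locMinus p k ℓ D := by
  by_cases h : p = ℓ
  · subst h
    by_cases hk1 : k = 1
    · subst hk1
      have h1 := tor_prime hp hp hodd hD
      have h2 : p ^ 1 = p := pow_one p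
      rw [h2]
      exact h1
    · have hk2 : 2 ≤ k := by omega
      have h1 : locPlus p k p = p := by simp [locPlus, hk1]
      refine ⟨by rw [h1]; exact torPlus_own _ _ hp hodd hk2, ?_⟩
      have h9 : ∀ n : ℕ, ((n : ℕ) : ZMod 9) = 6 ↔ n % 9 = 6 := fun n => by
        have : (6 : ZMod 9) = ((6 : ℕ) : ZMod 9) := rfl
        rw [this, ZMod.natCast_eq_natCast_iff]
        rfl
      have hcast : ((((D % 4 : ℕ) : ℤ) ^ 2 + 4 * ((D / 4 : ℕ) : ℤ) : ℤ) : ZMod 9) = (D : ZMod 9) := by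
        rw [← hD.cast_eq (ZMod 9)]
        push_cast
        rfl
      by_cases h3 : p = 3 ∧ D % 9 = 6
      · obtain ⟨rfl, h6⟩ := h3
        have h4 : locMinus 3 k 3 D = 9 := by simp [locMinus, hk1, h6]
        rw [h4]
        exact torMinus_own_three _ _ hk2 (by rw [hcast, h9]; exact h6)
      · have h4 : locMinus p k p D = p := by simp [locMinus, hk1, h3, hodd]
        rw [h4]
        exact torMinus_own _ _ hp hodd hk2 (by rw [hcast, h9]; exact h3)
  · have h1 := tor_quadMod_primePow hp hk ((Nat.coprime_primes hp hℓ).2 h) (D / 4 : ℕ) (D % 4 : ℕ)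
    have h2 := tor_prime hp hℓ hodd hD
    have h3 : locPlus p k ℓ = locPlus p 1 ℓ := by simp [locPlus, h]
    have h4 : locMinus p k ℓ D = locMinus p 1 ℓ D := by simp [locMinus, h]
    rw [h3, h4]
    exact ⟨h1.1.trans h2.1, h1.2.trans h2.2⟩

/-- The modulus that determines the behaviour of the discriminant `n` at `p`. -/
def locMod (p : ℕ) : ℕ := if p = 2 then 16 else p ^ 2

/-- The condition at `p` for `n` to be a fundamental discriminant. -/
def FundAt (p n : ℕ) : Prop := if p = 2 then FundTwo n else ¬ p ^ 2 ∣ n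

theorem fundAt_mod (p n : ℕ) : FundAt p (n % locMod p) ↔ FundAt p n := by
  unfold FundAt locMod
  split_ifs with h
  · unfold FundTwo
    rw [Nat.mod_mod]
  · rw [Nat.dvd_mod_iff (dvd_refl _)]

/-- The modulus 16 determines D mod 8, the modulus p² determines D mod p, and for p = ℓ = 3 it is
exactly the modulus 9 needed to recognise ℚ_3(√-3). -/
theorem locMinus_mod (p k ℓ n : ℕ) :
    locMinus p k ℓ (n % locMod p) = locMinus p k ℓ n := by
  by_cases h2 : p = 2
  · have hm : locMod p = 16 := if_pos h2
    rw [hm]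
    unfold locMinus
    simp only [if_pos h2]
    rw [Nat.mod_mod_of_dvd n (by norm_num : 8 ∣ 16)]
  · have hm : locMod p = p ^ 2 := if_neg h2
    rw [hm]
    have hc : ((n % p ^ 2 : ℕ) : ZMod p) = n := by
      rw [ZMod.natCast_eq_natCast_iff]
      exact Nat.mod_mod_of_dvd n (dvd_pow_self p two_ne_zero)
    unfold locMinus
    by_cases h : p = ℓ
    · simp only [if_neg h2, hc, if_pos h]
      by_cases h3 : ℓ = 3
      · rw [h, h3]
        norm_num
      · simp only [h3, false_and]
    · simp only [if_neg h2, hc, if_neg h]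

end LocalCounts

/-! ### Means of the local counts over the admissible residues -/

section LocalMeans

variable {p ℓ : ℕ}

theorem sum_zmod_sq_cast [Fact p.Prime] (f : ZMod p → ℝ) :
    ∑ r : ZMod (p ^ 2), f (ZMod.castHom (dvd_pow_self p two_ne_zero) (ZMod p) r) =
      p * ∑ x, f x := by
  classical
  have hp0 : p ≠ 0 := (Fact.out : p.Prime).ne_zero
  have : NeZero (p ^ 2) := ⟨pow_ne_zero 2 hp0⟩
  set c := ZMod.castHom (dvd_pow_self p two_ne_zero) (ZMod p) with hc
  have hsurj : Function.Surjective c := ZMod.castHom_surjective _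
  have hcard : ∀ x y : ZMod p, (Finset.univ.filter fun r => c r = x).card =
      (Finset.univ.filter fun r => c r = y).card := fun x y =>
    AddMonoidHom.card_fiber_eq_of_mem_range c.toAddMonoidHom (hsurj x) (hsurj y)
  have htot : p ^ 2 = ∑ x : ZMod p, (Finset.univ.filter fun r => c r = x).card := by
    rw [← Finset.card_eq_sum_card_fiberwise (f := c) (s := Finset.univ) (t := Finset.univ)
      (fun _ _ => Finset.mem_coe.2 (Finset.mem_univ _)), Finset.card_univ, ZMod.card]
  have h0 : ∀ x : ZMod p, (Finset.univ.filter fun r => c r = x).card = p := fun x => by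
    rw [Finset.sum_congr rfl fun y _ => hcard y x, Finset.sum_const, Finset.card_univ, ZMod.card,
      smul_eq_mul] at htot
    exact Nat.eq_of_mul_eq_mul_left (Nat.pos_of_ne_zero hp0) (htot.symm.trans (pow_two p))
  rw [← Finset.sum_fiberwise (s := Finset.univ) (g := c), Finset.mul_sum]
  refine Finset.sum_congr rfl fun x _ => ?_
  rw [Finset.sum_congr rfl fun r hr => by rw [(Finset.mem_filter.1 hr).2], Finset.sum_const, h0,
    nsmul_eq_mul]

open Classical in
/-- The mean of `locMinus p k ℓ` over the fundamental discriminants, computed locally at `p`. -/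
def localMean (p k ℓ : ℕ) [NeZero (locMod p)] : ℝ :=
  (∑ r ∈ Finset.univ.filter (fun r : ZMod (locMod p) => FundAt p r.val),
    (locMinus p k ℓ r.val : ℝ)) /
      ((Finset.univ.filter fun r : ZMod (locMod p) => FundAt p r.val).card : ℝ)

instance [Fact p.Prime] : NeZero (locMod p) :=
  ⟨by unfold locMod; split_ifs; · norm_num
      · exact pow_ne_zero 2 (Fact.out : p.Prime).ne_zero⟩

/-- Replaces the modulus `locMod p` by an explicit number, so that the finite sums at 2 and 3 can be
decided. -/
theorem localMean_eq_of_filter [Fact p.Prime] {q : ℕ} [NeZero q] (hq : locMod p = q)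
    (P : ZMod q → Prop) [DecidablePred P] (hP : ∀ r : ZMod q, FundAt p r.val ↔ P r) (k : ℕ)
    (w : ZMod q → ℕ) (hw : ∀ r : ZMod q, locMinus p k ℓ r.val = w r) :
    localMean p k ℓ = ((∑ r ∈ Finset.univ.filter P, w r : ℕ) : ℝ) /
      (Finset.univ.filter P).card := by
  classical
  have key : ∀ (q' : ℕ) [NeZero q'], q' = q →
      (∑ r ∈ Finset.univ.filter (fun r : ZMod q' => FundAt p r.val),
        (locMinus p k ℓ r.val : ℝ)) /
      ((Finset.univ.filter fun r : ZMod q' => FundAt p r.val).card : ℝ) =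
        ((∑ r ∈ Finset.univ.filter P, w r : ℕ) : ℝ) / (Finset.univ.filter P).card := by
    intro q' _ hq'
    subst hq'
    have h1 : (Finset.univ.filter fun r : ZMod q' => FundAt p r.val) = Finset.univ.filter P := by
      ext r
      simp only [Finset.mem_filter, Finset.mem_univ, true_and]
      exact hP r
    rw [h1, Nat.cast_sum]
    simp only [hw]
  exact key _ hq

theorem localMean_two (k : ℕ) [Fact (Nat.Prime 2)] :
    localMean 2 k ℓ = if ℓ = 3 then 5 / 3 else 1 := by
  have hcard : (Finset.univ.filter fun r : ZMod 16 => FundTwo r.val).card = 6 := by decide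
  -- Of the six admissible classes 1, 5, 8, 9, 12, 13 the two inert ones, 5 and 13, count 3 each: 2
  -- · 3 + 4 = 10.
  have hs : ∑ r ∈ Finset.univ.filter (fun r : ZMod 16 => FundTwo r.val),
    (if r.val % 8 = 5 then 3 else 1) = 10 := by decide
  have hP : ∀ r : ZMod 16, FundAt 2 r.val ↔ FundTwo r.val := fun r => by
    unfold FundAt; rw [if_pos rfl]
  split_ifs with h
  · rw [localMean_eq_of_filter (q := 16) rfl (fun r => FundTwo r.val) hP k
      (fun r => if r.val % 8 = 5 then 3 else 1) (fun r => by simp [locMinus, h]), hs, hcard]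
    norm_num
  · rw [localMean_eq_of_filter (q := 16) rfl (fun r => FundTwo r.val) hP k
      (fun r => 1) (fun r => by simp [locMinus, h]), Finset.sum_const, hcard]
    norm_num

/-- The admissible classes modulo p² are the p² - 1 non-zero ones, and every class modulo p has p
lifts; removing the zero class subtracts f 0 once. -/
theorem localMean_of_cast [Fact p.Prime] (hp2 : p ≠ 2) (k : ℕ) (f : ZMod p → ℝ)
    (hf : ∀ n : ℕ, (locMinus p k ℓ n : ℝ) = f n) :
    localMean p k ℓ = (p * ∑ x, f x - f 0) / ((p : ℝ) ^ 2 - 1) := by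
  classical
  have hp0 : p ≠ 0 := (Fact.out : p.Prime).ne_zero
  have : NeZero (p ^ 2) := ⟨pow_ne_zero 2 hp0⟩
  have hq : locMod p = p ^ 2 := if_neg hp2
  have key : ∀ (q : ℕ) [NeZero q], q = p ^ 2 →
      (∑ r ∈ Finset.univ.filter (fun r : ZMod q => FundAt p r.val),
        (locMinus p k ℓ r.val : ℝ)) /
      ((Finset.univ.filter fun r : ZMod q => FundAt p r.val).card : ℝ) =
        (p * ∑ x, f x - f 0) / ((p : ℝ) ^ 2 - 1) := by
    intro q _ hq
    subst hq
    have h1 : (Finset.univ.filter fun r : ZMod (p ^ 2) => FundAt p r.val) =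
        Finset.univ.erase 0 := by
      ext r
      simp only [Finset.mem_filter, Finset.mem_univ, true_and, Finset.mem_erase, and_true]
      unfold FundAt
      rw [if_neg hp2, ← ZMod.natCast_eq_zero_iff, ZMod.natCast_zmod_val]
    have h2 : ∀ r : ZMod (p ^ 2), (locMinus p k ℓ r.val : ℝ) =
        f (ZMod.castHom (dvd_pow_self p two_ne_zero) (ZMod p) r) := fun r => by
      rw [hf]
      congr 1
      conv_rhs => rw [← ZMod.natCast_zmod_val r, map_natCast]
    have h3 := sum_zmod_sq_cast f
    rw [← Finset.add_sum_erase _ _ (Finset.mem_univ (0 : ZMod (p ^ 2))), map_zero] at h3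
    rw [h1, Finset.sum_congr rfl fun r _ => h2 r, Finset.card_erase_of_mem (Finset.mem_univ _),
      Finset.card_univ, ZMod.card, Nat.cast_sub (Nat.one_le_iff_ne_zero.2 (pow_ne_zero 2 hp0)),
      ← h3]
    push_cast
    ring
  exact key _ hq

/-- Off zero the function is (s + i) / 2 plus (s - i) / 2 times the quadratic character, whose
values sum to zero; s and i are the split and inert values. -/
theorem sum_signMinus [Fact p.Prime] (hp2 : p ≠ 2) :
    ∑ x : ZMod p, (signMinus p ℓ x : ℝ) = 1 + ((p : ℝ) - 1) / 2 *
      ((if ℓ ∣ p - 1 then (ℓ : ℝ) else 1) + if ℓ ∣ p + 1 then (ℓ : ℝ) else 1) := by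
  classical
  have hchar : ringChar (ZMod p) ≠ 2 := by rwa [ZMod.ringChar_zmod_n]
  generalize hs : (if ℓ ∣ p - 1 then (ℓ : ℝ) else 1) = s
  generalize hi : (if ℓ ∣ p + 1 then (ℓ : ℝ) else 1) = i
  have h : ∀ x : ZMod p, (signMinus p ℓ x : ℝ) = (s + i) / 2 +
      ((quadraticChar (ZMod p) x : ℤ) : ℝ) * ((s - i) / 2) +
        if x = 0 then 1 - (s + i) / 2 else 0 := fun x => by
    unfold signMinus
    by_cases h0 : x = 0
    · simp [h0]
    · rw [if_neg h0, if_neg h0]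
      by_cases hx : IsSquare x
      · rw [if_pos hx, (quadraticChar_one_iff_isSquare h0).2 hx, ← hs]
        push_cast
        ring
      · rw [if_neg hx, quadraticChar_neg_one_iff_not_isSquare.2 hx, ← hi]
        push_cast
        ring
  rw [Finset.sum_congr rfl fun x _ => h x, Finset.sum_add_distrib, Finset.sum_add_distrib,
    ← Finset.sum_mul, ← Int.cast_sum, quadraticChar_sum_zero hchar]
  simp
  ring

theorem localMean_other [Fact p.Prime] (hp2 : p ≠ 2) (hpℓ : p ≠ ℓ) (k : ℕ) :
    localMean p k ℓ = (1 + (p : ℝ) / 2 *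
      ((if ℓ ∣ p - 1 then (ℓ : ℝ) else 1) + if ℓ ∣ p + 1 then (ℓ : ℝ) else 1)) / (p + 1) := by
  have hp1 : (1 : ℝ) < p := by exact_mod_cast (Fact.out : p.Prime).one_lt
  rw [localMean_of_cast hp2 k (fun x => (signMinus p ℓ x : ℝ))
    (fun n => by simp only [locMinus, if_neg hp2, if_neg hpℓ]), sum_signMinus hp2]
  have h0 : signMinus p ℓ 0 = 1 := if_pos rfl
  rw [h0, div_eq_div_iff (by nlinarith) (by linarith)]
  push_cast
  ring

theorem localMean_self_one [Fact p.Prime] (hp2 : p ≠ 2) :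
    localMean p 1 p = 2 * p / (p + 1) := by
  classical
  have hp1 : (1 : ℝ) < p := by exact_mod_cast (Fact.out : p.Prime).one_lt
  rw [localMean_of_cast hp2 1 (fun x => if x = 0 then (p : ℝ) else 1)
    (fun n => by simp only [locMinus, if_neg hp2, if_true]; split_ifs <;> simp)]
  have h : ∀ x : ZMod p, (if x = 0 then (p : ℝ) else 1) = 1 + if x = 0 then (p : ℝ) - 1 else 0 :=
    fun x => by split_ifs <;> ring
  rw [Finset.sum_congr rfl fun x _ => h x, Finset.sum_add_distrib]
  simp only [Finset.sum_const, Finset.card_univ, ZMod.card, nsmul_eq_mul, mul_one,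
    Finset.sum_ite_eq', Finset.mem_univ, if_true]
  rw [div_eq_div_iff (by nlinarith) (by linarith)]
  ring

theorem localMean_self_of_three_lt [Fact p.Prime] (hp3 : 3 < p) {k : ℕ} (hk : 2 ≤ k) :
    localMean p k p = p := by
  have hp1 : (1 : ℝ) < p := by exact_mod_cast (Fact.out : p.Prime).one_lt
  have hp2 : p ≠ 2 := by omega
  have hk1 : k ≠ 1 := by omega
  have h3 : p ≠ 3 := by omega
  rw [localMean_of_cast hp2 k (fun _ => (p : ℝ))
    (fun n => by simp only [locMinus, if_neg hp2, if_true, if_neg hk1, h3, false_and, if_false])]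
  simp only [Finset.sum_const, Finset.card_univ, ZMod.card, nsmul_eq_mul]
  rw [div_eq_iff (by nlinarith)]
  ring

theorem localMean_three [Fact (Nat.Prime 3)] {k : ℕ} (hk : 2 ≤ k) : localMean 3 k 3 = 15 / 4 := by
  have hk1 : k ≠ 1 := by omega
  have hcard : (Finset.univ.filter fun r : ZMod 9 => ¬ 9 ∣ r.val).card = 8 := by decide
  -- Of the eight admissible classes, 6 counts 9 and the other seven count 3, which gives 30.
  have hs : ∑ r ∈ Finset.univ.filter (fun r : ZMod 9 => ¬ 9 ∣ r.val),
      (if r.val % 9 = 6 then 9 else 3) = 30 := by decide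
  rw [localMean_eq_of_filter (q := 9) rfl (fun r => ¬ 9 ∣ r.val)
    (fun r => by unfold FundAt; rw [if_neg (by norm_num)]; norm_num) k
    (fun r => if r.val % 9 = 6 then 9 else 3) (fun r => by simp [locMinus, hk1]), hs, hcard]
  norm_num

end LocalMeans

/-! ### Averages over fundamental discriminants -/

section Fundamental

/-- Fundamental discriminants among the positive integers. -/
def IsFund (n : ℕ) : Prop := FundTwo n ∧ ∀ p : ℕ, p.Prime → p ≠ 2 → ¬ p ^ 2 ∣ n

theorem prime_dvd_locMod {p q : ℕ} (hp : p.Prime) (hq : q.Prime) : q ∣ locMod p ↔ q = p := by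
  unfold locMod
  split_ifs with h
  · subst h
    rw [show 16 = 2 ^ 4 by norm_num]
    exact ⟨fun h => (Nat.prime_dvd_prime_iff_eq hq hp).1 (hq.dvd_of_dvd_pow h),
      fun h => h ▸ dvd_pow_self _ (by norm_num)⟩
  · exact ⟨fun h => (Nat.prime_dvd_prime_iff_eq hq hp).1 (hq.dvd_of_dvd_pow h),
      fun h => h ▸ dvd_pow_self _ (by norm_num)⟩

/-- Separates the local conditions at the primes of T from squarefreeness away from T; this is the
shape to which the sieve applies. -/
theorem isFund_iff {T : Finset ℕ} (hT : ∀ p ∈ T, p.Prime) (h2 : 2 ∈ T) (n : ℕ) :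
    IsFund n ↔ SqfreeAway (∏ p : T, locMod p) n ∧ ∀ p : T, FundAt p n := by
  have hdvd : ∀ q : ℕ, q.Prime → (q ∣ ∏ p : T, locMod p ↔ q ∈ T) := fun q hq => by
    rw [hq.prime.dvd_finsetProd_iff]
    constructor
    · rintro ⟨p, -, h⟩
      rw [(prime_dvd_locMod (hT p p.2) hq).1 h]
      exact p.2
    · intro h
      exact ⟨⟨q, h⟩, Finset.mem_univ _, (prime_dvd_locMod (hT q h) hq).2 rfl⟩
  constructor
  · rintro ⟨h, h'⟩
    refine ⟨fun q hq hqT => h' q hq ?_, fun p => ?_⟩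
    · rintro rfl
      exact hqT ((hdvd 2 hq).2 h2)
    · unfold FundAt
      split_ifs with h3
      · exact h
      · exact h' p (hT p p.2) h3
  · rintro ⟨h, h'⟩
    refine ⟨by simpa [FundAt] using h' ⟨2, h2⟩, fun q hq hq2 => ?_⟩
    by_cases hqT : q ∈ T
    · simpa [FundAt, hq2] using h' ⟨q, hqT⟩
    · exact h q hq (fun h3 => hqT ((hdvd q hq).1 h3))

open Classical in
theorem tendsto_average_locMinus (m ℓ : ℕ) :
    Filter.Tendsto (fun N : ℕ => (∑ n ∈ (Finset.Ioc 1 N).filter IsFund,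
        ∏ p : m.primeFactors, (locMinus p (m.factorization p) ℓ n : ℝ)) /
          (((Finset.Ioc 1 N).filter IsFund).card : ℝ)) Filter.atTop
      (nhds (∏ p : m.primeFactors, localMean p (m.factorization p) ℓ)) := by
  -- The prime 2 is included even when m is odd, since being fundamental at 2 is a condition modulo
  -- 16 and not squarefreeness. Its weight is then 1.
  let T : Finset ℕ := insert 2 m.primeFactors
  have hT : ∀ p ∈ T, p.Prime := fun p hp => by
    rcases Finset.mem_insert.1 hp with rfl | h
    · exact Nat.prime_two
    · exact Nat.prime_of_mem_primeFactors h
  have h2 : 2 ∈ T := Finset.mem_insert_self _ _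
  have hmT : m.primeFactors ⊆ T := Finset.subset_insert _ _
  have : ∀ p : T, Fact (p : ℕ).Prime := fun p => ⟨hT p p.2⟩
  have hco : Pairwise (Function.onFun Nat.Coprime fun p : T => locMod p) := fun p q hpq => by
    refine Nat.Coprime.symm (Nat.coprime_of_dvd fun r hr h3 h4 => hpq (Subtype.ext ?_))
    rw [← (prime_dvd_locMod (hT p p.2) hr).1 h4, ← (prime_dvd_locMod (hT q q.2) hr).1 h3]
  have hval : ∀ (p : T) (n : ℕ), ((n : ZMod (locMod p))).val = n % locMod p := fun p n =>
    ZMod.val_natCast _ n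
  have hg : ∀ p : T, ∃ r : ZMod (locMod p), FundAt p r.val := fun p => by
    refine ⟨((1 : ℕ) : ZMod (locMod p)), ?_⟩
    rw [hval, fundAt_mod]
    unfold FundAt
    split_ifs
    · left; norm_num
    · exact fun h => (hT p p.2).one_lt.ne' (Nat.dvd_one.1 ((dvd_pow_self _ two_ne_zero).trans h))
  have key := tendsto_average_prod (fun p : T => locMod p) (fun p => NeZero.ne _) hco
    (fun p r => FundAt p r.val) hg
    (fun p r => if (p : ℕ) ∈ m.primeFactors then (locMinus p (m.factorization p) ℓ r.val : ℝ) else 1)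
  have hfilter : ∀ N : ℕ, (Finset.Ioc 1 N).filter (fun n => SqfreeAway (∏ p : T, locMod p) n ∧
      ∀ p : T, FundAt p (n : ZMod (locMod p)).val) = (Finset.Ioc 1 N).filter IsFund := fun N => by
    refine Finset.filter_congr fun n _ => ?_
    rw [isFund_iff hT h2]
    simp only [hval, fundAt_mod]
  have hprod : ∀ f : ℕ → ℝ, (∏ p : T, if (p : ℕ) ∈ m.primeFactors then f p else 1) =
      ∏ p : m.primeFactors, f p := fun f => by
    rw [Finset.prod_coe_sort T (fun p => if p ∈ m.primeFactors then f p else 1),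
      Finset.prod_coe_sort m.primeFactors f, Finset.prod_ite_mem,
      Finset.inter_eq_right.2 hmT]
  have hlim : (∏ p : T, (∑ r ∈ Finset.univ.filter (fun r : ZMod (locMod p) => FundAt p r.val),
      (if (p : ℕ) ∈ m.primeFactors then (locMinus p (m.factorization p) ℓ r.val : ℝ) else 1)) /
        ((Finset.univ.filter fun r : ZMod (locMod p) => FundAt p r.val).card : ℝ)) =
      ∏ p : m.primeFactors, localMean p (m.factorization p) ℓ := by
    have h3 : ∀ p : T, (∑ r ∈ Finset.univ.filter (fun r : ZMod (locMod p) => FundAt p r.val),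
      (if (p : ℕ) ∈ m.primeFactors then (locMinus p (m.factorization p) ℓ r.val : ℝ) else 1)) /
        ((Finset.univ.filter fun r : ZMod (locMod p) => FundAt p r.val).card : ℝ) =
        if (p : ℕ) ∈ m.primeFactors then (fun p : ℕ => if h : p.Prime then
          haveI : Fact p.Prime := ⟨h⟩
          localMean p (m.factorization p) ℓ else 0) p else 1 := fun p => by
      split_ifs with h4
      · simp only [dif_pos (hT p p.2)]
        rfl
      · rw [Finset.sum_const, nsmul_eq_mul, mul_one, div_self]
        obtain ⟨r, hr⟩ := hg p
        exact Nat.cast_ne_zero.2 (Finset.card_ne_zero_of_mem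
          (Finset.mem_filter.2 ⟨Finset.mem_univ r, hr⟩))
    rw [Finset.prod_congr rfl fun p _ => h3 p]
    refine (hprod fun p : ℕ => if h : p.Prime then
      haveI : Fact p.Prime := ⟨h⟩
      localMean p (m.factorization p) ℓ else 0).trans (Finset.prod_congr rfl fun p _ => ?_)
    simp only [dif_pos (Nat.prime_of_mem_primeFactors p.2)]
  rw [← hlim]
  refine key.congr fun N => ?_
  rw [hfilter]
  congr 1
  refine Finset.sum_congr rfl fun n _ => ?_
  refine Eq.trans (Finset.prod_congr rfl fun p _ => ?_)
    (hprod fun p => (locMinus p (m.factorization p) ℓ n : ℝ))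
  simp only [hval, locMinus_mod]

end Fundamental

/-! ### Closed forms of the predicted average -/

section ClosedForm

variable {p m ℓ : ℕ}

theorem mem_primesOne : p ∈ primesOne m ℓ ↔ p ∈ m.primeFactors ∧ ℓ ∣ p - 1 := by
  unfold primesOne
  rw [Finset.mem_filter]
  refine and_congr_right fun hp => ?_
  have h1 := (Nat.prime_of_mem_primeFactors hp).one_le
  rw [← Int.natCast_dvd_natCast, Nat.cast_sub h1, Nat.cast_one]
  exact ⟨fun h => Int.modEq_iff_dvd.1 h.symm, fun h => (Int.modEq_iff_dvd.2 h).symm⟩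

theorem mem_primesPlusMinusOne : p ∈ primesPlusMinusOne m ℓ ↔
    p ∈ m.primeFactors ∧ (ℓ ∣ p - 1 ∨ ℓ ∣ p + 1) := by
  unfold primesPlusMinusOne
  rw [Finset.mem_filter]
  refine and_congr_right fun hp => ?_
  have h1 := (Nat.prime_of_mem_primeFactors hp).one_le
  rw [← Int.natCast_dvd_natCast, ← Int.natCast_dvd_natCast, Nat.cast_sub h1, Nat.cast_one,
    Nat.cast_add, Nat.cast_one]
  refine or_congr ⟨fun h => Int.modEq_iff_dvd.1 h.symm, fun h => (Int.modEq_iff_dvd.2 h).symm⟩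
    ⟨fun h => ?_, fun h => (Int.modEq_iff_dvd.2 ?_).symm⟩
  · have := Int.modEq_iff_dvd.1 h.symm
    rwa [sub_neg_eq_add] at this
  · rwa [sub_neg_eq_add]

theorem prod_locPlus (hℓ : ℓ.Prime) (hm : m ≠ 0) : ∏ p : m.primeFactors, locPlus p (m.factorization p) ℓ =
    ℓ ^ ((primesOne m ℓ).card + if ℓ ^ 2 ∣ m then 1 else 0) := by
  classical
  have h1 : primesOne m ℓ = m.primeFactors.filter fun p => ℓ ∣ p - 1 := by
    ext p
    rw [mem_primesOne, Finset.mem_filter]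
  have hf := hℓ.pow_dvd_iff_le_factorization (k := 2) hm
  have h2 : ∀ p ∈ m.primeFactors, locPlus p (m.factorization p) ℓ =
      (if ℓ ∣ p - 1 then ℓ else 1) * if p = ℓ then (if ℓ ^ 2 ∣ m then ℓ else 1) else 1 :=
    fun p hp => by
    unfold locPlus
    by_cases h : p = ℓ
    · subst h
      have h0 : m.factorization p ≠ 0 := Finsupp.mem_support_iff.1 hp
      simp only [if_true, not_dvd_pred_self hℓ, if_false, one_mul, hf]
      split_ifs <;> first | rfl | omega
    · simp only [if_neg h, mul_one]
  rw [Finset.prod_coe_sort m.primeFactors (fun p => locPlus p (m.factorization p) ℓ),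
    Finset.prod_congr rfl h2, Finset.prod_mul_distrib, Finset.prod_ite_eq', ← Finset.prod_filter,
    Finset.prod_const, ← h1, pow_add]
  congr 1
  by_cases h : ℓ ^ 2 ∣ m
  · have : ℓ ∈ m.primeFactors := Nat.mem_primeFactors.2 ⟨hℓ, (dvd_pow_self _ two_ne_zero).trans h, hm⟩
    rw [if_pos this, if_pos h, if_pos h, pow_one]
  · simp [h]

/-- An odd prime ℓ divides at most one of p ± 1, so among the split and inert values at most one is
ℓ and the formula is symmetric in the two signs. For p = 2 only ℓ = 3 matters, and the formula
specialises to 5 / 3. -/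
theorem localMean_of_ne [Fact p.Prime] (hℓ : ℓ.Prime) (hodd : ℓ ≠ 2) (hpℓ : p ≠ ℓ) (k : ℕ) :
    localMean p k ℓ = if ℓ ∣ p - 1 ∨ ℓ ∣ p + 1 then ((p : ℝ) * (ℓ + 1) + 2) / (2 * (p + 1))
      else 1 := by
  have hp := (Fact.out : p.Prime)
  have h1 := hp.one_le
  by_cases hp2 : p = 2
  · subst hp2
    rw [localMean_two]
    have h3 : ℓ ∣ 3 ↔ ℓ = 3 := Nat.prime_dvd_prime_iff_eq hℓ Nat.prime_three
    have h1 : ¬ ℓ ∣ 1 := fun h => hℓ.one_lt.ne' (Nat.dvd_one.1 h)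
    norm_num [h3, h1]
    split_ifs with h
    · subst h
      norm_num
    · rfl
  · rw [localMean_other hp2 hpℓ]
    have hp0 : ((p : ℝ) + 1) ≠ 0 := by positivity
    by_cases ha : ℓ ∣ p - 1
    · have hb : ¬ ℓ ∣ p + 1 := fun hb => by
        have h2 : ℓ ∣ 2 := by
          have := Nat.dvd_sub hb ha
          rwa [show p + 1 - (p - 1) = 2 by omega] at this
        exact hodd ((Nat.prime_dvd_prime_iff_eq hℓ Nat.prime_two).1 h2)
      simp only [ha, hb, if_true, if_false, or_false]
      field_simp
      ring
    · by_cases hb : ℓ ∣ p + 1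
      · simp only [ha, hb, if_true, if_false, or_true]
        field_simp
        ring
      · simp only [ha, hb, if_false, or_false]
        field_simp
        ring

theorem prod_localMean (hℓ : ℓ.Prime) (hodd : ℓ ≠ 2) (m : ℕ) {c : ℝ}
    (hc : ∀ _ : ℓ ∈ m.primeFactors, ∀ [Fact ℓ.Prime], localMean ℓ (m.factorization ℓ) ℓ = c) :
    ∏ p : m.primeFactors, localMean p (m.factorization p) ℓ =
      (if ℓ ∈ m.primeFactors then c else 1) *
        ∏ p ∈ primesPlusMinusOne m ℓ, ((p : ℝ) * (ℓ + 1) + 2) / (2 * (p + 1)) := by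
  classical
  have h1 : primesPlusMinusOne m ℓ = m.primeFactors.filter fun p => ℓ ∣ p - 1 ∨ ℓ ∣ p + 1 := by
    ext p
    rw [mem_primesPlusMinusOne, Finset.mem_filter]
  have h2 : ∀ p : m.primeFactors, localMean p (m.factorization p) ℓ =
      (if (p : ℕ) = ℓ then c else 1) *
        if ℓ ∣ p - 1 ∨ ℓ ∣ p + 1 then (((p : ℕ) : ℝ) * (ℓ + 1) + 2) / (2 * ((p : ℕ) + 1)) else 1 :=
    fun p => by
    by_cases h : (p : ℕ) = ℓ
    · obtain ⟨p, hp⟩ := p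
      simp only at h
      subst h
      have h3 : ¬ (p ∣ p - 1 ∨ p ∣ p + 1) := fun h =>
        h.elim (not_dvd_pred_self hℓ) (not_dvd_succ_self hℓ)
      simp only [if_true, h3, if_false, mul_one]
      have : Fact p.Prime := ⟨hℓ⟩
      exact hc hp
    · rw [localMean_of_ne hℓ hodd h, if_neg h, one_mul]
  rw [Finset.prod_congr rfl fun p _ => h2 p,
    Finset.prod_coe_sort m.primeFactors (fun p : ℕ => (if p = ℓ then c else 1) *
      if ℓ ∣ p - 1 ∨ ℓ ∣ p + 1 then ((p : ℝ) * (ℓ + 1) + 2) / (2 * (p + 1)) else 1),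
    Finset.prod_mul_distrib, Finset.prod_ite_eq', ← Finset.prod_filter, ← h1]

/-- The predicted average number of elements of order dividing `ℓ` in the ray class group. -/
def predictedAverage (m ℓ : ℕ) : ℝ :=
  ((∏ p : m.primeFactors, locPlus p (m.factorization p) ℓ : ℕ) : ℝ) *
    (1 + 1 / (ℓ : ℝ) * ∏ p : m.primeFactors, localMean p (m.factorization p) ℓ)

theorem predictedAverage_of_not_dvd (hℓ : ℓ.Prime) (hodd : ℓ ≠ 2) (hm : m ≠ 0) (h : ¬ ℓ ∣ m) :
    predictedAverage m ℓ = (ℓ : ℝ) ^ (primesOne m ℓ).card *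
      (1 + 1 / (ℓ : ℝ) * ∏ p ∈ primesPlusMinusOne m ℓ,
        ((p : ℝ) * (ℓ + 1) + 2) / (2 * (p + 1))) := by
  have h1 : ℓ ∉ m.primeFactors := fun h' => h (Nat.dvd_of_mem_primeFactors h')
  have h2 : ¬ ℓ ^ 2 ∣ m := fun h' => h ((dvd_pow_self _ two_ne_zero).trans h')
  unfold predictedAverage
  rw [prod_locPlus hℓ hm, prod_localMean hℓ hodd m (c := 1) (fun h' => absurd h' h1), if_neg h1,
    if_neg h2, add_zero, one_mul, Nat.cast_pow]

theorem predictedAverage_of_dvd (hℓ : ℓ.Prime) (hodd : ℓ ≠ 2) (hm : m ≠ 0) (h : ℓ ∣ m)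
    (h2 : ¬ ℓ ^ 2 ∣ m) :
    predictedAverage m ℓ = (ℓ : ℝ) ^ (primesOne m ℓ).card *
      (1 + 2 / ((ℓ : ℝ) + 1) * ∏ p ∈ primesPlusMinusOne m ℓ,
        ((p : ℝ) * (ℓ + 1) + 2) / (2 * (p + 1))) := by
  have h1 : ℓ ∈ m.primeFactors := Nat.mem_primeFactors.2 ⟨hℓ, h, hm⟩
  have hf : m.factorization ℓ = 1 := by
    have h3 := hℓ.pow_dvd_iff_le_factorization (k := 2) hm
    have h4 : m.factorization ℓ ≠ 0 := Finsupp.mem_support_iff.1 h1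
    rw [h3] at h2
    omega
  have hℓ0 : (ℓ : ℝ) ≠ 0 := Nat.cast_ne_zero.2 hℓ.ne_zero
  unfold predictedAverage
  rw [prod_locPlus hℓ hm, prod_localMean hℓ hodd m (c := 2 * ℓ / (ℓ + 1))
    (fun _ _ => by rw [hf]; exact localMean_self_one hodd), if_pos h1,
    if_neg h2, add_zero, Nat.cast_pow, ← mul_assoc]
  congr 3
  field_simp

theorem predictedAverage_of_sq_dvd (hℓ : ℓ.Prime) (hm : m ≠ 0) (h3 : 3 < ℓ) (h2 : ℓ ^ 2 ∣ m) :
    predictedAverage m ℓ = (ℓ : ℝ) ^ ((primesOne m ℓ).card + 1) *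
      (1 + ∏ p ∈ primesPlusMinusOne m ℓ, ((p : ℝ) * (ℓ + 1) + 2) / (2 * (p + 1))) := by
  have h1 : ℓ ∈ m.primeFactors :=
    Nat.mem_primeFactors.2 ⟨hℓ, (dvd_pow_self _ two_ne_zero).trans h2, hm⟩
  have hℓ0 : (ℓ : ℝ) ≠ 0 := Nat.cast_ne_zero.2 hℓ.ne_zero
  unfold predictedAverage
  rw [prod_locPlus hℓ hm, prod_localMean hℓ (by omega) m (c := ℓ) (fun _ _ =>
    localMean_self_of_three_lt h3 ((hℓ.pow_dvd_iff_le_factorization hm).1 h2)), if_pos h1,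
    if_pos h2, Nat.cast_pow, ← mul_assoc, one_div_mul_cancel hℓ0, one_mul]

/-- The constant is (1 / 3) · (15 / 4), with the exceptional local mean at 3. -/
theorem predictedAverage_three (hm : m ≠ 0) (h2 : 3 ^ 2 ∣ m) :
    predictedAverage m 3 = (3 : ℝ) ^ ((primesOne m 3).card + 1) *
      (1 + 5 / 4 * ∏ p ∈ primesPlusMinusOne m 3, (2 * (p : ℝ) + 1) / (p + 1)) := by
  have hℓ := Nat.prime_three
  have h1 : 3 ∈ m.primeFactors :=
    Nat.mem_primeFactors.2 ⟨hℓ, (dvd_pow_self _ two_ne_zero).trans h2, hm⟩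
  unfold predictedAverage
  rw [prod_locPlus hℓ hm, prod_localMean hℓ (by norm_num) m (c := 15 / 4) (fun _ _ =>
    localMean_three ((hℓ.pow_dvd_iff_le_factorization hm).1 h2)), if_pos h1,
    if_pos h2, Nat.cast_pow, ← mul_assoc]
  have h4 : ∀ p : ℕ, ((p : ℝ) * ((3 : ℕ) + 1) + 2) / (2 * (p + 1)) = (2 * (p : ℝ) + 1) / (p + 1) :=
    fun p => by
    have : (p : ℝ) + 1 ≠ 0 := by positivity
    field_simp
    push_cast
    ring
  simp only [h4]
  norm_num

end ClosedForm

/-! ### Square roots of fundamental discriminants in cyclotomic fields -/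

section CyclotomicSquares

/-- The integer `d` is a square in the `n`-th cyclotomic field. -/
def CycSq (n : ℕ) (d : ℤ) : Prop := ∃ x : CyclotomicField n ℚ, x ^ 2 = d

theorem CycSq.mul {n : ℕ} {d e : ℤ} (hd : CycSq n d) (he : CycSq n e) : CycSq n (d * e) := by
  obtain ⟨x, hx⟩ := hd
  obtain ⟨y, hy⟩ := he
  exact ⟨x * y, by rw [mul_pow, hx, hy, Int.cast_mul]⟩

theorem CycSq.of_mul {n : ℕ} {d e : ℤ} (hd : CycSq n d) (h0 : d ≠ 0) (he : CycSq n (d * e)) :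
    CycSq n e := by
  obtain ⟨x, hx⟩ := hd
  obtain ⟨y, hy⟩ := he
  have hd0 : (d : CyclotomicField n ℚ) ≠ 0 := Int.cast_ne_zero.2 h0
  exact ⟨y / x, by rw [div_pow, hx, hy, Int.cast_mul, mul_div_cancel_left₀ _ hd0]⟩

theorem cycSq_sq (n : ℕ) (d : ℤ) : CycSq n (d ^ 2) := ⟨d, by push_cast; rfl⟩

instance (n : ℕ) [NeZero n] : IsCyclotomicExtension {n} ℚ (CyclotomicField n ℚ) := by
  have h : (DivisionRing.toRatAlgebra : Algebra ℚ (CyclotomicField n ℚ)) =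
    CyclotomicField.algebra n ℚ := Subsingleton.elim _ _
  rw [h]
  exact CyclotomicField.isCyclotomicExtension n ℚ

theorem exists_primitiveRoot {n N : ℕ} (h : n ∣ N) (hN : N ≠ 0) :
    ∃ ζ : CyclotomicField N ℚ, IsPrimitiveRoot ζ n := by
  have : NeZero N := ⟨hN⟩
  obtain ⟨k, hk⟩ := h
  exact ⟨_, (IsCyclotomicExtension.zeta_spec N ℚ (CyclotomicField N ℚ)).pow
    (Nat.pos_of_ne_zero hN) (hk.trans (mul_comm n k))⟩

theorem CycSq.mono {n N : ℕ} {d : ℤ} (h : n ∣ N) (hN : N ≠ 0) (hd : CycSq n d) : CycSq N d := by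
  obtain ⟨ζ, hζ⟩ := exists_primitiveRoot h hN
  have hn : n ≠ 0 := fun h0 => hN (by subst h0; exact Nat.eq_zero_of_zero_dvd h)
  have hsplit : ((Polynomial.cyclotomic n ℚ).map
      (algebraMap ℚ (CyclotomicField N ℚ))).Splits := by
    have h1 := Polynomial.X_pow_sub_one_splits hζ
    refine Polynomial.Splits.of_dvd h1 (Polynomial.X_pow_sub_C_ne_zero (Nat.pos_of_ne_zero hn) _) ?_
    rw [Polynomial.map_cyclotomic, Polynomial.C_1]
    exact Polynomial.cyclotomic.dvd_X_pow_sub_one n _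
  have : NeZero n := ⟨hn⟩
  have := IsCyclotomicExtension.splitting_field_cyclotomic n ℚ (CyclotomicField n ℚ)
  have f : CyclotomicField n ℚ →ₐ[ℚ] CyclotomicField N ℚ :=
    Polynomial.IsSplittingField.lift _ (Polynomial.cyclotomic n ℚ) hsplit
  obtain ⟨x, hx⟩ := hd
  exact ⟨f x, by rw [← map_pow, hx, map_intCast]⟩

/-- The root is the quadratic Gauss sum, whose square is χ(-1) · p. -/
theorem cycSq_prime {p : ℕ} (hp : p.Prime) (hp2 : p ≠ 2) : CycSq p (ZMod.χ₄ p * p) := by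
  classical
  have : Fact p.Prime := ⟨hp⟩
  obtain ⟨ζ, hζ⟩ := exists_primitiveRoot (dvd_refl p) hp.ne_zero
  have hchar : ringChar (ZMod p) ≠ 2 := by rwa [ZMod.ringChar_zmod_n]
  have hinj : Function.Injective (Int.castRingHom (CyclotomicField p ℚ)) := Int.cast_injective
  let χ : MulChar (ZMod p) (CyclotomicField p ℚ) :=
    (quadraticChar (ZMod p)).ringHomComp (Int.castRingHom _)
  have h1 : χ ≠ 1 := by
    rw [MulChar.ringHomComp_ne_one_iff hinj]
    exact quadraticChar_ne_one hchar
  have h2 : χ.IsQuadratic := (quadraticChar_isQuadratic (ZMod p)).comp _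
  have h3 := gaussSum_sq h1 h2 (AddChar.zmodChar_primitive_of_primitive_root p hζ)
  refine ⟨_, h3.trans ?_⟩
  rw [MulChar.ringHomComp_apply, quadraticChar_neg_one hchar, ZMod.card]
  simp

theorem cycSq_odd {d : ℕ} (hodd : Odd d) (hsq : Squarefree d) : CycSq d (ZMod.χ₄ d * d) := by
  induction d using Nat.recOnMul with
  | zero => exact absurd hodd (by decide)
  | one => exact ⟨1, by simp⟩
  | prime p hp => exact cycSq_prime hp (by rintro rfl; exact absurd hodd (by decide))
  | mul a b ha hb =>
    have h0 : a * b ≠ 0 := hsq.ne_zero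
    have h1 := (ha (Nat.odd_mul.1 hodd).1 (hsq.squarefree_of_dvd (dvd_mul_right a b))).mono
      (dvd_mul_right a b) h0
    have h2 := (hb (Nat.odd_mul.1 hodd).2 (hsq.squarefree_of_dvd (dvd_mul_left b a))).mono
      (dvd_mul_left b a) h0
    have h3 := h1.mul h2
    have h4 : ZMod.χ₄ ((a * b : ℕ) : ZMod 4) * ((a * b : ℕ) : ℤ) =
        ZMod.χ₄ a * a * (ZMod.χ₄ b * b) := by
      push_cast
      rw [map_mul]
      ring
    rwa [h4]

theorem eq_neg_one_of_sq_eq_one {R : Type*} [CommRing R] [IsDomain R] {x : R} (h : x ^ 2 = 1)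
    (h1 : x ≠ 1) : x = -1 :=
  ((mul_self_eq_one_iff (a := x)).1 (by rw [← pow_two, h])).resolve_left h1

theorem cycSq_four : CycSq 4 (-1) := by
  obtain ⟨ζ, hζ⟩ := exists_primitiveRoot (dvd_refl 4) (by norm_num)
  have h1 : (ζ ^ 2) ^ 2 = 1 := by rw [← pow_mul]; exact hζ.pow_eq_one
  have h2 : ζ ^ 2 ≠ 1 := hζ.pow_ne_one_of_pos_of_lt (by norm_num) (by norm_num)
  exact ⟨ζ, by rw [eq_neg_one_of_sq_eq_one h1 h2]; simp⟩

theorem pow_four_eq_neg_one {R : Type*} [CommRing R] [IsDomain R] {ζ : R}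
    (hζ : IsPrimitiveRoot ζ 8) : ζ ^ 4 = -1 := by
  have h1 : (ζ ^ 4) ^ 2 = 1 := by rw [← pow_mul]; exact hζ.pow_eq_one
  have h2 : ζ ^ 4 ≠ 1 := hζ.pow_ne_one_of_pos_of_lt (by norm_num) (by norm_num)
  exact eq_neg_one_of_sq_eq_one h1 h2

/-- √2 = ζ + ζ⁻¹, and ζ⁻¹ = -ζ³ because ζ⁴ = -1. -/
theorem cycSq_eight : CycSq 8 2 := by
  obtain ⟨ζ, hζ⟩ := exists_primitiveRoot (dvd_refl 8) (by norm_num)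
  have h4 := pow_four_eq_neg_one hζ
  exact ⟨ζ - ζ ^ 3, by push_cast; linear_combination (ζ ^ 2 - 2) * h4⟩

theorem cycSq_eight_neg : CycSq 8 (-2) := by
  have h := cycSq_eight.mul (cycSq_four.mono (by norm_num) (by norm_num))
  simpa using h

theorem IsFund.ne_zero {D : ℕ} (h : IsFund D) : D ≠ 0 := by
  rintro rfl
  have := h.1
  unfold FundTwo at this
  omega

theorem IsFund.squarefree_of_dvd {D d : ℕ} (h : IsFund D) (hd : d ∣ D) (hodd : Odd d) :
    Squarefree d := by
  rw [Nat.squarefree_iff_prime_squarefree]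
  intro p hp hpd
  refine h.2 p hp ?_ ((pow_two p ▸ hpd).trans hd)
  rintro rfl
  exact absurd (hodd.of_dvd_nat ((dvd_mul_right 2 2).trans hpd)) (by decide)

theorem chi_four_odd {d : ℕ} (hd : Odd d) : ZMod.χ₄ d = 1 ∨ ZMod.χ₄ d = -1 := by
  rw [ZMod.χ₄_nat_eq_if_mod_four]
  have : d % 2 = 1 := Nat.odd_iff.1 hd
  split_ifs <;> omega

/-- Up to squares, D is a product of the numbers ±p ≡ 1 mod 4 and possibly -1, 2 or -2, each of
which has a root at a level dividing D. This bounds the conductor from above. -/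
theorem IsFund.cycSq {D : ℕ} (h : IsFund D) : CycSq D D := by
  have h0 := h.ne_zero
  have hcases : D % 4 = 1 ∨ D % 16 = 12 ∨ D % 16 = 8 := by
    have := h.1
    unfold FundTwo at this
    omega
  rcases hcases with h1 | h1 | h1
  · have hodd : Odd D := Nat.odd_iff.2 (by omega)
    have h2 := cycSq_odd hodd (h.squarefree_of_dvd dvd_rfl hodd)
    rwa [ZMod.χ₄_nat_one_mod_four h1, one_mul] at h2
  · obtain ⟨d, rfl⟩ : 4 ∣ D := Nat.dvd_of_mod_eq_zero (by omega)
    have hodd : Odd d := Nat.odd_iff.2 (by omega)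
    have h2 := (cycSq_odd hodd (h.squarefree_of_dvd (dvd_mul_left d 4) hodd)).mono
      (dvd_mul_left d 4) h0
    rw [ZMod.χ₄_nat_three_mod_four (by omega)] at h2
    have h3 := (h2.mul (cycSq_four.mono (dvd_mul_right 4 d) h0)).mul (cycSq_sq (4 * d) 2)
    convert h3 using 1
    push_cast
    ring
  · obtain ⟨d, rfl⟩ : 8 ∣ D := Nat.dvd_of_mod_eq_zero (by omega)
    have hodd : Odd d := Nat.odd_iff.2 (by omega)
    have h2 := (cycSq_odd hodd (h.squarefree_of_dvd (dvd_mul_left d 8) hodd)).mono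
      (dvd_mul_left d 8) h0
    rcases chi_four_odd hodd with h5 | h5
    · rw [h5] at h2
      have h3 := (h2.mul (cycSq_eight.mono (dvd_mul_right 8 d) h0)).mul (cycSq_sq (8 * d) 2)
      convert h3 using 1
      push_cast
      ring
    · rw [h5] at h2
      have h3 := (h2.mul (cycSq_eight_neg.mono (dvd_mul_right 8 d) h0)).mul (cycSq_sq (8 * d) 2)
      convert h3 using 1
      push_cast
      ring

end CyclotomicSquares

/-! ### Lower bound for the level of a cyclotomic field containing √D -/

section CyclotomicConverse

variable {n : ℕ}

/-- For p ∤ n one has p ^ φ(n) ≡ 1 mod n, so the φ(n)-fold Frobenius of 𝓞 / p fixes ζ, which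
generates this ring. It is therefore the identity, and 𝓞 / p is reduced: p is unramified. -/
theorem pow_card_eq_self_mod {p : ℕ} (hp : p.Prime) (hn : n ≠ 0) (hpn : ¬ p ∣ n)
    (y : 𝓞 (CyclotomicField n ℚ) ⧸ Ideal.span {(p : 𝓞 (CyclotomicField n ℚ))}) :
    y ^ p ^ n.totient = y := by
  have : NeZero n := ⟨hn⟩
  have : Fact p.Prime := ⟨hp⟩
  rcases subsingleton_or_nontrivial
    (𝓞 (CyclotomicField n ℚ) ⧸ Ideal.span {(p : 𝓞 (CyclotomicField n ℚ))}) with h | h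
  · exact Subsingleton.elim _ _
  have hp0 : ((p : ℕ) : 𝓞 (CyclotomicField n ℚ) ⧸ Ideal.span {(p : 𝓞 (CyclotomicField n ℚ))}) =
      0 := by
    rw [← map_natCast (Ideal.Quotient.mk _), Ideal.Quotient.eq_zero_iff_mem]
    exact Ideal.mem_span_singleton_self _
  have := (CharP.charP_iff_prime_eq_zero hp).2 hp0
  have hζ := IsCyclotomicExtension.zeta_spec n ℚ (CyclotomicField n ℚ)
  have htop := IsCyclotomicExtension.Rat.adjoin_singleton_eq_top hζ
  have hpow : hζ.toInteger ^ p ^ n.totient = hζ.toInteger := by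
    have h1 : hζ.toInteger ^ n = 1 := hζ.toInteger_isPrimitiveRoot.pow_eq_one
    have h2 : p ^ n.totient ≡ 1 [MOD n] :=
      Nat.ModEq.pow_totient ((Nat.Prime.coprime_iff_not_dvd hp).2 hpn)
    rw [pow_eq_pow_mod _ h1, h2, ← pow_eq_pow_mod _ h1, pow_one]
  have key : ((iterateFrobenius _ p n.totient).comp (Ideal.Quotient.mk
      (Ideal.span {(p : 𝓞 (CyclotomicField n ℚ))}))).toIntAlgHom =
      (Ideal.Quotient.mk (Ideal.span {(p : 𝓞 (CyclotomicField n ℚ))})).toIntAlgHom := by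
    refine AlgHom.ext_of_adjoin_eq_top htop ?_
    rintro _ rfl
    change (Ideal.Quotient.mk _ hζ.toInteger) ^ p ^ n.totient = Ideal.Quotient.mk _ hζ.toInteger
    rw [← map_pow, hpow]
  obtain ⟨x, rfl⟩ := Ideal.Quotient.mk_surjective y
  exact DFunLike.congr_fun key x

/-- If p ∤ n then 𝓞 / p is reduced, so p ∣ d makes √d a multiple of p, and p² ∣ d follows. -/
theorem CycSq.prime_dvd {p : ℕ} {d : ℤ} (h : CycSq n d) (hp : p.Prime) (hn : n ≠ 0)
    (hpd : (p : ℤ) ∣ d) (hp2 : ¬ (p : ℤ) ^ 2 ∣ d) : p ∣ n := by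
  by_contra hpn
  obtain ⟨x, hx⟩ := h
  have hxint : IsIntegral ℤ x :=
    IsIntegral.of_pow (n := 2) two_pos (hx ▸ isIntegral_algebraMap (x := d))
  obtain ⟨α, rfl⟩ : ∃ α : 𝓞 (CyclotomicField n ℚ), (α : CyclotomicField n ℚ) = x := ⟨⟨x, hxint⟩, rfl⟩
  have hα : α ^ 2 = (d : 𝓞 (CyclotomicField n ℚ)) := by
    apply FaithfulSMul.algebraMap_injective _ (CyclotomicField n ℚ)
    rw [map_pow, hx, map_intCast]
  have h0 : Ideal.Quotient.mk (Ideal.span {(p : 𝓞 (CyclotomicField n ℚ))}) α = 0 := by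
    rw [← pow_card_eq_self_mod hp hn hpn (Ideal.Quotient.mk _ α)]
    have h2 : 2 ≤ p ^ n.totient :=
      hp.two_le.trans (Nat.le_self_pow (Nat.totient_pos.2 (Nat.pos_of_ne_zero hn)).ne' p)
    refine pow_eq_zero_of_le h2 ?_
    rw [← map_pow, hα, Ideal.Quotient.eq_zero_iff_mem, Ideal.mem_span_singleton]
    have := map_dvd (Int.castRingHom (𝓞 (CyclotomicField n ℚ))) hpd
    simpa using this
  rw [Ideal.Quotient.eq_zero_iff_mem, Ideal.mem_span_singleton] at h0
  obtain ⟨β, rfl⟩ := h0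
  obtain ⟨e, rfl⟩ := hpd
  have hp0 : (p : ℤ) ≠ 0 := Int.natCast_ne_zero.2 hp.ne_zero
  have hpK : (p : 𝓞 (CyclotomicField n ℚ)) ≠ 0 := Nat.cast_ne_zero.2 hp.ne_zero
  have h3 : (p : 𝓞 (CyclotomicField n ℚ)) * β ^ 2 = e := by
    apply mul_left_cancel₀ hpK
    push_cast at hα
    linear_combination hα
  have h4 : IsIntegral ℤ ((e / p : ℚ)) := by
    have h5 : IsIntegral ℤ ((β : CyclotomicField n ℚ) ^ 2) := β.2.pow 2
    have h6 : (β : CyclotomicField n ℚ) ^ 2 = algebraMap ℚ (CyclotomicField n ℚ) (e / p) := by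
      have h7 := congrArg (algebraMap (𝓞 (CyclotomicField n ℚ)) (CyclotomicField n ℚ)) h3
      rw [map_mul, map_pow, map_natCast, map_intCast] at h7
      have hpF : (p : CyclotomicField n ℚ) ≠ 0 := Nat.cast_ne_zero.2 hp.ne_zero
      rw [map_div₀, map_intCast, map_natCast, ← h7, mul_div_cancel_left₀ _ hpF]
    rw [h6] at h5
    exact (isIntegral_algebraMap_iff (algebraMap ℚ (CyclotomicField n ℚ)).injective).1 h5
  obtain ⟨f, hf⟩ := IsIntegrallyClosed.isIntegral_iff.1 h4
  apply hp2
  refine ⟨f, ?_⟩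
  have hpQ : (p : ℚ) ≠ 0 := Nat.cast_ne_zero.2 hp.ne_zero
  have h8 : ((p * f : ℤ) : ℚ) = e := by
    rw [eq_div_iff hpQ] at hf
    push_cast
    rw [mul_comm, ← hf]
    simp
  have h9 : (p : ℤ) * f = e := by exact_mod_cast h8
  rw [← h9]
  ring

/-- The number of roots of unity is n for even n and 2n for odd n; the second is not divisible by 4,
so 4 ∣ l excludes it. -/
theorem dvd_of_isPrimitiveRoot {l : ℕ} (hn : n ≠ 0) (hl : 4 ∣ l) (hl0 : l ≠ 0)
    {ζ : CyclotomicField n ℚ} (hζ : IsPrimitiveRoot ζ l) : l ∣ n := by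
  have : NeZero n := ⟨hn⟩
  have : NeZero l := ⟨hl0⟩
  have h1 := NumberField.Units.dvd_torsionOrder_of_isPrimitiveRoot hζ
  rw [IsCyclotomicExtension.Rat.torsionOrder_eq (n := n)] at h1
  split_ifs at h1 with h
  · exact h1
  · exfalso
    have h2 := hl.trans h1
    rw [Nat.even_iff] at h
    omega

theorem isPrimitiveRoot_two_pow {K : Type*} [Field K] [CharZero K] {ζ : K} {k : ℕ}
    (h : ζ ^ 2 ^ k = -1) : IsPrimitiveRoot ζ (2 ^ (k + 1)) := by
  have : Fact (Nat.Prime 2) := ⟨Nat.prime_two⟩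
  have h1 : ¬ ζ ^ 2 ^ k = 1 := by
    rw [h]
    intro h'
    have h3 : (2 : K) = 0 := by linear_combination -h'
    exact two_ne_zero h3
  have h2 : ζ ^ 2 ^ (k + 1) = 1 := by rw [pow_succ, pow_mul, h, neg_one_sq]
  rw [← orderOf_eq_prime_pow h1 h2]
  exact IsPrimitiveRoot.orderOf ζ

theorem CycSq.four_dvd (h : CycSq n (-1)) (hn : n ≠ 0) : 4 ∣ n := by
  obtain ⟨x, hx⟩ := h
  have hx' : x ^ 2 ^ 1 = -1 := by simpa using hx
  exact dvd_of_isPrimitiveRoot hn (by norm_num) (by norm_num) (isPrimitiveRoot_two_pow hx')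

theorem CycSq.eight_dvd (h : CycSq n 2) (h1 : CycSq n (-1)) (hn : n ≠ 0) : 8 ∣ n := by
  obtain ⟨y, hy⟩ := h
  obtain ⟨i, hi⟩ := h1
  push_cast at hy hi
  have hy0 : y ≠ 0 := by
    rintro rfl
    norm_num at hy
  -- (1 + i) / √2 is a primitive eighth root of unity.
  have hx' : ((1 + i) / y) ^ 2 ^ 2 = -1 := by
    have h2 : ((1 + i) / y) ^ 2 = i := by
      rw [div_pow, hy, div_eq_iff two_ne_zero]
      linear_combination hi
    rw [pow_two 2, pow_mul, h2, hi]
  exact dvd_of_isPrimitiveRoot hn (by norm_num) (by norm_num) (isPrimitiveRoot_two_pow hx')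

theorem dvd_of_squarefree {d : ℕ} (hd : Squarefree d) (h : ∀ p : ℕ, p.Prime → p ∣ d → p ∣ n) :
    d ∣ n := by
  rw [← Nat.prod_primeFactors_of_squarefree hd]
  exact Finset.prod_primes_dvd n (fun p hp => (Nat.prime_of_mem_primeFactors hp).prime)
    fun p hp => h p (Nat.prime_of_mem_primeFactors hp) (Nat.dvd_of_mem_primeFactors hp)

/-- The odd part of D divides n prime by prime. Dividing √D by a root of ± the odd part leaves a
root of -1 or of ±2, and the roots of unity obtained from it force 4 ∣ n or 8 ∣ n. -/
theorem CycSq.dvd_of_isFund {D : ℕ} (h : CycSq n D) (hD : IsFund D) (hn : n ≠ 0) : D ∣ n := by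
  have hpart : ∀ d : ℕ, d ∣ D → Odd d → d ∣ n := fun d hd hodd =>
    dvd_of_squarefree (hD.squarefree_of_dvd hd hodd) fun p hp hpd =>
      h.prime_dvd hp hn (Int.natCast_dvd_natCast.2 (hpd.trans hd)) (by
        have hp2 : p ≠ 2 := by
          rintro rfl
          exact absurd (hodd.of_dvd_nat hpd) (by decide)
        have := hD.2 p hp hp2
        exact_mod_cast this)
  have hcases : D % 4 = 1 ∨ D % 16 = 12 ∨ D % 16 = 8 := by
    have := hD.1
    unfold FundTwo at this
    omega
  rcases hcases with h1 | h1 | h1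
  · exact hpart D dvd_rfl (Nat.odd_iff.2 (by omega))
  · obtain ⟨d, rfl⟩ : 4 ∣ D := Nat.dvd_of_mod_eq_zero (by omega)
    have hodd : Odd d := Nat.odd_iff.2 (by omega)
    have hdn := hpart d (dvd_mul_left d 4) hodd
    have h2 := (cycSq_odd hodd (hD.squarefree_of_dvd (dvd_mul_left d 4) hodd)).mono hdn hn
    rw [ZMod.χ₄_nat_three_mod_four (by omega)] at h2
    have h3 : CycSq n (-1) := by
      refine ((cycSq_sq n 2).mul h2).of_mul ?_ ?_
      · have := hodd.pos.ne'
        simpa using this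
      · convert h using 1
        push_cast
        ring
    exact Nat.Coprime.mul_dvd_of_dvd_of_dvd (Nat.Coprime.pow_left 2
      ((Nat.coprime_two_left (n := d)).2 hodd)) (h3.four_dvd hn) hdn
  · obtain ⟨d, rfl⟩ : 8 ∣ D := Nat.dvd_of_mod_eq_zero (by omega)
    have hodd : Odd d := Nat.odd_iff.2 (by omega)
    have hdn := hpart d (dvd_mul_left d 8) hodd
    -- The eighth root of unity needs i, which is adjoined by passing to level lcm(n, 4). As 8
    -- divides that level only if 4 ∣ n, nothing is lost.
    have hL : Nat.lcm n 4 ≠ 0 := Nat.lcm_ne_zero hn (by norm_num)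
    have h2 := (cycSq_odd hodd (hD.squarefree_of_dvd (dvd_mul_left d 8) hodd)).mono
      (hdn.trans (Nat.dvd_lcm_left n 4)) hL
    have hi := cycSq_four.mono (Nat.dvd_lcm_right n 4) hL
    have hD' := h.mono (Nat.dvd_lcm_left n 4) hL
    have hd0 : (d : ℤ) ≠ 0 := Int.natCast_ne_zero.2 hodd.pos.ne'
    have h3 : CycSq (Nat.lcm n 4) 2 := by
      rcases chi_four_odd hodd with h5 | h5
      · rw [h5] at h2
        refine ((cycSq_sq _ 2).mul h2).of_mul (by simpa using hd0) ?_
        convert hD' using 1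
        push_cast
        ring
      · rw [h5] at h2
        refine (((cycSq_sq _ 2).mul h2).mul hi).of_mul (by simpa using hd0) ?_
        convert hD' using 1
        push_cast
        ring
    have h8 := h3.eight_dvd hi hL
    have h8n : 8 ∣ n := by
      by_cases h4 : 4 ∣ n
      · rwa [Nat.lcm_eq_left h4] at h8
      · exfalso
        by_cases h22 : n % 2 = 0
        · have := h8.trans (Nat.lcm_dvd (k := 2 * n) (dvd_mul_left n 2) (by omega))
          omega
        · have := h8.trans (Nat.lcm_dvd (k := 4 * n) (dvd_mul_left n 4) (dvd_mul_right 4 n))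
          omega
    exact Nat.Coprime.mul_dvd_of_dvd_of_dvd (Nat.Coprime.pow_left 3
      ((Nat.coprime_two_left (n := d)).2 hodd)) h8n hdn

/-- Irrationality of √D is the case n = 1 of the lower bound. -/
theorem IsFund.rat_sq_ne {D : ℕ} (hD : IsFund D) (h1 : D ≠ 1) (r : ℚ) : r ^ 2 ≠ D := by
  intro h
  have h2 : CycSq 1 D := ⟨r, by rw [← Rat.cast_pow, h]; simp⟩
  exact h1 (Nat.dvd_one.1 (h2.dvd_of_isFund hD one_ne_zero))

end CyclotomicConverse

/-! ### Real quadratic fields and their conductors -/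

section QuadraticFields

/-- The homomorphism from the quadratic order of discriminant `b ^ 2 + 4 * a` to a field in which
`x` is a square root of the discriminant. -/
def quadLift (R : Type*) {K : Type*} [CommRing R] [Field K] [CharZero K] [Algebra R K] (a b : ℤ)
    (x : K) (hx : x ^ 2 = (b : K) ^ 2 + 4 * a) :
    QuadraticAlgebra R (a : R) (b : R) →ₐ[R] K :=
  QuadraticAlgebra.lift ⟨((b : K) + x) / 2, by
    rw [Algebra.smul_def, Algebra.smul_def, map_intCast, map_intCast]
    field_simp
    linear_combination hx⟩

section Lift

variable {R K : Type*} [CommRing R] [Field K] [CharZero K] [Algebra R K] {a b : ℤ} {x : K}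
  (hx : x ^ 2 = (b : K) ^ 2 + 4 * a)

theorem quadLift_apply (z : QuadraticAlgebra R (a : R) (b : R)) :
    quadLift R a b x hx z =
      algebraMap R K z.re + algebraMap R K z.im * (((b : K) + x) / 2) := by
  unfold quadLift
  rw [QuadraticAlgebra.lift_apply_apply, Algebra.smul_def, Algebra.smul_def, mul_one]

theorem quadLift_star (g : K →ₐ[R] K) (hg : g x = -x) (z : QuadraticAlgebra R (a : R) (b : R)) :
    quadLift R a b x hx (star z) = g (quadLift R a b x hx z) := by
  have h2 : g 2 = 2 := map_ofNat g 2
  rw [quadLift_apply, quadLift_apply, map_add, map_mul, map_div₀, map_add, hg, h2, g.commutes,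
    g.commutes, map_intCast, QuadraticAlgebra.re_star, QuadraticAlgebra.im_star, map_add, map_mul,
    map_neg, map_intCast]
  ring

end Lift

variable {D : ℕ}

theorem IsFund.fact_rat (hD : IsFund D) (h1 : D ≠ 1) : Fact (∀ r : ℚ,
    r ^ 2 ≠ (((D / 4 : ℕ) : ℤ) : ℚ) + (((D % 4 : ℕ) : ℤ) : ℚ) * r) :=
  ⟨fun r hr => hD.rat_sq_ne h1 (2 * r - ((D % 4 : ℕ) : ℤ)) (by
    rw [← hD.1.cast_eq ℚ]
    linear_combination 4 * hr)⟩

theorem realQuad_eq_of_ne (F : RealQuad) {g : F.1 ≃ₐ[ℚ] F.1} (hg : g ≠ AlgEquiv.refl) :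
    g = galConj F := by
  have h : Nat.card (F.1 ≃ₐ[ℚ] F.1) = 2 := by rw [IsGalois.card_aut_eq_finrank, F.2]
  obtain ⟨c, -, hc⟩ := (Nat.card_eq_two_iff' (AlgEquiv.refl : F.1 ≃ₐ[ℚ] F.1)).1 h
  rw [hc g hg, hc (galConj F) (exists_galConj F).choose_spec]

theorem mem_rat_of_galConj (F : RealQuad) {y : F.1} (hy : galConj F y = y) :
    ∃ r : ℚ, (r : F.1) = y := by
  have : y ∈ Set.range (algebraMap ℚ F.1) := by
    rw [IsGalois.mem_range_algebraMap_iff_fixed]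
    intro f
    by_cases hf : f = AlgEquiv.refl
    · rw [hf]; rfl
    · rw [realQuad_eq_of_ne F hf, hy]
  obtain ⟨r, hr⟩ := this
  exact ⟨r, by rw [← hr]; simp⟩

theorem exists_sqrt_squarefree (F : RealQuad) :
    ∃ (d : ℕ) (x : F.1), Squarefree d ∧ galConj F x = -x ∧ x ^ 2 = d := by
  obtain ⟨y, hy⟩ : ∃ y, galConj F y ≠ y := by
    by_contra! h
    exact (exists_galConj F).choose_spec (AlgEquiv.ext h)
  obtain ⟨x, hx0, hx⟩ : ∃ x : F.1, x ≠ 0 ∧ galConj F x = -x :=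
    ⟨y - galConj F y, sub_ne_zero.2 hy.symm, by rw [map_sub, galConj_galConj]; ring⟩
  obtain ⟨q, hq⟩ := mem_rat_of_galConj F (y := x ^ 2) (by rw [map_pow, hx, neg_sq])
  have hpos : 0 < q := by
    have h1 : ((q : F.1) : ℝ) = (x : ℝ) ^ 2 := by rw [hq]; rfl
    have h2 : (q : ℝ) = (x : ℝ) ^ 2 := by rw [← h1]; simp
    have h3 : (x : ℝ) ≠ 0 := by simpa using hx0
    have h4 : 0 < (x : ℝ) ^ 2 := by positivity
    rw [← h2] at h4
    exact_mod_cast h4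
  obtain ⟨n, hn⟩ : ∃ n : ℕ, q.num = n := ⟨q.num.toNat, (Int.toNat_of_nonneg (Rat.num_pos.2 hpos).le).symm⟩
  have hn0 : n ≠ 0 := by
    rintro rfl
    have := Rat.num_pos.2 hpos
    rw [hn] at this
    simp at this
  obtain ⟨d, s, hsd, hd⟩ := Nat.sq_mul_squarefree (n * q.den)
  have hs0 : s ≠ 0 := by
    rintro rfl
    have := mul_ne_zero hn0 q.den_nz
    rw [← hsd] at this
    simp at this
  have hsF : (s : F.1) ≠ 0 := Nat.cast_ne_zero.2 hs0
  -- Here x² = q is a positive rational with num · den = s² d, so (x · den / s)² = num · den / s² =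
  -- d.
  refine ⟨d, x * q.den / s, hd, ?_, ?_⟩
  · rw [map_div₀, map_mul, map_natCast, map_natCast, hx]
    ring
  · have h1 : (q : F.1) * q.den = n := by
      have h2 : q * q.den = n := by
        rw [Rat.mul_den_eq_num, hn]
        simp
      have h3 := congrArg (Rat.cast : ℚ → F.1) h2
      push_cast at h3
      exact h3
    rw [div_pow, div_eq_iff (pow_ne_zero 2 hsF), mul_pow, ← hq]
    have h4 := congrArg (Nat.cast : ℕ → F.1) hsd
    push_cast at h4
    linear_combination (q.den : F.1) * h1 - h4

theorem exists_sqrt_fund (F : RealQuad) :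
    ∃ (D : ℕ) (x : F.1), IsFund D ∧ D ≠ 1 ∧ galConj F x = -x ∧ x ^ 2 = D := by
  obtain ⟨d, x, hd, hx, hxd⟩ := exists_sqrt_squarefree F
  have hd1 : d ≠ 1 := by
    rintro rfl
    have hx0 : x ≠ 0 := by
      rintro rfl
      norm_num at hxd
    have h2 : galConj F x = x := by
      rcases mul_self_eq_one_iff.1 (by rw [← pow_two, hxd, Nat.cast_one] : x * x = 1) with h | h
      · rw [h, map_one]
      · rw [h, map_neg, map_one]
    rw [hx] at h2
    exact hx0 (self_eq_neg.1 h2.symm)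
  have hsq : ∀ p : ℕ, p.Prime → ¬ p ^ 2 ∣ d := fun p hp h => by
    rw [pow_two] at h
    exact hp.one_lt.ne' (Nat.isUnit_iff.1 (hd p h))
  have h4 : d % 4 ≠ 0 := fun h => hsq 2 Nat.prime_two (Nat.dvd_of_mod_eq_zero h)
  by_cases h1 : d % 4 = 1
  · refine ⟨d, x, ⟨?_, fun p hp _ => hsq p hp⟩, hd1, hx, hxd⟩
    unfold FundTwo
    omega
  · refine ⟨4 * d, 2 * x, ⟨?_, fun p hp hp2 h => hsq p hp ?_⟩, by omega, ?_, ?_⟩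
    · unfold FundTwo
      omega
    · have h2 : Nat.Coprime (p ^ 2) 4 :=
        Nat.Coprime.pow 2 2 ((Nat.coprime_primes hp Nat.prime_two).2 hp2)
      exact h2.dvd_of_dvd_mul_left h
    · rw [map_mul, hx, map_ofNat]
      ring
    · rw [mul_pow, hxd]
      push_cast
      ring

theorem sq_eq_of_isFund {K : Type*} [Field K] (hD : IsFund D) {x : K} (hx : x ^ 2 = D) :
    x ^ 2 = (((D % 4 : ℕ) : ℤ) : K) ^ 2 + 4 * (((D / 4 : ℕ) : ℤ) : K) := by
  rw [hx, hD.1.cast_eq K]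

/-- The homomorphism to a field in which `x` is a square root of the fundamental discriminant
`D`. -/
abbrev discLift (R : Type*) {K : Type*} [CommRing R] [Field K] [CharZero K] [Algebra R K]
    (hD : IsFund D) {x : K} (hx : x ^ 2 = D) :=
  quadLift R ((D / 4 : ℕ) : ℤ) ((D % 4 : ℕ) : ℤ) x (sq_eq_of_isFund hD hx)

theorem discLift_injective {K : Type*} [Field K] [CharZero K] [Algebra ℚ K] (hD : IsFund D)
    (h1 : D ≠ 1) {x : K} (hx : x ^ 2 = D) : Function.Injective (discLift ℚ hD hx) := by
  have := hD.fact_rat h1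
  exact RingHom.injective (discLift ℚ hD hx).toRingHom

theorem discLift_surjective {F : RealQuad} {x : F.1} (hD : IsFund D) (h1 : D ≠ 1)
    (hx : x ^ 2 = D) : Function.Surjective (discLift ℚ hD hx) := by
  have h := LinearMap.injective_iff_surjective_of_finrank_eq_finrank
    (f := (discLift ℚ hD hx).toLinearMap) (by rw [QuadraticAlgebra.finrank_eq_two, F.2])
  exact h.1 (discLift_injective hD h1 hx)

theorem galConj_sqrt {F : RealQuad} {x : F.1} (hD : IsFund D) (h1 : D ≠ 1) (hx : x ^ 2 = D) :
    galConj F x = -x := by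
  have h2 : galConj F x ^ 2 = x ^ 2 := by rw [← map_pow, hx, map_natCast]
  rcases sq_eq_sq_iff_eq_or_eq_neg.1 h2 with h | h
  · exfalso
    refine (exists_galConj F).choose_spec (AlgEquiv.ext fun y => ?_)
    obtain ⟨z, rfl⟩ := discLift_surjective hD h1 hx y
    change galConj F _ = _
    rw [quadLift_apply, map_add, map_mul, map_div₀, map_add, h, map_intCast, map_ofNat,
      AlgEquiv.commutes, AlgEquiv.commutes]
    rfl
  · exact h

/-- D is itself an admissible level by `IsFund.cycSq`, and it divides every admissible level by
`CycSq.dvd_of_isFund`. -/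
theorem conductor_eq {F : RealQuad} {x : F.1} (hD : IsFund D) (h1 : D ≠ 1) (hx : x ^ 2 = D) :
    conductor F.1 = D := by
  have hmem : D ∈ {n : ℕ | 0 < n ∧ Nonempty (F.1 →+* CyclotomicField n ℚ)} := by
    refine ⟨Nat.pos_of_ne_zero hD.ne_zero, ?_⟩
    obtain ⟨y, hy⟩ := hD.cycSq
    rw [Int.cast_natCast] at hy
    let e := AlgEquiv.ofBijective (discLift ℚ hD hx)
      ⟨discLift_injective hD h1 hx, discLift_surjective hD h1 hx⟩
    exact ⟨(discLift ℚ hD hy).toRingHom.comp e.symm.toRingEquiv.toRingHom⟩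
  refine le_antisymm (Nat.sInf_le hmem) (le_csInf ⟨D, hmem⟩ ?_)
  rintro n ⟨hn, ⟨f⟩⟩
  have h2 : CycSq n D := ⟨f x, by rw [← map_pow, hx, map_natCast, Int.cast_natCast]⟩
  exact Nat.le_of_dvd hn (h2.dvd_of_isFund hD hn.ne')

theorem isFund_conductor (F : RealQuad) :
    IsFund (conductor F.1) ∧ conductor F.1 ≠ 1 ∧ ∃ x : F.1, x ^ 2 = conductor F.1 := by
  obtain ⟨D, x, hD, h1, -, hx⟩ := exists_sqrt_fund F
  rw [conductor_eq hD h1 hx]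
  exact ⟨hD, h1, x, hx⟩

/-- Inside ℝ both fields are generated over ℚ by a square root of the common conductor, unique up to
sign. -/
theorem le_of_conductor_eq {F F' : RealQuad} (h : conductor F.1 = conductor F'.1) : F.1 ≤ F'.1 := by
  obtain ⟨hD, h1, x, hx⟩ := isFund_conductor F
  obtain ⟨-, -, x', hx'⟩ := isFund_conductor F'
  have hmem : (x : ℝ) ∈ F'.1 := by
    have h2 : (x : ℝ) ^ 2 = (x' : ℝ) ^ 2 := by
      have h3 := congrArg (algebraMap F.1 ℝ) hx
      have h4 := congrArg (algebraMap F'.1 ℝ) hx'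
      rw [map_pow, map_natCast] at h3 h4
      exact h3.trans (h ▸ h4.symm)
    rcases sq_eq_sq_iff_eq_or_eq_neg.1 h2 with h5 | h5
    · rw [h5]; exact x'.2
    · rw [h5]; exact neg_mem x'.2
  intro y hy
  obtain ⟨z, hz⟩ := discLift_surjective hD h1 hx ⟨y, hy⟩
  have h6 : y = (z.re : ℝ) + (z.im : ℝ) * (((((conductor F.1 % 4 : ℕ) : ℤ) : ℝ) + x) / 2) := by
    rw [quadLift_apply] at hz
    have h7 := congrArg (algebraMap F.1 ℝ) hz
    simp only [map_add, map_mul, map_div₀, map_intCast, map_ofNat] at h7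
    simpa using h7.symm
  rw [h6]
  have hq : ∀ q : ℚ, (q : ℝ) ∈ F'.1 := fun q => SubfieldClass.ratCast_mem F'.1 q
  exact add_mem (hq _) (mul_mem (hq _) (div_mem (add_mem (intCast_mem _ _) hmem)
    (ofNat_mem F'.1 2)))

theorem conductor_injective : Function.Injective fun F : RealQuad => conductor F.1 :=
  fun _ _ h => Subtype.ext (le_antisymm (le_of_conductor_eq h) (le_of_conductor_eq h.symm))

theorem exists_conductor_eq (hD : IsFund D) (h1 : D ≠ 1) : ∃ F : RealQuad, conductor F.1 = D := by
  have hx : (√(D : ℝ)) ^ 2 = (D : ℝ) := Real.sq_sqrt (Nat.cast_nonneg D)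
  have := hD.fact_rat h1
  let f := discLift ℚ hD hx
  let F : IntermediateField ℚ ℝ := f.fieldRange
  have hF : Module.finrank ℚ F = 2 := by
    rw [← QuadraticAlgebra.finrank_eq_two (((D / 4 : ℕ) : ℤ) : ℚ) (((D % 4 : ℕ) : ℤ) : ℚ)]
    exact (AlgEquiv.ofInjectiveField f).toLinearEquiv.finrank_eq.symm
  have hmem : √(D : ℝ) ∈ F := by
    refine ⟨⟨-(((D % 4 : ℕ) : ℤ) : ℚ), 2⟩, ?_⟩
    change discLift ℚ hD hx _ = _
    rw [quadLift_apply]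
    simp only [map_neg, map_intCast, map_ofNat]
    ring
  exact ⟨⟨F, hF⟩, conductor_eq (F := ⟨F, hF⟩) (x := ⟨_, hmem⟩) hD h1 (Subtype.ext (by simp))⟩

theorem finite_realQuadBelow (X : ℝ) : (realQuadBelow X).Finite := by
  refine Set.Finite.of_injOn (f := fun F : RealQuad => conductor F.1) (t := Set.Iio ⌈X⌉₊) ?_
    conductor_injective.injOn (Set.finite_Iio _)
  intro F hF
  exact Nat.lt_ceil.2 hF

open Classical in
/-- Sums over real quadratic fields, ordered by the conductor, are sums over fundamental
discriminants. -/
theorem finsum_realQuadBelow (f : ℕ → ℝ) (X : ℝ) :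
    ∑ᶠ F : realQuadBelow X, f (conductor F.1.1) =
      ∑ n ∈ (Finset.Ioc 1 (⌈X⌉₊ - 1)).filter IsFund, f n := by
  have := (finite_realQuadBelow X).fintype
  rw [finsum_eq_sum_of_fintype]
  refine Finset.sum_bij (fun F _ => conductor F.1.1) (fun F _ => ?_) (fun F _ F' _ h => ?_)
    (fun n hn => ?_) (fun F _ => rfl)
  · obtain ⟨hD, h1, -⟩ := isFund_conductor F.1
    -- For a natural number, being less than X means being at most ⌈X⌉₊ - 1; the lower end excludes
    -- the discriminant 1.
    have h2 : conductor F.1.1 < ⌈X⌉₊ := Nat.lt_ceil.2 F.2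
    have h3 := hD.ne_zero
    exact Finset.mem_filter.2 ⟨Finset.mem_Ioc.2 ⟨by omega, by omega⟩, hD⟩
  · exact Subtype.ext (conductor_injective h)
  · obtain ⟨h2, hD⟩ := Finset.mem_filter.1 hn
    obtain ⟨h3, h4⟩ := Finset.mem_Ioc.1 h2
    obtain ⟨F, rfl⟩ := exists_conductor_eq hD (by omega)
    have h5 : conductor F.1 < ⌈X⌉₊ := by omega
    exact ⟨⟨F, Nat.lt_ceil.1 h5⟩, Finset.mem_univ _, rfl⟩

end QuadraticFields

/-! ### Integral elements over ℚ_p in terms of trace and norm -/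

section Integrality

variable {p : ℕ} [Fact p.Prime]

theorem padic_norm_add_le {x y : ℚ_[p]} {r : ℝ} (hx : ‖x‖ ≤ r) (hy : ‖y‖ ≤ r) : ‖x + y‖ ≤ r :=
  (Padic.nonarchimedean x y).trans (max_le hx hy)

theorem padic_norm_sub_le {x y : ℚ_[p]} {r : ℝ} (hx : ‖x‖ ≤ r) (hy : ‖y‖ ≤ r) : ‖x - y‖ ≤ r := by
  rw [sub_eq_add_neg]
  exact padic_norm_add_le hx (by rwa [_root_.norm_neg])

theorem padic_norm_mul_le {x y : ℚ_[p]} (hx : ‖x‖ ≤ 1) (hy : ‖y‖ ≤ 1) : ‖x * y‖ ≤ 1 := by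
  rw [norm_mul]
  exact mul_le_one₀ hx (norm_nonneg _) hy

/-- In valuations: v(d) ≤ 2n + 1 and v(d) + 2v(c) ≥ 0 give v(c) ≥ -n - 1/2, hence v(c) ≥ -n. -/
theorem padic_sq_le_of_mul {d : ℤ} {c : ℚ_[p]} {n : ℕ} (hd : ¬ (p : ℤ) ^ (2 * n + 2) ∣ d)
    (h : ‖(d : ℚ_[p]) * c ^ 2‖ ≤ 1) : ‖c‖ ≤ (p : ℝ) ^ n := by
  have hp0 : (0 : ℝ) < p := Nat.cast_pos.2 (Fact.out : p.Prime).pos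
  have h1 : (p : ℝ) ^ (-((2 * n + 2 : ℕ) : ℤ)) < ‖(d : ℚ_[p])‖ := by
    by_contra! h'
    have h2 := (Padic.norm_int_le_pow_iff_dvd d (2 * n + 2)).1 h'
    exact hd (by exact_mod_cast h2)
  rw [norm_mul, norm_pow] at h
  have h3 : ‖c‖ < (p : ℝ) ^ (n + 1) := by
    by_contra! h'
    have h4 : ((p : ℝ) ^ (n + 1)) ^ 2 ≤ ‖c‖ ^ 2 := pow_le_pow_left₀ (by positivity) h' 2
    have h5 : (p : ℝ) ^ (-((2 * n + 2 : ℕ) : ℤ)) * ((p : ℝ) ^ (n + 1)) ^ 2 = 1 := by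
      rw [zpow_neg, zpow_natCast, ← pow_mul, show (n + 1) * 2 = 2 * n + 2 by ring]
      exact inv_mul_cancel₀ (by positivity)
    have h6 : 0 < ((p : ℝ) ^ (n + 1)) ^ 2 := by positivity
    have h7 := mul_lt_mul_of_pos_right h1 h6
    have h8 := mul_le_mul_of_nonneg_left h4 (norm_nonneg (d : ℚ_[p]))
    linarith
  have h9 := (Padic.norm_le_pow_iff_norm_lt_pow_add_one c n).2 (by exact_mod_cast h3)
  exact_mod_cast h9

/-- Once c₁ is integral, c₀ is a root of a monic quadratic polynomial with integral coefficients. -/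
theorem padic_fst_of_snd {a b : ℤ} {c₀ c₁ : ℚ_[p]} (h1 : ‖c₁‖ ≤ 1)
    (hN : ‖c₀ ^ 2 + b * c₀ * c₁ - a * c₁ ^ 2‖ ≤ 1) : ‖c₀‖ ≤ 1 := by
  by_contra! h
  have hb : ‖(b : ℚ_[p]) * c₁‖ ≤ 1 := padic_norm_mul_le (Padic.norm_int_le_one b) h1
  have ha : ‖(a : ℚ_[p]) * c₁ ^ 2‖ ≤ 1 := padic_norm_mul_le (Padic.norm_int_le_one a)
    (by rw [norm_pow]; exact pow_le_one₀ (norm_nonneg _) h1)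
  have h2 : ‖c₀ ^ 2‖ ≤ ‖c₀‖ := by
    have h3 : c₀ ^ 2 = (c₀ ^ 2 + b * c₀ * c₁ - a * c₁ ^ 2) + (a * c₁ ^ 2 - c₀ * (b * c₁)) := by ring
    rw [h3]
    refine padic_norm_add_le (hN.trans h.le) (padic_norm_sub_le (ha.trans h.le) ?_)
    rw [norm_mul]
    exact mul_le_of_le_one_right (norm_nonneg _) hb
  rw [norm_pow] at h2
  nlinarith

theorem zmod_four_sq_ne : ∀ u w v : ZMod 4, w * v = 1 →
    u ^ 2 ≠ 2 * w ^ 2 ∧ u ^ 2 ≠ 3 * w ^ 2 := by decide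

/-- If c₁ is not integral then w = 2c₁ is a unit, and integrality of the norm gives (2c₀)² ≡ d w²
mod 4. This is impossible, as d is 2 or 3 modulo 4 and the squares modulo 4 are 0 and 1. -/
theorem two_adic_aux [Fact (Nat.Prime 2)] {d : ℕ} (hd : d % 4 = 2 ∨ d % 4 = 3) {c₀ c₁ : ℚ_[2]}
    (ht : ‖2 * c₀‖ ≤ 1) (h2 : ‖2 * c₁‖ ≤ 1) (hN : ‖c₀ ^ 2 - d * c₁ ^ 2‖ ≤ 1) : ‖c₁‖ ≤ 1 := by
  by_contra! h
  have hn2 : ‖(2 : ℚ_[2])‖ = 2⁻¹ := by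
    have := Padic.norm_p (p := 2)
    exact_mod_cast this
  let u : ℤ_[2] := ⟨2 * c₀, ht⟩
  let w : ℤ_[2] := ⟨2 * c₁, h2⟩
  let N : ℤ_[2] := ⟨c₀ ^ 2 - d * c₁ ^ 2, hN⟩
  have huw : u ^ 2 = d * w ^ 2 + 4 * N := by
    apply Subtype.ext
    change (2 * c₀) ^ 2 = d * (2 * c₁) ^ 2 + 4 * (c₀ ^ 2 - d * c₁ ^ 2)
    ring
  have hw : IsUnit w := by
    rw [PadicInt.isUnit_iff]
    refine le_antisymm h2 ?_
    have h3 : (1 : ℝ) < (2 : ℝ) ^ (0 + 1 : ℤ) * ‖(2 : ℚ_[2]) * c₁‖ := by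
      rw [norm_mul, hn2]
      norm_num
      linarith
    by_contra! h4
    have h4' : ‖(2 : ℚ_[2]) * c₁‖ < 1 := h4
    have h5 := (Padic.norm_lt_pow_iff_norm_le_pow_sub_one ((2 : ℚ_[2]) * c₁) 0).1
      (by rwa [zpow_zero])
    norm_num at h3 h5
    linarith
  obtain ⟨v, hv⟩ := hw.exists_right_inv
  have h6 := congrArg (PadicInt.toZModPow (p := 2) 2) huw
  have h7 := congrArg (PadicInt.toZModPow (p := 2) 2) hv
  rw [map_pow, map_add, map_mul, map_mul, map_pow, map_natCast, map_ofNat] at h6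
  rw [map_mul, map_one] at h7
  have h4 : (4 : ZMod (2 ^ 2)) = 0 := by decide
  rw [h4, zero_mul, add_zero] at h6
  have h8 := zmod_four_sq_ne (PadicInt.toZModPow 2 u) (PadicInt.toZModPow 2 w)
    (PadicInt.toZModPow 2 v) h7
  rcases hd with hd | hd
  · refine h8.1 (h6.trans ?_)
    have h9 : ((d : ℕ) : ZMod (2 ^ 2)) = ((2 : ℕ) : ZMod (2 ^ 2)) :=
      (ZMod.natCast_eq_natCast_iff _ _ _).2 hd
    rw [h9]
    rfl
  · refine h8.2 (h6.trans ?_)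
    have h9 : ((d : ℕ) : ZMod (2 ^ 2)) = ((3 : ℕ) : ZMod (2 ^ 2)) :=
      (ZMod.natCast_eq_natCast_iff _ _ _).2 hd
    rw [h9]
    rfl

/-- The identity trace² - 4 · norm = D · c₁² bounds c₁ at once if p² ∤ D. Otherwise p = 2 and 4 ∣ D;
then only 2c₁ is seen to be integral, and `two_adic_aux` removes the factor 2. -/
theorem IsFund.padic_integral {D : ℕ} (hD : IsFund D) {c₀ c₁ : ℚ_[p]}
    (ht : ‖2 * c₀ + (((D % 4 : ℕ) : ℤ) : ℚ_[p]) * c₁‖ ≤ 1)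
    (hN : ‖c₀ ^ 2 + (((D % 4 : ℕ) : ℤ) : ℚ_[p]) * c₀ * c₁ -
      (((D / 4 : ℕ) : ℤ) : ℚ_[p]) * c₁ ^ 2‖ ≤ 1) : ‖c₀‖ ≤ 1 ∧ ‖c₁‖ ≤ 1 := by
  suffices h : ‖c₁‖ ≤ 1 from ⟨padic_fst_of_snd h hN, h⟩
  have hdisc : ‖((D : ℤ) : ℚ_[p]) * c₁ ^ 2‖ ≤ 1 := by
    have h1 : ((D : ℤ) : ℚ_[p]) * c₁ ^ 2 = (2 * c₀ + (((D % 4 : ℕ) : ℤ) : ℚ_[p]) * c₁) ^ 2 -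
        ((4 : ℤ) : ℚ_[p]) * (c₀ ^ 2 + (((D % 4 : ℕ) : ℤ) : ℚ_[p]) * c₀ * c₁ -
          (((D / 4 : ℕ) : ℤ) : ℚ_[p]) * c₁ ^ 2) := by
      have h2 := hD.1.cast_eq ℚ_[p]
      have h3 : ((D : ℤ) : ℚ_[p]) = D := Int.cast_natCast D
      have h4 : ((4 : ℤ) : ℚ_[p]) = 4 := by norm_num
      rw [h3, h4, ← h2]
      ring
    rw [h1]
    refine padic_norm_sub_le ?_ (padic_norm_mul_le (Padic.norm_int_le_one 4) hN)
    rw [norm_pow]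
    exact pow_le_one₀ (norm_nonneg _) ht
  by_cases hp2 : p ^ 2 ∣ D
  · obtain rfl : p = 2 := by
      by_contra h
      exact hD.2 p Fact.out h hp2
    have h4 : D % 4 = 0 := Nat.mod_eq_zero_of_dvd hp2
    have hd : D / 4 % 4 = 2 ∨ D / 4 % 4 = 3 := by
      have := hD.1
      unfold FundTwo at this
      omega
    rw [h4] at ht hN
    have h2 : ‖2 * c₁‖ ≤ 1 := by
      have h16 : ¬ ((2 : ℕ) : ℤ) ^ (2 * 1 + 2) ∣ (D : ℤ) := by
        intro h
        have h5 : 16 ∣ D := by exact_mod_cast h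
        have := hD.1
        unfold FundTwo at this
        omega
      have h6 := padic_sq_le_of_mul h16 hdisc
      have hn2 : ‖(2 : ℚ_[2])‖ = 2⁻¹ := by
        have := Padic.norm_p (p := 2)
        exact_mod_cast this
      rw [norm_mul, hn2]
      norm_num at h6 ⊢
      linarith
    refine two_adic_aux hd (by simpa using ht) h2 ?_
    rw [Int.cast_natCast, Int.cast_natCast] at hN
    simpa only [Nat.cast_zero, zero_mul, add_zero] using hN
  · have h := padic_sq_le_of_mul (n := 0) (d := (D : ℤ)) (by
      intro h
      exact hp2 (by exact_mod_cast h)) hdisc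
    simpa using h

end Integrality

theorem exists_int_of_padic_norm_le {q : ℚ} (h : ∀ (p : ℕ) [Fact p.Prime], ‖(q : ℚ_[p])‖ ≤ 1) :
    ∃ z : ℤ, (z : ℚ) = q := by
  suffices hq : q.den = 1 from ⟨q.num, Rat.coe_int_num_of_den_eq_one hq⟩
  by_contra hden
  obtain ⟨p, hp, hpd⟩ := Nat.exists_prime_and_dvd hden
  have : Fact p.Prime := ⟨hp⟩
  have h1 : ‖((q.den : ℤ) : ℚ_[p])‖ < 1 := Padic.norm_intCast_lt_one_iff.2 (Int.natCast_dvd_natCast.2 hpd)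
  have h2 : (q : ℚ_[p]) * ((q.den : ℤ) : ℚ_[p]) = (q.num : ℚ_[p]) := by
    have h3 := congrArg (Rat.cast : ℚ → ℚ_[p]) (Rat.mul_den_eq_num q)
    push_cast at h3 ⊢
    exact h3
  have h4 : ‖(q.num : ℚ_[p])‖ < 1 := by
    rw [← h2, norm_mul]
    exact (mul_le_of_le_one_left (norm_nonneg _) (h p)).trans_lt h1
  have h5 : (p : ℤ) ∣ q.num := Padic.norm_intCast_lt_one_iff.1 h4
  have h6 := Nat.dvd_gcd (Int.natCast_dvd.1 h5) hpd
  rw [q.reduced] at h6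
  exact hp.one_lt.ne' (Nat.dvd_one.1 h6)

/-! ### The order of discriminant D is the ring of integers -/

section Order

variable {D : ℕ}

/-- The quadratic order of discriminant `D`. -/
abbrev Order (D : ℕ) : Type :=
  QuadraticAlgebra ℤ (((D / 4 : ℕ) : ℤ) : ℤ) (((D % 4 : ℕ) : ℤ) : ℤ)

theorem discLift_rat_eq {K : Type*} [Field K] [CharZero K] [Algebra ℚ K] (hD : IsFund D)
    {x : K} (hx : x ^ 2 = D) (z : Order D) :
    discLift ℚ hD hx ⟨z.re, z.im⟩ = discLift ℤ hD hx z := by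
  rw [quadLift_apply, quadLift_apply]
  simp

theorem isIntegral_discLift {K : Type*} [Field K] [CharZero K] (hD : IsFund D)
    {x : K} (hx : x ^ 2 = D) (z : Order D) : IsIntegral ℤ (discLift ℤ hD hx z) := by
  have : Module.Finite ℤ (Order D) := Module.Finite.of_basis (QuadraticAlgebra.basis _ _)
  exact (Algebra.IsIntegral.isIntegral z).map _

theorem isIntegral_rat {K : Type*} [Field K] [CharZero K] {q : ℚ} (h : IsIntegral ℤ (q : K)) :
    ∃ z : ℤ, (z : ℚ) = q := by
  have h1 : IsIntegral ℤ q := by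
    refine (isIntegral_algHom_iff (Rat.castHom K).toIntAlgHom Rat.cast_injective).1 ?_
    exact h
  exact IsIntegrallyClosed.isIntegral_iff.1 h1

/-- The trace and norm of an integral element are integers. `IsFund.padic_integral` then makes its
coordinates integral at every prime, hence integers. -/
theorem exists_discLift_eq {F : RealQuad} {x : F.1} (hD : IsFund D) (h1 : D ≠ 1)
    (hx : x ^ 2 = D) {y : F.1} (hy : IsIntegral ℤ y) : ∃ z : Order D, discLift ℤ hD hx z = y := by
  obtain ⟨c, rfl⟩ := discLift_surjective hD h1 hx y
  have hstar : discLift ℚ hD hx (star c) = galConj F (discLift ℚ hD hx c) :=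
    quadLift_star _ (galConj F).toAlgHom (galConj_sqrt hD h1 hx) c
  have hy' : IsIntegral ℤ (discLift ℚ hD hx (star c)) := by
    rw [hstar]
    exact hy.map ((galConj F).toAlgHom.restrictScalars ℤ)
  obtain ⟨t, ht⟩ : ∃ t : ℤ, (t : ℚ) = QuadraticAlgebra.trace c := by
    refine isIntegral_rat (K := F.1) ?_
    have h2 := hy.add hy'
    rw [← map_add, ← QuadraticAlgebra.algebraMap_trace_eq_add_star, AlgHom.commutes] at h2
    simpa using h2
  obtain ⟨N, hN⟩ : ∃ N : ℤ, (N : ℚ) = QuadraticAlgebra.norm c := by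
    refine isIntegral_rat (K := F.1) ?_
    have h2 := hy.mul hy'
    rw [← map_mul, ← QuadraticAlgebra.algebraMap_norm_eq_mul_star, AlgHom.commutes] at h2
    simpa using h2
  have key : ∀ (p : ℕ) [Fact p.Prime], ‖(c.re : ℚ_[p])‖ ≤ 1 ∧ ‖(c.im : ℚ_[p])‖ ≤ 1 := by
    intro p _
    refine hD.padic_integral ?_ ?_
    · have h2 := congrArg (Rat.cast : ℚ → ℚ_[p]) ht
      rw [QuadraticAlgebra.trace_def, Rat.cast_intCast] at h2
      have h3 := Padic.norm_int_le_one (p := p) t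
      rw [h2] at h3
      simpa using h3
    · have h2 := congrArg (Rat.cast : ℚ → ℚ_[p]) hN
      rw [QuadraticAlgebra.norm_def, Rat.cast_intCast] at h2
      have h3 := Padic.norm_int_le_one (p := p) N
      rw [h2] at h3
      convert h3 using 2
      push_cast
      ring
  obtain ⟨r, hr⟩ := exists_int_of_padic_norm_le fun p _ => (key p).1
  obtain ⟨s, hs⟩ := exists_int_of_padic_norm_le fun p _ => (key p).2
  refine ⟨⟨r, s⟩, ?_⟩
  rw [← discLift_rat_eq]
  congr 1
  exact QuadraticAlgebra.ext hr hs

end Order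

/-! ### Residue rings of real quadratic fields -/

section Quotients

/-- Two surjective ring homomorphisms with the same kernel have isomorphic targets, compatibly
with involutions. -/
theorem exists_equiv_of_ker {A R R' : Type*} [CommRing A] [CommRing R] [CommRing R']
    {f : A →+* R} {g : A →+* R'} (hf : Function.Surjective f) (hg : Function.Surjective g)
    (hker : ∀ a, f a = 0 ↔ g a = 0) {σ : A → A} {τ : R ≃+* R} {τ' : R' ≃+* R'}
    (hσ : ∀ a, f (σ a) = τ (f a)) (hσ' : ∀ a, g (σ a) = τ' (g a)) :
    ∃ r : R ≃+* R', ∀ x, r (τ x) = τ' (r x) := by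
  have hk : RingHom.ker f = RingHom.ker g := Ideal.ext fun a => hker a
  let e : R ≃+* R' := (RingHom.quotientKerEquivOfSurjective hf).symm.trans
    ((Ideal.quotEquivOfEq hk).trans (RingHom.quotientKerEquivOfSurjective hg))
  have he : ∀ a, e (f a) = g a := fun a => by
    have h1 : (RingHom.quotientKerEquivOfSurjective hf).symm (f a) = Ideal.Quotient.mk _ a := by
      rw [RingEquiv.symm_apply_eq]
      rfl
    simp only [e, RingEquiv.trans_apply, h1]
    rfl
  refine ⟨e, fun x => ?_⟩
  obtain ⟨a, rfl⟩ := hf x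
  rw [← hσ, he, he, hσ']

variable {D : ℕ}

/-- Reduction modulo `m`. -/
def orderToQuadMod (D m : ℕ) : Order D →+* QuadMod m (D / 4 : ℕ) (D % 4 : ℕ) :=
  quadMap (Int.castRingHom (ZMod m)) rfl rfl

theorem orderToQuadMod_surjective (D m : ℕ) : Function.Surjective (orderToQuadMod D m) := by
  intro z
  obtain ⟨r, hr⟩ := ZMod.intCast_surjective z.re
  obtain ⟨s, hs⟩ := ZMod.intCast_surjective z.im
  exact ⟨⟨r, s⟩, QuadraticAlgebra.ext hr hs⟩

theorem orderToQuadMod_eq_zero (D m : ℕ) (z : Order D) :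
    orderToQuadMod D m z = 0 ↔ (m : ℤ) ∣ z.re ∧ (m : ℤ) ∣ z.im := by
  rw [QuadraticAlgebra.ext_iff]
  exact and_congr (ZMod.intCast_zmod_eq_zero_iff_dvd _ _) (ZMod.intCast_zmod_eq_zero_iff_dvd _ _)

theorem orderToQuadMod_star (D m : ℕ) (z : Order D) :
    orderToQuadMod D m (star z) = discConj D m (orderToQuadMod D m z) :=
  quadMap_conj (Int.castRingHom (ZMod m)) rfl rfl z

theorem order_eq_mul {m : ℕ} {z : Order D} (h : (m : ℤ) ∣ z.re ∧ (m : ℤ) ∣ z.im) :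
    ∃ w : Order D, z = m * w := by
  obtain ⟨⟨r, hr⟩, s, hs⟩ := h
  refine ⟨⟨r, s⟩, QuadraticAlgebra.ext ?_ ?_⟩
  · simp [hr]
  · simp [hs]

section Global

variable {F : RealQuad} {x : F.1}

/-- The homomorphism from the quadratic order to the ring of integers. -/
def orderToInt (hD : IsFund D) (hx : x ^ 2 = D) : Order D →+* 𝓞 F.1 :=
  (discLift ℤ hD hx).toRingHom.codRestrict (integralClosure ℤ F.1)
    (fun z => isIntegral_discLift hD hx z)

theorem orderToInt_surjective (hD : IsFund D) (hx : x ^ 2 = D) (h1 : D ≠ 1) : Function.Surjective (orderToInt hD hx) := by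
  intro y
  obtain ⟨z, hz⟩ := exists_discLift_eq hD h1 hx y.2
  exact ⟨z, NumberField.RingOfIntegers.ext hz⟩

theorem orderToInt_injective (hD : IsFund D) (hx : x ^ 2 = D) (h1 : D ≠ 1) : Function.Injective (orderToInt hD hx) := by
  intro z w h
  have h2 := congrArg (algebraMap (𝓞 F.1) F.1) h
  change discLift ℤ hD hx z = discLift ℤ hD hx w at h2
  rw [← discLift_rat_eq, ← discLift_rat_eq] at h2
  have h3 := discLift_injective hD h1 hx h2
  rw [QuadraticAlgebra.ext_iff] at h3 ⊢
  exact ⟨Int.cast_injective h3.1, Int.cast_injective h3.2⟩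

theorem orderToInt_star (hD : IsFund D) (hx : x ^ 2 = D) (h1 : D ≠ 1) (z : Order D) :
    orderToInt hD hx (star z) = galInt (galConj F) (orderToInt hD hx z) := by
  apply NumberField.RingOfIntegers.ext
  exact quadLift_star (sq_eq_of_isFund hD hx) ((galConj F).toAlgHom.restrictScalars ℤ) (galConj_sqrt hD h1 hx) z

/-- The residue ring of a real quadratic field modulo `m` is determined by the discriminant. -/
theorem exists_galQuot_equiv (hD : IsFund D) (hx : x ^ 2 = D) (h1 : D ≠ 1) (m : ℕ) :
    ∃ r : (𝓞 F.1 ⧸ modIdeal F.1 m) ≃+* QuadMod m (D / 4 : ℕ) (D % 4 : ℕ),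
      ∀ y, r (galQuot F.1 m (galConj F) y) = discConj D m (r y) := by
  refine exists_equiv_of_ker (A := Order D) (σ := star)
    (f := (Ideal.Quotient.mk (modIdeal F.1 m)).comp (orderToInt hD hx)) (g := orderToQuadMod D m)
    (Ideal.Quotient.mk_surjective.comp (orderToInt_surjective hD hx h1))
    (orderToQuadMod_surjective D m) (fun z => ?_) (fun z => ?_) (orderToQuadMod_star D m)
  · rw [orderToQuadMod_eq_zero, RingHom.comp_apply, Ideal.Quotient.eq_zero_iff_mem,
      Ideal.mem_span_singleton]
    constructor
    · rintro ⟨y, hy⟩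
      obtain ⟨w, rfl⟩ := orderToInt_surjective hD hx h1 y
      rw [← map_natCast (orderToInt hD hx), ← map_mul] at hy
      have h2 := orderToInt_injective hD hx h1 hy
      rw [h2]
      exact ⟨⟨w.re, by simp⟩, ⟨w.im, by simp⟩⟩
    · intro h
      obtain ⟨w, rfl⟩ := order_eq_mul h
      exact ⟨orderToInt hD hx w, by rw [map_mul, map_natCast]⟩
  · rw [RingHom.comp_apply, orderToInt_star hD hx h1]
    rfl

end Global

end Quotients

/-! ### Quadratic algebras of non-zero discriminant are étale -/

section QuadraticEtale

variable {K : Type} [Field K] {a b : K}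

/-- At a root u the derivative 2u - b has square b² + 4a, which is invertible, so two roots that
agree modulo a square-zero ideal are equal. -/
theorem lift_root_unique {B : Type*} [CommRing B] [Algebra K B] {I : Ideal B} (hI : I ^ 2 = ⊥)
    (hd : b ^ 2 + 4 * a ≠ 0) {u v : B} (huv : u - v ∈ I)
    (hu : u * u = algebraMap K B a + algebraMap K B b * u)
    (hv : v * v = algebraMap K B a + algebraMap K B b * v) : u = v := by
  have h1 : (u - v) * (u - v) = 0 := by
    have := Ideal.mul_mem_mul huv huv
    rwa [← pow_two, hI, Ideal.mem_bot] at this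
  set d := b ^ 2 + 4 * a with hdef
  have h2 : algebraMap K B d = (algebraMap K B b) ^ 2 + 4 * algebraMap K B a := by
    rw [hdef, map_add, map_mul, map_pow, map_ofNat]
  have h3 : algebraMap K B d * (u - v) = 0 := by
    rw [h2]
    linear_combination (u - v) * (-4) * hu + (2 * u - algebraMap K B b) * (hu - hv) +
      (2 * u - algebraMap K B b) * h1
  have h4 : algebraMap K B d⁻¹ * algebraMap K B d = 1 := by
    rw [← map_mul, inv_mul_cancel₀ hd, map_one]
  have h5 : u - v = 0 := by
    calc u - v = algebraMap K B d⁻¹ * (algebraMap K B d * (u - v)) := by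
          rw [← mul_assoc, h4, one_mul]
      _ = 0 := by rw [h3, mul_zero]
  exact sub_eq_zero.1 h5

theorem lift_root_exists {B : Type*} [CommRing B] [Algebra K B] {I : Ideal B} (hI : I ^ 2 = ⊥)
    (hd : b ^ 2 + 4 * a ≠ 0) {u : B}
    (hu : u * u - (algebraMap K B a + algebraMap K B b * u) ∈ I) :
    ∃ v : B, v - u ∈ I ∧ v * v = algebraMap K B a + algebraMap K B b * v := by
  set e := u * u - (algebraMap K B a + algebraMap K B b * u) with he
  have h1 : e * e = 0 := by
    have := Ideal.mul_mem_mul hu hu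
    rwa [← pow_two, hI, Ideal.mem_bot] at this
  set d := b ^ 2 + 4 * a with hdef
  set i := algebraMap K B d⁻¹ with hi
  have h2 : algebraMap K B d = (algebraMap K B b) ^ 2 + 4 * algebraMap K B a := by
    rw [hdef, map_add, map_mul, map_pow, map_ofNat]
  have h4 : i * ((algebraMap K B b) ^ 2 + 4 * algebraMap K B a) = 1 := by
    rw [← h2, hi, ← map_mul, inv_mul_cancel₀ hd, map_one]
  -- One Newton step. Since (2u - b)² = d + 4e with d the discriminant, (2u - b) · d⁻¹ inverts the
  -- derivative modulo the ideal, and e² = 0 makes one step sufficient.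
  refine ⟨u - e * ((2 * u - algebraMap K B b) * i), ?_, ?_⟩
  · rw [sub_sub_cancel_left]
    exact neg_mem (Ideal.mul_mem_right _ _ hu)
  · linear_combination (-1 : B) * he + (2 * u - algebraMap K B b) ^ 2 * i * i * h1 - 4 * i * h1 -
      e * h4 + 4 * i * e * he

/-- Homomorphisms from the algebra are roots of its defining polynomial, and roots lift uniquely
along square-zero ideals. -/
theorem quadraticAlgebra_etale (hd : b ^ 2 + 4 * a ≠ 0) :
    Algebra.Etale K (QuadraticAlgebra K a b) := by
  have h1 : Algebra.FormallyEtale K (QuadraticAlgebra K a b) := by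
    rw [Algebra.FormallyEtale.iff_comp_bijective]
    intro B _ _ I hI
    have hroot : ∀ (C : Type) [CommRing C] [Algebra K C] (f : QuadraticAlgebra K a b →ₐ[K] C),
        f QuadraticAlgebra.omega * f QuadraticAlgebra.omega =
          algebraMap K C a + algebraMap K C b * f QuadraticAlgebra.omega := by
      intro C _ _ f
      rw [← map_mul, QuadraticAlgebra.omega_mul_omega_eq_add, map_add, map_smul, map_smul, map_one,
        Algebra.smul_def, Algebra.smul_def, mul_one]
    constructor
    · intro f g hfg
      refine QuadraticAlgebra.algHom_ext ?_
      refine lift_root_unique hI hd ?_ (hroot B f) (hroot B g)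
      rw [← Ideal.Quotient.eq]
      exact DFunLike.congr_fun hfg _
    · intro f
      obtain ⟨u, hu⟩ := Ideal.Quotient.mk_surjective (f QuadraticAlgebra.omega)
      have hr := hroot _ f
      rw [← hu] at hr
      obtain ⟨v, hv, hv'⟩ := lift_root_exists (u := u) hI hd (by
        rw [← Ideal.Quotient.eq, map_mul, hr, map_add, map_mul]
        rfl)
      refine ⟨QuadraticAlgebra.lift ⟨v, by
        rw [hv', Algebra.smul_def, Algebra.smul_def, mul_one]⟩, ?_⟩
      refine QuadraticAlgebra.algHom_ext ?_
      change Ideal.Quotient.mk I (QuadraticAlgebra.lift _ QuadraticAlgebra.omega) = _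
      rw [← hu, Ideal.Quotient.eq]
      simpa using hv
  have : Module.Finite K (QuadraticAlgebra K a b) :=
    Module.Finite.of_basis (QuadraticAlgebra.basis _ _)
  exact { formallyEtale := h1, finitePresentation := Algebra.FinitePresentation.of_finiteType.1 inferInstance }

end QuadraticEtale

/-! ### The local algebras attached to a fundamental discriminant -/

section DiscriminantData

variable {D : ℕ}

/-- The quadratic algebra of discriminant `D`. -/
abbrev DiscAlg (K : Type*) [CommRing K] (D : ℕ) : Type _ :=
  QuadraticAlgebra K (((D / 4 : ℕ) : ℤ) : K) (((D % 4 : ℕ) : ℤ) : K)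

/-- The non-trivial automorphism of a quadratic algebra. -/
def quadConjAlg {K : Type*} [CommRing K] (a b : K) :
    QuadraticAlgebra K a b ≃ₐ[K] QuadraticAlgebra K a b :=
  { quadConj a b with
    commutes' := fun r => by
      change star (algebraMap K (QuadraticAlgebra K a b) r) = _
      ext <;> simp [QuadraticAlgebra.algebraMap_eq] }

theorem quadConjAlg_apply {K : Type*} [CommRing K] (a b : K) (z : QuadraticAlgebra K a b) :
    quadConjAlg a b z = star z := rfl

/-- The choice of the étale algebras `ℚ_p ⊗ F`, where `F` has discriminant `D`. -/
def discData (m : ℕ) (hD : IsFund D) : LocalData m where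
  A p := DiscAlg ℚ_[p] D
  etale p := quadraticAlgebra_etale (by
    rw [hD.1.cast_eq]
    exact Nat.cast_ne_zero.2 hD.ne_zero)
  finrank_eq p := QuadraticAlgebra.finrank_eq_two _ _
  conj p := quadConjAlg _ _
  conj_ne p h := by
    have h1 := congrArg QuadraticAlgebra.im (DFunLike.congr_fun h QuadraticAlgebra.omega)
    rw [quadConjAlg_apply, QuadraticAlgebra.im_star] at h1
    change -(1 : ℚ_[p]) = 1 at h1
    norm_num at h1

end DiscriminantData

/-! ### The local maximal orders and their residue rings -/

section LocalOrder

theorem _root_.QuadraticAlgebra.eq_algebraMap_add_mul_omega {K : Type*} [CommRing K] {a b : K}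
    (z : QuadraticAlgebra K a b) :
    z = algebraMap K _ z.re + algebraMap K _ z.im * QuadraticAlgebra.omega := by
  ext <;> simp [QuadraticAlgebra.algebraMap_eq]

theorem _root_.QuadraticAlgebra.re_sq_add_mul_sub_eq_norm {K : Type*} [CommRing K] {a b : K}
    (z : QuadraticAlgebra K a b) :
    z.re ^ 2 + b * z.re * z.im - a * z.im ^ 2 = QuadraticAlgebra.norm z := by
  rw [QuadraticAlgebra.norm_def]
  ring

theorem _root_.QuadraticAlgebra.algebraMap_mul_re {K : Type*} [CommRing K] {a b : K} (c : K)
    (z : QuadraticAlgebra K a b) : (algebraMap K _ c * z).re = c * z.re := by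
  simp [QuadraticAlgebra.algebraMap_eq]

theorem _root_.QuadraticAlgebra.algebraMap_mul_im {K : Type*} [CommRing K] {a b : K} (c : K)
    (z : QuadraticAlgebra K a b) : (algebraMap K _ c * z).im = c * z.im := by
  simp [QuadraticAlgebra.algebraMap_eq]

variable {D m : ℕ} (hD : IsFund D)

/-- The homomorphism from the quadratic order to its completion. -/
def orderToLocal (p : m.primeFactors) : Order D →+* (discData m hD).A p :=
  (quadMap (Int.castRingHom ℚ_[p]) rfl rfl : Order D →+* DiscAlg ℚ_[p] D)

/-- The coordinates of an element of the local algebra. -/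
def localRe {hD : IsFund D} {p : m.primeFactors} (y : (discData m hD).A p) : ℚ_[p] :=
  QuadraticAlgebra.re (y : DiscAlg ℚ_[p] D)

/-- The second coordinate of an element of the local algebra. -/
def localIm {hD : IsFund D} {p : m.primeFactors} (y : (discData m hD).A p) : ℚ_[p] :=
  QuadraticAlgebra.im (y : DiscAlg ℚ_[p] D)

theorem norm_le_of_isIntegral {p : m.primeFactors} {t : ℚ_[p]}
    (h : IsIntegral ℤ_[p] (algebraMap ℚ_[p] ((discData m hD).A p) t)) : ‖t‖ ≤ 1 := by
  have h1 : IsIntegral ℤ_[p] t :=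
    (isIntegral_algebraMap_iff (R := ℤ_[p]) (B := (discData m hD).A p)
      (QuadraticAlgebra.C_injective)).1 h
  obtain ⟨z, rfl⟩ := IsIntegrallyClosed.isIntegral_iff.1 h1
  exact z.2

theorem isIntegral_orderToLocal (p : m.primeFactors) (z : Order D) :
    IsIntegral ℤ_[p] (orderToLocal hD p z) := by
  have : Module.Finite ℤ (Order D) := Module.Finite.of_basis (QuadraticAlgebra.basis _ _)
  have h : IsIntegral ℤ (orderToLocal hD p z) :=
    (Algebra.IsIntegral.isIntegral z).map (orderToLocal hD p).toIntAlgHom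
  exact h.tower_top

/-- Trace and norm of an integral element are integral, so `IsFund.padic_integral` applies. The
local maximal order is thus ℤ_p[ω], with the same ω as in the global order. -/
theorem isIntegral_local_iff (p : m.primeFactors) (y : (discData m hD).A p) :
    IsIntegral ℤ_[p] y ↔ ‖localRe y‖ ≤ 1 ∧ ‖localIm y‖ ≤ 1 := by
  constructor
  · intro hy
    have hy' : IsIntegral ℤ_[p] ((discData m hD).conj p y) :=
      hy.map (((discData m hD).conj p).restrictScalars ℤ_[p])
    refine hD.padic_integral ?_ ?_
    · refine norm_le_of_isIntegral hD ?_
      have h1 : algebraMap ℚ_[p] ((discData m hD).A p)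
          (2 * localRe y + (((D % 4 : ℕ) : ℤ) : ℚ_[p]) * localIm y) =
          y + (discData m hD).conj p y :=
        QuadraticAlgebra.algebraMap_trace_eq_add_star (y : DiscAlg ℚ_[p] D)
      rw [h1]
      exact hy.add hy'
    · refine norm_le_of_isIntegral hD ?_
      have h2 : localRe y ^ 2 + (((D % 4 : ℕ) : ℤ) : ℚ_[p]) * localRe y * localIm y -
          (((D / 4 : ℕ) : ℤ) : ℚ_[p]) * localIm y ^ 2 =
          QuadraticAlgebra.norm (y : DiscAlg ℚ_[p] D) :=
        QuadraticAlgebra.re_sq_add_mul_sub_eq_norm (y : DiscAlg ℚ_[p] D)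
      rw [h2]
      have h1 : algebraMap ℚ_[p] ((discData m hD).A p)
          (QuadraticAlgebra.norm (y : DiscAlg ℚ_[p] D)) = y * (discData m hD).conj p y :=
        QuadraticAlgebra.algebraMap_norm_eq_mul_star (y : DiscAlg ℚ_[p] D)
      rw [h1]
      exact hy.mul hy'
  · rintro ⟨h0, h1⟩
    have h2 : y = algebraMap ℤ_[p] _ ⟨localRe y, h0⟩ +
        algebraMap ℤ_[p] _ ⟨localIm y, h1⟩ * orderToLocal hD p QuadraticAlgebra.omega := by
      have h3 : orderToLocal hD p QuadraticAlgebra.omega =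
          (QuadraticAlgebra.omega : DiscAlg ℚ_[p] D) :=
        QuadraticAlgebra.ext (by exact Int.cast_zero) (by exact Int.cast_one)
      rw [h3]
      exact QuadraticAlgebra.eq_algebraMap_add_mul_omega (y : DiscAlg ℚ_[p] D)
    rw [h2]
    exact isIntegral_algebraMap.add (isIntegral_algebraMap.mul (isIntegral_orderToLocal hD p _))

/-- The diagonal homomorphism from the quadratic order. -/
def orderToOA (m : ℕ) : Order D →+* (discData m hD).OA :=
  RingHom.pi fun p => (orderToLocal hD p).codRestrict (integralClosure ℤ_[p] _)
    (isIntegral_orderToLocal hD p)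

theorem orderToOA_star (z : Order D) :
    orderToOA hD m (star z) = (discData m hD).conjOA (orderToOA hD m z) := by
  funext p
  apply Subtype.ext
  exact quadMap_conj (Int.castRingHom ℚ_[p]) rfl rfl z

theorem norm_natCast_eq_pow (p : m.primeFactors) :
    ‖(m : ℚ_[p])‖ = ((p : ℕ) : ℝ) ^ (-(m.factorization p : ℤ)) := by
  have hm : m ≠ 0 := fun h => by
    have := p.2
    simp [h] at this
  rw [Padic.norm_eq_zpow_neg_valuation (Nat.cast_ne_zero.2 hm), Padic.valuation_natCast,
    Nat.factorization_def _ (Fact.out : (p : ℕ).Prime)]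

/-- The Chinese remainder theorem approximates all c p at once to the precision given by m. It makes
the map from the global order to the product of local orders modulo m surjective. -/
theorem exists_int_approx (hm : m ≠ 0) {c : ∀ p : m.primeFactors, ℚ_[p]}
    (hc : ∀ p, ‖c p‖ ≤ 1) : ∃ n : ℤ, ∀ p, ‖c p - n‖ ≤ ‖(m : ℚ_[p])‖ := by
  obtain ⟨n, hn⟩ := ZMod.intCast_surjective ((ZMod.equivPi m hm).symm fun p =>
    ((PadicInt.appr (⟨c p, hc p⟩ : ℤ_[p]) (m.factorization p) : ℕ) : ZMod _))
  refine ⟨n, fun p => ?_⟩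
  rw [RingEquiv.eq_symm_apply, map_intCast] at hn
  have h1 := congrFun hn p
  rw [Pi.intCast_apply] at h1
  have h2 := PadicInt.appr_spec (m.factorization p) (⟨c p, hc p⟩ : ℤ_[p])
  rw [← PadicInt.norm_le_pow_iff_mem_span_pow] at h2
  set k := PadicInt.appr (⟨c p, hc p⟩ : ℤ_[p]) (m.factorization p)
  have h3 : (((p : ℕ) ^ m.factorization p : ℕ) : ℤ) ∣ (k : ℤ) - n := by
    rw [← ZMod.intCast_zmod_eq_zero_iff_dvd, Int.cast_sub, h1, Int.cast_natCast, sub_self]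
  rw [Nat.cast_pow, ← Padic.norm_int_le_pow_iff_dvd] at h3
  rw [norm_natCast_eq_pow]
  have h4 : c p - n = (c p - k) + (((k : ℤ) - n : ℤ) : ℚ_[p]) := by push_cast; ring
  rw [h4]
  refine (Padic.nonarchimedean _ _).trans (max_le ?_ h3)
  have h5 : ‖(show ℤ_[p] from ⟨c p, hc p⟩) - (k : ℤ_[p])‖ = ‖c p - k‖ := by
    rw [PadicInt.norm_def, PadicInt.coe_sub, PadicInt.coe_natCast]
  exact h5.symm.trans_le h2

theorem int_dvd_of_norm_le (hm : m ≠ 0) {n : ℤ}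
    (h : ∀ p : m.primeFactors, ‖(n : ℚ_[p])‖ ≤ ‖(m : ℚ_[p])‖) : (m : ℤ) ∣ n := by
  have h0 : m ∣ n.natAbs := by
    rw [Nat.dvd_iff_prime_pow_dvd_dvd]
    intro q k hq hk
    rcases Nat.eq_zero_or_pos k with rfl | hk0
    · simp
    have hqm : q ∈ m.primeFactors :=
      Nat.mem_primeFactors.2 ⟨hq, (dvd_pow_self q hk0.ne').trans hk, hm⟩
    have h1 := h ⟨q, hqm⟩
    rw [norm_natCast_eq_pow] at h1
    change _ ≤ (q : ℝ) ^ _ at h1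
    have : Fact q.Prime := ⟨hq⟩
    have h2 := (Padic.norm_int_le_pow_iff_dvd (p := q) n (m.factorization q)).1 h1
    have h3 : k ≤ m.factorization q := (hq.pow_dvd_iff_le_factorization hm).1 hk
    have h4 : ((q ^ k : ℕ) : ℤ) ∣ n := by
      push_cast
      exact (pow_dvd_pow _ h3).trans h2
    exact Int.natCast_dvd.1 h4
  exact Int.natCast_dvd.2 h0

/-- The residue ring of the local maximal orders is determined by the discriminant. -/
theorem exists_localR_equiv (m : ℕ) [NeZero m] :
    ∃ r : (discData m hD).R ≃+* QuadMod m (D / 4 : ℕ) (D % 4 : ℕ),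
      ∀ y, r ((discData m hD).conjR y) = discConj D m (r y) := by
  refine exists_equiv_of_ker (A := Order D) (σ := star)
    (f := (Ideal.Quotient.mk (Ideal.span {(m : (discData m hD).OA)})).comp (orderToOA hD m))
    (g := orderToQuadMod D m) ?_
    (orderToQuadMod_surjective D m) (fun z => ?_) (fun z => ?_) (orderToQuadMod_star D m)
  · intro y
    obtain ⟨y, rfl⟩ := Ideal.Quotient.mk_surjective y
    have hy := fun p => (isIntegral_local_iff hD p (y p : (discData m hD).A p)).1 (y p).2
    obtain ⟨n₀, h₀⟩ := exists_int_approx (NeZero.ne m) fun p => (hy p).1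
    obtain ⟨n₁, h₁⟩ := exists_int_approx (NeZero.ne m) fun p => (hy p).2
    refine ⟨⟨n₀, n₁⟩, ?_⟩
    rw [RingHom.comp_apply, eq_comm, Ideal.Quotient.eq, Ideal.mem_span_singleton]
    have hw : ∀ p : m.primeFactors, IsIntegral ℤ_[p]
        (algebraMap ℚ_[p] ((discData m hD).A p) (m : ℚ_[p])⁻¹ *
          ((y p : (discData m hD).A p) - orderToLocal hD p ⟨n₀, n₁⟩)) := by
      intro p
      have hpos : 0 < ‖(m : ℚ_[p])‖ := norm_pos_iff.2 (Nat.cast_ne_zero.2 (NeZero.ne m))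
      rw [isIntegral_local_iff]
      constructor
      · have h2 : localRe (algebraMap ℚ_[p] ((discData m hD).A p) (m : ℚ_[p])⁻¹ *
            ((y p : (discData m hD).A p) - orderToLocal hD p ⟨n₀, n₁⟩)) =
            (m : ℚ_[p])⁻¹ * (localRe (y p : (discData m hD).A p) - n₀) :=
          QuadraticAlgebra.algebraMap_mul_re _ _
        rw [h2, norm_mul, norm_inv, inv_mul_le_one₀ hpos]
        exact h₀ p
      · have h2 : localIm (algebraMap ℚ_[p] ((discData m hD).A p) (m : ℚ_[p])⁻¹ *
            ((y p : (discData m hD).A p) - orderToLocal hD p ⟨n₀, n₁⟩)) =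
            (m : ℚ_[p])⁻¹ * (localIm (y p : (discData m hD).A p) - n₁) :=
          QuadraticAlgebra.algebraMap_mul_im _ _
        rw [h2, norm_mul, norm_inv, inv_mul_le_one₀ hpos]
        exact h₁ p
    refine ⟨fun p => ⟨_, hw p⟩, ?_⟩
    funext p
    apply Subtype.ext
    change (y p : (discData m hD).A p) - orderToLocal hD p ⟨n₀, n₁⟩ =
      ((m : integralClosure ℤ_[p] ((discData m hD).A p)) : (discData m hD).A p) * _
    rw [← mul_assoc]
    have h3 : ((m : integralClosure ℤ_[p] ((discData m hD).A p)) : (discData m hD).A p) =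
        algebraMap ℚ_[p] ((discData m hD).A p) m := by simp
    rw [h3, ← map_mul, mul_inv_cancel₀ (Nat.cast_ne_zero.2 (NeZero.ne m)), map_one, one_mul]
  · rw [orderToQuadMod_eq_zero, RingHom.comp_apply, Ideal.Quotient.eq_zero_iff_mem,
      Ideal.mem_span_singleton]
    constructor
    · rintro ⟨w, hw⟩
      have hw' : ∀ p : m.primeFactors, orderToLocal hD p z =
          algebraMap ℚ_[p] ((discData m hD).A p) m * (w p : (discData m hD).A p) := by
        intro p
        have h1 := congrArg Subtype.val (congrFun hw p)
        refine h1.trans ?_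
        change ((m : integralClosure ℤ_[p] ((discData m hD).A p)) : (discData m hD).A p) * _ = _
        congr 1
      have hi := fun p => (isIntegral_local_iff hD p (w p : (discData m hD).A p)).1 (w p).2
      constructor
      · refine int_dvd_of_norm_le (NeZero.ne m) fun p => ?_
        have h2 : (z.re : ℚ_[p]) = m * localRe (w p : (discData m hD).A p) :=
          (congrArg localRe (hw' p)).trans (QuadraticAlgebra.algebraMap_mul_re _ _)
        rw [h2, norm_mul]
        exact mul_le_of_le_one_right (norm_nonneg _) (hi p).1
      · refine int_dvd_of_norm_le (NeZero.ne m) fun p => ?_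
        have h2 : (z.im : ℚ_[p]) = m * localIm (w p : (discData m hD).A p) :=
          (congrArg localIm (hw' p)).trans (QuadraticAlgebra.algebraMap_mul_im _ _)
        rw [h2, norm_mul]
        exact mul_le_of_le_one_right (norm_nonneg _) (hi p).2
    · intro h
      obtain ⟨w, rfl⟩ := order_eq_mul h
      exact ⟨orderToOA hD m w, by rw [map_mul, map_natCast]⟩
  · rw [RingHom.comp_apply, orderToOA_star]
    rfl

end LocalOrder

/-! ### Finiteness of the ray class group -/

section Finiteness

open IsDedekindDomain NumberField

variable {F : Type} [Field F] [NumberField F] {m : ℕ}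

/-- The denominator ideal J' is coprime to m and so contains some d ≡ 1 mod m; multiplying by it
makes α integral without changing its class modulo m. -/
theorem exists_mul_eq_of_mem_idCoprime {α : Fˣ} (h : toPrincipalIdeal (𝓞 F) F α ∈ idCoprime F m) :
    ∃ d a : 𝓞 F, d - 1 ∈ modIdeal F m ∧ (d : F) * α = a := by
  obtain ⟨J, J', -, -, -, h4, h5⟩ := h
  obtain ⟨d, hd, x, hx, hdx⟩ := Ideal.isCoprime_iff_exists.1 h4
  have h6 : (d : F) ∈ (J' : FractionalIdeal (𝓞 F)⁰ F) :=
    (FractionalIdeal.mem_coeIdeal _).2 ⟨d, hd, rfl⟩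
  have h7 : (α : F) ∈ ((toPrincipalIdeal (𝓞 F) F α : Frac F) : FractionalIdeal (𝓞 F)⁰ F) := by
    rw [coe_toPrincipalIdeal]
    exact FractionalIdeal.mem_spanSingleton_self _ _
  have h8 := FractionalIdeal.mul_mem_mul h7 h6
  rw [h5] at h8
  obtain ⟨a, -, ha⟩ := (FractionalIdeal.mem_coeIdeal _).1 h8
  refine ⟨d, a, ?_, by rw [mul_comm]; exact ha.symm⟩
  rw [← hdx, sub_add_cancel_left]
  exact neg_mem hx

theorem valuation_le_of_mem_modIdeal {x : 𝓞 F} (hx : x ∈ modIdeal F m)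
    (v : HeightOneSpectrum (𝓞 F)) : v.valuation F (x : F) ≤ v.valuation F (m : F) := by
  obtain ⟨y, rfl⟩ := Ideal.mem_span_singleton.1 hx
  rw [RingOfIntegers.coe_eq_algebraMap, map_mul, map_natCast, map_mul]
  exact mul_le_of_le_one_right' (v.valuation_le_one y)

theorem valuation_eq_one_of_sub_mem {v : HeightOneSpectrum (𝓞 F)} (hv : (m : 𝓞 F) ∈ v.asIdeal)
    {d : 𝓞 F} (hd : d - 1 ∈ modIdeal F m) : v.valuation F (d : F) = 1 := by
  refine valuation_eq_one_of F m hv ?_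
  have := valuation_le_of_mem_modIdeal hd v
  rwa [RingOfIntegers.coe_eq_algebraMap, map_sub, map_one] at this

theorem valuation_eq_one_of_mem_idCoprime {α : Fˣ}
    (h : toPrincipalIdeal (𝓞 F) F α ∈ idCoprime F m) {v : HeightOneSpectrum (𝓞 F)}
    (hv : (m : 𝓞 F) ∈ v.asIdeal) : v.valuation F (α : F) = 1 := by
  have key : ∀ β : Fˣ, toPrincipalIdeal (𝓞 F) F β ∈ idCoprime F m →
      v.valuation F (β : F) ≤ 1 := by
    intro β hβ
    obtain ⟨d, a, hd, ha⟩ := exists_mul_eq_of_mem_idCoprime hβ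
    have h1 := v.valuation_le_one (K := F) a
    change v.valuation F (a : F) ≤ 1 at h1
    rwa [← ha, map_mul, valuation_eq_one_of_sub_mem hv hd, one_mul] at h1
  refine le_antisymm (key α h) ?_
  have h2 := key α⁻¹ (by rw [map_inv]; exact inv_mem h)
  rw [Units.val_inv_eq_inv_val, map_inv₀] at h2
  exact (inv_le_one₀ (zero_lt_iff.2 ((Valuation.ne_zero_iff _).2 α.ne_zero))).1 h2

/-- As the denominators d and e are congruent to 1, the numerators a and b modulo m decide whether α
and β agree modulo F¹(m). -/
theorem inv_mul_mem_rayUnits {α β : Fˣ} (hα : toPrincipalIdeal (𝓞 F) F α ∈ idCoprime F m)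
    {d a e b : 𝓞 F} (hd : d - 1 ∈ modIdeal F m) (ha : (d : F) * α = a)
    (he : e - 1 ∈ modIdeal F m) (hb : (e : F) * β = b) (hab : a - b ∈ modIdeal F m) :
    α⁻¹ * β ∈ rayUnits F m := by
  intro v hv
  have h1 : (((α⁻¹ * β : Fˣ) : F) - 1) * ((d : F) * e * α) = ((d * b - e * a : 𝓞 F) : F) := by
    have h0 : (α : F) ≠ 0 := α.ne_zero
    rw [RingOfIntegers.coe_eq_algebraMap (d * b - e * a), map_sub, map_mul, map_mul,
      ← RingOfIntegers.coe_eq_algebraMap a, ← RingOfIntegers.coe_eq_algebraMap b, ← ha, ← hb,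
      Units.val_mul, Units.val_inv_eq_inv_val]
    field_simp
  have h2 : d * b - e * a ∈ modIdeal F m := by
    have : d * b - e * a = (d - 1) * b - (e - 1) * a - (a - b) := by ring
    rw [this]
    exact sub_mem (sub_mem (Ideal.mul_mem_right _ _ hd) (Ideal.mul_mem_right _ _ he)) hab
  have h3 := valuation_le_of_mem_modIdeal h2 v
  rwa [← h1, map_mul, map_mul, map_mul, valuation_eq_one_of_sub_mem hv hd,
    valuation_eq_one_of_sub_mem hv he, valuation_eq_one_of_mem_idCoprime hα hv, one_mul, mul_one,
    mul_one] at h3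

variable (F m) in
-- The map to the finite class group has a kernel consisting of principal ideals, whose classes are
-- separated by the residues of the numerators in the finite ring 𝓞 F / m. Finiteness makes the
-- torsion count positive, which rules out the degenerate case of the model.
theorem finite_rayClassGroup [NeZero m] : Finite (RayClassGroup F m) := by
  have hne : modIdeal F m ≠ ⊥ := by
    rw [Ne, Ideal.span_singleton_eq_bot]
    exact_mod_cast NeZero.ne m
  have := Ideal.finiteQuotientOfFreeOfNeBot (modIdeal F m) hne
  let N := ((rayUnits F m).map (toPrincipalIdeal (𝓞 F) F)).subgroupOf (idCoprime F m)
  have hfin : Finite (Frac F ⧸ (toPrincipalIdeal (𝓞 F) F).range) :=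
    Finite.of_equiv _ (ClassGroup.equiv (R := 𝓞 F) F).toEquiv
  let c : idCoprime F m →* Frac F ⧸ (toPrincipalIdeal (𝓞 F) F).range :=
    (QuotientGroup.mk' _).comp (idCoprime F m).subtype
  have hK : ∀ k : c.ker, ∃ (α : Fˣ) (d a : 𝓞 F), toPrincipalIdeal (𝓞 F) F α = k.1.1 ∧
      d - 1 ∈ modIdeal F m ∧ (d : F) * α = a := by
    rintro ⟨k, hk⟩
    obtain ⟨α, hα⟩ := (QuotientGroup.eq_one_iff (k : Frac F)).1 hk
    obtain ⟨d, a, hd, ha⟩ := exists_mul_eq_of_mem_idCoprime (α := α) (by rw [hα]; exact k.2)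
    exact ⟨α, d, a, hα, hd, ha⟩
  choose α d a hα hd ha using hK
  have h1 : Finite (c.ker ⧸ N.subgroupOf c.ker) := by
    refine Finite.of_injective (β := 𝓞 F ⧸ modIdeal F m)
      (fun q => Ideal.Quotient.mk _ (a q.out)) fun q q' h => ?_
    rw [← Quotient.out_eq q, ← Quotient.out_eq q']
    refine QuotientGroup.eq.2 ?_
    refine Subgroup.mem_subgroupOf.2 (Subgroup.mem_subgroupOf.2 ⟨(α q.out)⁻¹ * α q'.out, ?_, ?_⟩)
    · exact inv_mul_mem_rayUnits (by rw [hα]; exact (q.out).1.2) (hd _) (ha _) (hd _) (ha _)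
        (Ideal.Quotient.eq.1 h)
    · rw [map_mul, map_inv, hα, hα]
      rfl
  have h2 : N.relIndex c.ker ≠ 0 := Nat.card_ne_zero.2 ⟨inferInstance, h1⟩
  have h3 : c.ker.relIndex ⊤ ≠ 0 := by
    rw [Subgroup.relIndex_top_right, Subgroup.index_ker]
    exact Nat.card_ne_zero.2 ⟨inferInstance, inferInstance⟩
  have h4 := Subgroup.relIndex_ne_zero_trans h2 h3
  rw [Subgroup.relIndex_top_right] at h4
  exact Nat.finite_of_card_ne_zero h4

end Finiteness

/-! ### Averages over finitely many classes -/

section Averages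

/-- If the averages of `g` over all members of every class of a finite partition tend to the values
of a class function, then `g` and that class function have the same average. -/
theorem tendsto_average_of_classes {ι K : Type*} [Fintype K] [DecidableEq K] (κ : ι → K)
    (T : ℝ → Finset ι) (g : ι → ℝ) (e : K → ℝ) {L : ℝ}
    (h : ∀ k, Filter.Tendsto (fun X => (∑ i ∈ (T X).filter (κ · = k), g i) /
      (((T X).filter (κ · = k)).card : ℝ)) Filter.atTop (nhds (e k)))
    (he : Filter.Tendsto (fun X => (∑ i ∈ T X, e (κ i)) / ((T X).card : ℝ)) Filter.atTop
      (nhds L)) :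
    Filter.Tendsto (fun X => (∑ i ∈ T X, g i) / ((T X).card : ℝ)) Filter.atTop (nhds L) := by
  -- The two averages differ by the errors of the classes, weighted by their proportions. These
  -- weights are bounded by 1, so the classes need not have densities; an empty class has weight 0.
  have key : ∀ X, (∑ i ∈ T X, g i) / ((T X).card : ℝ) = (∑ i ∈ T X, e (κ i)) / ((T X).card : ℝ) +
      ∑ k, ((∑ i ∈ (T X).filter (κ · = k), g i) / (((T X).filter (κ · = k)).card : ℝ) - e k) *
        ((((T X).filter (κ · = k)).card : ℝ) / ((T X).card : ℝ)) := by
    intro X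
    have h1 : ∀ k, ((∑ i ∈ (T X).filter (κ · = k), g i) / (((T X).filter (κ · = k)).card : ℝ) -
        e k) * ((((T X).filter (κ · = k)).card : ℝ) / ((T X).card : ℝ)) =
        (∑ i ∈ (T X).filter (κ · = k), g i - ∑ i ∈ (T X).filter (κ · = k), e (κ i)) /
          ((T X).card : ℝ) := by
      intro k
      have h2 : ∑ i ∈ (T X).filter (κ · = k), e (κ i) =
          (((T X).filter (κ · = k)).card : ℝ) * e k := by
        rw [Finset.sum_congr rfl fun i hi => congrArg e (Finset.mem_filter.1 hi).2,
          Finset.sum_const, nsmul_eq_mul]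
      rw [h2]
      rcases Finset.eq_empty_or_nonempty ((T X).filter (κ · = k)) with h0 | h0
      · simp [h0]
      · have : (((T X).filter (κ · = k)).card : ℝ) ≠ 0 :=
          Nat.cast_ne_zero.2 (Finset.card_pos.2 h0).ne'
        field_simp
    simp only [h1]
    rw [← Finset.sum_div, Finset.sum_sub_distrib, Finset.sum_fiberwise, Finset.sum_fiberwise]
    ring
  have h2 : Filter.Tendsto (fun X => (∑ i ∈ T X, e (κ i)) / ((T X).card : ℝ) +
      ∑ k, ((∑ i ∈ (T X).filter (κ · = k), g i) / (((T X).filter (κ · = k)).card : ℝ) - e k) *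
        ((((T X).filter (κ · = k)).card : ℝ) / ((T X).card : ℝ))) Filter.atTop
      (nhds (L + ∑ _k : K, 0)) := by
    refine he.add (tendsto_finsetSum _ fun k _ => ?_)
    have h3 : Filter.Tendsto (fun X => (∑ i ∈ (T X).filter (κ · = k), g i) /
        (((T X).filter (κ · = k)).card : ℝ) - e k) Filter.atTop (nhds 0) := by
      simpa using (h k).sub_const (e k)
    refine h3.zero_mul_isBoundedUnder_le (Filter.isBoundedUnder_of ⟨1, fun X => ?_⟩)
    change ‖_‖ ≤ _
    rw [Real.norm_of_nonneg (by positivity)]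
    exact div_le_one_of_le₀ (Nat.cast_le.2 (Finset.card_filter_le _ _)) (Nat.cast_nonneg _)
  rw [Finset.sum_const_zero, add_zero] at h2
  exact h2.congr fun X => (key X).symm

end Averages

/-! ### Classes of fields with isomorphic residue rings -/

section Classes

theorem exists_equiv_trans_symm {R R' Q : Type*} [CommRing R] [CommRing R'] [CommRing Q]
    {τ : R ≃+* R} {τ' : R' ≃+* R'} {ρ : Q ≃+* Q} (h : ∃ r : R ≃+* Q, ∀ x, r (τ x) = ρ (r x))
    (h' : ∃ r : R' ≃+* Q, ∀ x, r (τ' x) = ρ (r x)) :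
    ∃ r : R ≃+* R', ∀ x, r (τ x) = τ' (r x) := by
  obtain ⟨r, hr⟩ := h
  obtain ⟨s, hs⟩ := h'
  refine ⟨r.trans s.symm, fun x => ?_⟩
  rw [RingEquiv.trans_apply, RingEquiv.symm_apply_eq, hs, RingEquiv.trans_apply,
    RingEquiv.apply_symm_apply, hr]

variable {m : ℕ} [NeZero m] {ℓ : ℕ}

/-- The number of elements of order dividing `ℓ` in the ray class group. -/
def classTorsion (m ℓ : ℕ) (F : RealQuad) : ℕ := Nat.card {c : RayClassGroup F.1 m // c ^ ℓ = 1}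

theorem classTorsion_pos (F : RealQuad) : 0 < classTorsion m ℓ F := by
  have := finite_rayClassGroup F.1 m
  exact Nat.card_pos_iff.2 ⟨⟨1, one_pow ℓ⟩, inferInstance⟩

theorem torsionSize_arakelovSeq (hℓ : ℓ.Prime) (D : LocalData m) (F : RealQuad) (r : Marking D F) :
    torsionSize {ℓ} D.R D.conjR ℓ ⟦arakelovSeq {ℓ} D F r⟧ = ((ℓ * classTorsion m ℓ F : ℕ) : ℂ) := by
  have h : Nat.card {b : (arakelovSeq {ℓ} D F r).B // b ^ ℓ = 1} = ℓ * classTorsion m ℓ F :=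
    (card_sTors_torsion hℓ (Finset.mem_singleton_self ℓ)).trans
      (card_picTorsion m (NeZero.ne m) F.1.val.toRingHom F.2 hℓ.ne_zero)
  exact congrArg Nat.cast h

variable (m) in
/-- Two real quadratic fields are equivalent if their residue rings modulo `m` are isomorphic,
compatibly with the Galois action. -/
def residueSetoid : Setoid RealQuad where
  r F F' := ∃ r : (𝓞 F.1 ⧸ modIdeal F.1 m) ≃+* (𝓞 F'.1 ⧸ modIdeal F'.1 m),
    ∀ x, r (galQuot F.1 m (galConj F) x) = galQuot F'.1 m (galConj F') (r x)
  iseqv :=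
    { refl := fun F => ⟨RingEquiv.refl _, fun _ => rfl⟩
      symm := by
        rintro F F' ⟨r, hr⟩
        refine ⟨r.symm, fun x => ?_⟩
        rw [RingEquiv.symm_apply_eq, hr, RingEquiv.apply_symm_apply]
      trans := by
        rintro F F' F'' ⟨r, hr⟩ ⟨s, hs⟩
        exact ⟨r.trans s, fun x => by simp only [RingEquiv.trans_apply, hr, hs]⟩ }

/-- The choice of the étale algebras `ℚ_p ⊗ F`. -/
def fieldData (m : ℕ) (F : RealQuad) : LocalData m := discData m (isFund_conductor F).1

theorem exists_galQuot_equiv_conductor (m : ℕ) (F : RealQuad) :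
    ∃ r : (𝓞 F.1 ⧸ modIdeal F.1 m) ≃+*
        QuadMod m (conductor F.1 / 4 : ℕ) (conductor F.1 % 4 : ℕ),
      ∀ y, r (galQuot F.1 m (galConj F) y) = discConj (conductor F.1) m (r y) := by
  obtain ⟨hD, h1, x, hx⟩ := isFund_conductor F
  exact exists_galQuot_equiv hD hx h1 m

theorem nonempty_marking (F : RealQuad) : Nonempty (Marking (fieldData m F) F) := by
  obtain ⟨r, hr⟩ := exists_equiv_trans_symm (exists_localR_equiv (isFund_conductor F).1 m)
    (exists_galQuot_equiv_conductor m F)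
  exact ⟨⟨r, hr⟩⟩

/-- The residue ring with its involution depends only on D / 4 and D % 4 modulo m. -/
theorem finite_quotient_residueSetoid : Finite (Quotient (residueSetoid m)) := by
  refine Finite.of_injective (β := ZMod m × ZMod m) (fun q =>
    (((conductor q.out.1 / 4 : ℕ) : ℤ), ((conductor q.out.1 % 4 : ℕ) : ℤ))) fun q q' h => ?_
  rw [← Quotient.out_eq q, ← Quotient.out_eq q']
  refine Quotient.sound ?_
  obtain ⟨r, hr⟩ := exists_galQuot_equiv_conductor m q.out
  obtain ⟨s, hs⟩ := exists_galQuot_equiv_conductor m q'.out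
  obtain ⟨h1, h2⟩ := Prod.ext_iff.1 h
  have key : ∀ (a b a' b' : ℤ), (a : ZMod m) = a' → (b : ZMod m) = b' →
      ∃ t : QuadMod m a b ≃+* QuadMod m a' b', ∀ x, t (quadModConj m a b x) =
        quadModConj m a' b' (t x) := by
    intro a b a' b' ha hb
    unfold QuadMod quadModConj
    rw [ha, hb]
    exact ⟨RingEquiv.refl _, fun _ => rfl⟩
  obtain ⟨t, ht⟩ := key _ _ _ _ h1 h2
  exact exists_equiv_trans_symm
    ⟨r.trans t, fun x => (congrArg t (hr x)).trans (ht _)⟩ ⟨s, hs⟩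

end Classes

/-! ### The average on a single class -/

section ClassAverages

variable {m : ℕ} [NeZero m] {ℓ : ℕ}

theorem finite_quadMod (a b : ℤ) : Finite (QuadMod m a b) :=
  Finite.of_injective (fun z : QuadMod m a b => (z.re, z.im)) fun _ _ h =>
    QuadraticAlgebra.ext (congrArg Prod.fst h) (congrArg Prod.snd h)

theorem finite_fieldData_R (F : RealQuad) : Finite (fieldData m F).R := by
  obtain ⟨r, -⟩ := exists_localR_equiv (isFund_conductor F).1 m
  have := finite_quadMod (m := m) (conductor F.1 / 4 : ℕ) (conductor F.1 % 4 : ℕ)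
  exact Finite.of_equiv _ r.symm.toEquiv

theorem finite_marking (F₀ F : RealQuad) : Finite (Marking (fieldData m F₀) F) := by
  have := finite_fieldData_R (m := m) F₀
  have hne : modIdeal F.1 m ≠ ⊥ := by
    rw [Ne, Ideal.span_singleton_eq_bot]
    exact_mod_cast NeZero.ne m
  have := Ideal.finiteQuotientOfFreeOfNeBot (modIdeal F.1 m) hne
  refine Finite.of_injective (β := (𝓞 F.1 ⧸ modIdeal F.1 m) → (fieldData m F₀).R)
    (fun r => r.1.symm) fun r s h => Subtype.ext ?_
  rw [← RingEquiv.symm_symm r.1, ← RingEquiv.symm_symm s.1]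
  exact congrArg RingEquiv.symm (RingEquiv.ext fun x => congrFun h x)

theorem card_marking_le {m : ℕ} (D : LocalData m) {F F' : RealQuad} [Finite (Marking D F')]
    (h : (residueSetoid m).r F F') : Nat.card (Marking D F) ≤ Nat.card (Marking D F') := by
  obtain ⟨r, hr⟩ := h
  refine Nat.card_le_card_of_injective
    (fun s : Marking D F => (⟨s.1.trans r, fun x => by
      rw [RingEquiv.trans_apply, s.2, hr, RingEquiv.trans_apply]⟩ : Marking D F')) fun s t h => ?_
  refine Subtype.ext (RingEquiv.ext fun x => r.injective ?_)
  exact DFunLike.congr_fun (congrArg Subtype.val h) x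

open Classical in
-- The number of markings is constant on the class of F₀ and zero outside it. Averaging over pairs
-- (F, r) is therefore the same as averaging over the fields of the class.
theorem card_marking (F₀ F : RealQuad) : Nat.card (Marking (fieldData m F₀) F) =
    if Quotient.mk (residueSetoid m) F = Quotient.mk (residueSetoid m) F₀ then
      Nat.card (Marking (fieldData m F₀) F₀) else 0 := by
  have := finite_marking (m := m) F₀
  split_ifs with h
  · have h1 : (residueSetoid m).r F F₀ := Quotient.exact h
    exact le_antisymm (card_marking_le _ h1) (card_marking_le _ ((residueSetoid m).symm h1))
  · refine Nat.card_eq_zero.2 (Or.inl ⟨fun s => h (Quotient.sound ?_)⟩)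
    obtain ⟨r⟩ := nonempty_marking (m := m) F₀
    refine ⟨s.1.symm.trans r.1, fun x => ?_⟩
    obtain ⟨y, rfl⟩ := s.1.surjective x
    rw [← s.2]
    simp only [RingEquiv.trans_apply, RingEquiv.symm_apply_apply]
    exact r.2 y

open Classical in
/-- The average of the heuristic is an average over a class of real quadratic fields. -/
theorem average_markedBelow (hℓ : ℓ.Prime) (F₀ : RealQuad) (X : ℝ) :
    (∑ᶠ p : MarkedBelow (fieldData m F₀) X, torsionSize {ℓ} (fieldData m F₀).R
        (fieldData m F₀).conjR ℓ ⟦arakelovSeq {ℓ} (fieldData m F₀) p.1.1 p.2⟧) /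
      (Nat.card (MarkedBelow (fieldData m F₀) X) : ℂ) =
    ((ℓ * ((∑ F ∈ (finite_realQuadBelow X).toFinset.filter
      (Quotient.mk (residueSetoid m) · = Quotient.mk (residueSetoid m) F₀),
        (classTorsion m ℓ F : ℝ)) / (((finite_realQuadBelow X).toFinset.filter
      (Quotient.mk (residueSetoid m) · = Quotient.mk (residueSetoid m) F₀)).card : ℝ)) : ℝ) : ℂ) := by
  have := finite_marking (m := m) F₀
  have := fun F => Fintype.ofFinite (Marking (fieldData m F₀) F)
  have := (finite_realQuadBelow X).fintype
  have hM : (Nat.card (Marking (fieldData m F₀) F₀) : ℂ) ≠ 0 :=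
    Nat.cast_ne_zero.2 (Nat.card_ne_zero.2 ⟨nonempty_marking F₀, inferInstance⟩)
  have hT : ∀ f : RealQuad → ℂ, ∑ F : realQuadBelow X, f F.1 =
      ∑ F ∈ (finite_realQuadBelow X).toFinset, f F := fun f =>
    (Finset.sum_subtype _ (fun F => Set.Finite.mem_toFinset _) f).symm
  have h1 : ∑ᶠ p : MarkedBelow (fieldData m F₀) X, torsionSize {ℓ} (fieldData m F₀).R
        (fieldData m F₀).conjR ℓ ⟦arakelovSeq {ℓ} (fieldData m F₀) p.1.1 p.2⟧ =
      Nat.card (Marking (fieldData m F₀) F₀) * (ℓ * ∑ F ∈ (finite_realQuadBelow X).toFinset.filter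
      (Quotient.mk (residueSetoid m) · = Quotient.mk (residueSetoid m) F₀),
        (classTorsion m ℓ F : ℂ)) := by
    rw [finsum_eq_sum_of_fintype, Fintype.sum_sigma]
    simp only [torsionSize_arakelovSeq hℓ]
    simp only [Finset.sum_const, Finset.card_univ, ← Nat.card_eq_fintype_card, nsmul_eq_mul]
    rw [hT fun F => (Nat.card (Marking (fieldData m F₀) F) : ℂ) * ((ℓ * classTorsion m ℓ F : ℕ) : ℂ),
      Finset.sum_filter, Finset.mul_sum, Finset.mul_sum]
    refine Finset.sum_congr rfl fun F _ => ?_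
    rw [card_marking]
    split_ifs <;> push_cast <;> ring
  have h2 : (Nat.card (MarkedBelow (fieldData m F₀) X) : ℂ) =
      Nat.card (Marking (fieldData m F₀) F₀) * ((finite_realQuadBelow X).toFinset.filter
      (Quotient.mk (residueSetoid m) · = Quotient.mk (residueSetoid m) F₀)).card := by
    rw [Nat.card_sigma, Nat.cast_sum, hT fun F => (Nat.card (Marking (fieldData m F₀) F) : ℂ),
      Finset.card_filter, Nat.cast_sum, Finset.mul_sum]
    refine Finset.sum_congr rfl fun F _ => ?_
    rw [card_marking]
    split_ifs <;> simp
  rw [h1, h2, mul_div_mul_left _ _ hM]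
  push_cast
  rw [mul_div_assoc]

/-- The average predicted for the class of a field of conductor `n`. -/
def classMean (m ℓ n : ℕ) : ℝ := ((∏ p : m.primeFactors, locPlus p (m.factorization p) ℓ : ℕ) : ℝ) *
  (1 + 1 / (ℓ : ℝ) * ∏ p : m.primeFactors, (locMinus p (m.factorization p) ℓ n : ℝ))

/-- The model ring is the residue ring of the order of discriminant D, so #U⁺[ℓ] and #U⁻[ℓ] are the
products of the local counts. The factor ℓ is the one by which the Arakelov torsion exceeds that of
the ray class group. -/
theorem expectation_fieldData (hℓ : ℓ.Prime) (hodd : ℓ ≠ 2) (F : RealQuad)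
    (h0 : cptMass {ℓ} (fieldData m F).R (fieldData m F).conjR Set.univ ≠ 0)
    (htop : cptMass {ℓ} (fieldData m F).R (fieldData m F).conjR Set.univ ≠ ⊤) :
    expectation (torsionSize {ℓ} (fieldData m F).R (fieldData m F).conjR ℓ) =
      ((ℓ * classMean m ℓ (conductor F.1) : ℝ) : ℂ) := by
  have := finite_fieldData_R (m := m) F
  have hS := Finset.mem_singleton_self ℓ
  have hoddℓ := hℓ.odd_of_ne_two hodd
  obtain ⟨r, hr⟩ := exists_localR_equiv (isFund_conductor F).1 m
  have hp := torPlus_congr r hr ℓ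
  have hm := torMinus_congr r hr ℓ
  obtain ⟨h1, h2⟩ := tor_quadMod_eq_prod (NeZero.ne m) ℓ (conductor F.1 / 4 : ℕ)
    (conductor F.1 % 4 : ℕ)
  have h3 := fun p : m.primeFactors => tor_discConj (k := m.factorization p)
    (Nat.prime_of_mem_primeFactors p.2) (Finsupp.mem_support_iff.1 p.2) hℓ hodd
    (isFund_conductor F).1.1
  have h4 := hp.trans (h1.trans (Finset.prod_congr rfl fun p _ => (h3 p).1))
  have h5 := hm.trans (h2.trans (Finset.prod_congr rfl fun p _ => (h3 p).2))
  rw [expectation_torsionSize hℓ hoddℓ hS h0 htop, uPlus_eq _ hℓ hoddℓ hS, uMinus_eq _ hℓ hoddℓ hS,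
    unitPlus_eq_torPlus _ hℓ.ne_zero, unitMinus_eq_torMinus _ hℓ.ne_zero]
  unfold classMean
  have hℓ0 : (ℓ : ℂ) ≠ 0 := Nat.cast_ne_zero.2 hℓ.ne_zero
  erw [h4, h5]
  push_cast
  field_simp
  ring

open Classical in
theorem tendsto_class_average (hℓ : ℓ.Prime) (hodd : ℓ ≠ 2) (F₀ : RealQuad)
    (heuristic : HeuristicHolds {ℓ} (fieldData m F₀)
      (torsionSize {ℓ} (fieldData m F₀).R (fieldData m F₀).conjR ℓ)) :
    Filter.Tendsto (fun X => (∑ F ∈ (finite_realQuadBelow X).toFinset.filter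
      (Quotient.mk (residueSetoid m) · = Quotient.mk (residueSetoid m) F₀),
        (classTorsion m ℓ F : ℝ)) / (((finite_realQuadBelow X).toFinset.filter
      (Quotient.mk (residueSetoid m) · = Quotient.mk (residueSetoid m) F₀)).card : ℝ))
      Filter.atTop (nhds (classMean m ℓ (conductor F₀.1))) := by
  have hℓ0 : (ℓ : ℝ) ≠ 0 := Nat.cast_ne_zero.2 hℓ.ne_zero
  unfold HeuristicHolds at heuristic
  simp only [average_markedBelow hℓ F₀] at heuristic
  have h1 := (Complex.continuous_re.tendsto _).comp heuristic
  have h2 := h1.const_mul (ℓ : ℝ)⁻¹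
  have h3 : ∀ E : ℝ, (ℓ : ℝ)⁻¹ * (((ℓ * E : ℝ) : ℂ)).re = E := fun E => by
    rw [Complex.ofReal_re, inv_mul_cancel_left₀ hℓ0]
  simp only [Function.comp_def, h3] at h2
  by_cases hdeg : cptMass {ℓ} (fieldData m F₀).R (fieldData m F₀).conjR Set.univ = 0 ∨
      cptMass {ℓ} (fieldData m F₀).R (fieldData m F₀).conjR Set.univ = ⊤
  -- With degenerate mass the heuristic would predict the limit 0, whereas every ray class group
  -- contributes at least 1.
  · exfalso
    rw [expectation_eq_zero hdeg, Complex.zero_re, mul_zero] at h2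
    refine absurd (ge_of_tendsto h2 (b := 1) ?_) (by norm_num)
    filter_upwards [Filter.eventually_gt_atTop (conductor F₀.1 : ℝ)] with X hX
    have hpos : 0 < ((finite_realQuadBelow X).toFinset.filter
        (Quotient.mk (residueSetoid m) · = Quotient.mk (residueSetoid m) F₀)).card :=
      Finset.card_pos.2 ⟨F₀, Finset.mem_filter.2 ⟨(Set.Finite.mem_toFinset _).2 hX, rfl⟩⟩
    rw [le_div_iff₀ (Nat.cast_pos.2 hpos), one_mul, ← Nat.cast_sum, Nat.cast_le,
      Finset.card_eq_sum_ones]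
    exact Finset.sum_le_sum fun F _ => classTorsion_pos F
  · rw [not_or] at hdeg
    rw [expectation_fieldData hℓ hodd F₀ hdeg.1 hdeg.2, h3] at h2
    exact h2

end ClassAverages

/-! ### The average over all real quadratic fields -/

section MainAverage

variable {m : ℕ} [NeZero m] {ℓ : ℕ}

theorem sum_realQuadBelow (f : RealQuad → ℝ) (X : ℝ) :
    ∑ᶠ F : realQuadBelow X, f F.1 = ∑ F ∈ (finite_realQuadBelow X).toFinset, f F := by
  have := (finite_realQuadBelow X).fintype
  rw [finsum_eq_sum_of_fintype]
  exact (Finset.sum_subtype _ (fun F => Set.Finite.mem_toFinset _) f).symm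

theorem card_realQuadBelow (X : ℝ) :
    Nat.card (realQuadBelow X) = (finite_realQuadBelow X).toFinset.card :=
  Set.ncard_eq_toFinset_card _ _

theorem isFund_five : IsFund 5 := by
  refine ⟨Or.inr (Or.inl rfl), fun p hp h2 h => ?_⟩
  have h1 := Nat.le_of_dvd (by norm_num) h
  have h3 := hp.two_le
  have h4 : 3 ≤ p := by omega
  nlinarith

theorem tendsto_average_classMean (m ℓ : ℕ) : Filter.Tendsto
    (fun X => (∑ F ∈ (finite_realQuadBelow X).toFinset, classMean m ℓ (conductor F.1)) /
      ((finite_realQuadBelow X).toFinset.card : ℝ)) Filter.atTop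
    (nhds (predictedAverage m ℓ)) := by
  classical
  have h1 := tendsto_average_locMinus m ℓ
  have h2 : Filter.Tendsto (fun X : ℝ => ⌈X⌉₊ - 1) Filter.atTop Filter.atTop :=
    (Filter.tendsto_sub_atTop_nat 1).comp tendsto_nat_ceil_atTop
  have h3 : ∀ (f : ℕ → ℝ) (X : ℝ), ∑ F ∈ (finite_realQuadBelow X).toFinset, f (conductor F.1) =
      ∑ n ∈ (Finset.Ioc 1 (⌈X⌉₊ - 1)).filter IsFund, f n := fun f X => by
    rw [← sum_realQuadBelow (fun F => f (conductor F.1)), finsum_realQuadBelow]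
  have h4 : ∀ X : ℝ, ((finite_realQuadBelow X).toFinset.card : ℝ) =
      (((Finset.Ioc 1 (⌈X⌉₊ - 1)).filter IsFund).card : ℝ) := fun X => by
    simpa using h3 (fun _ => 1) X
  have h5 := ((h1.comp h2).const_mul (1 / (ℓ : ℝ))).const_add 1 |>.const_mul
    ((∏ p : m.primeFactors, locPlus p (m.factorization p) ℓ : ℕ) : ℝ)
  refine h5.congr' ?_
  filter_upwards [Filter.eventually_gt_atTop (5 : ℝ)] with X hX
  have h6 : ((finite_realQuadBelow X).toFinset.card : ℝ) ≠ 0 := by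
    obtain ⟨F, hF⟩ := exists_conductor_eq (D := 5) isFund_five (by norm_num)
    exact Nat.cast_ne_zero.2 (Finset.card_pos.2 ⟨F, (Set.Finite.mem_toFinset _).2 (by
      change (conductor F.1 : ℝ) < X
      rw [hF]
      exact_mod_cast hX)⟩).ne'
  have h7 := h3 (classMean m ℓ) X
  rw [h7, h4]
  rw [h4] at h6
  unfold classMean
  simp only [Function.comp_def]
  rw [← Finset.mul_sum, Finset.sum_add_distrib, ← Finset.mul_sum, Finset.sum_const, nsmul_eq_mul,
    mul_one]
  field_simp

theorem tendsto_averageTorsion (hℓ : ℓ.Prime) (hodd : ℓ ≠ 2)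
    (heuristic : ∀ D : LocalData m, HeuristicHolds {ℓ} D (torsionSize {ℓ} D.R D.conjR ℓ)) :
    Filter.Tendsto (averageTorsion m ℓ) Filter.atTop (nhds (predictedAverage m ℓ)) := by
  classical
  have := finite_quotient_residueSetoid (m := m)
  have := Fintype.ofFinite (Quotient (residueSetoid m))
  -- That the predicted mean depends only on the class follows from uniqueness of limits, as both
  -- values are the limit of the same class average.
  have hmean : ∀ F F' : RealQuad, Quotient.mk (residueSetoid m) F =
      Quotient.mk (residueSetoid m) F' →
      classMean m ℓ (conductor F.1) = classMean m ℓ (conductor F'.1) := by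
    intro F F' h
    have h1 := tendsto_class_average hℓ hodd F (heuristic _)
    rw [h] at h1
    exact tendsto_nhds_unique h1 (tendsto_class_average hℓ hodd F' (heuristic _))
  have h1 := tendsto_average_of_classes (Quotient.mk (residueSetoid m))
    (fun X => (finite_realQuadBelow X).toFinset) (fun F => (classTorsion m ℓ F : ℝ))
    (fun k => classMean m ℓ (conductor k.out.1)) (L := predictedAverage m ℓ) (fun k => by
      have := tendsto_class_average hℓ hodd k.out (heuristic _)
      rwa [Quotient.out_eq] at this)
    ((tendsto_average_classMean m ℓ).congr fun X => by
      congr 1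
      exact Finset.sum_congr rfl fun F _ => hmean _ _ (Quotient.out_eq _).symm)
  refine h1.congr fun X => ?_
  unfold averageTorsion
  rw [card_realQuadBelow]
  congr 1
  exact (sum_realQuadBelow (fun F => (classTorsion m ℓ F : ℝ)) X).symm

end MainAverage

end RayHeuristic

end

theorem mainTheorem2 (ℓ : ℕ) (hℓ : ℓ.Prime) (hodd : ℓ ≠ 2) (m : ℕ) [NeZero m]
    (heuristic : ∀ D : RayHeuristic.LocalData m,
      RayHeuristic.HeuristicHolds {ℓ} D (RayHeuristic.torsionSize {ℓ} D.R D.conjR ℓ)) :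
    (¬ ℓ ∣ m → Filter.Tendsto (RayHeuristic.averageTorsion m ℓ) Filter.atTop
      (nhds ((ℓ : ℝ) ^ (RayHeuristic.primesOne m ℓ).card *
        (1 + 1 / (ℓ : ℝ) * ∏ p ∈ RayHeuristic.primesPlusMinusOne m ℓ,
          ((p : ℝ) * (ℓ + 1) + 2) / (2 * (p + 1)))))) ∧
    (ℓ ∣ m ∧ ¬ ℓ ^ 2 ∣ m → Filter.Tendsto (RayHeuristic.averageTorsion m ℓ) Filter.atTop
      (nhds ((ℓ : ℝ) ^ (RayHeuristic.primesOne m ℓ).card *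
        (1 + 2 / ((ℓ : ℝ) + 1) * ∏ p ∈ RayHeuristic.primesPlusMinusOne m ℓ,
          ((p : ℝ) * (ℓ + 1) + 2) / (2 * (p + 1)))))) ∧
    (3 < ℓ ∧ ℓ ^ 2 ∣ m → Filter.Tendsto (RayHeuristic.averageTorsion m ℓ) Filter.atTop
      (nhds ((ℓ : ℝ) ^ ((RayHeuristic.primesOne m ℓ).card + 1) *
        (1 + ∏ p ∈ RayHeuristic.primesPlusMinusOne m ℓ,
          ((p : ℝ) * (ℓ + 1) + 2) / (2 * (p + 1)))))) ∧
    (ℓ = 3 ∧ ℓ ^ 2 ∣ m → Filter.Tendsto (RayHeuristic.averageTorsion m ℓ) Filter.atTop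
      (nhds ((3 : ℝ) ^ ((RayHeuristic.primesOne m ℓ).card + 1) *
        (1 + 5 / 4 * ∏ p ∈ RayHeuristic.primesPlusMinusOne m ℓ,
          (2 * (p : ℝ) + 1) / (p + 1))))) := by
  have hm := NeZero.ne m
  have h := RayHeuristic.tendsto_averageTorsion hℓ hodd heuristic
  refine ⟨fun h1 => ?_, fun h1 => ?_, fun h1 => ?_, fun h1 => ?_⟩
  · rwa [RayHeuristic.predictedAverage_of_not_dvd hℓ hodd hm h1] at h
  · rwa [RayHeuristic.predictedAverage_of_dvd hℓ hodd hm h1.1 h1.2] at h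
  · rwa [RayHeuristic.predictedAverage_of_sq_dvd hℓ hm h1.1 h1.2] at h
  · obtain ⟨rfl, h2⟩ := h1
    rwa [RayHeuristic.predictedAverage_three hm h2] at h
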